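/- **Setting.** Functions of the radius $y\in(0,\infty)$ are viewed as radial functions on $\mathbb R^2$: $L^2$ is taken with respect to $2\pi y\,dy$, and $(f,g)_r=2\pi\int_0^\infty \mathrm{Re}(\bar f g)\,y\,dy$. Write $\langle x\rangle=(1+x^2)^{1/2}$, $\log_+ y=\max\{0,\log y\}$, $|v|_{-1}=\max\{|\partial_y v|,y^{-1}|v|\}$, $$\|f\|_X=\|\langle y\rangle^{-2}\langle\log_+y\rangle f\|_{L^2},\qquad \|v\|_{\dot{\mathcal H}^1_2}=\|\partial_yv\|_{L^2}+\|y^{-1}\langle\log_+y\rangle^{-1}v\|_{L^2},$$ $$\|v\|_{\dot{\mathcal H}^2_1}=\|\partial_{yy}v\|_{L^2}+\|y^{-1}\langle\log y\rangle^{-1}|v|_{-1}\|_{L^2}.$$ Let $\Lambda_sf=(1-s+y\partial_y)f$, $\Lambda=\Lambda_0$, $A_\theta[v](y)=-\frac12\int_0^y|v|^2y'dy'$, and $$\mathbf D_vw=\partial_yw-\tfrac1yA_\theta[v]w,\quad A_vw=\partial_yw-\tfrac1y(1+A_\theta[v])w,\quad L_vw=\mathbf D_vw+\tfrac vy\int_0^y\mathrm{Re}(\bar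 vw)y'dy',$$ with formal $L^2$-adjoints $$A_v^*w=-\partial_yw-\tfrac1y(2+A_\theta[v])w,\qquad L_v^*w=-\partial_yw-\tfrac1y(1+A_\theta[v])w+v\int_y^\infty\mathrm{Re}(\bar vw)\,dy'.$$ Let $Q(y)=\sqrt8/(1+y^2)$, and let $\rho$ be the smooth real solution of $L_Q\rho=\frac12yQ$ with $\rho(0)=0$. Fix a smooth cutoff $\chi$ with $0\le\chi\le1$, $\chi(y)=1$ for $y\le1$ and $\chi(y)=0$ for $y\ge2$; put $\chi_B(y)=\chi(y/B)$, and for $0<b<1$ put $B_0=b^{-1/2}$, $B_1=b^{-1/2}|\log b|$, $$c_b=\frac{(\Lambda(\frac y2Q),\frac y2Q)_r}{(\frac y2Q\chi_{B_0},\frac y2Q)_r},\qquad g_2=\Lambda(\tfrac y2Q)-c_b\tfrac y2Q\chi_{B_0}.$$ With $J=yQ$ and $\Gamma(y)=J(y)\int_1^yJ(y')^{-2}\frac{dy'}{y'}$, let $[H_Q^{-1}f](y)=\int_0^yy'\big(J(y)\Gamma(y')-\Gamma(y)J(y')\big)f(y')\,dy'$ be the outgoing right inverse of $H_Q=A_Q^*A_Q$.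 Put $$T_{2,0}=H_Q^{-1}g_2,\quad U_2=A_QT_{2,0},\quad g_{3,0}=\Lambda_1T_{2,0}-\Big(\int_0^y\big(QT_{2,0}+\tfrac{(y')^3}8Q^2\big)dy'\Big)\tfrac y2Q,\quad U_{3,0}=A_QH_Q^{-1}g_{3,0},$$ $$\begin{aligned}P&=Q+\chi_{B_1}\{-ib\tfrac{y^2}4Q-\eta\rho\},\\P_1&=\chi_{B_1}\{-(ib+\eta)\tfrac y2Q\}+\chi_{B_0}b^2T_{2,0},\\P_2&=\chi_{B_0}\{(b^2-2ib\eta-\eta^2)U_2+ib^3U_{3,0}\},\end{aligned}$$ and $\mathbf v_k=(\Lambda_{-k}P_k,-iP_k,-\partial_bP_k,-\partial_\eta P_k)$ for $k=0,1,2$, where $P_0=P$, $\mathbf v=\mathbf v_0$. **Proposition (Modified profile).** There are constants $K,C>0$, depending only on $\chi$, such that for every $M>0$ there is $b^*>0$ for which the following holds whenever $0<b<b^*$ and $|\eta|\le b/|\log b|$. First, $\big|c_b-\frac1{|\log b|}\big|\le K|\log b|^{-2}$. The profiles $P,P_1,P_2$ are smooth in $y$ on $(0,\infty)$ and differentiable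 in $(b,\eta)$, with parameter derivatives that are smooth in $y$. Moreover, with $\lesssim$ standing for an inequality with the factor $K$: 1. (Modulation vectors) On $(0,2M]$, $|\Lambda P-\Lambda Q|+|iP-iQ|\lesssim b$, $\partial_bP=-i\frac{y^2}4Q$ and $\partial_\eta P=-\rho$. Further, $$\|\Lambda_{-1}P_1\|_X+\|iP_1\|_X\lesssim b,\qquad\|\partial_bP_1+\chi_{B_1}i\tfrac y2Q\|_X+\|\partial_\eta P_1+\chi_{B_1}\tfrac y2Q\|_X\lesssim b|\log b|^C,$$ $$\|\Lambda_{-2}P_2\|_{\dot{\mathcal H}^1_2}+\|iP_2\|_{\dot{\mathcal H}^1_2}\lesssim b^2,\qquad\|\partial_bP_2\|_{\dot{\mathcal H}^1_2}+\|\partial_\eta P_2\|_{\dot{\mathcal H}^1_2}\lesssim b.$$ 2. (Compatibility) $\|\mathbf D_PP-P_1\|_{L^2}\lesssim b$, $\|\mathbf D_PP-P_1\|_{\dot{\mathcal H}^2_1}\lesssim b^2$ and $\|A_PP_1-P_2\|_{\dot{\mathcal H}^1_2}\lesssim b^2/|\log b|$. 3. (Equations) There are functions $\Psi,\Psi_1,\Psi_2$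 of $y$ such that the following identities hold on $(0,\infty)$ at every time $s$ at which differentiable real curves $\lambda>0,\gamma,b,\eta$ take the given values $b(s)=b$, $\eta(s)=\eta$, for every real number $\widetilde\gamma_s$ (the corrected phase speed). With $$\mathbf{Mod}=(\tfrac{\lambda_s}\lambda+b,\ \gamma_s-\eta,\ b_s+b^2+\eta^2,\ \eta_s),$$ $$\widetilde{\mathbf{Mod}}=(\tfrac{\lambda_s}\lambda+b,\ \widetilde\gamma_s+\eta,\ b_s+b^2+\eta^2+c_b(b^2-\eta^2),\ \eta_s+2c_bb\eta),$$ and $P_k=P_k(y;b(s),\eta(s))$ under $\partial_s$, $$\begin{aligned} (\partial_s-\tfrac{\lambda_s}\lambda\Lambda+\gamma_si)P+iL_P^*P_1&=-\mathbf{Mod}\cdot\mathbf v+i\Psi,\\ (\partial_s-\tfrac{\lambda_s}\lambda\Lambda_{-1}+\widetilde\gamma_si)P_1+iA_P^*P_2-\Big(\int_0^y\mathrm{Re}(\overline PP_1)dy'\Big)iP_1&=-\widetilde{\mathbf{Mod}}\cdot\mathbf v_1+i\Psi_1,\\ (\partial_s-\tfrac{\lambda_s}\lambda\Lambda_{-2}+\widetilde\gamma_si)P_2+iA_PA_P^*P_2-\Big(\int_0^y\mathrm{Re}(\overline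 PP_1)dy'\Big)iP_2-i\overline P(P_1)^2&=-\widetilde{\mathbf{Mod}}\cdot\mathbf v_2+i\Psi_2, \end{aligned}$$ and $$|\Psi|\lesssim b^2|\log b|\ \text{ on }(0,2M],\qquad\|\Psi_1\|_X\lesssim b^3|\log b|^C,\qquad\|\Psi_2\|_{\dot{\mathcal H}^1_2}\lesssim\frac{b^3}{|\log b|}.$$ -/

import Mathlib

open scoped ContDiff

namespace CSS

noncomputable section

/-! Radial functions on `ℝ²` are functions of the radius `y ∈ (0, ∞)`; they are represented by
functions on `ℝ`, and nothing below looks at their values on `(-∞, 0]`. -/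

/-- The ground state `Q(y) = √8 / (1 + y²)`. -/
def Q (y : ℝ) : ℝ := √8 / (1 + y ^ 2)

/-- `Q` as a complex valued function. -/
def Qc (y : ℝ) : ℂ := (Q y : ℂ)

/-! ### Operators -/

/-- The generator `Λ_s f = (1 - s + y ∂_y) f` of the `Ḣ^s`-invariant scaling; `Λ = Λ_0`. -/
def Lam {E : Type*} [NormedAddCommGroup E] [NormedSpace ℝ E] (s : ℝ) (f : ℝ → E) (y : ℝ) : E :=
  (1 - s) • f y + y • deriv f y

/-- The gauge potential `A_θ[v](y) = -½ ∫_0^y |v|² r dr`. -/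
def Atheta (v : ℝ → ℂ) (y : ℝ) : ℝ := -(1 / 2) * ∫ r in (0 : ℝ)..y, ‖v r‖ ^ 2 * r

/-- The radial Cauchy–Riemann operator `∂_y w - (m + A_θ[v]) w / y` on `m`-equivariant functions. -/
def CR {E : Type*} [NormedAddCommGroup E] [NormedSpace ℝ E] (m : ℝ) (v : ℝ → ℂ) (w : ℝ → E)
    (y : ℝ) : E :=
  deriv w y - ((m + Atheta v y) / y) • w y

/-- The formal adjoint of `CR m v` with respect to the measure `y dy`. -/
def CRadj {E : Type*} [NormedAddCommGroup E] [NormedSpace ℝ E] (m : ℝ) (v : ℝ → ℂ) (w : ℝ → E)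
    (y : ℝ) : E :=
  -deriv w y - ((m + 1 + Atheta v y) / y) • w y

/-- The Bogomol'nyi operator `𝐃_v`. -/
abbrev Dop {E : Type*} [NormedAddCommGroup E] [NormedSpace ℝ E] (v : ℝ → ℂ) (w : ℝ → E) : ℝ → E :=
  CR 0 v w

/-- The operator `A_v`. -/
abbrev Aop {E : Type*} [NormedAddCommGroup E] [NormedSpace ℝ E] (v : ℝ → ℂ) (w : ℝ → E) : ℝ → E :=
  CR 1 v w

/-- The operator `A_v^*`. -/
abbrev Aadj {E : Type*} [NormedAddCommGroup E] [NormedSpace ℝ E] (v : ℝ → ℂ) (w : ℝ → E) : ℝ → E :=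
  CRadj 1 v w

/-- The linearization `L_v` of `v ↦ 𝐃_v v`. -/
def Lop (v w : ℝ → ℂ) (y : ℝ) : ℂ :=
  Dop v w y + v y * (((1 / y) * ∫ r in (0 : ℝ)..y, (star (v r) * w r).re * r : ℝ) : ℂ)

/-- The formal adjoint `L_v^*` of `L_v` for the real inner product `∫ Re(f̄ g) y dy`. -/
def Ladj (v w : ℝ → ℂ) (y : ℝ) : ℂ :=
  CRadj 0 v w y + v y * ((∫ r in Set.Ioi y, (star (v r) * w r).re : ℝ) : ℂ)

/-! ### The generalized nullspace element `ρ`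

`φ₁ = ΛQ / Q` and `φ₂` are two solutions of `φ'' + φ' / y + Q² φ = 0` with
`y (φ₁ φ₂' - φ₁' φ₂) = 1`, so that `ρ / Q` is the solution of `f'' + f' / y + Q² f = 1` that
vanishes at `y = 0`. This is the equation `L_Q ρ = ½ y Q` after a multiplication by `y / Q` and a
differentiation; `Lop_rho` below is the equation itself. -/

def phi1 (y : ℝ) : ℝ := (1 - y ^ 2) / (1 + y ^ 2)

def phi2 (y : ℝ) : ℝ := phi1 y * Real.log y + 1

/-- The solution of `L_Q ρ = ½ y Q` that is smooth across `y = 0` with `ρ(0) = 0`. -/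
def rho (y : ℝ) : ℝ :=
  Q y * (phi2 y * (∫ z in (0 : ℝ)..y, phi1 z * z) - phi1 y * ∫ z in (0 : ℝ)..y, phi2 z * z)

theorem hasDerivAt_phi1 (y : ℝ) : HasDerivAt phi1 (-4 * y / (1 + y ^ 2) ^ 2) y := by
  have h : (1 + y ^ 2) ≠ 0 := by positivity
  have h1 : HasDerivAt (fun y : ℝ => 1 - y ^ 2) (-(2 * y)) y := by
    simpa using (hasDerivAt_pow 2 y).const_sub 1
  have h2 : HasDerivAt (fun y : ℝ => 1 + y ^ 2) (2 * y) y := by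
    simpa using (hasDerivAt_pow 2 y).const_add 1
  refine (h1.div h2 h).congr_deriv ?_
  field_simp
  ring

theorem hasDerivAt_phi2 {y : ℝ} (hy : 0 < y) :
    HasDerivAt phi2 (-4 * y / (1 + y ^ 2) ^ 2 * Real.log y + phi1 y * y⁻¹) y :=
  ((hasDerivAt_phi1 y).mul (Real.hasDerivAt_log hy.ne')).add_const 1

theorem hasDerivAt_Q (y : ℝ) : HasDerivAt Q (-(2 * y / (1 + y ^ 2)) * Q y) y := by
  have h : (1 + y ^ 2) ≠ 0 := by positivity
  have h2 : HasDerivAt (fun y : ℝ => 1 + y ^ 2) (2 * y) y := by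
    simpa using (hasDerivAt_pow 2 y).const_add 1
  refine ((hasDerivAt_const y (√8)).div h2 h).congr_deriv ?_
  unfold Q
  field_simp
  ring

theorem Q_sq (y : ℝ) : Q y ^ 2 = 8 / (1 + y ^ 2) ^ 2 := by
  unfold Q
  rw [div_pow, Real.sq_sqrt (by norm_num)]

theorem continuous_phi1 : Continuous phi1 :=
  continuous_iff_continuousAt.2 fun y => (hasDerivAt_phi1 y).continuousAt

theorem continuous_Q : Continuous Q :=
  continuous_iff_continuousAt.2 fun y => (hasDerivAt_Q y).continuousAt

theorem continuous_phi2_mul : Continuous fun z => phi2 z * z := by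
  have h : (fun z => phi2 z * z) = fun z => phi1 z * (z * Real.log z) + z := by
    funext z; unfold phi2; ring
  rw [h]
  exact (continuous_phi1.mul Real.continuous_mul_log).add continuous_id

theorem Atheta_Qc {y : ℝ} (hy : 0 < y) : Atheta Qc y = -(2 * y ^ 2 / (1 + y ^ 2)) := by
  have hd : ∀ z ∈ Set.uIcc 0 y,
      HasDerivAt (fun z : ℝ => -4 / (1 + z ^ 2)) (‖Qc z‖ ^ 2 * z) z := by
    intro z _
    have h : (1 + z ^ 2) ≠ 0 := by positivity
    have h2 : HasDerivAt (fun y : ℝ => 1 + y ^ 2) (2 * z) z := by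
      simpa using (hasDerivAt_pow 2 z).const_add 1
    refine ((hasDerivAt_const z (-4 : ℝ)).div h2 h).congr_deriv ?_
    simp only [Qc, Complex.norm_real, Real.norm_eq_abs, sq_abs, Q_sq]
    field_simp
    ring
  have hc : Continuous fun z => ‖Qc z‖ ^ 2 * z := by
    unfold Qc
    exact ((Complex.continuous_ofReal.comp continuous_Q).norm.pow 2).mul continuous_id
  rw [Atheta, intervalIntegral.integral_eq_sub_of_hasDerivAt hd (hc.intervalIntegrable _ _)]
  have h : (1 + y ^ 2) ≠ 0 := by positivity
  field_simp
  ring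

theorem hasDerivAt_rho_aux {f : ℝ → ℝ} (hf : Continuous f) (y : ℝ) :
    HasDerivAt (fun y => ∫ z in (0 : ℝ)..y, f z) (f y) y :=
  intervalIntegral.integral_hasDerivAt_right (hf.intervalIntegrable _ _)
    (hf.stronglyMeasurableAtFilter _ _) hf.continuousAt

theorem continuous_phi1_mul : Continuous fun z => phi1 z * z := continuous_phi1.mul continuous_id

/-- The function `y (ρ / Q)'` for `y > 0`. -/
def rhoFlux (y : ℝ) : ℝ :=
  (-4 * y / (1 + y ^ 2) ^ 2 * (y * Real.log y) + phi1 y) * (∫ z in (0 : ℝ)..y, phi1 z * z) -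
    (-4 * y ^ 2 / (1 + y ^ 2) ^ 2) * ∫ z in (0 : ℝ)..y, phi2 z * z

theorem hasDerivAt_rho {y : ℝ} (hy : 0 < y) :
    HasDerivAt rho (-(2 * y / (1 + y ^ 2)) * rho y + Q y * (rhoFlux y / y)) y := by
  have h := (hasDerivAt_Q y).mul
    (((hasDerivAt_phi2 hy).mul (hasDerivAt_rho_aux continuous_phi1_mul y)).sub
      ((hasDerivAt_phi1 y).mul (hasDerivAt_rho_aux continuous_phi2_mul y)))
  refine h.congr_deriv ?_
  unfold rho rhoFlux
  simp only [Pi.mul_apply, Pi.sub_apply]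
  have h0 : (1 + y ^ 2) ≠ 0 := by positivity
  have h1 := hy.ne'
  field_simp
  ring

theorem hasDerivAt_rhoFlux {y : ℝ} (hy : 0 < y) :
    HasDerivAt rhoFlux (y - Q y * rho y * y) y := by
  have h0 : (1 + y ^ 2) ≠ 0 := by positivity
  have h00 : (1 + y ^ 2) ^ 2 ≠ 0 := by positivity
  have h1 := hy.ne'
  have hd : HasDerivAt (fun y : ℝ => (1 + y ^ 2) ^ 2) (2 * (1 + y ^ 2) * (2 * y)) y := by
    have h2 : HasDerivAt (fun y : ℝ => 1 + y ^ 2) (2 * y) y := by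
      simpa using (hasDerivAt_pow 2 y).const_add 1
    refine (h2.pow 2).congr_deriv ?_
    norm_num
  have hk1 : HasDerivAt (fun y : ℝ => -4 * y / (1 + y ^ 2) ^ 2)
      ((-4 * (1 + y ^ 2) ^ 2 - -4 * y * (2 * (1 + y ^ 2) * (2 * y))) / ((1 + y ^ 2) ^ 2) ^ 2) y := by
    refine (((hasDerivAt_id y).const_mul (-4)).div hd h00).congr_deriv ?_
    simp
  have hk2 : HasDerivAt (fun y : ℝ => -4 * y ^ 2 / (1 + y ^ 2) ^ 2)
      ((-4 * (2 * y) * (1 + y ^ 2) ^ 2 - -4 * y ^ 2 * (2 * (1 + y ^ 2) * (2 * y))) /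
        ((1 + y ^ 2) ^ 2) ^ 2) y := by
    refine (((hasDerivAt_pow 2 y).const_mul (-4)).div hd h00).congr_deriv ?_
    simp
  have hl : HasDerivAt (fun y : ℝ => y * Real.log y) (Real.log y + 1) y :=
    Real.hasDerivAt_mul_log h1
  have h := (((hk1.mul hl).add (hasDerivAt_phi1 y)).mul
    (hasDerivAt_rho_aux continuous_phi1_mul y)).sub
      (hk2.mul (hasDerivAt_rho_aux continuous_phi2_mul y))
  refine h.congr_deriv ?_
  have hQ : Q y * rho y * y = 8 / (1 + y ^ 2) ^ 2 * y * (phi2 y * (∫ z in (0 : ℝ)..y, phi1 z * z)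
      - phi1 y * ∫ z in (0 : ℝ)..y, phi2 z * z) := by
    rw [← Q_sq]; unfold rho; ring
  rw [hQ]
  generalize (∫ z in (0 : ℝ)..y, phi1 z * z) = a
  generalize (∫ z in (0 : ℝ)..y, phi2 z * z) = c
  simp only [Pi.mul_apply, Pi.add_apply]
  unfold phi2 phi1
  field_simp
  ring

theorem continuous_rhoFlux : Continuous rhoFlux := by
  have hp : ∀ y : ℝ, (1 + y ^ 2) ^ 2 ≠ 0 := fun y => by positivity
  have h1 : Continuous fun y => ∫ z in (0 : ℝ)..y, phi1 z * z :=
    continuous_iff_continuousAt.2 fun y =>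
      (hasDerivAt_rho_aux continuous_phi1_mul y).continuousAt
  have h2 : Continuous fun y => ∫ z in (0 : ℝ)..y, phi2 z * z :=
    continuous_iff_continuousAt.2 fun y =>
      (hasDerivAt_rho_aux continuous_phi2_mul y).continuousAt
  have h3 : Continuous fun y : ℝ => -4 * y / (1 + y ^ 2) ^ 2 :=
    Continuous.div (by fun_prop) (by fun_prop) hp
  have h4 : Continuous fun y : ℝ => -4 * y ^ 2 / (1 + y ^ 2) ^ 2 :=
    Continuous.div (by fun_prop) (by fun_prop) hp
  exact (((h3.mul Real.continuous_mul_log).add continuous_phi1).mul h1).sub (h4.mul h2)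

theorem continuous_Q_mul_rho_mul : Continuous fun z => Q z * rho z * z := by
  have h1 : Continuous fun y => ∫ z in (0 : ℝ)..y, phi1 z * z :=
    continuous_iff_continuousAt.2 fun y =>
      (hasDerivAt_rho_aux continuous_phi1_mul y).continuousAt
  have h2 : Continuous fun y => ∫ z in (0 : ℝ)..y, phi2 z * z :=
    continuous_iff_continuousAt.2 fun y =>
      (hasDerivAt_rho_aux continuous_phi2_mul y).continuousAt
  have h : (fun z => Q z * rho z * z) = fun y => Q y ^ 2 * ((phi2 y * y) *
      (∫ z in (0 : ℝ)..y, phi1 z * z) - (phi1 y * y) * ∫ z in (0 : ℝ)..y, phi2 z * z) := by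
    funext z; unfold rho; ring
  rw [h]
  exact (continuous_Q.pow 2).mul
    ((continuous_phi2_mul.mul h1).sub (continuous_phi1_mul.mul h2))

/-- `ρ` solves `L_Q ρ = ½ y Q`. -/
theorem Lop_rho {y : ℝ} (hy : 0 < y) :
    Lop Qc (fun z => (rho z : ℂ)) y = ((y / 2 * Q y : ℝ) : ℂ) := by
  have hint : ∫ z in (0 : ℝ)..y, (z - Q z * rho z * z) = rhoFlux y := by
    rw [intervalIntegral.integral_eq_sub_of_hasDerivAt_of_le hy.le
      continuous_rhoFlux.continuousOn (fun z hz => hasDerivAt_rhoFlux hz.1)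
      ((continuous_id.sub continuous_Q_mul_rho_mul).intervalIntegrable _ _)]
    simp [rhoFlux]
  have hsub := intervalIntegral.integral_sub
    ((continuous_id (X := ℝ)).intervalIntegrable (μ := MeasureTheory.volume) 0 y)
    (continuous_Q_mul_rho_mul.intervalIntegrable (μ := MeasureTheory.volume) 0 y)
  simp only [id] at hsub
  rw [hsub, integral_id] at hint
  have hI : ∫ r in (0 : ℝ)..y, (star (Qc r) * ((rho r : ℝ) : ℂ)).re * r
      = y ^ 2 / 2 - rhoFlux y := by
    have : (fun r : ℝ => (star (Qc r) * ((rho r : ℝ) : ℂ)).re * r) =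
        fun z => Q z * rho z * z := by
      funext z
      simp [Qc]
    rw [this]
    linarith
  have hdr : deriv (fun z => (rho z : ℂ)) y
      = ((-(2 * y / (1 + y ^ 2)) * rho y + Q y * (rhoFlux y / y) : ℝ) : ℂ) :=
    (hasDerivAt_rho hy).ofReal_comp.deriv
  rw [Lop, hI, Dop, CR, hdr, Atheta_Qc hy, Complex.real_smul, Qc]
  rw [← Complex.ofReal_mul, ← Complex.ofReal_sub, ← Complex.ofReal_mul, ← Complex.ofReal_add]
  congr 1
  have h0 : (1 + y ^ 2) ≠ 0 := by positivity
  have h1 := hy.ne'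
  field_simp
  ring

/-- `ρ` vanishes at the origin, which singles it out among the solutions `ρ + c ΛQ`. -/
theorem tendsto_rho : Filter.Tendsto rho (nhdsWithin 0 (Set.Ioi 0)) (nhds 0) := by
  have h1 : Continuous fun y => ∫ z in (0 : ℝ)..y, phi1 z * z :=
    continuous_iff_continuousAt.2 fun y =>
      (hasDerivAt_rho_aux continuous_phi1_mul y).continuousAt
  have h2 : Continuous fun y => ∫ z in (0 : ℝ)..y, phi2 z * z :=
    continuous_iff_continuousAt.2 fun y =>
      (hasDerivAt_rho_aux continuous_phi2_mul y).continuousAt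
  have ha : HasDerivAt (fun y => ∫ z in (0 : ℝ)..y, phi1 z * z) 0 0 := by
    simpa using hasDerivAt_rho_aux continuous_phi1_mul 0
  have hslope : Filter.Tendsto (fun y : ℝ => y⁻¹ * ∫ z in (0 : ℝ)..y, phi1 z * z)
      (nhdsWithin 0 (Set.Ioi 0)) (nhds 0) := by
    have h := ha.tendsto_slope.mono_left
      (nhdsWithin_mono (0 : ℝ) (fun x (hx : 0 < x) => (ne_of_gt hx : x ≠ 0)))
    refine h.congr fun y => ?_
    simp [slope_def_field, div_eq_inv_mul]
  have hc : ∀ {f : ℝ → ℝ}, Continuous f →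
      Filter.Tendsto f (nhdsWithin 0 (Set.Ioi 0)) (nhds (f 0)) :=
    fun hf => hf.continuousAt.tendsto.mono_left nhdsWithin_le_nhds
  have key := (hc continuous_Q).mul
    (((((hc continuous_phi1).mul (hc Real.continuous_mul_log)).mul hslope).add (hc h1)).sub
      ((hc continuous_phi1).mul (hc h2)))
  simp only [intervalIntegral.integral_same, mul_zero, add_zero, sub_zero] at key
  refine key.congr' ?_
  filter_upwards [self_mem_nhdsWithin] with y hy
  have hy' : y ≠ 0 := ne_of_gt hy
  unfold rho phi2
  field_simp

/-! ### Cutoffs and scales -/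

/-- A smooth cutoff to `y ≤ 1`, supported in `y ≤ 2`. -/
structure IsCutoff (χ : ℝ → ℝ) : Prop where
  smooth : ContDiff ℝ ∞ χ
  nonneg : ∀ y, 0 ≤ χ y
  le_one : ∀ y, χ y ≤ 1
  eq_one : ∀ y, y ≤ 1 → χ y = 1
  eq_zero : ∀ y, 2 ≤ y → χ y = 0

/-- `χ_B(y) = χ(y / B)`. -/
def cut (χ : ℝ → ℝ) (B y : ℝ) : ℝ := χ (y / B)

/-- `B₀ = b^{-1/2}`. -/
def B0 (b : ℝ) : ℝ := b ^ (-(1 / 2) : ℝ)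

/-- `B₁ = b^{-1/2} |log b|`. -/
def B1 (b : ℝ) : ℝ := b ^ (-(1 / 2) : ℝ) * |Real.log b|

/-! ### The profiles `T_{2,0}`, `U_2`, `U_{3,0}` -/

/-- The real `L²(ℝ²)` inner product of two real valued radial functions. -/
def ipR (f g : ℝ → ℝ) : ℝ := 2 * Real.pi * ∫ r in Set.Ioi (0 : ℝ), f r * g r * r

/-- The resonance `½ y Q`. -/
def halfyQ (y : ℝ) : ℝ := y / 2 * Q y

/-- `c_b = (Λ(½yQ), ½yQ) / (½yQ χ_{B₀}, ½yQ)`. -/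
def cb (χ : ℝ → ℝ) (b : ℝ) : ℝ :=
  ipR (Lam 0 halfyQ) halfyQ / ipR (fun y => halfyQ y * cut χ (B0 b) y) halfyQ

def J (y : ℝ) : ℝ := y * Q y

def Gam (y : ℝ) : ℝ := J y * ∫ z in (1 : ℝ)..y, ((J z) ^ 2)⁻¹ * z⁻¹

/-- The right inverse of `H_Q = A_Q^* A_Q` given by the outgoing Green's function. -/
def outHinv (f : ℝ → ℝ) (y : ℝ) : ℝ :=
  ∫ z in (0 : ℝ)..y, z * (J y * Gam z - Gam y * J z) * f z

def g2 (χ : ℝ → ℝ) (b y : ℝ) : ℝ := Lam 0 halfyQ y - cb χ b * (halfyQ y * cut χ (B0 b) y)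

def T20 (χ : ℝ → ℝ) (b : ℝ) : ℝ → ℝ := outHinv (g2 χ b)

def U2 (χ : ℝ → ℝ) (b : ℝ) : ℝ → ℝ := Aop Qc (T20 χ b)

def g30 (χ : ℝ → ℝ) (b y : ℝ) : ℝ :=
  Lam 1 (T20 χ b) y -
    (∫ z in (0 : ℝ)..y, (Q z * T20 χ b z + z ^ 3 / 8 * Q z ^ 2)) * halfyQ y

def U30 (χ : ℝ → ℝ) (b : ℝ) : ℝ → ℝ := Aop Qc (outHinv (g30 χ b))

/-! ### The localized modified profiles -/

def P (χ : ℝ → ℝ) (b η y : ℝ) : ℂ :=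
  Q y + cut χ (B1 b) y * (-(Complex.I * b * (y ^ 2 / 4 * Q y : ℝ)) - η * rho y)

def P1 (χ : ℝ → ℝ) (b η y : ℝ) : ℂ :=
  cut χ (B1 b) y * (-((Complex.I * b + η) * halfyQ y)) + cut χ (B0 b) y * (b ^ 2 * T20 χ b y)

def P2 (χ : ℝ → ℝ) (b η y : ℝ) : ℂ :=
  cut χ (B0 b) y * ((b ^ 2 - 2 * Complex.I * b * η - η ^ 2) * U2 χ b y
    + Complex.I * b ^ 3 * U30 χ b y)

/-- `∂_b F` for a profile `F = F(y; b, η)`, written `F b η y`. -/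
def dB (F : ℝ → ℝ → ℝ → ℂ) (b η y : ℝ) : ℂ := deriv (fun b' => F b' η y) b

/-- `∂_η F`. -/
def dEta (F : ℝ → ℝ → ℝ → ℂ) (b η y : ℝ) : ℂ := deriv (fun η' => F b η' y) η

/-- `F` is smooth in `y` on `(0, ∞)` and differentiable in `(b, η)` there, with parameter
derivatives that are smooth in `y`: no derivative below is a default value. -/
def SmoothProfile (F : ℝ → ℝ → ℝ → ℂ) (b η : ℝ) : Prop :=
  ContDiffOn ℝ ∞ (F b η) (Set.Ioi 0) ∧
  (∀ y, 0 < y → DifferentiableAt ℝ (fun p : ℝ × ℝ => F p.1 p.2 y) (b, η)) ∧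
  ContDiffOn ℝ ∞ (dB F b η) (Set.Ioi 0) ∧
  ContDiffOn ℝ ∞ (dEta F b η) (Set.Ioi 0)

/-! ### Modulation vectors -/

/-- `𝐯_k = (Λ_{-k} P_k, -i P_k, -∂_b P_k, -∂_η P_k)`. -/
def vvec (k : ℝ) (F : ℝ → ℝ → ℝ → ℂ) (b η : ℝ) : Fin 4 → ℝ → ℂ :=
  ![Lam (-k) (F b η), fun y => -(Complex.I * F b η y), fun y => -dB F b η y,
    fun y => -dEta F b η y]

/-- `𝐌𝐨𝐝`, in terms of `ls = λ_s / λ`, `gs = γ_s`, `bs = b_s`, `es = η_s`. -/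
def ModVec (b η ls gs bs es : ℝ) : Fin 4 → ℝ :=
  ![ls + b, gs - η, bs + b ^ 2 + η ^ 2, es]

/-- The logarithmically corrected version of `𝐌𝐨𝐝`; here `gts` is the corrected phase speed. -/
def ModT (χ : ℝ → ℝ) (b η ls gts bs es : ℝ) : Fin 4 → ℝ :=
  ![ls + b, gts + η, bs + b ^ 2 + η ^ 2 + cb χ b * (b ^ 2 - η ^ 2), es + 2 * cb χ b * b * η]

/-- `m · v` for a real vector `m` and a vector `v` of functions. -/
def modDot (m : Fin 4 → ℝ) (v : Fin 4 → ℝ → ℂ) (y : ℝ) : ℂ := ∑ i, (m i : ℂ) * v i y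

/-- `∫_0^y Re(P̄ P₁) dy'`. -/
def nonloc (χ : ℝ → ℝ) (b η y : ℝ) : ℝ :=
  ∫ r in (0 : ℝ)..y, (star (P χ b η r) * P1 χ b η r).re

/-! ### Norms, with values in `[0, ∞]` -/

/-- Lebesgue measure of `ℝ²` in the radial variable: `2π r dr` on `(0, ∞)`. -/
def radialMeasure : MeasureTheory.Measure ℝ :=
  (MeasureTheory.volume.restrict (Set.Ioi (0 : ℝ))).withDensity
    (fun r => ENNReal.ofReal (2 * Real.pi * r))

def normL2 {E : Type*} [NormedAddCommGroup E] (f : ℝ → E) : ENNReal :=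
  MeasureTheory.eLpNorm f 2 radialMeasure

/-- The Japanese bracket `⟨x⟩`. -/
def jb (x : ℝ) : ℝ := √(1 + x ^ 2)

def logPlus (y : ℝ) : ℝ := max 0 (Real.log y)

/-- `‖f‖_X = ‖⟨y⟩^{-2} ⟨log₊ y⟩ f‖_{L²}`. -/
def normX (f : ℝ → ℂ) : ENNReal := normL2 (fun y => ((jb y ^ 2)⁻¹ * jb (logPlus y)) • f y)

/-- The norm of `𝓗̇¹₂`. -/
def normH12 (v : ℝ → ℂ) : ENNReal :=
  normL2 (deriv v) + normL2 (fun y => (y⁻¹ * (jb (logPlus y))⁻¹) • v y)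

/-- `|v|_{-1} = sup {|∂_y v|, |v| / y}`. -/
def absNegOne (v : ℝ → ℂ) (y : ℝ) : ℝ := max ‖deriv v y‖ (y⁻¹ * ‖v y‖)

/-- The norm of `𝓗̇²₁`. -/
def normH21 (v : ℝ → ℂ) : ENNReal :=
  normL2 (deriv (deriv v)) + normL2 (fun y => y⁻¹ * (jb (Real.log y))⁻¹ * absNegOne v y)

end

end CSS

open CSS

/-!
# Modified profiles for the self-dual Chern–Simons–Schrödinger equation

The profiles are an expansion in `b` and `η` around `Q`, and on `y < B₀`, where both cutoffs equal
one, they solve their equations up to the claimed order by algebra: `L_Q` maps `i y² Q / 4` and `ρ`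
to `i y Q / 2` and `y Q / 2`, so `𝐃_P P - P₁` has no linear term in `(b, η)`, and
`A_Q^* U₂ = g₂`, `A_Q^* U_{3,0} = g_{3,0}`, so the terms of order `b²` in the equation for `P₁`
cancel. The part `-c_b (b - iη)² y Q / 2` of `(b - iη)² g₂` is what the corrections `c_b (b² - η²)`
and `2 c_b b η` in the laws of `b` and `η` absorb. The outcome is a set of formulas for the
residuals below `B₀`, `Psi0_inner`, `Psi1_inner`, `Psi2_inner`, `compat_first` and `Aop_P1T_inner`,
in which every remaining term is small. Beyond `B₀` (`B₁` for `𝐃_P P - P₁`) no cancellation is used: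
there a power of `y` can be paid for with a power of `b^{1/2}`, and each term is bounded by itself.

The analytic input is the growth of `T_{2,0}`, `U₂` and `U_{3,0}`. Since `A_Q H_Q^{-1} f` is
`-(y J)⁻¹ ∫_0^y z J f` (`Adm.Aop_outHinv`), it is governed by one scalar integral, which for `g₂` is
`2 ((y² / (1 + y²))² - c_b ∫_0^y (½ z Q)² χ_{B₀} z dz)` (`JInt_g2`). The constant
`c_b` is the one for which this tends to zero at infinity. The integral is bounded
(`bd_JInt_g2`), and on `y ≲ B₀` it is also `O(B₀ / (y |log b|))` (`bd_JInt_g2'`), because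
the truncated norm differs from its limit by `∫_y^{2B₀} dz / z = O(B₀ / y)` (`KInf_sub_le`), while
`c_b` is comparable to `1 / |log b|` (`abs_cb_sub_le`). The second bound is the source of the
logarithmic gains.

All estimates are uniform in `(b, η)` and are phrased in symbol classes. With `t = b^{1/2}` and
`L = |log b|`, a family `F` belongs to `Sy S p q m n` if all its Euler derivatives `(y ∂_y)^k F` are
`O(y^p (1 + y)^q t^m L^{-n})` on the region `S`. These classes are stable under sums, products,
`y ∂_y` and, on intervals that start at the origin, primitives, so membership of each profile and
each term of a residual is a computation with four integers; smoothness in `y` comes with it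
(`Sym.contDiffOn`). On `y ≤ 2 B₀` or `y ≤ 2 B₁` powers of `y` may be exchanged for powers of `t`
and `L` (`Sy.leB0`, `Sy.leB1`), and beyond `B₀` or `B₁` in the opposite direction (`Sy.geB0`,
`Sy.geB1`).

The scales `B₀`, `2 B₀`, `B₁`, `2 B₁` cut the half line into the regions `R0`, …, `R4`. Pointwise
bounds by explicit weights on each of them give the norms (`normX_le`, `normH12_le`, `normH21_le`,
`normL2_le`), since the weights have finite norms of the required size. The sharp powers of
`|log b|` rest on two features of the weights: `y⁻¹` has an `L²` norm of order `|log b|^{1/2}` only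
on `[1, 2 B₁]`, which a factor `L⁻¹` outweighs, and `t` has norm `O(1)` on `(0, 2 B₀)`.

The derivatives in `b` solve the same problems with `∂_b g₂` as source (`hasDerivAt_U2_b`,
`hasDerivAt_U30_b`), and the residuals are by definition what the evolution equations leave over,
which the chain rule identifies (`evolution_P`, `evolution_P1`, `evolution_P2`).
-/

set_option linter.unusedSectionVars false

namespace CSS

noncomputable section

/-! ### Uniform symbol classes -/

/-- A family of open subsets of `(0, ∞)`, on which families of radial functions are estimated. -/
structure Region (ι : Type*) where
  /-- The member of index `i`. -/
  carrier : ι → Set ℝ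
  isOpen : ∀ i, IsOpen (carrier i)
  pos : ∀ i, ∀ y ∈ carrier i, 0 < y

instance {ι : Type*} : CoeFun (Region ι) (fun _ => ι → Set ℝ) := ⟨Region.carrier⟩

section Symbols

variable {ι : Type*} {E : Type*} [NormedRing E] [NormedAlgebra ℝ E]

/-- The Euler derivative `y ∂_y`. -/
def euler (f : ℝ → E) (y : ℝ) : E := y • deriv f y

/-- `F = O(m)` on `S`, uniformly in the index. -/
def Bd (S : Region ι) (m : ι → ℝ → ℝ) (F : ι → ℝ → E) : Prop :=
  ∃ C : ℝ, ∀ i, ∀ y ∈ S i, ‖F i y‖ ≤ C * m i y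

/-- Symbol bounds for the first `k` Euler derivatives. -/
def SymK (S : Region ι) (m : ι → ℝ → ℝ) : ℕ → (ι → ℝ → E) → Prop
  | 0, F => Bd S m F
  | k + 1, F => Bd S m F ∧ (∀ i, ∀ y ∈ S i, DifferentiableAt ℝ (F i) y) ∧
      SymK S m k (fun i => euler (F i))

/-- The symbol class of the weight `m`: all Euler derivatives of the family `F` exist on `S` and are
`O(m)` there, uniformly in the index. -/
def Sym (S : Region ι) (m : ι → ℝ → ℝ) (F : ι → ℝ → E) : Prop := ∀ k, SymK S m k F

variable {S S' : Region ι} {m m' m₁ m₂ : ι → ℝ → ℝ} {F G H : ι → ℝ → E}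

theorem Bd.mono (h : Bd S m F) (hm : ∃ K : ℝ, ∀ i, ∀ y ∈ S i, |m i y| ≤ K * m' i y) :
    Bd S m' F := by
  obtain ⟨C, hC⟩ := h
  obtain ⟨K, hK⟩ := hm
  refine ⟨|C| * K, fun i y hy => (hC i y hy).trans ?_⟩
  calc C * m i y ≤ |C * m i y| := le_abs_self _
    _ = |C| * |m i y| := abs_mul _ _
    _ ≤ |C| * (K * m' i y) := mul_le_mul_of_nonneg_left (hK i y hy) (abs_nonneg _)
    _ = |C| * K * m' i y := by ring

theorem Bd.congr (h : Bd S m F) (e : ∀ i, ∀ y ∈ S i, F i y = G i y) : Bd S m G := by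
  obtain ⟨C, hC⟩ := h
  exact ⟨C, fun i y hy => e i y hy ▸ hC i y hy⟩

theorem Bd.add (h : Bd S m F) (h' : Bd S m G) : Bd S m (fun i y => F i y + G i y) := by
  obtain ⟨C, hC⟩ := h
  obtain ⟨C', hC'⟩ := h'
  refine ⟨C + C', fun i y hy => (norm_add_le _ _).trans ?_⟩
  rw [add_mul]
  exact add_le_add (hC i y hy) (hC' i y hy)

theorem Bd.mul (h : Bd S m₁ F) (h' : Bd S m₂ G) :
    Bd S (fun i y => m₁ i y * m₂ i y) (fun i y => F i y * G i y) := by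
  obtain ⟨C, hC⟩ := h
  obtain ⟨C', hC'⟩ := h'
  refine ⟨C * C', fun i y hy => (norm_mul_le _ _).trans ?_⟩
  calc ‖F i y‖ * ‖G i y‖ ≤ (C * m₁ i y) * (C' * m₂ i y) :=
        mul_le_mul (hC i y hy) (hC' i y hy) (norm_nonneg _) ((norm_nonneg _).trans (hC i y hy))
    _ = C * C' * (m₁ i y * m₂ i y) := by ring

theorem Bd.neg (h : Bd S m F) : Bd S m (fun i y => -F i y) := by
  obtain ⟨C, hC⟩ := h
  exact ⟨C, fun i y hy => by rw [norm_neg]; exact hC i y hy⟩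

theorem Bd.restrict (h : Bd S m F) (hS : ∀ i, S' i ⊆ S i) : Bd S' m F := by
  obtain ⟨C, hC⟩ := h
  exact ⟨C, fun i y hy => hC i y (hS i hy)⟩

theorem SymK.bd {k : ℕ} (h : SymK S m k F) : Bd S m F := by
  cases k with
  | zero => exact h
  | succ k => exact h.1

theorem SymK.pred {k : ℕ} (h : SymK S m (k + 1) F) : SymK S m k F := by
  induction k generalizing F with
  | zero => exact h.1
  | succ k ih => exact ⟨h.1, h.2.1, ih h.2.2⟩

theorem Region.mem_nhds (S : Region ι) {i : ι} {y : ℝ} (hy : y ∈ S i) : S i ∈ nhds y :=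
  (S.isOpen i).mem_nhds hy

theorem eventuallyEq_of_region (e : ∀ i, ∀ y ∈ S i, F i y = G i y) {i : ι} {y : ℝ}
    (hy : y ∈ S i) : F i =ᶠ[nhds y] G i := by
  filter_upwards [S.mem_nhds hy] with z hz using e i z hz

theorem euler_congr (e : ∀ i, ∀ y ∈ S i, F i y = G i y) {i : ι} {y : ℝ} (hy : y ∈ S i) :
    euler (F i) y = euler (G i) y := by
  unfold euler
  rw [(eventuallyEq_of_region e hy).deriv_eq]

theorem SymK.congr {k : ℕ} (h : SymK S m k F) (e : ∀ i, ∀ y ∈ S i, F i y = G i y) :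
    SymK S m k G := by
  induction k generalizing F G with
  | zero => exact Bd.congr h e
  | succ k ih =>
    exact ⟨h.1.congr e, fun i y hy =>
      (h.2.1 i y hy).congr_of_eventuallyEq (eventuallyEq_of_region e hy).symm,
      ih h.2.2 fun i y hy => euler_congr e hy⟩

theorem SymK.mono {k : ℕ} (h : SymK S m k F)
    (hm : ∃ K : ℝ, ∀ i, ∀ y ∈ S i, |m i y| ≤ K * m' i y) : SymK S m' k F := by
  induction k generalizing F with
  | zero => exact Bd.mono h hm
  | succ k ih => exact ⟨h.1.mono hm, h.2.1, ih h.2.2⟩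

theorem SymK.restrict {k : ℕ} (h : SymK S m k F) (hS : ∀ i, S' i ⊆ S i) : SymK S' m k F := by
  induction k generalizing F with
  | zero => exact Bd.restrict h hS
  | succ k ih => exact ⟨h.1.restrict hS, fun i y hy => h.2.1 i y (hS i hy), ih h.2.2⟩

theorem SymK.add {k : ℕ} (h : SymK S m k F) (h' : SymK S m k G) :
    SymK S m k (fun i y => F i y + G i y) := by
  induction k generalizing F G with
  | zero => exact Bd.add h h'
  | succ k ih =>
    refine ⟨h.1.add h'.1, fun i y hy => (h.2.1 i y hy).add (h'.2.1 i y hy),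
      (ih h.2.2 h'.2.2).congr fun i y hy => ?_⟩
    simp only [euler]
    rw [deriv_fun_add (h.2.1 i y hy) (h'.2.1 i y hy), smul_add]

theorem SymK.neg {k : ℕ} (h : SymK S m k F) : SymK S m k (fun i y => -F i y) := by
  induction k generalizing F with
  | zero => exact Bd.neg h
  | succ k ih =>
    refine ⟨h.1.neg, fun i y hy => (h.2.1 i y hy).neg, (ih h.2.2).congr fun i y hy => ?_⟩
    simp only [euler]
    rw [deriv.fun_neg, smul_neg]

theorem SymK.mul {k : ℕ} (h : SymK S m₁ k F) (h' : SymK S m₂ k G) :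
    SymK S (fun i y => m₁ i y * m₂ i y) k (fun i y => F i y * G i y) := by
  induction k generalizing F G with
  | zero => exact Bd.mul h h'
  | succ k ih =>
    refine ⟨h.1.mul h'.1, fun i y hy => (h.2.1 i y hy).mul (h'.2.1 i y hy),
      ((ih h.2.2 h'.pred).add (ih h.pred h'.2.2)).congr fun i y hy => ?_⟩
    simp only [euler]
    rw [deriv_fun_mul (h.2.1 i y hy) (h'.2.1 i y hy), smul_add, smul_mul_assoc, mul_smul_comm]

theorem Sym.bd (h : Sym S m F) : Bd S m F := h 0

theorem Sym.diff (h : Sym S m F) {i : ι} {y : ℝ} (hy : y ∈ S i) : DifferentiableAt ℝ (F i) y :=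
  (h 1).2.1 i y hy

theorem Sym.euler (h : Sym S m F) : Sym S m (fun i => euler (F i)) := fun k => (h (k + 1)).2.2

theorem Sym.of_euler (hb : Bd S m F) (hd : ∀ i, ∀ y ∈ S i, DifferentiableAt ℝ (F i) y)
    (h : Sym S m (fun i => CSS.euler (F i))) : Sym S m F := fun k => by
  cases k with
  | zero => exact hb
  | succ k => exact ⟨hb, hd, h k⟩

theorem Sym.congr (h : Sym S m F) (e : ∀ i, ∀ y ∈ S i, F i y = G i y) : Sym S m G :=
  fun k => (h k).congr e

theorem Sym.mono (h : Sym S m F) (hm : ∃ K : ℝ, ∀ i, ∀ y ∈ S i, |m i y| ≤ K * m' i y) :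
    Sym S m' F := fun k => (h k).mono hm

theorem Sym.restrict (h : Sym S m F) (hS : ∀ i, S' i ⊆ S i) : Sym S' m F :=
  fun k => (h k).restrict hS

theorem Sym.add (h : Sym S m F) (h' : Sym S m G) : Sym S m (fun i y => F i y + G i y) :=
  fun k => (h k).add (h' k)

theorem Sym.neg (h : Sym S m F) : Sym S m (fun i y => -F i y) := fun k => (h k).neg

theorem Sym.sub (h : Sym S m F) (h' : Sym S m G) : Sym S m (fun i y => F i y - G i y) :=
  (h.add h'.neg).congr fun _ _ _ => (sub_eq_add_neg _ _).symm

theorem Sym.mul (h : Sym S m₁ F) (h' : Sym S m₂ G) :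
    Sym S (fun i y => m₁ i y * m₂ i y) (fun i y => F i y * G i y) := fun k => (h k).mul (h' k)

theorem SymK.zero {k : ℕ} (hz : ∀ i, ∀ y ∈ S i, F i y = 0) : SymK S m k F := by
  induction k generalizing F with
  | zero => exact ⟨0, fun i y hy => by simp [hz i y hy]⟩
  | succ k ih =>
    refine ⟨⟨0, fun i y hy => by simp [hz i y hy]⟩, fun i y hy => ?_, ih fun i y hy => ?_⟩
    · exact (differentiableAt_const (0 : E)).congr_of_eventuallyEq
        (eventuallyEq_of_region (S := S) (G := fun _ _ => 0) hz hy)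
    · rw [euler_congr (S := S) (G := fun _ _ => 0) hz hy]
      simp [CSS.euler]

theorem Sym.zero (hz : ∀ i, ∀ y ∈ S i, F i y = 0) : Sym S m F := fun _ => SymK.zero hz

theorem Sym.const {c : ι → E} (hc : ∃ C : ℝ, ∀ i, ∀ y ∈ S i, ‖c i‖ ≤ C * m i y) :
    Sym S m (fun i _ => c i) :=
  Sym.of_euler hc (fun _ _ _ => differentiableAt_const _)
    (Sym.zero fun _ _ _ => by simp [CSS.euler])

theorem Sym.contDiffOn (h : Sym S m F) (i : ι) : ContDiffOn ℝ ∞ (F i) (S i) := by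
  rw [contDiffOn_infty]
  intro n
  induction n generalizing F with
  | zero =>
    exact contDiffOn_zero.2 fun y hy => (h.diff hy).continuousAt.continuousWithinAt
  | succ n ih =>
    rw [Nat.cast_add, Nat.cast_one, contDiffOn_succ_iff_deriv_of_isOpen (S.isOpen i)]
    refine ⟨fun y hy => (h.diff hy).differentiableWithinAt, by simp, ?_⟩
    have h1 : ContDiffOn ℝ n (fun y : ℝ => y⁻¹ • CSS.euler (F i) y) (S i) :=
      (contDiffOn_id.inv fun y hy => (S.pos i y hy).ne').smul (ih h.euler)
    refine h1.congr fun y hy => ?_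
    simp only [CSS.euler]
    rw [smul_smul, inv_mul_cancel₀ (S.pos i y hy).ne', one_smul]

theorem SymK.ofReal {F : ι → ℝ → ℝ} {k : ℕ} (h : SymK S m k F) :
    SymK S m k (fun i y => (F i y : ℂ)) := by
  induction k generalizing F with
  | zero =>
    obtain ⟨C, hC⟩ := h
    exact ⟨C, fun i y hy => by rw [Complex.norm_real]; exact hC i y hy⟩
  | succ k ih =>
    refine ⟨?_, fun i y hy => (h.2.1 i y hy).hasDerivAt.ofReal_comp.differentiableAt,
      (ih h.2.2).congr fun i y hy => ?_⟩
    · obtain ⟨C, hC⟩ := h.1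
      exact ⟨C, fun i y hy => by rw [Complex.norm_real]; exact hC i y hy⟩
    · simp only [CSS.euler]
      rw [(h.2.1 i y hy).hasDerivAt.ofReal_comp.deriv]
      simp

theorem Sym.ofReal {F : ι → ℝ → ℝ} (h : Sym S m F) : Sym S m (fun i y => (F i y : ℂ)) :=
  fun k => (h k).ofReal

/-- The second derivative in terms of Euler derivatives. -/
theorem Sym.deriv_deriv (h : Sym S m F) {i : ι} {y : ℝ} (hy : y ∈ S i) :
    (y ^ 2) • deriv (deriv (F i)) y = CSS.euler (CSS.euler (F i)) y - CSS.euler (F i) y := by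
  have e1 : deriv (F i) =ᶠ[nhds y] fun z : ℝ => z⁻¹ • CSS.euler (F i) z := by
    filter_upwards [S.mem_nhds hy] with z hz
    simp only [CSS.euler]
    rw [smul_smul, inv_mul_cancel₀ (S.pos i z hz).ne', one_smul]
  have hy0 := (S.pos i y hy).ne'
  have hd : DifferentiableAt ℝ (deriv (F i)) y :=
    ((differentiableAt_id.inv hy0).smul (h.euler.diff hy)).congr_of_eventuallyEq e1
  have h2 : deriv (CSS.euler (F i)) y = deriv (F i) y + y • deriv (deriv (F i)) y := by
    have := (hasDerivAt_id y).smul hd.hasDerivAt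
    have h3 := this.deriv
    simp only [id, one_smul] at h3
    rw [add_comm]
    exact h3
  rw [CSS.euler, h2, CSS.euler, smul_add, smul_smul, pow_two, add_sub_cancel_left]

/-! ### Primitives -/

theorem intervalIntegrable_of_bdd {f : ℝ → ℝ} {y C : ℝ} (hy : 0 < y)
    (hc : ContinuousOn f (Set.Ioc 0 y)) (hb : ∀ z ∈ Set.Ioc 0 y, |f z| ≤ C) :
    IntervalIntegrable f MeasureTheory.volume 0 y := by
  rw [intervalIntegrable_iff_integrableOn_Ioc_of_le hy.le]
  refine MeasureTheory.IntegrableOn.of_bound (by simp)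
    (hc.aestronglyMeasurable measurableSet_Ioc) C ?_
  exact (MeasureTheory.ae_restrict_mem measurableSet_Ioc).mono fun z hz => hb z hz

theorem hasDerivAt_integral_of_bdd {f : ℝ → ℝ} {y C : ℝ} {s : Set ℝ} (hs : IsOpen s) (hy : 0 < y)
    (hsy : Set.Ioc 0 y ⊆ s) (hc : ContinuousOn f s) (hb : ∀ z ∈ Set.Ioc 0 y, |f z| ≤ C) :
    HasDerivAt (fun y => ∫ z in (0 : ℝ)..y, f z) (f y) y := by
  have hys : s ∈ nhds y := hs.mem_nhds (hsy ⟨hy, le_rfl⟩)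
  exact intervalIntegral.integral_hasDerivAt_right
    (intervalIntegrable_of_bdd hy (hc.mono hsy) hb)
    ⟨s, hys, hc.aestronglyMeasurable hs.measurableSet⟩ (hc.continuousAt hys)

theorem norm_integral_le_of_bdd {f : ℝ → ℝ} {y C : ℝ} (hy : 0 < y)
    (hb : ∀ z ∈ Set.Ioc 0 y, |f z| ≤ C) : |∫ z in (0 : ℝ)..y, f z| ≤ C * y := by
  have := intervalIntegral.norm_integral_le_of_norm_le_const (a := 0) (b := y) (f := f) (C := C)
    (fun z hz => by rw [Set.uIoc_of_le hy.le] at hz; exact hb z hz)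
  rwa [sub_zero, abs_of_pos hy] at this

/-- A region that contains `(0, y]` along with `y`. -/
def Region.Initial (S : Region ι) : Prop := ∀ i, ∀ y ∈ S i, Set.Ioc 0 y ⊆ S i

theorem Sym.continuousOn (h : Sym S m F) (i : ι) : ContinuousOn (F i) (S i) :=
  (h.contDiffOn i).continuousOn

theorem Sym.hasDerivAt_integral {F : ι → ℝ → ℝ} (hS : S.Initial) (h : Sym S m F)
    (hl : ∀ i, ∀ y ∈ S i, ∃ C, ∀ z ∈ Set.Ioc 0 y, |F i z| ≤ C) {i : ι} {y : ℝ} (hy : y ∈ S i) :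
    HasDerivAt (fun y => ∫ z in (0 : ℝ)..y, F i z) (F i y) y := by
  obtain ⟨C, hC⟩ := hl i y hy
  exact hasDerivAt_integral_of_bdd (S.isOpen i) (S.pos i y hy) (hS i y hy) (h.continuousOn i) hC

/-- Primitives of symbols are symbols. -/
theorem Sym.primitive_of_bd {F : ι → ℝ → ℝ} (hS : S.Initial) (h : Sym S m F)
    (hl : ∀ i, ∀ y ∈ S i, ∃ C, ∀ z ∈ Set.Ioc 0 y, |F i z| ≤ C)
    (hb : Bd S m' fun i y => ∫ z in (0 : ℝ)..y, F i z)
    (hm : Sym S m' fun i y => y * F i y) :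
    Sym S m' fun i y => ∫ z in (0 : ℝ)..y, F i z :=
  Sym.of_euler hb (fun _ _ hy => (h.hasDerivAt_integral hS hl hy).differentiableAt)
    (hm.congr fun i y hy => by
      simp only [CSS.euler]
      rw [(h.hasDerivAt_integral hS hl hy).deriv, smul_eq_mul])

end Symbols

/-! ### Parameters and weights -/

/-- The admissible parameters `(b, η)`. The explicit bound on `b` makes `|log b| > 16`, so that
numerical constants can be absorbed. -/
structure Par where
  /-- The scaling parameter. -/
  b : ℝ
  /-- The rotation parameter. -/
  eta : ℝ
  pos : 0 < b
  small : b < Real.exp (-16)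
  eta_le : |eta| ≤ b / |Real.log b|

namespace Par

variable (i : Par)

/-- `t = b^{1/2}`, the inverse of the scale `B₀`. -/
def t : ℝ := √i.b

/-- `L = |log b|`. -/
def L : ℝ := |Real.log i.b|

theorem t_pos : 0 < i.t := Real.sqrt_pos.2 i.pos

theorem t_sq : i.t ^ 2 = i.b := Real.sq_sqrt i.pos.le

theorem b_lt_one : i.b < 1 := i.small.trans (Real.exp_lt_one_iff.2 (by norm_num))

theorem L_eq : i.L = -Real.log i.b := abs_of_neg (Real.log_neg i.pos i.b_lt_one)

theorem L_gt : 16 < i.L := by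
  rw [L_eq]
  have := (Real.log_lt_iff_lt_exp i.pos).2 i.small
  linarith

theorem L_pos : 0 < i.L := by linarith [i.L_gt]

theorem t_eq : i.t = Real.exp (-(i.L / 2)) := by
  have : i.b = Real.exp (-(i.L / 2)) ^ 2 := by
    rw [← Real.exp_nat_mul, L_eq]
    simp only [Nat.cast_ofNat]
    rw [show (2 : ℝ) * -(-Real.log i.b / 2) = Real.log i.b by ring, Real.exp_log i.pos]
  rw [t, this, Real.sqrt_sq (Real.exp_pos _).le]

theorem t_lt_one : i.t < 1 := by
  rw [t_eq]
  exact Real.exp_lt_one_iff.2 (by linarith [i.L_pos])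

theorem t_mul_L_pow (k : ℕ) : i.t * i.L ^ k ≤ 2 ^ k * k.factorial := by
  have h := Real.pow_div_factorial_le_exp (i.L / 2) (by linarith [i.L_pos]) k
  rw [div_pow, div_div, div_le_iff₀ (by positivity)] at h
  calc i.t * i.L ^ k ≤ i.t * (Real.exp (i.L / 2) * (2 ^ k * k.factorial)) :=
        mul_le_mul_of_nonneg_left h i.t_pos.le
    _ = (i.t * Real.exp (i.L / 2)) * (2 ^ k * k.factorial) := by ring
    _ = 2 ^ k * k.factorial := by
        rw [t_eq, ← Real.exp_add, neg_add_cancel, Real.exp_zero, one_mul]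

theorem abs_eta_le : |i.eta| ≤ i.t ^ 2 * i.L⁻¹ := by
  rw [t_sq, ← div_eq_mul_inv]
  exact i.eta_le

end Par

/-- The monomial `t^m L^{-n}` in the parameters; larger `m` and `n` mean smaller families. -/
def Par.c (i : Par) (m n : ℤ) : ℝ := i.t ^ m * i.L ^ (-n)

theorem Par.c_pos (i : Par) (m n : ℤ) : 0 < i.c m n :=
  mul_pos (zpow_pos i.t_pos _) (zpow_pos i.L_pos _)

theorem Par.c_mul (i : Par) (m n m' n' : ℤ) : i.c m n * i.c m' n' = i.c (m + m') (n + n') := by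
  unfold Par.c
  rw [zpow_add₀ i.t_pos.ne', neg_add, zpow_add₀ i.L_pos.ne']
  ring

theorem Par.c_zero (i : Par) : i.c 0 0 = 1 := by simp [Par.c]

/-- Powers of `t` beat powers of `L`. -/
theorem Par.c_le {m n m' n' : ℤ} (h : m' < m ∨ m' = m ∧ n' ≤ n) :
    ∃ K : ℝ, 0 < K ∧ ∀ i : Par, i.c m n ≤ K * i.c m' n' := by
  rcases h with h | ⟨rfl, h⟩
  · set k := (n' - n).toNat with hk
    refine ⟨2 ^ k * k.factorial, by positivity, fun i => ?_⟩
    have e : i.c m n = (i.t ^ (m - m') * i.L ^ (n' - n)) * i.c m' n' := by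
      have : i.t ^ (m - m') * i.L ^ (n' - n) = i.c (m - m') (n - n') := by
        unfold Par.c; congr 2; ring
      rw [this, Par.c_mul]; congr 1 <;> ring
    rw [e]
    refine mul_le_mul_of_nonneg_right ?_ (i.c_pos _ _).le
    refine le_trans (mul_le_mul ?_ ?_ (zpow_nonneg i.L_pos.le _) i.t_pos.le) (i.t_mul_L_pow k)
    · calc i.t ^ (m - m') ≤ i.t ^ (1 : ℤ) :=
            zpow_le_zpow_right_of_le_one₀ i.t_pos i.t_lt_one.le (by omega)
        _ = i.t := zpow_one _
    · rw [← zpow_natCast]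
      exact zpow_le_zpow_right₀ (by linarith [i.L_gt]) (by omega)
  · refine ⟨1, one_pos, fun i => ?_⟩
    rw [one_mul]
    exact mul_le_mul_of_nonneg_left
      (zpow_le_zpow_right₀ (by linarith [i.L_gt]) (by omega)) (zpow_nonneg i.t_pos.le _)

/-- The weight `y^p (1 + y)^q t^m L^{-n}`. -/
def W (p q m n : ℤ) (i : Par) (y : ℝ) : ℝ := y ^ p * (1 + y) ^ q * i.c m n

theorem W_pos {p q m n : ℤ} {i : Par} {y : ℝ} (hy : 0 < y) : 0 < W p q m n i y :=
  mul_pos (mul_pos (zpow_pos hy _) (zpow_pos (by linarith) _)) (i.c_pos _ _)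

theorem W_mul {p q m n p' q' m' n' : ℤ} {i : Par} {y : ℝ} (hy : 0 < y) :
    W p q m n i y * W p' q' m' n' i y = W (p + p') (q + q') (m + m') (n + n') i y := by
  unfold W
  rw [← Par.c_mul, zpow_add₀ hy.ne', zpow_add₀ (by linarith : (1 : ℝ) + y ≠ 0)]
  ring

theorem weight_le {p q p' q' : ℤ} (hp : p' ≤ p) (hq : p + q ≤ p' + q') {y : ℝ} (hy : 0 < y) :
    y ^ p * (1 + y) ^ q ≤ y ^ p' * (1 + y) ^ q' := by
  have hs : (0 : ℝ) < 1 + y := by linarith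
  calc y ^ p * (1 + y) ^ q = y ^ p' * y ^ (p - p') * (1 + y) ^ q := by
        rw [← zpow_add₀ hy.ne']; congr 2; ring
    _ ≤ y ^ p' * (1 + y) ^ (p - p') * (1 + y) ^ q := by
        refine mul_le_mul_of_nonneg_right (mul_le_mul_of_nonneg_left ?_ (zpow_nonneg hy.le _))
          (zpow_nonneg hs.le _)
        exact zpow_le_zpow_left₀ (by omega) hy.le (by linarith)
    _ = y ^ p' * (1 + y) ^ (p - p' + q) := by rw [mul_assoc, ← zpow_add₀ hs.ne']
    _ ≤ y ^ p' * (1 + y) ^ q' :=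
        mul_le_mul_of_nonneg_left (zpow_le_zpow_right₀ (by linarith) (by omega))
          (zpow_nonneg hy.le _)

/-- The symbol class of the weight `W p q m n`. -/
abbrev Sy {E : Type*} [NormedRing E] [NormedAlgebra ℝ E] (S : Region Par) (p q m n : ℤ)
    (F : Par → ℝ → E) : Prop := Sym S (W p q m n) F

section

variable {E : Type*} [NormedRing E] [NormedAlgebra ℝ E] {S S' : Region Par}
  {p q m n p' q' m' n' : ℤ} {F G : Par → ℝ → E}

theorem W_le (hp : p' ≤ p) (hq : p + q ≤ p' + q') (hc : m' < m ∨ m' = m ∧ n' ≤ n) :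
    ∃ K : ℝ, ∀ i, ∀ y ∈ S i, |W p q m n i y| ≤ K * W p' q' m' n' i y := by
  obtain ⟨K, hK, h⟩ := Par.c_le hc
  refine ⟨K, fun i y hy => ?_⟩
  have hy0 := S.pos i y hy
  rw [abs_of_pos (W_pos hy0)]
  calc W p q m n i y ≤ (y ^ p' * (1 + y) ^ q') * (K * i.c m' n') :=
        mul_le_mul (weight_le hp hq hy0) (h i) (i.c_pos _ _).le
          (mul_nonneg (zpow_nonneg hy0.le _) (zpow_nonneg (by linarith) _))
    _ = K * W p' q' m' n' i y := by unfold W; ring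

theorem Bd.le (h : Bd S (W p q m n) F) (hp : p' ≤ p := by omega)
    (hq : p + q ≤ p' + q' := by omega)
    (hc : m' < m ∨ m' = m ∧ n' ≤ n := by omega) : Bd S (W p' q' m' n') F :=
  Bd.mono h (W_le hp hq hc)

/-- Weakening: the exponent at the origin may drop, the growth at infinity may rise, and a power of
`t` pays for any power of `L`. The side conditions are linear integer arithmetic. -/
theorem Sy.le (h : Sy S p q m n F) (hp : p' ≤ p := by omega) (hq : p + q ≤ p' + q' := by omega)
    (hc : m' < m ∨ m' = m ∧ n' ≤ n := by omega) : Sy S p' q' m' n' F :=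
  Sym.mono h (W_le hp hq hc)

theorem Sy.mul {p₁ q₁ m₁ n₁ p₂ q₂ m₂ n₂ : ℤ} (h : Sy S p₁ q₁ m₁ n₁ F) (h' : Sy S p₂ q₂ m₂ n₂ G)
    (hp : p' ≤ p₁ + p₂ := by omega) (hq : p₁ + p₂ + (q₁ + q₂) ≤ p' + q' := by omega)
    (hc : m' < m₁ + m₂ ∨ m' = m₁ + m₂ ∧ n' ≤ n₁ + n₂ := by omega) :
    Sy S p' q' m' n' (fun i y => F i y * G i y) := by
  have h1 : Sy S (p₁ + p₂) (q₁ + q₂) (m₁ + m₂) (n₁ + n₂) (fun i y => F i y * G i y) :=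
    (Sym.mul h h').mono ⟨1, fun i y hy => by
      have hy0 := S.pos i y hy
      rw [abs_of_pos (mul_pos (W_pos hy0) (W_pos hy0)), W_mul hy0, one_mul]⟩
  exact h1.le hp hq hc

theorem Sy.scalar {c : Par → E} (hc : ∃ C : ℝ, ∀ i, ‖c i‖ ≤ C * i.c m n) :
    Sy S 0 0 m n (fun i _ => c i) := by
  obtain ⟨C, hC⟩ := hc
  exact Sym.const ⟨C, fun i y _ => by simpa [W] using hC i⟩

theorem Sy.number (c : E) : Sy S 0 0 0 0 (fun _ _ => c) :=
  Sy.scalar ⟨‖c‖, fun i => by simp [Par.c_zero]⟩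

theorem Sy.id : Sy S 1 0 0 0 (fun _ y => y) := by
  refine fun k => ?_
  induction k with
  | zero =>
    exact ⟨1, fun i y hy => by
      rw [Real.norm_eq_abs, abs_of_pos (S.pos i y hy)]; simp [W, Par.c_zero]⟩
  | succ k ih =>
    refine ⟨⟨1, fun i y hy => ?_⟩, fun _ _ _ => differentiableAt_id, ih.congr fun i y hy => ?_⟩
    · rw [Real.norm_eq_abs, abs_of_pos (S.pos i y hy)]; simp [W, Par.c_zero]
    · simp [euler]

/-! ### Trading powers of `y` for powers of the parameters -/

/-- The region lies below `2 B₀`. -/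
def Region.LeB0 (S : Region Par) : Prop := ∀ i, ∀ y ∈ S i, y * i.t ≤ 2

/-- The region lies above `B₀`. -/
def Region.GeB0 (S : Region Par) : Prop := ∀ i, ∀ y ∈ S i, 1 ≤ y * i.t

/-- The region lies below `2 B₁`. -/
def Region.LeB1 (S : Region Par) : Prop := ∀ i, ∀ y ∈ S i, y * i.t ≤ 2 * i.L

/-- The region lies above `B₁`. -/
def Region.GeB1 (S : Region Par) : Prop := ∀ i, ∀ y ∈ S i, i.L ≤ y * i.t

theorem Region.GeB1.geB0 (h : S.GeB1) : S.GeB0 := fun i y hy =>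
  le_trans (by linarith [i.L_gt]) (h i y hy)

theorem W_le_of_one_add_le {u v : ℤ} (C : ℝ)
    (hS : ∀ i, ∀ y ∈ S i, 1 + y ≤ C * i.c u v) (a : ℕ) :
    ∃ K : ℝ, ∀ i, ∀ y ∈ S i, |W p q m n i y| ≤ K * W p (q - a) (m + a * u) (n + a * v) i y := by
  refine ⟨C ^ a, fun i y hy => ?_⟩
  have hy0 := S.pos i y hy
  have hs : (0 : ℝ) < 1 + y := by linarith
  rw [abs_of_pos (W_pos hy0)]
  have hpow : i.c u v ^ a = i.c (a * u) (a * v) := by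
    unfold Par.c
    rw [mul_pow, ← zpow_natCast, ← zpow_natCast, ← zpow_mul, ← zpow_mul]
    congr 2 <;> ring
  have h1 : (1 + y) ^ a ≤ C ^ a * i.c (a * u) (a * v) := by
    rw [← hpow, ← mul_pow]
    exact pow_le_pow_left₀ hs.le (hS i y hy) a
  have h2 : (1 + y) ^ q = (1 + y) ^ (q - a) * (1 + y) ^ a := by
    rw [← zpow_natCast, ← zpow_add₀ hs.ne']; congr 1; ring
  unfold W
  rw [← Par.c_mul, h2]
  have h3 : 0 < y ^ p * (1 + y) ^ (q - a) := mul_pos (zpow_pos hy0 _) (zpow_pos hs _)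
  calc y ^ p * ((1 + y) ^ (q - a) * (1 + y) ^ a) * i.c m n
      = y ^ p * (1 + y) ^ (q - a) * i.c m n * (1 + y) ^ a := by ring
    _ ≤ y ^ p * (1 + y) ^ (q - a) * i.c m n * (C ^ a * i.c (a * u) (a * v)) :=
        mul_le_mul_of_nonneg_left h1 (mul_pos h3 (i.c_pos _ _)).le
    _ = _ := by ring

/-- Below `2 B₀` a factor `1 + y` costs `t⁻¹`. -/
theorem Sy.leB0 (h : Sy S p q m n F) (hS : S.LeB0) (a : ℕ) (hp : p' ≤ p := by omega)
    (hq : p + (q - a) ≤ p' + q' := by omega)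
    (hc : m' < m - a ∨ m' = m - a ∧ n' ≤ n := by omega) : Sy S p' q' m' n' F := by
  have h1 : Sy S p (q - a) (m + a * (-1)) (n + a * 0) F :=
    Sym.mono h (W_le_of_one_add_le 3 (fun i y hy => by
      have := hS i y hy
      have ht := i.t_pos
      have ht1 := i.t_lt_one
      rw [Par.c, zpow_neg_one, neg_zero, zpow_zero, mul_one, ← div_eq_mul_inv, le_div_iff₀ ht]
      linarith) a)
  exact h1.le hp hq (by omega)

/-- Below `2 B₁` a factor `1 + y` costs `L t⁻¹`. -/
theorem Sy.leB1 (h : Sy S p q m n F) (hS : S.LeB1) (a : ℕ) (hp : p' ≤ p := by omega)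
    (hq : p + (q - a) ≤ p' + q' := by omega)
    (hc : m' < m - a ∨ m' = m - a ∧ n' ≤ n - a := by omega) : Sy S p' q' m' n' F := by
  have h1 : Sy S p (q - a) (m + a * (-1)) (n + a * (-1)) F :=
    Sym.mono h (W_le_of_one_add_le 3 (fun i y hy => by
      have := hS i y hy
      have ht := i.t_pos
      have ht1 := i.t_lt_one
      have hL := i.L_gt
      rw [Par.c, zpow_neg_one, neg_neg, zpow_one, ← div_eq_inv_mul, ← mul_div_assoc,
        le_div_iff₀ ht]
      linarith) a)
  exact h1.le hp hq (by omega)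

theorem one_add_zpow_le {y : ℝ} (hy : 1 ≤ y) (p : ℤ) :
    y ^ p ≤ 2 ^ p.natAbs * (1 + y) ^ p := by
  have h2 : (1 : ℝ) ≤ 2 ^ p.natAbs := one_le_pow₀ (by norm_num)
  rcases le_total 0 p with hp | hp
  · calc y ^ p ≤ (1 + y) ^ p := zpow_le_zpow_left₀ hp (by linarith) (by linarith)
      _ ≤ _ := le_mul_of_one_le_left (zpow_nonneg (by linarith) _) h2
  · obtain ⟨k, rfl⟩ : ∃ k : ℕ, p = -k := ⟨p.natAbs, by omega⟩
    simp only [Int.natAbs_neg, Int.natAbs_natCast, zpow_neg, zpow_natCast]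
    rw [← inv_pow, ← inv_pow, ← mul_pow]
    refine pow_le_pow_left₀ (by positivity) ?_ k
    rw [← div_eq_mul_inv, inv_eq_one_div, div_le_div_iff₀ (by linarith) (by linarith)]
    linarith

theorem zpow_one_add_le {y : ℝ} (hy : 1 ≤ y) (p : ℤ) :
    (1 + y) ^ p ≤ 2 ^ p.natAbs * y ^ p := by
  have h := one_add_zpow_le hy (-p)
  have hs : (0 : ℝ) < 1 + y := by linarith
  have hy0 : (0 : ℝ) < y := by linarith
  rw [zpow_neg, zpow_neg, Int.natAbs_neg, ← div_eq_mul_inv, inv_eq_one_div,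
    div_le_div_iff₀ (zpow_pos hy0 _) (zpow_pos hs _)] at h
  linarith

theorem W_le_of_le_one_add {u v : ℤ} (hS1 : ∀ i, ∀ y ∈ S i, 1 ≤ y)
    (hS : ∀ i, ∀ y ∈ S i, 1 ≤ (1 + y) * i.c u v) (a : ℕ)
    (hq : p + q + a ≤ p' + q') :
    ∃ K : ℝ, ∀ i, ∀ y ∈ S i, |W p q m n i y| ≤ K * W p' q' (m + a * u) (n + a * v) i y := by
  refine ⟨2 ^ p.natAbs * 2 ^ p'.natAbs, fun i y hy => ?_⟩
  have hy1 := hS1 i y hy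
  have hy0 := S.pos i y hy
  have hs : (0 : ℝ) < 1 + y := by linarith
  rw [abs_of_pos (W_pos hy0)]
  have hpow : i.c u v ^ a = i.c (a * u) (a * v) := by
    unfold Par.c
    rw [mul_pow, ← zpow_natCast, ← zpow_natCast, ← zpow_mul, ← zpow_mul]
    congr 2 <;> ring
  have h1 : (1 : ℝ) ≤ (1 + y) ^ a * i.c (a * u) (a * v) := by
    rw [← hpow, ← mul_pow]
    exact one_le_pow₀ (hS i y hy)
  unfold W
  rw [← Par.c_mul]
  have hc := (i.c_pos m n).le
  have hca := (i.c_pos (a * u) (a * v)).le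
  calc y ^ p * (1 + y) ^ q * i.c m n
      ≤ 2 ^ p.natAbs * (1 + y) ^ p * (1 + y) ^ q * i.c m n := by
        gcongr; exact one_add_zpow_le hy1 p
    _ = 2 ^ p.natAbs * (1 + y) ^ (p + q) * i.c m n * 1 := by rw [zpow_add₀ hs.ne']; ring
    _ ≤ 2 ^ p.natAbs * (1 + y) ^ (p + q) * i.c m n * ((1 + y) ^ a * i.c (a * u) (a * v)) := by
        gcongr
    _ = 2 ^ p.natAbs * (1 + y) ^ (p + q + a) * (i.c m n * i.c (a * u) (a * v)) := by
        rw [zpow_add₀ hs.ne' (p + q), zpow_natCast]; ring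
    _ ≤ 2 ^ p.natAbs * (1 + y) ^ (p' + q') * (i.c m n * i.c (a * u) (a * v)) := by
        gcongr 2 ^ p.natAbs * ?_ * _
        exact zpow_le_zpow_right₀ (by linarith) hq
    _ = 2 ^ p.natAbs * ((1 + y) ^ p' * (1 + y) ^ q') * (i.c m n * i.c (a * u) (a * v)) := by
        rw [zpow_add₀ hs.ne' p']
    _ ≤ 2 ^ p.natAbs * ((2 ^ p'.natAbs * y ^ p') * (1 + y) ^ q') *
          (i.c m n * i.c (a * u) (a * v)) := by
        gcongr; exact zpow_one_add_le hy1 p'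
    _ = _ := by ring

theorem Region.GeB0.one_le (hS : S.GeB0) : ∀ i, ∀ y ∈ S i, 1 ≤ y := fun i y hy => by
  have := hS i y hy
  have ht := i.t_lt_one
  have hy0 := S.pos i y hy
  nlinarith

/-- Above `B₀` every power of `t` may be traded for growth in `y`; since `y ≥ 1` there, the
exponents of `y` and `1 + y` count together. -/
theorem Sy.geB0 (h : Sy S p q m n F) (hS : S.GeB0) (a : ℕ)
    (hq : p + q + a ≤ p' + q' := by omega)
    (hc : m' < m + a ∨ m' = m + a ∧ n' ≤ n := by omega) : Sy S p' q' m' n' F := by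
  have h1 : Sy S p' q' (m + a * 1) (n + a * 0) F :=
    Sym.mono h (W_le_of_le_one_add hS.one_le (fun i y hy => by
      have := hS i y hy
      rw [Par.c, zpow_one, neg_zero, zpow_zero, mul_one]
      linarith [i.t_pos]) a hq)
  exact h1.le le_rfl le_rfl (by omega)

/-- Above `B₁` every factor `t` traded for growth in `y` also gains a factor `L⁻¹`. -/
theorem Sy.geB1 (h : Sy S p q m n F) (hS : S.GeB1) (a : ℕ)
    (hq : p + q + a ≤ p' + q' := by omega)
    (hc : m' < m + a ∨ m' = m + a ∧ n' ≤ n + a := by omega) : Sy S p' q' m' n' F := by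
  have h1 : Sy S p' q' (m + a * 1) (n + a * 1) F :=
    Sym.mono h (W_le_of_le_one_add hS.geB0.one_le (fun i y hy => by
      have := hS i y hy
      have hL := i.L_pos
      rw [Par.c, zpow_one, zpow_neg_one, ← mul_assoc, ← div_eq_mul_inv, le_div_iff₀ hL]
      linarith [i.t_pos]) a hq)
  exact h1.le le_rfl le_rfl (by omega)

end

/-! ### Primitives of weighted symbols -/

theorem weight_mono {p q : ℤ} (hp : 0 ≤ p) (hpq : 0 ≤ p + q) {z y : ℝ} (hz : 0 < z) (hzy : z ≤ y) :
    z ^ p * (1 + z) ^ q ≤ y ^ p * (1 + y) ^ q := by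
  have hy : 0 < y := hz.trans_le hzy
  have hs : (0 : ℝ) < 1 + z := by linarith
  have hs' : (0 : ℝ) < 1 + y := by linarith
  rcases le_total 0 q with hq | hq
  · exact mul_le_mul (zpow_le_zpow_left₀ hp hz.le hzy)
      (zpow_le_zpow_left₀ hq hs.le (by linarith)) (zpow_nonneg hs.le _) (zpow_nonneg hy.le _)
  · have e : ∀ x : ℝ, 0 < x → x ^ p * (1 + x) ^ q = x ^ (p + q) * (x / (1 + x)) ^ (-q) := by
      intro x hx
      rw [div_zpow, zpow_neg, zpow_neg, div_inv_eq_mul, zpow_add₀ hx.ne']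
      field_simp
    rw [e z hz, e y hy]
    refine mul_le_mul (zpow_le_zpow_left₀ hpq hz.le hzy) (zpow_le_zpow_left₀ (by omega)
      (by positivity) ?_) (zpow_nonneg (by positivity) _) (zpow_nonneg hy.le _)
    rw [div_le_div_iff₀ hs hs']
    nlinarith

theorem W_mono {p q m n : ℤ} (hp : 0 ≤ p) (hpq : 0 ≤ p + q) {i : Par} {z y : ℝ} (hz : 0 < z)
    (hzy : z ≤ y) : W p q m n i z ≤ W p q m n i y :=
  mul_le_mul_of_nonneg_right (weight_mono hp hpq hz hzy) (i.c_pos _ _).le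

section

variable {S : Region Par} {p q m n : ℤ} {F : Par → ℝ → ℝ}

/-- A crude bound near the origin, enough for integrability. -/
theorem Bd.local (h : Bd S (W p q m n) F) (hS : S.Initial) (hp : 0 ≤ p) :
    ∀ i, ∀ y ∈ S i, ∃ C, ∀ z ∈ Set.Ioc 0 y, |F i z| ≤ C := by
  intro i y hy
  obtain ⟨C, hC⟩ := Bd.le (p' := p) (q' := max q (-p)) (m' := m) (n' := n) h
  refine ⟨|C| * W p (max q (-p)) m n i y, fun z hz => (hC i z (hS i y hy hz)).trans ?_⟩
  calc C * W p (max q (-p)) m n i z ≤ |C| * W p (max q (-p)) m n i z :=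
        mul_le_mul_of_nonneg_right (le_abs_self _) (W_pos hz.1).le
    _ ≤ _ := mul_le_mul_of_nonneg_left (W_mono hp (by omega) hz.1 hz.2) (abs_nonneg _)

theorem Sy.primitive_of_bd {p' q' m' n' : ℤ} (h : Sy S p q m n F) (hS : S.Initial)
    (hb : Bd S (W p' q' m' n') fun i y => ∫ z in (0 : ℝ)..y, F i z)
    (hm : Sy S p' q' m' n' fun i y => y * F i y) (hp : 0 ≤ p := by omega) :
    Sy S p' q' m' n' fun i y => ∫ z in (0 : ℝ)..y, F i z :=
  Sym.primitive_of_bd hS h (h.bd.local hS hp) hb hm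

theorem Bd.primitive (h : Bd S (W p q m n) F) (hS : S.Initial)
    (hp : 0 ≤ p) (hpq : 0 ≤ p + q) :
    Bd S (W (p + 1) q m n) fun i y => ∫ z in (0 : ℝ)..y, F i z := by
  obtain ⟨C, hC⟩ := h
  refine ⟨|C|, fun i y hy => ?_⟩
  have hy0 := S.pos i y hy
  refine (norm_integral_le_of_bdd (C := |C| * W p q m n i y) hy0 fun z hz =>
    (hC i z (hS i y hy hz)).trans ?_).trans (le_of_eq ?_)
  · calc C * W p q m n i z ≤ |C| * W p q m n i z :=
          mul_le_mul_of_nonneg_right (le_abs_self _) (W_pos hz.1).le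
      _ ≤ _ := mul_le_mul_of_nonneg_left (W_mono hp (by omega) hz.1 hz.2) (abs_nonneg _)
  · unfold W
    rw [zpow_add₀ hy0.ne', zpow_one]
    ring

theorem Sy.primitive {p' q' m' n' : ℤ} (h : Sy S p q m n F) (hS : S.Initial)
    (hp : 0 ≤ p := by omega) (hpq : 0 ≤ p + q := by omega)
    (hp' : p' ≤ p + 1 := by omega) (hq : p + 1 + q ≤ p' + q' := by omega)
    (hc : m' < m ∨ m' = m ∧ n' ≤ n := by omega) :
    Sy S p' q' m' n' fun i y => ∫ z in (0 : ℝ)..y, F i z := by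
  have h1 : Sy S (p + 1) q m n fun i y => ∫ z in (0 : ℝ)..y, F i z :=
    h.primitive_of_bd hS (h.bd.primitive hS hp hpq) (Sy.mul Sy.id h)
  exact h1.le

/-- Primitives of integrable symbols are bounded. -/
theorem Sy.primitive_decay {p' q' m' n' : ℤ} (h : Sy S p q m n F) (hS : S.Initial)
    (hp : 0 ≤ p := by omega) (hpq : p + q ≤ -2 := by omega)
    (hp' : p' ≤ p + 1 := by omega) (hq : 0 ≤ p' + q' := by omega)
    (hc : m' < m ∨ m' = m ∧ n' ≤ n := by omega) :
    Sy S p' q' m' n' fun i y => ∫ z in (0 : ℝ)..y, F i z := by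
  obtain ⟨k, rfl⟩ : ∃ k : ℕ, p = k := ⟨p.toNat, by omega⟩
  have h1 : Sy S (k + 1) (-(k + 1)) m n fun i y => ∫ z in (0 : ℝ)..y, F i z := by
    refine h.primitive_of_bd hS ?_ (Sy.mul Sy.id h)
    obtain ⟨C, hC⟩ := h.bd
    refine ⟨|C|, fun i y hy => ?_⟩
    have hy0 := S.pos i y hy
    have hd : ∀ z ∈ Set.uIcc 0 y, HasDerivAt (fun z : ℝ => (z / (1 + z)) ^ (k + 1))
        ((k + 1 : ℕ) * (z / (1 + z)) ^ k * (1 / (1 + z) ^ 2)) z := by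
      intro z hz
      rw [Set.uIcc_of_le hy0.le] at hz
      have hs : (1 : ℝ) + z ≠ 0 := by linarith [hz.1]
      have h2 : HasDerivAt (fun z : ℝ => z / (1 + z)) (1 / (1 + z) ^ 2) z := by
        refine ((hasDerivAt_id z).div ((hasDerivAt_id z).const_add 1) hs).congr_deriv ?_
        simp
      exact h2.pow (k + 1)
    have hcont : ContinuousOn (fun z : ℝ => ((k + 1 : ℕ) : ℝ) * (z / (1 + z)) ^ k *
        (1 / (1 + z) ^ 2)) (Set.uIcc 0 y) := by
      have hs : ∀ z ∈ Set.uIcc 0 y, (1 : ℝ) + z ≠ 0 := fun z hz => by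
        rw [Set.uIcc_of_le hy0.le] at hz; linarith [hz.1]
      have hs2 : ∀ z ∈ Set.uIcc 0 y, ((1 : ℝ) + z) ^ 2 ≠ 0 := fun z hz => pow_ne_zero 2 (hs z hz)
      fun_prop (disch := assumption)
    have hint := hcont.intervalIntegrable (μ := MeasureTheory.volume)
    have hI := intervalIntegral.integral_eq_sub_of_hasDerivAt hd hint
    have hle := intervalIntegral.norm_integral_le_of_norm_le (f := F i)
      (g := fun z : ℝ => |C| * i.c m n * (((k + 1 : ℕ) : ℝ) * (z / (1 + z)) ^ k *
        (1 / (1 + z) ^ 2))) hy0.le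
      (MeasureTheory.ae_of_all _ fun z hz => ?_) (hint.const_mul _)
    · refine hle.trans (le_of_eq ?_)
      rw [intervalIntegral.integral_const_mul, hI]
      have hs : (1 : ℝ) + y ≠ 0 := by linarith
      unfold W
      rw [show ((k : ℤ) + 1) = ((k + 1 : ℕ) : ℤ) by push_cast; ring, zpow_neg, zpow_natCast,
        zpow_natCast]
      simp [div_pow]
      field_simp
    · have hz0 := hz.1
      have hs : (0 : ℝ) < 1 + z := by linarith
      refine (hC i z (hS i y hy hz)).trans ?_
      have hW : W k q m n i z ≤ i.c m n * ((z / (1 + z)) ^ k * (1 / (1 + z) ^ 2)) := by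
        unfold W
        rw [mul_comm]
        refine mul_le_mul_of_nonneg_left ?_ (i.c_pos _ _).le
        calc z ^ (k : ℤ) * (1 + z) ^ q ≤ z ^ (k : ℤ) * (1 + z) ^ (-(k : ℤ) - 2) :=
              weight_le le_rfl (by omega) hz0
          _ = _ := by
              rw [zpow_sub₀ hs.ne', zpow_neg, zpow_natCast, zpow_natCast, div_pow]
              norm_cast
              field_simp
      calc C * W k q m n i z ≤ |C| * W k q m n i z :=
            mul_le_mul_of_nonneg_right (le_abs_self _) (W_pos hz0).le
        _ ≤ |C| * (i.c m n * ((z / (1 + z)) ^ k * (1 / (1 + z) ^ 2))) :=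
            mul_le_mul_of_nonneg_left hW (abs_nonneg _)
        _ = |C| * i.c m n * (1 * (z / (1 + z)) ^ k * (1 / (1 + z) ^ 2)) := by ring
        _ ≤ |C| * i.c m n * (((k + 1 : ℕ) : ℝ) * (z / (1 + z)) ^ k * (1 / (1 + z) ^ 2)) := by
            have := (i.c_pos m n).le
            gcongr
            push_cast
            linarith [(Nat.cast_nonneg k : (0 : ℝ) ≤ k)]
  exact h1.le

end

/-! ### The regions cut out by the scales -/

/-- The half line `(0, ∞)`. -/
def RAll : Region Par := ⟨fun _ => Set.Ioi 0, fun _ => isOpen_Ioi, fun _ _ hy => hy⟩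

/-- The interval `(0, 2 B₀)`. -/
def RA0 : Region Par := ⟨fun i => Set.Ioo 0 (2 / i.t), fun _ => isOpen_Ioo, fun _ _ hy => hy.1⟩

/-- The interval `(0, 2 B₁)`. -/
def RA1 : Region Par :=
  ⟨fun i => Set.Ioo 0 (2 * i.L / i.t), fun _ => isOpen_Ioo, fun _ _ hy => hy.1⟩

/-- The interval `(0, B₀)`. -/
def R0 : Region Par := ⟨fun i => Set.Ioo 0 (1 / i.t), fun _ => isOpen_Ioo, fun _ _ hy => hy.1⟩

/-- The interval `(B₀, 2 B₀)`. -/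
def R1 : Region Par := ⟨fun i => Set.Ioo (1 / i.t) (2 / i.t), fun _ => isOpen_Ioo, fun i _ hy =>
  (one_div_pos.2 i.t_pos).trans hy.1⟩

/-- The interval `(2 B₀, B₁)`. -/
def R2 : Region Par := ⟨fun i => Set.Ioo (2 / i.t) (i.L / i.t), fun _ => isOpen_Ioo, fun i _ hy =>
  (div_pos two_pos i.t_pos).trans hy.1⟩

/-- The interval `(B₁, 2 B₁)`. -/
def R3 : Region Par :=
  ⟨fun i => Set.Ioo (i.L / i.t) (2 * i.L / i.t), fun _ => isOpen_Ioo, fun i _ hy =>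
    (div_pos i.L_pos i.t_pos).trans hy.1⟩

/-- The half line `(2 B₁, ∞)`. -/
def R4 : Region Par := ⟨fun i => Set.Ioi (2 * i.L / i.t), fun _ => isOpen_Ioi, fun i _ hy =>
  (div_pos (mul_pos two_pos i.L_pos) i.t_pos).trans hy⟩

theorem RAll.initial : RAll.Initial := fun _ _ _ _ hz => hz.1
theorem RA0.initial : RA0.Initial := fun _ _ hy _ hz => ⟨hz.1, hz.2.trans_lt hy.2⟩
theorem RA1.initial : RA1.Initial := fun _ _ hy _ hz => ⟨hz.1, hz.2.trans_lt hy.2⟩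
theorem R0.initial : R0.Initial := fun _ _ hy _ hz => ⟨hz.1, hz.2.trans_lt hy.2⟩

theorem Region.sub_all (S : Region Par) : ∀ i, S i ⊆ RAll i := fun i y hy => S.pos i y hy

theorem RA0.leB0 : RA0.LeB0 := fun i _ hy => ((lt_div_iff₀ i.t_pos).1 hy.2).le
theorem R0.leB0 : R0.LeB0 := fun i _ hy =>
  ((lt_div_iff₀ i.t_pos).1 hy.2).le.trans (by norm_num)
theorem R1.leB0 : R1.LeB0 := fun i _ hy => ((lt_div_iff₀ i.t_pos).1 hy.2).le
theorem R1.geB0 : R1.GeB0 := fun i _ hy => ((div_lt_iff₀ i.t_pos).1 hy.1).le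
theorem RA1.leB1 : RA1.LeB1 := fun i _ hy => ((lt_div_iff₀ i.t_pos).1 hy.2).le
theorem R3.leB1 : R3.LeB1 := fun i _ hy => ((lt_div_iff₀ i.t_pos).1 hy.2).le
theorem R3.geB1 : R3.GeB1 := fun i _ hy => ((div_lt_iff₀ i.t_pos).1 hy.1).le
theorem R4.geB1 : R4.GeB1 := fun i y hy =>
  le_trans (by linarith [i.L_pos]) ((div_lt_iff₀ i.t_pos).1 hy).le

theorem R0.sub_RA0 : ∀ i, R0 i ⊆ RA0 i := fun i _ hy =>
  ⟨hy.1, hy.2.trans (div_lt_div_of_pos_right (by norm_num) i.t_pos)⟩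
theorem R1.sub_RA0 : ∀ i, R1 i ⊆ RA0 i := fun i y hy => ⟨R1.pos i y hy, hy.2⟩
theorem RA0.sub_RA1 : ∀ i, RA0 i ⊆ RA1 i := fun i _ hy =>
  ⟨hy.1, hy.2.trans (div_lt_div_of_pos_right (by linarith [i.L_gt]) i.t_pos)⟩
theorem R0.sub_RA1 : ∀ i, R0 i ⊆ RA1 i := fun i _ hy => RA0.sub_RA1 i (R0.sub_RA0 i hy)
theorem R1.sub_RA1 : ∀ i, R1 i ⊆ RA1 i := fun i _ hy => RA0.sub_RA1 i (R1.sub_RA0 i hy)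
theorem R2.sub_RA1 : ∀ i, R2 i ⊆ RA1 i := fun i y hy => ⟨R2.pos i y hy,
  hy.2.trans (div_lt_div_of_pos_right (by linarith [i.L_pos]) i.t_pos)⟩
theorem R3.sub_RA1 : ∀ i, R3 i ⊆ RA1 i := fun i y hy => ⟨R3.pos i y hy, hy.2⟩

/-! ### Explicit symbols -/

theorem Sy.restrict {E : Type*} [NormedRing E] [NormedAlgebra ℝ E] {S S' : Region Par}
    {p q m n : ℤ} {F : Par → ℝ → E} (h : Sy S p q m n F) (hS : ∀ i, S' i ⊆ S i) :
    Sy S' p q m n F := Sym.restrict h hS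

theorem Sy.add {E : Type*} [NormedRing E] [NormedAlgebra ℝ E] {S : Region Par}
    {p q m n : ℤ} {F G : Par → ℝ → E} (h : Sy S p q m n F) (h' : Sy S p q m n G) :
    Sy S p q m n (fun i y => F i y + G i y) := Sym.add h h'

theorem Sy.sub {E : Type*} [NormedRing E] [NormedAlgebra ℝ E] {S : Region Par}
    {p q m n : ℤ} {F G : Par → ℝ → E} (h : Sy S p q m n F) (h' : Sy S p q m n G) :
    Sy S p q m n (fun i y => F i y - G i y) := Sym.sub h h'

theorem Sy.neg {E : Type*} [NormedRing E] [NormedAlgebra ℝ E] {S : Region Par}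
    {p q m n : ℤ} {F : Par → ℝ → E} (h : Sy S p q m n F) :
    Sy S p q m n (fun i y => -F i y) := Sym.neg h

theorem Sy.congr {E : Type*} [NormedRing E] [NormedAlgebra ℝ E] {S : Region Par}
    {p q m n : ℤ} {F G : Par → ℝ → E} (h : Sy S p q m n F)
    (e : ∀ i, ∀ y ∈ S i, F i y = G i y) : Sy S p q m n G := Sym.congr h e

theorem Sy.euler {E : Type*} [NormedRing E] [NormedAlgebra ℝ E] {S : Region Par}
    {p q m n : ℤ} {F : Par → ℝ → E} (h : Sy S p q m n F) :
    Sy S p q m n (fun i => CSS.euler (F i)) := Sym.euler h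

theorem Sy.ofReal {S : Region Par} {p q m n : ℤ} {F : Par → ℝ → ℝ} (h : Sy S p q m n F) :
    Sy S p q m n (fun i y => (F i y : ℂ)) := Sym.ofReal h

theorem Sy.constMul {E : Type*} [NormedRing E] [NormedAlgebra ℝ E] {S : Region Par}
    {p q m n : ℤ} {F : Par → ℝ → E} (h : Sy S p q m n F) (c : E) :
    Sy S p q m n (fun i y => c * F i y) := Sy.mul (Sy.number c) h

variable {S : Region Par}

theorem sy_inv : Sy S (-1) 0 0 0 (fun _ y => y⁻¹) := by
  refine fun k => ?_
  have hb : Bd S (W (-1) 0 0 0) (fun _ (y : ℝ) => y⁻¹) := ⟨1, fun i y hy => by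
    rw [Real.norm_eq_abs, abs_of_pos (inv_pos.2 (S.pos i y hy))]; simp [W, Par.c_zero]⟩
  induction k with
  | zero => exact hb
  | succ k ih =>
    refine ⟨hb, fun i y hy => differentiableAt_id.inv (S.pos i y hy).ne', ih.neg.congr
      fun i y hy => ?_⟩
    have := (S.pos i y hy).ne'
    simp only [euler, deriv_inv, smul_eq_mul]
    field_simp

/-- The function `1 / (1 + y²)`. -/
def pf (y : ℝ) : ℝ := (1 + y ^ 2)⁻¹

theorem hasDerivAt_pf (y : ℝ) : HasDerivAt pf (-(2 * y * pf y ^ 2)) y := by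
  have h : (1 + y ^ 2) ≠ 0 := by positivity
  have h2 : HasDerivAt (fun y : ℝ => 1 + y ^ 2) (2 * y) y := by
    simpa using (hasDerivAt_pow 2 y).const_add 1
  refine (h2.inv h).congr_deriv ?_
  unfold pf
  field_simp

theorem sy_pf : Sy S 0 (-2) 0 0 (fun _ y => pf y) := by
  have hb : Bd S (W 0 (-2) 0 0) (fun _ (y : ℝ) => pf y) := ⟨2, fun i y hy => by
    have hy0 := S.pos i y hy
    have h0 : (0 : ℝ) < pf y := by unfold pf; positivity
    rw [Real.norm_eq_abs, abs_of_pos h0]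
    simp only [W, Par.c_zero, zpow_zero, one_mul, mul_one, zpow_neg]
    unfold pf
    norm_cast
    rw [← div_eq_mul_inv, inv_eq_one_div, div_le_div_iff₀ (by positivity) (by positivity)]
    nlinarith [sq_nonneg (y - 1)]⟩
  refine fun k => ?_
  induction k with
  | zero => exact hb
  | succ k ih =>
    refine ⟨hb, fun i y _ => (hasDerivAt_pf y).differentiableAt, ?_⟩
    have h1 : SymK S (W 0 (-2) 0 0) k (fun _ y => pf y * pf y) :=
      (ih.mul ih).mono ⟨1, fun i y hy => by
        have hy0 := S.pos i y hy
        rw [abs_of_pos (mul_pos (W_pos hy0) (W_pos hy0)), W_mul hy0, one_mul]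
        exact mul_le_mul_of_nonneg_right (weight_le (by norm_num) (by norm_num) hy0)
          (i.c_pos _ _).le⟩
    have h2 := (h1.add ih.neg)
    refine (h2.add h2).congr fun i y _ => ?_
    simp only [euler, (hasDerivAt_pf y).deriv, smul_eq_mul]
    unfold pf
    have h : (1 + y ^ 2) ≠ 0 := by positivity
    field_simp
    ring

theorem Q_eq (y : ℝ) : Q y = √8 * pf y := div_eq_mul_inv _ _

theorem sy_Q : Sy S 0 (-2) 0 0 (fun _ y => Q y) :=
  (sy_pf.constMul (√8)).congr fun _ y _ => (Q_eq y).symm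

theorem sy_f : Sy S 1 (-2) 0 0 (fun _ y => halfyQ y) :=
  (Sy.mul (Sy.constMul Sy.id (1 / 2)) sy_Q : Sy S 1 (-2) 0 0 _).congr fun i y _ => by
    unfold halfyQ; ring

/-- The profile `¼ y² Q`. -/
def qf (y : ℝ) : ℝ := y ^ 2 / 4 * Q y

theorem sy_qf : Sy S 2 (-2) 0 0 (fun _ y => qf y) :=
  (Sy.mul Sy.id (Sy.constMul sy_f (1 / 2)) : Sy S 2 (-2) 0 0 _).congr fun i y _ => by
    unfold qf halfyQ; ring

theorem sy_J : Sy S 1 (-2) 0 0 (fun _ y => J y) :=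
  (Sy.mul Sy.id sy_Q : Sy S 1 (-2) 0 0 _).congr fun i y _ => rfl

theorem J_pos {y : ℝ} (hy : 0 < y) : 0 < J y := by
  unfold J Q; positivity

theorem sqrt8_ne : √(8 : ℝ) ≠ 0 := by positivity

theorem sy_Jinv : Sy S (-1) 2 0 0 (fun _ y => (J y)⁻¹) := by
  have h1 : Sy S (-1) 2 0 0 (fun _ (y : ℝ) => y⁻¹) := sy_inv.le
  have h2 : Sy S (-1) 2 0 0 (fun _ (y : ℝ) => y) := Sy.id.le
  have h3 : Sy S (-1) 2 0 0 (fun _ (y : ℝ) => y⁻¹ + y) := h1.add h2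
  refine (h3.constMul (√8)⁻¹).congr fun i y hy => ?_
  have := (S.pos i y hy).ne'
  have := sqrt8_ne
  unfold J Q
  field_simp

theorem phi1_eq (y : ℝ) : phi1 y = 2 * pf y - 1 := by
  unfold phi1 pf
  have h : (1 + y ^ 2) ≠ 0 := by positivity
  field_simp
  ring

theorem sy_phi1 : Sy S 0 0 0 0 (fun _ y => phi1 y) :=
  ((sy_pf.constMul 2).le.sub (Sy.number 1)).congr fun _ y _ => (phi1_eq y).symm

theorem hasDerivAt_J (y : ℝ) (hy : y ≠ 0) : HasDerivAt J (phi1 y / y * J y) y := by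
  refine ((hasDerivAt_id y).mul (hasDerivAt_Q y)).congr_deriv ?_
  have h : (1 + y ^ 2) ≠ 0 := by positivity
  simp only [id]
  unfold J phi1 Q
  field_simp
  ring

theorem hasDerivAt_halfyQ (y : ℝ) : HasDerivAt halfyQ (Q y / 2 * phi1 y) y := by
  refine (((hasDerivAt_id y).div_const 2).mul (hasDerivAt_Q y)).congr_deriv ?_
  have h : (1 + y ^ 2) ≠ 0 := by positivity
  simp only [id]
  unfold phi1 Q
  field_simp
  ring

/-- The function `Λ(½yQ)`. -/
theorem Lam_halfyQ (y : ℝ) : Lam 0 halfyQ y = 2 * (halfyQ y * pf y) := by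
  rw [Lam, (hasDerivAt_halfyQ y).deriv]
  have h : (1 + y ^ 2) ≠ 0 := by positivity
  simp only [smul_eq_mul]
  unfold phi1 halfyQ Q pf
  field_simp
  ring

theorem sy_Lamf : Sy S 1 (-4) 0 0 (fun _ y => Lam 0 halfyQ y) :=
  (Sy.constMul (Sy.mul sy_f sy_pf : Sy S 1 (-4) 0 0 _) 2).congr fun _ y _ => (Lam_halfyQ y).symm

/-! ### Cutoffs -/

theorem bounded_of_support {φ : ℝ → ℝ} (h : Continuous φ) (h0 : ∀ x, 2 < x → φ x = 0) :
    ∃ C, ∀ x, 0 < x → |φ x| ≤ C := by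
  obtain ⟨C, hC⟩ := isCompact_Icc.exists_bound_of_continuousOn (h.continuousOn (s := Set.Icc 0 2))
  refine ⟨C, fun x hx => ?_⟩
  rcases le_or_gt x 2 with h2 | h2
  · exact hC x ⟨hx.le, h2⟩
  · rw [h0 x h2, abs_zero]
    exact (norm_nonneg _).trans (hC 0 ⟨le_rfl, by norm_num⟩)

theorem euler_support {φ : ℝ → ℝ} (h0 : ∀ x, 2 < x → φ x = 0) : ∀ x, 2 < x → euler φ x = 0 := by
  intro x hx
  have : φ =ᶠ[nhds x] fun _ => 0 := by
    filter_upwards [isOpen_Ioi.mem_nhds hx] with z hz using h0 z hz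
  rw [euler, this.deriv_eq]
  simp

theorem contDiff_euler {φ : ℝ → ℝ} (h : ContDiff ℝ ∞ φ) : ContDiff ℝ ∞ (euler φ) :=
  contDiff_id.smul (contDiff_infty_iff_deriv.1 h).2

/-- Rescaled cutoffs are symbols of order zero, whatever the scales are. -/
theorem sy_rescaled {φ : ℝ → ℝ} (h : ContDiff ℝ ∞ φ) (h0 : ∀ x, 2 < x → φ x = 0)
    {r : Par → ℝ} (hr : ∀ i, 0 < r i) : Sy S 0 0 0 0 (fun i y => φ (y * r i)) := by
  intro k
  induction k generalizing φ with
  | zero =>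
    obtain ⟨C, hC⟩ := bounded_of_support h.continuous h0
    exact ⟨C, fun i y hy => by
      simpa [W, Par.c_zero] using hC _ (mul_pos (S.pos i y hy) (hr i))⟩
  | succ k ih =>
    refine ⟨(ih h h0).bd, fun i y _ => ?_, (ih (contDiff_euler h) (euler_support h0)).congr
      fun i y _ => ?_⟩
    · exact (h.differentiable (by simp)).differentiableAt.comp y
        (differentiableAt_id.mul_const _)
    · have hd := ((h.differentiable (by simp)) (y * r i)).hasDerivAt.comp y
        ((hasDerivAt_id y).mul_const (r i))
      simp only [id, Function.comp_def, one_mul] at hd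
      simp only [euler, hd.deriv, smul_eq_mul]
      ring

theorem B0_eq (i : Par) : B0 i.b = i.t⁻¹ := by
  rw [B0, Real.rpow_neg i.pos.le, ← Real.sqrt_eq_rpow, Par.t]

theorem B1_eq (i : Par) : B1 i.b = i.L / i.t := by
  rw [B1, Real.rpow_neg i.pos.le, ← Real.sqrt_eq_rpow, div_eq_inv_mul, Par.t, Par.L]

theorem cut_B0 (φ : ℝ → ℝ) (i : Par) (y : ℝ) : cut φ (B0 i.b) y = φ (y * i.t) := by
  rw [cut, B0_eq, div_inv_eq_mul]

theorem cut_B1 (φ : ℝ → ℝ) (i : Par) (y : ℝ) : cut φ (B1 i.b) y = φ (y * (i.t / i.L)) := by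
  rw [cut, B1_eq, div_div_eq_mul_div, mul_div_assoc]

theorem sy_cut0 {φ : ℝ → ℝ} (h : ContDiff ℝ ∞ φ) (h0 : ∀ x, 2 < x → φ x = 0) :
    Sy S 0 0 0 0 (fun i y => cut φ (B0 i.b) y) :=
  (sy_rescaled h h0 (r := Par.t) Par.t_pos).congr fun i y _ => (cut_B0 φ i y).symm

theorem sy_cut1 {φ : ℝ → ℝ} (h : ContDiff ℝ ∞ φ) (h0 : ∀ x, 2 < x → φ x = 0) :
    Sy S 0 0 0 0 (fun i y => cut φ (B1 i.b) y) :=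
  (sy_rescaled h h0 (r := fun i => i.t / i.L) fun i => div_pos i.t_pos i.L_pos).congr
    fun i y _ => (cut_B1 φ i y).symm

/-! ### The nullspace element `ρ` -/

theorem abs_phi1_le (y : ℝ) : |phi1 y| ≤ 1 := by
  unfold phi1
  rw [abs_div, abs_of_pos (by positivity : (0 : ℝ) < 1 + y ^ 2), div_le_one (by positivity), abs_le]
  constructor <;> nlinarith [sq_nonneg y]

/-- The quadratic growth of `ρ / Q`: the logarithms cancel, since they combine to
`∫_0^y φ₁ z log (y / z) dz`. -/
theorem abs_rho_le {y : ℝ} (hy : 0 < y) : |rho y| ≤ Q y * (5 / 2 * y ^ 2) := by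
  have hA : |∫ z in (0 : ℝ)..y, phi1 z * z| ≤ y * y :=
    norm_integral_le_of_bdd hy fun z hz => by
      rw [abs_mul, abs_of_pos hz.1]
      nlinarith [abs_phi1_le z, hz.1, hz.2]
  have hcl : Continuous fun z => phi1 z * (z * Real.log z) :=
    continuous_phi1.mul Real.continuous_mul_log
  have hD : |∫ z in (0 : ℝ)..y, (Real.log y * (phi1 z * z) - phi1 z * (z * Real.log z))|
      ≤ y * y := norm_integral_le_of_bdd hy fun z hz => by
    have e : Real.log y * (phi1 z * z) - phi1 z * (z * Real.log z) =
        phi1 z * (z * Real.log (y / z)) := by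
      rw [Real.log_div hy.ne' hz.1.ne']; ring
    have h1 : 0 ≤ Real.log (y / z) := Real.log_nonneg ((one_le_div hz.1).2 hz.2)
    have h2 : Real.log (y / z) ≤ y / z := by
      linarith [Real.log_le_sub_one_of_pos (div_pos hy hz.1)]
    rw [e, abs_mul, abs_of_nonneg (mul_nonneg hz.1.le h1)]
    calc |phi1 z| * (z * Real.log (y / z)) ≤ 1 * (z * (y / z)) :=
          mul_le_mul (abs_phi1_le z) (mul_le_mul_of_nonneg_left h2 hz.1.le)
            (mul_nonneg hz.1.le h1) zero_le_one
      _ = y := by have := hz.1.ne'; field_simp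
  rw [intervalIntegral.integral_sub ((continuous_phi1_mul.const_mul _).intervalIntegrable _ _)
    (hcl.intervalIntegrable _ _), intervalIntegral.integral_const_mul] at hD
  have hB : ∫ z in (0 : ℝ)..y, phi2 z * z
      = (∫ z in (0 : ℝ)..y, phi1 z * (z * Real.log z)) + y ^ 2 / 2 := by
    have e : (fun z => phi2 z * z) = fun z => phi1 z * (z * Real.log z) + z := by
      funext z; unfold phi2; ring
    have h := intervalIntegral.integral_add
      (hcl.intervalIntegrable (μ := MeasureTheory.volume) 0 y)
      ((continuous_id (X := ℝ)).intervalIntegrable (μ := MeasureTheory.volume) 0 y)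
    simp only [id] at h
    rw [e, h, integral_id]
    ring
  have hQ : 0 < Q y := by unfold Q; positivity
  rw [rho, abs_mul, abs_of_pos hQ, hB]
  refine mul_le_mul_of_nonneg_left ?_ hQ.le
  have e : phi2 y * (∫ z in (0 : ℝ)..y, phi1 z * z) -
      phi1 y * ((∫ z in (0 : ℝ)..y, phi1 z * (z * Real.log z)) + y ^ 2 / 2) =
      (∫ z in (0 : ℝ)..y, phi1 z * z) + phi1 y * (Real.log y * (∫ z in (0 : ℝ)..y, phi1 z * z) -
        (∫ z in (0 : ℝ)..y, phi1 z * (z * Real.log z)) - y ^ 2 / 2) := by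
    unfold phi2; ring
  rw [e]
  refine (abs_add_le _ _).trans ?_
  rw [abs_mul]
  have h3 : |Real.log y * (∫ z in (0 : ℝ)..y, phi1 z * z) -
        (∫ z in (0 : ℝ)..y, phi1 z * (z * Real.log z)) - y ^ 2 / 2| ≤ y * y + y ^ 2 / 2 := by
    refine (abs_sub _ _).trans (add_le_add hD ?_)
    rw [abs_of_pos (by positivity)]
  have h4 := mul_le_mul (abs_phi1_le y) h3 (abs_nonneg _) zero_le_one
  nlinarith

theorem rhoFlux_eq {y : ℝ} (hy : 0 < y) :
    rhoFlux y = ∫ z in (0 : ℝ)..y, (z - Q z * rho z * z) := by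
  rw [intervalIntegral.integral_eq_sub_of_hasDerivAt_of_le hy.le
    continuous_rhoFlux.continuousOn (fun z hz => hasDerivAt_rhoFlux hz.1)
    ((continuous_id.sub continuous_Q_mul_rho_mul).intervalIntegrable _ _)]
  simp [rhoFlux]

theorem Q_pos (y : ℝ) : 0 < Q y := by unfold Q; positivity

theorem abs_rhoFlux_le {y : ℝ} (hy : 0 < y) : |rhoFlux y| ≤ 21 * y * y := by
  rw [rhoFlux_eq hy]
  refine norm_integral_le_of_bdd hy fun z hz => ?_
  have h1 : |Q z * rho z * z| ≤ 20 * z := by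
    rw [abs_mul, abs_of_pos hz.1, abs_mul, abs_of_pos (Q_pos z)]
    refine mul_le_mul_of_nonneg_right ?_ hz.1.le
    calc Q z * |rho z| ≤ Q z * (Q z * (5 / 2 * z ^ 2)) :=
          mul_le_mul_of_nonneg_left (abs_rho_le hz.1) (Q_pos z).le
      _ = 20 * (z ^ 2 / (1 + z ^ 2) ^ 2) := by
          rw [← mul_assoc, ← pow_two, Q_sq]; ring
      _ ≤ 20 * 1 := by
          gcongr
          rw [div_le_one (by positivity)]
          nlinarith [sq_nonneg z, sq_nonneg (z ^ 2)]
      _ = 20 := by norm_num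
  have h2 := abs_sub z (Q z * rho z * z)
  rw [abs_of_pos hz.1] at h2
  linarith [hz.2]

theorem W_mul_le {p q m n p₁ q₁ m₁ n₁ p₂ q₂ m₂ n₂ : ℤ}
    (hp : p ≤ p₁ + p₂) (hq : p₁ + p₂ + (q₁ + q₂) ≤ p + q)
    (hc : m < m₁ + m₂ ∨ m = m₁ + m₂ ∧ n ≤ n₁ + n₂) :
    ∃ K : ℝ, ∀ i, ∀ y ∈ S i, |W p₁ q₁ m₁ n₁ i y * W p₂ q₂ m₂ n₂ i y| ≤ K * W p q m n i y := by
  obtain ⟨K, hK⟩ := W_le (S := S) hp hq hc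
  exact ⟨K, fun i y hy => by rw [W_mul (S.pos i y hy)]; exact hK i y hy⟩

theorem sy_rho : Sy S 2 (-2) 0 0 (fun _ y => rho y) := by
  have hb : Bd S (W 2 (-2) 0 0) (fun _ (y : ℝ) => rho y) := by
    have h1 : Bd S (W 2 (-2) 0 0) (fun _ (y : ℝ) => Q y * (5 / 2 * y ^ 2)) :=
      Bd.congr (((sy_qf (S := S)).constMul 10).bd) fun _ y _ => by unfold qf; ring
    obtain ⟨C, hC⟩ := h1
    refine ⟨C, fun i y hy => le_trans ?_ (hC i y hy)⟩
    exact (abs_rho_le (S.pos i y hy)).trans (le_abs_self _)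
  have hb' : Bd S (W 2 0 0 0) (fun _ (y : ℝ) => rhoFlux y) := by
    have h0 : Sy S 2 0 0 0 (fun _ y => y * (21 * y)) := Sy.mul Sy.id (Sy.constMul Sy.id 21)
    have h1 : Bd S (W 2 0 0 0) (fun _ (y : ℝ) => 21 * y * y) :=
      Bd.congr h0.bd fun _ y _ => by ring
    obtain ⟨C, hC⟩ := h1
    refine ⟨C, fun i y hy => le_trans ?_ (hC i y hy)⟩
    exact (abs_rhoFlux_le (S.pos i y hy)).trans (le_abs_self _)
  suffices h : ∀ k, SymK S (W 2 (-2) 0 0) k (fun _ y => rho y) ∧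
      SymK S (W 2 0 0 0) k (fun _ y => rhoFlux y) from fun k => (h k).1
  intro k
  induction k with
  | zero => exact ⟨hb, hb'⟩
  | succ k ih =>
    obtain ⟨h1, h2⟩ := ih
    refine ⟨⟨hb, fun i y hy => (hasDerivAt_rho (S.pos i y hy)).differentiableAt, ?_⟩,
      ⟨hb', fun i y hy => (hasDerivAt_rhoFlux (S.pos i y hy)).differentiableAt, ?_⟩⟩
    · have h0 : Sy S 1 (-2) 0 0 (fun _ y => y * pf y) := Sy.mul Sy.id sy_pf
      have h00 : Sy S 0 0 0 0 (fun _ y => y * (y * pf y)) := Sy.mul Sy.id h0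
      have ha : Sy S 0 0 0 0 (fun _ y => -2 * (y * (y * pf y))) := h00.constMul (-2)
      have hb1 := ((ha k).mul h1).mono (W_mul_le (p := 2) (q := -2) (m := 0) (n := 0)
        (by norm_num) (by norm_num) (by norm_num))
      have hc1 := (((sy_Q (S := S)) k).mul h2).mono (W_mul_le (p := 2) (q := -2) (m := 0) (n := 0)
        (by norm_num) (by norm_num) (by norm_num))
      refine (hb1.add hc1).congr fun i y hy => ?_
      have := (S.pos i y hy).ne'
      simp only [euler, (hasDerivAt_rho (S.pos i y hy)).deriv, smul_eq_mul]
      unfold pf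
      field_simp
    · have ha : Sy S 2 0 0 0 (fun _ y => y * y) := Sy.mul Sy.id Sy.id
      have h0 : Sy S 1 (-2) 0 0 (fun _ y => y * Q y) := Sy.mul Sy.id sy_Q
      have hc0 : Sy S 0 0 0 0 (fun _ y => y * (y * Q y)) := Sy.mul Sy.id h0
      have hc1 := ((hc0 k).mul h1).mono (W_mul_le (p := 2) (q := 0) (m := 0) (n := 0)
        (by norm_num) (by norm_num) (by norm_num))
      refine ((ha k).add hc1.neg).congr fun i y hy => ?_
      simp only [euler, (hasDerivAt_rhoFlux (S.pos i y hy)).deriv, smul_eq_mul]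
      ring

/-! ### The outgoing Green's function -/

/-- Sources for the Green's function: continuous on `(0, ∞)` and `O(y)` at the origin. -/
structure Adm (f : ℝ → ℝ) : Prop where
  cont : ContinuousOn f (Set.Ioi 0)
  bound : ∀ R, 0 < R → ∃ C, 0 ≤ C ∧ ∀ z ∈ Set.Ioc 0 R, |f z| ≤ C * z

theorem Sy.adm {p q m n : ℤ} {F : Par → ℝ → ℝ} (h : Sy RAll p q m n F) (hp : 1 ≤ p) (i : Par) :
    Adm (F i) := by
  refine ⟨Sym.continuousOn h i, fun R hR => ?_⟩
  have h1 : Sy RAll 0 (max q (-p) + p) m n (fun i y => y⁻¹ * F i y) :=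
    Sy.mul sy_inv h
  obtain ⟨C, hC⟩ := h1.bd.local RAll.initial le_rfl i R hR
  refine ⟨C, (abs_nonneg _).trans (hC R ⟨hR, le_rfl⟩), fun z hz => ?_⟩
  have := hC z hz
  rw [abs_mul, abs_of_pos (inv_pos.2 hz.1), inv_mul_le_iff₀ hz.1] at this
  linarith

/-- The primitive of `y J f`. -/
def JInt (f : ℝ → ℝ) (y : ℝ) : ℝ := ∫ z in (0 : ℝ)..y, z * J z * f z

/-- The solution operator `f ↦ A_Q H_Q^{-1} f`, which inverts `A_Q^*`. -/
def Uop (f : ℝ → ℝ) (y : ℝ) : ℝ := -((y * J y)⁻¹ * JInt f y)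

theorem zJ_le {z : ℝ} (hz : 0 < z) : z * J z ≤ 3 * z ^ 2 ∧ 0 < z * J z := by
  refine ⟨?_, mul_pos hz (J_pos hz)⟩
  have h8 : √(8 : ℝ) ≤ 3 := by
    rw [Real.sqrt_le_left (by norm_num)]; norm_num
  have : Q z ≤ 3 := by
    unfold Q
    rw [div_le_iff₀ (by positivity)]
    nlinarith [sq_nonneg z]
  unfold J
  nlinarith [sq_nonneg z]

theorem continuous_J : Continuous J := continuous_id.mul continuous_Q

theorem JInt_le {f : ℝ → ℝ} {C y : ℝ} (hC : 0 ≤ C) (hy : 0 < y)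
    (h : ∀ z ∈ Set.Ioc 0 y, |f z| ≤ C * z) : |JInt f y| ≤ 3 * C * y ^ 3 * y := by
  refine norm_integral_le_of_bdd hy fun z hz => ?_
  obtain ⟨h1, h2⟩ := zJ_le hz.1
  rw [abs_mul, abs_of_pos h2]
  calc z * J z * |f z| ≤ (3 * z ^ 2) * (C * z) :=
        mul_le_mul h1 (h z hz) (abs_nonneg _) (by positivity)
    _ = 3 * C * z ^ 3 := by ring
    _ ≤ 3 * C * y ^ 3 := by
        have := hz.1.le
        have := hz.2
        gcongr

theorem Adm.hasDerivAt_JInt {f : ℝ → ℝ} (hf : Adm f) {y : ℝ} (hy : 0 < y) :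
    HasDerivAt (JInt f) (y * J y * f y) y := by
  obtain ⟨C, hC0, hC⟩ := hf.bound y hy
  refine hasDerivAt_integral_of_bdd (C := 3 * y ^ 2 * (C * y)) isOpen_Ioi hy (fun z hz => hz.1)
    ((continuous_id.mul continuous_J).continuousOn.mul hf.cont) fun z hz => ?_
  obtain ⟨h1, h2⟩ := zJ_le hz.1
  simp only [abs_mul (z * J z), abs_of_pos h2]
  have := hz.1.le
  have := hz.2
  calc z * J z * |f z| ≤ (3 * z ^ 2) * (C * z) :=
        mul_le_mul h1 (hC z hz) (abs_nonneg _) (by positivity)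
    _ ≤ _ := by gcongr

/-- `A_Q^* (Uop f) = f`. -/
theorem Adm.hasDerivAt_Uop {f : ℝ → ℝ} (hf : Adm f) {y : ℝ} (hy : 0 < y) :
    HasDerivAt (Uop f) (-f y - 2 * pf y / y * Uop f y) y := by
  have hJ := (J_pos hy).ne'
  have hy0 := hy.ne'
  have hyJ : y * J y ≠ 0 := mul_ne_zero hy0 hJ
  have h1 := ((hasDerivAt_id y).mul (hasDerivAt_J y hy0)).inv hyJ
  refine (h1.mul (hf.hasDerivAt_JInt hy)).neg.congr_deriv ?_
  simp only [id, Pi.mul_apply, Pi.inv_apply]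
  unfold Uop
  rw [phi1_eq]
  field_simp
  ring

/-- The closed form of the quotient `Γ / J`. -/
theorem Gam_eq {y : ℝ} (hy : 0 < y) :
    Gam y = J y * (1 / 8 * (y ^ 2 / 2 + 2 * Real.log y - 1 / (2 * y ^ 2))) := by
  rw [Gam]
  congr 1
  have hpos : ∀ z ∈ Set.uIcc 1 y, 0 < z := fun z hz =>
    lt_of_lt_of_le (lt_min one_pos hy) hz.1
  have hd : ∀ z ∈ Set.uIcc 1 y, HasDerivAt
      (fun z : ℝ => 1 / 8 * (z ^ 2 / 2 + 2 * Real.log z - 1 / (2 * z ^ 2)))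
      (((J z) ^ 2)⁻¹ * z⁻¹) z := by
    intro z hz
    have hz0 := (hpos z hz).ne'
    have h1 : HasDerivAt (fun z : ℝ => 2 * z ^ 2) (2 * (2 * z)) z := by
      simpa using (hasDerivAt_pow 2 z).const_mul 2
    have h2 := ((((hasDerivAt_pow 2 z).div_const 2).add
      ((Real.hasDerivAt_log hz0).const_mul 2)).sub
      ((hasDerivAt_const z (1 : ℝ)).div h1 (by positivity))).const_mul (1 / 8)
    refine h2.congr_deriv ?_
    have e : J z ^ 2 = z ^ 2 * (8 / (1 + z ^ 2) ^ 2) := by rw [J, mul_pow, Q_sq]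
    rw [e]
    field_simp
    ring
  have hcont : ContinuousOn (fun z => ((J z) ^ 2)⁻¹ * z⁻¹) (Set.uIcc 1 y) := by
    refine ContinuousOn.mul (ContinuousOn.inv₀ (continuous_J.pow 2).continuousOn fun z hz => ?_)
      (continuousOn_id.inv₀ fun z hz => (hpos z hz).ne')
    exact pow_ne_zero 2 (J_pos (hpos z hz)).ne'
  rw [intervalIntegral.integral_eq_sub_of_hasDerivAt hd hcont.intervalIntegrable]
  norm_num

theorem hasDerivAt_Gam {y : ℝ} (hy : 0 < y) :
    HasDerivAt Gam (phi1 y / y * Gam y + (y * J y)⁻¹) y := by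
  have hJ := (J_pos hy).ne'
  have hG : HasDerivAt (fun y => ∫ z in (1 : ℝ)..y, ((J z) ^ 2)⁻¹ * z⁻¹)
      (((J y) ^ 2)⁻¹ * y⁻¹) y := by
    have hcont : ContinuousOn (fun z => ((J z) ^ 2)⁻¹ * z⁻¹) (Set.Ioi 0) := by
      refine ContinuousOn.mul (ContinuousOn.inv₀ (continuous_J.pow 2).continuousOn fun z hz => ?_)
        (continuousOn_id.inv₀ fun z hz => (ne_of_gt hz))
      exact pow_ne_zero 2 (J_pos hz).ne'
    have hsub : Set.uIcc 1 y ⊆ Set.Ioi 0 := fun z hz =>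
      lt_of_lt_of_le (lt_min one_pos hy) hz.1
    exact intervalIntegral.integral_hasDerivAt_right (hcont.mono hsub).intervalIntegrable
      ⟨Set.Ioi 0, Ioi_mem_nhds hy, hcont.aestronglyMeasurable measurableSet_Ioi⟩
      (hcont.continuousAt (Ioi_mem_nhds hy))
  refine ((hasDerivAt_J y hy.ne').mul hG).congr_deriv ?_
  unfold Gam
  have := hy.ne'
  field_simp

theorem abs_log_le {z : ℝ} (hz : 0 < z) : |Real.log z| ≤ z + z⁻¹ := by
  rw [abs_le]
  have h1 := Real.log_le_sub_one_of_pos hz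
  have h2 := Real.log_le_sub_one_of_pos (inv_pos.2 hz)
  rw [Real.log_inv] at h2
  have := inv_pos.2 hz
  constructor <;> linarith

theorem abs_Gam_le {z R : ℝ} (hz : 0 < z) (hzR : z ≤ R) :
    |Gam z| ≤ J z * ((2 * R ^ 4 + 3 * R ^ 2 + 3) / z ^ 2) := by
  rw [Gam_eq hz, abs_mul, abs_of_pos (J_pos hz)]
  refine mul_le_mul_of_nonneg_left ?_ (J_pos hz).le
  have h1 := abs_log_le hz
  have h2 : |1 / 8 * (z ^ 2 / 2 + 2 * Real.log z - 1 / (2 * z ^ 2))| ≤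
      z ^ 2 + (z + z⁻¹) + (z ^ 2)⁻¹ := by
    have h3 : (0 : ℝ) < (z ^ 2)⁻¹ := by positivity
    have h4 : 1 / (2 * z ^ 2) = (z ^ 2)⁻¹ / 2 := by field_simp
    rw [abs_le] at h1 ⊢
    rw [h4]
    have := sq_nonneg z
    have h5 := inv_pos.2 hz
    constructor <;> linarith [h1.1, h1.2]
  refine h2.trans ?_
  rw [le_div_iff₀ (by positivity)]
  have e : (z ^ 2 + (z + z⁻¹) + (z ^ 2)⁻¹) * z ^ 2 = z ^ 4 + z ^ 3 + z + 1 := by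
    field_simp
    ring
  have h6 : z ^ 4 ≤ R ^ 4 := pow_le_pow_left₀ hz.le hzR 4
  have h7 : z ^ 2 ≤ R ^ 2 := pow_le_pow_left₀ hz.le hzR 2
  rw [e]
  nlinarith [sq_nonneg (z ^ 2 - z), sq_nonneg (z - 1), sq_nonneg (R ^ 2), sq_nonneg R]

theorem continuousOn_Gam : ContinuousOn Gam (Set.Ioi 0) := fun _ hy =>
  (hasDerivAt_Gam hy).continuousAt.continuousWithinAt

theorem Adm.bdd_Gam {f : ℝ → ℝ} (hf : Adm f) {y : ℝ} (hy : 0 < y) :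
    ∃ C, 0 ≤ C ∧ ∀ z ∈ Set.Ioc 0 y, |z * Gam z * f z| ≤ C := by
  obtain ⟨C, hC0, hC⟩ := hf.bound y hy
  set D := 2 * y ^ 4 + 3 * y ^ 2 + 3 with hD
  refine ⟨3 * D * C * y, by positivity, fun z hz => ?_⟩
  have hz0 := hz.1
  have h1 := abs_Gam_le hz.1 hz.2
  obtain ⟨h2, -⟩ := zJ_le hz.1
  rw [abs_mul, abs_mul, abs_of_pos hz0]
  calc z * |Gam z| * |f z| ≤ z * (J z * (D / z ^ 2)) * (C * z) := by
        have := hC z hz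
        have := J_pos hz0
        gcongr
    _ = (z * J z) * (D / z ^ 2) * (C * z) := by ring
    _ ≤ (3 * z ^ 2) * (D / z ^ 2) * (C * z) := by gcongr
    _ = 3 * D * C * z := by field_simp
    _ ≤ 3 * D * C * y := by have := hz.2; gcongr

theorem Adm.outHinv_eq {f : ℝ → ℝ} (hf : Adm f) {y : ℝ} (hy : 0 < y) :
    outHinv f y = J y * (∫ z in (0 : ℝ)..y, z * Gam z * f z) - Gam y * JInt f y := by
  obtain ⟨C, -, hC⟩ := hf.bdd_Gam hy
  obtain ⟨C', hC0', hC'⟩ := hf.bound y hy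
  have h1 : IntervalIntegrable (fun z => z * Gam z * f z) MeasureTheory.volume 0 y :=
    intervalIntegrable_of_bdd hy (((continuousOn_id.mul continuousOn_Gam).mul hf.cont).mono
      fun z hz => hz.1) hC
  have h2 : IntervalIntegrable (fun z => z * J z * f z) MeasureTheory.volume 0 y := by
    refine intervalIntegrable_of_bdd (C := 3 * y ^ 2 * (C' * y)) hy
      (((continuous_id.mul continuous_J).continuousOn.mul hf.cont).mono fun z hz => hz.1)
      fun z hz => ?_
    obtain ⟨h1, h2⟩ := zJ_le hz.1
    simp only [abs_mul (z * J z), abs_of_pos h2]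
    have := hz.1.le
    have := hz.2
    calc z * J z * |f z| ≤ (3 * z ^ 2) * (C' * z) :=
          mul_le_mul h1 (hC' z hz) (abs_nonneg _) (by positivity)
      _ ≤ _ := by gcongr
  rw [outHinv, JInt, ← intervalIntegral.integral_const_mul, ← intervalIntegral.integral_const_mul,
    ← intervalIntegral.integral_sub (h1.const_mul _) (h2.const_mul _)]
  congr 1
  funext z
  ring

theorem Adm.hasDerivAt_outHinv {f : ℝ → ℝ} (hf : Adm f) {y : ℝ} (hy : 0 < y) :
    HasDerivAt (outHinv f) (phi1 y / y * outHinv f y + Uop f y) y := by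
  obtain ⟨C, -, hC⟩ := hf.bdd_Gam hy
  have h1 : HasDerivAt (fun y => ∫ z in (0 : ℝ)..y, z * Gam z * f z) (y * Gam y * f y) y :=
    hasDerivAt_integral_of_bdd isOpen_Ioi hy (fun z hz => hz.1)
      ((continuousOn_id.mul continuousOn_Gam).mul hf.cont) hC
  have h2 := ((hasDerivAt_J y hy.ne').mul h1).sub
    ((hasDerivAt_Gam hy).mul (hf.hasDerivAt_JInt hy))
  have h3 := h2.congr_of_eventuallyEq (f₁ := outHinv f) (by
    filter_upwards [Ioi_mem_nhds hy] with z hz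
    exact hf.outHinv_eq hz)
  refine h3.congr_deriv ?_
  rw [hf.outHinv_eq hy, Uop]
  ring

theorem CR_Qc {m : ℝ} {w : ℝ → ℝ} {y w' : ℝ} (hy : 0 < y) (h : HasDerivAt w w' y) :
    CR m Qc w y = w' - (m - 1 + phi1 y) / y * w y := by
  rw [CR, h.deriv, Atheta_Qc hy, smul_eq_mul]
  congr 3
  unfold phi1
  have h0 : (1 + y ^ 2) ≠ 0 := by positivity
  field_simp
  ring

/-- The two terms of the Green's function recombine into a single integral once `A_Q`, which
annihilates `J`, is applied. -/
theorem Adm.Aop_outHinv {f : ℝ → ℝ} (hf : Adm f) {y : ℝ} (hy : 0 < y) :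
    Aop Qc (outHinv f) y = Uop f y := by
  rw [Aop, CR_Qc hy (hf.hasDerivAt_outHinv hy)]
  ring

theorem Adm.Uop_div_le {f : ℝ → ℝ} (hf : Adm f) {R : ℝ} (hR : 0 < R) :
    ∃ C, 0 ≤ C ∧ ∀ z ∈ Set.Ioc 0 R, |Uop f z / J z| ≤ C := by
  obtain ⟨C, hC0, hC⟩ := hf.bound R hR
  refine ⟨3 * C * R * (1 + R ^ 2) ^ 2, by positivity, fun z hz => ?_⟩
  have hz0 := hz.1
  have hJ := J_pos hz0
  have h1 := JInt_le hC0 hz0 fun x hx => hC x ⟨hx.1, hx.2.trans hz.2⟩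
  rw [Uop, abs_div, abs_neg, abs_mul, abs_inv, abs_of_pos hJ, abs_of_pos (mul_pos hz0 hJ),
    div_le_iff₀ hJ, inv_mul_le_iff₀ (mul_pos hz0 hJ)]
  refine h1.trans ?_
  have e : z * J z * (3 * C * R * (1 + R ^ 2) ^ 2 * J z) =
      3 * C * z ^ 3 * (R * ((1 + R ^ 2) ^ 2 * 8 / (1 + z ^ 2) ^ 2)) := by
    have : z * J z * (3 * C * R * (1 + R ^ 2) ^ 2 * J z) =
      3 * C * z ^ 3 * (R * ((1 + R ^ 2) ^ 2 * Q z ^ 2)) := by unfold J; ring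
    rw [this, Q_sq, mul_div_assoc]
  rw [e]
  have h4 : (1 + z ^ 2) ^ 2 ≤ (1 + R ^ 2) ^ 2 := by
    have := hz.2; gcongr
  have h5 : 1 ≤ (1 + R ^ 2) ^ 2 * 8 / (1 + z ^ 2) ^ 2 := by
    rw [one_le_div (by positivity)]
    nlinarith [sq_nonneg (1 + R ^ 2)]
  have h6 : z ≤ R * ((1 + R ^ 2) ^ 2 * 8 / (1 + z ^ 2) ^ 2) := by nlinarith [hz.2]
  exact mul_le_mul_of_nonneg_left h6 (by positivity)

theorem Adm.outHinv_le {f : ℝ → ℝ} (hf : Adm f) :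
    ∃ C, ∀ z ∈ Set.Ioc (0 : ℝ) 1, |outHinv f z / J z| ≤ C * z := by
  obtain ⟨C, -, hC⟩ := hf.bdd_Gam one_pos
  obtain ⟨C', hC0', hC'⟩ := hf.bound 1 one_pos
  refine ⟨C + 24 * C', fun z hz => ?_⟩
  have hz0 := hz.1
  have hJ := J_pos hz0
  have h1 : |∫ x in (0 : ℝ)..z, x * Gam x * f x| ≤ C * z :=
    norm_integral_le_of_bdd hz0 fun x hx => hC x ⟨hx.1, hx.2.trans hz.2⟩
  have h2 := JInt_le hC0' hz0 fun x hx => hC' x ⟨hx.1, hx.2.trans hz.2⟩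
  have h3 := abs_Gam_le hz0 hz.2
  have h4 : |Gam z / J z * JInt f z| ≤ 24 * C' * z := by
    rw [abs_mul, abs_div, abs_of_pos hJ]
    have h5 : |Gam z| / J z ≤ 8 / z ^ 2 := by
      rw [div_le_iff₀ hJ, mul_comm]
      exact h3.trans (le_of_eq (by norm_num))
    calc |Gam z| / J z * |JInt f z| ≤ 8 / z ^ 2 * (3 * C' * z ^ 3 * z) := by gcongr
      _ = 24 * C' * z * z := by field_simp; ring
      _ ≤ 24 * C' * z * 1 := by have := hz.2; gcongr
      _ = _ := mul_one _
  rw [hf.outHinv_eq hz0, sub_div, mul_div_cancel_left₀ _ hJ.ne', mul_div_right_comm]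
  refine (abs_sub _ _).trans ?_
  linarith

/-- The Green's function in factorized form. -/
theorem Adm.outHinv_eq_integral {f : ℝ → ℝ} (hf : Adm f) {y : ℝ} (hy : 0 < y) :
    outHinv f y = J y * ∫ z in (0 : ℝ)..y, Uop f z / J z := by
  have hd : ∀ z, 0 < z → HasDerivAt (fun z => outHinv f z / J z) (Uop f z / J z) z := by
    intro z hz
    have hJ := (J_pos hz).ne'
    refine ((hf.hasDerivAt_outHinv hz).div (hasDerivAt_J z hz.ne') hJ).congr_deriv ?_
    field_simp
    ring
  obtain ⟨C, -, hC⟩ := hf.Uop_div_le hy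
  have hint : IntervalIntegrable (fun z => Uop f z / J z) MeasureTheory.volume 0 y :=
    intervalIntegrable_of_bdd hy (fun z hz => ((hf.hasDerivAt_Uop hz.1).continuousAt.div
      continuous_J.continuousAt (J_pos hz.1).ne').continuousWithinAt) hC
  have h0 : Filter.Tendsto (fun z => outHinv f z / J z) (nhdsWithin 0 (Set.Ioi 0)) (nhds 0) := by
    obtain ⟨C, hC⟩ := hf.outHinv_le
    refine squeeze_zero_norm' (a := fun z => C * z) ?_ ?_
    · filter_upwards [Ioc_mem_nhdsGT one_pos] with z hz using hC z hz
    · have : Filter.Tendsto (fun z : ℝ => C * z) (nhds 0) (nhds (C * 0)) :=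
        (continuous_const.mul continuous_id).tendsto 0
      rw [mul_zero] at this
      exact this.mono_left nhdsWithin_le_nhds
  rw [intervalIntegral.integral_eq_sub_of_hasDerivAt_of_tendsto hy
    (fun z hz => hd z hz.1) hint h0 ((hd y hy).continuousAt.tendsto.mono_left nhdsWithin_le_nhds),
    sub_zero, mul_div_cancel₀ _ (J_pos hy).ne']

/-! ### Green's operators on symbols -/

section

variable {S : Region Par} {p q m n p' q' m' n' : ℤ} {F : Par → ℝ → ℝ}

theorem sy_zJ : Sy S 2 (-2) 0 0 (fun _ y => y * J y) := Sy.mul Sy.id sy_J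

theorem sy_zJinv : Sy S (-2) 2 0 0 (fun _ y => (y * J y)⁻¹) :=
  (Sy.mul sy_inv sy_Jinv : Sy S (-2) 2 0 0 _).congr fun i y _ => (mul_inv _ _).symm

theorem Sy.uop (h : Sy S p q m n (fun i => JInt (F i))) (hp : p' ≤ p - 2 := by omega)
    (hq : p + q ≤ p' + q' := by omega) (hc : m' < m ∨ m' = m ∧ n' ≤ n := by omega) :
    Sy S p' q' m' n' (fun i => Uop (F i)) := by
  have h1 : Sy S (p - 2) (q + 2) m n (fun i y => (y * J y)⁻¹ * JInt (F i) y) :=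
    Sy.mul sy_zJinv h
  have h2 : Sy S (p - 2) (q + 2) m n (fun i => Uop (F i)) := h1.neg
  exact h2.le

theorem Sy.jInt_of_bd (h : Sy S p q m n F) (hS : S.Initial)
    (hb : Bd S (W p' q' m' n') fun i => JInt (F i))
    (hm : Sy S p' q' m' n' fun i y => y * (y * J y * F i y)) (hp : 0 ≤ p + 2 := by omega) :
    Sy S p' q' m' n' fun i => JInt (F i) :=
  (Sy.mul sy_zJ h : Sy S (p + 2) (q - 2) m n _).primitive_of_bd hS hb hm

theorem Sy.jInt (h : Sy S p q m n F) (hS : S.Initial) (hp : 0 ≤ p + 2 := by omega)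
    (hpq : 0 ≤ p + q := by omega) (hp' : p' ≤ p + 3 := by omega)
    (hq : p + q + 1 ≤ p' + q' := by omega) (hc : m' < m ∨ m' = m ∧ n' ≤ n := by omega) :
    Sy S p' q' m' n' fun i => JInt (F i) :=
  (Sy.mul sy_zJ h : Sy S (p + 2) (q - 2) m n _).primitive hS

theorem Sy.outHinv (hf : ∀ i, Adm (F i)) (h : Sy S p q m n (fun i => Uop (F i)))
    (hS : S.Initial) (hp : 1 ≤ p := by omega)
    (hpq : 0 ≤ p + q + 1 := by omega) (hp' : p' ≤ p + 1 := by omega)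
    (hq : p + 1 + q ≤ p' + q' := by omega) (hc : m' < m ∨ m' = m ∧ n' ≤ n := by omega) :
    Sy S p' q' m' n' fun i => outHinv (F i) := by
  have h1 : Sy S (p - 1) (q + 2) m n (fun i y => Uop (F i) y / J y) :=
    (Sy.mul h sy_Jinv : Sy S (p - 1) (q + 2) m n _).congr fun i y _ => (div_eq_mul_inv _ _).symm
  have h2 : Sy S p (q + 2) m n (fun i y => ∫ z in (0 : ℝ)..y, Uop (F i) z / J z) :=
    h1.primitive hS
  have h3 : Sy S (p + 1) q m n (fun i y => J y * ∫ z in (0 : ℝ)..y, Uop (F i) z / J z) :=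
    Sy.mul sy_J h2
  exact (h3.congr fun i y hy => ((hf i).outHinv_eq_integral (S.pos i y hy)).symm).le

/-- Weighted bounds from the behaviour near the origin and near infinity. -/
theorem Bd.of_split (C : ℝ) (h1 : ∀ i, ∀ y ∈ S i, y ≤ 1 → |F i y| ≤ C * (y ^ p * i.c m n))
    (h2 : ∀ i, ∀ y ∈ S i, 1 ≤ y → |F i y| ≤ C * (y ^ (p + q) * i.c m n)) :
    Bd S (W p q m n) F := by
  refine ⟨|C| * 2 ^ q.natAbs, fun i y hy => ?_⟩
  have hy0 := S.pos i y hy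
  have hs : (0 : ℝ) < 1 + y := by linarith
  have hc := (i.c_pos m n).le
  have hyp := (zpow_pos hy0 p).le
  rcases le_total y 1 with h | h
  · refine (h1 i y hy h).trans ?_
    have h3 : (1 : ℝ) ≤ 2 ^ q.natAbs * (1 + y) ^ q := by
      rcases le_total 0 q with hq | hq
      · exact one_le_mul_of_one_le_of_one_le (one_le_pow₀ (by norm_num))
          (one_le_zpow₀ (by linarith) hq)
      · obtain ⟨k, rfl⟩ : ∃ k : ℕ, q = -k := ⟨q.natAbs, by omega⟩
        simp only [Int.natAbs_neg, Int.natAbs_natCast, zpow_neg, zpow_natCast]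
        rw [← div_eq_mul_inv, one_le_div (by positivity)]
        exact pow_le_pow_left₀ hs.le (by linarith) k
    calc C * (y ^ p * i.c m n) ≤ |C| * (y ^ p * i.c m n) * 1 := by
          rw [mul_one]; exact mul_le_mul_of_nonneg_right (le_abs_self _) (mul_nonneg hyp hc)
      _ ≤ |C| * (y ^ p * i.c m n) * (2 ^ q.natAbs * (1 + y) ^ q) := by gcongr
      _ = _ := by unfold W; ring
  · refine (h2 i y hy h).trans ?_
    calc C * (y ^ (p + q) * i.c m n) ≤ |C| * (y ^ (p + q) * i.c m n) :=
          mul_le_mul_of_nonneg_right (le_abs_self _) (mul_nonneg (zpow_pos hy0 _).le hc)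
      _ = |C| * (y ^ p * y ^ q * i.c m n) := by rw [zpow_add₀ hy0.ne']
      _ ≤ |C| * (y ^ p * (2 ^ q.natAbs * (1 + y) ^ q) * i.c m n) := by
          have := one_add_zpow_le h q
          gcongr
      _ = _ := by unfold W; ring

end

/-! ### The logarithmic correction -/

theorem IsCutoff.support {χ : ℝ → ℝ} (hχ : IsCutoff χ) : ∀ x, 2 < x → χ x = 0 :=
  fun x hx => hχ.eq_zero x hx.le

theorem IsCutoff.sy0 {χ : ℝ → ℝ} (hχ : IsCutoff χ) {S : Region Par} :
    Sy S 0 0 0 0 (fun i y => cut χ (B0 i.b) y) := sy_cut0 hχ.smooth hχ.support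

theorem IsCutoff.sy1 {χ : ℝ → ℝ} (hχ : IsCutoff χ) {S : Region Par} :
    Sy S 0 0 0 0 (fun i y => cut χ (B1 i.b) y) := sy_cut1 hχ.smooth hχ.support

theorem cut_nonneg {χ : ℝ → ℝ} (hχ : IsCutoff χ) (B y : ℝ) : 0 ≤ cut χ B y := hχ.nonneg _
theorem cut_le_one {χ : ℝ → ℝ} (hχ : IsCutoff χ) (B y : ℝ) : cut χ B y ≤ 1 := hχ.le_one _

theorem continuous_cut {χ : ℝ → ℝ} (hχ : IsCutoff χ) (B : ℝ) : Continuous (cut χ B) :=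
  hχ.smooth.continuous.comp (continuous_id.div_const B)

theorem continuous_halfyQ : Continuous halfyQ := (continuous_id.div_const 2).mul continuous_Q

/-- The density `(½ y Q)² y`. -/
def kD (y : ℝ) : ℝ := halfyQ y * halfyQ y * y

theorem continuous_kD : Continuous kD :=
  (continuous_halfyQ.mul continuous_halfyQ).mul continuous_id

theorem kD_eq (y : ℝ) : kD y = 2 * y ^ 3 * pf y ^ 2 := by
  have : kD y = y ^ 3 / 4 * Q y ^ 2 := by unfold kD halfyQ; ring
  rw [this, Q_sq, pf]
  have h : (1 + y ^ 2) ≠ 0 := by positivity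
  field_simp
  ring

theorem kD_nonneg {y : ℝ} (hy : 0 ≤ y) : 0 ≤ kD y := by rw [kD_eq]; positivity

theorem kD_le {y : ℝ} (hy : 0 < y) : kD y ≤ 2 / y := by
  rw [kD_eq, pf, le_div_iff₀ hy]
  have h : (0 : ℝ) < 1 + y ^ 2 := by positivity
  rw [inv_pow, ← div_eq_mul_inv, div_mul_eq_mul_div, div_le_iff₀ (by positivity)]
  nlinarith [sq_nonneg y]

/-- A primitive of `kD`. -/
theorem hasDerivAt_kD_primitive (y : ℝ) :
    HasDerivAt (fun y => Real.log (1 + y ^ 2) + pf y) (kD y) y := by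
  have h : (1 + y ^ 2) ≠ 0 := by positivity
  have h2 : HasDerivAt (fun y : ℝ => 1 + y ^ 2) (2 * y) y := by
    simpa using (hasDerivAt_pow 2 y).const_add 1
  refine ((h2.log h).add (hasDerivAt_pf y)).congr_deriv ?_
  rw [kD_eq, pf]
  field_simp
  ring

theorem integral_kD (y : ℝ) : ∫ z in (0 : ℝ)..y, kD z = Real.log (1 + y ^ 2) + pf y - 1 := by
  rw [intervalIntegral.integral_eq_sub_of_hasDerivAt (fun z _ => hasDerivAt_kD_primitive z)
    (continuous_kD.intervalIntegrable _ _)]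
  simp [pf]

/-- The truncated square norm of the resonance. -/
def KInt (χ : ℝ → ℝ) (b y : ℝ) : ℝ := ∫ z in (0 : ℝ)..y, kD z * cut χ (B0 b) z

/-- The square norm of the resonance, cut off at `B₀`. -/
def KInf (χ : ℝ → ℝ) (b : ℝ) : ℝ := ∫ z in Set.Ioi (0 : ℝ), kD z * cut χ (B0 b) z

theorem continuous_kD_cut {χ : ℝ → ℝ} (hχ : IsCutoff χ) (B : ℝ) :
    Continuous fun z => kD z * cut χ B z := continuous_kD.mul (continuous_cut hχ B)

theorem integral_Ioi_eq_of_support {f : ℝ → ℝ} {a R : ℝ} (hR : a ≤ R)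
    (h : ∀ z, R < z → f z = 0) : ∫ z in Set.Ioi a, f z = ∫ z in a..R, f z := by
  rw [intervalIntegral.integral_of_le hR]
  refine MeasureTheory.setIntegral_eq_of_subset_of_forall_sdiff_eq_zero measurableSet_Ioi
    (fun z hz => hz.1) fun z hz => h z ?_
  by_contra hc
  exact hz.2 ⟨hz.1, not_lt.1 hc⟩

theorem KInf_eq {χ : ℝ → ℝ} (hχ : IsCutoff χ) (i : Par) {R : ℝ} (hR : 2 / i.t ≤ R) :
    KInf χ i.b = KInt χ i.b R := by
  refine integral_Ioi_eq_of_support ((div_pos two_pos i.t_pos).le.trans hR) fun z hz => ?_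
  rw [cut_B0, hχ.eq_zero, mul_zero]
  exact ((div_lt_iff₀ i.t_pos).1 (hR.trans_lt hz)).le

theorem KInt_sub {χ : ℝ → ℝ} (hχ : IsCutoff χ) (b : ℝ) (y R : ℝ) :
    KInt χ b R - KInt χ b y = ∫ z in y..R, kD z * cut χ (B0 b) z :=
  intervalIntegral.integral_interval_sub_left
    ((continuous_kD_cut hχ _).intervalIntegrable _ _)
    ((continuous_kD_cut hχ _).intervalIntegrable _ _)

theorem KInt_mono {χ : ℝ → ℝ} (hχ : IsCutoff χ) (b : ℝ) {y R : ℝ} (hy : 0 ≤ y) (hR : y ≤ R) :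
    KInt χ b y ≤ KInt χ b R := by
  have := KInt_sub hχ b y R
  have h2 : 0 ≤ ∫ z in y..R, kD z * cut χ (B0 b) z :=
    intervalIntegral.integral_nonneg hR fun z hz =>
      mul_nonneg (kD_nonneg (hy.trans hz.1)) (cut_nonneg hχ _ _)
  linarith

theorem KInt_le_KInf {χ : ℝ → ℝ} (hχ : IsCutoff χ) (i : Par) {y : ℝ} (hy : 0 ≤ y) :
    KInt χ i.b y ≤ KInf χ i.b := by
  rw [KInf_eq hχ i (le_max_right y (2 / i.t))]
  exact KInt_mono hχ _ hy (le_max_left _ _)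

theorem KInt_nonneg {χ : ℝ → ℝ} (hχ : IsCutoff χ) (b : ℝ) {y : ℝ} (hy : 0 ≤ y) :
    0 ≤ KInt χ b y := by
  have := KInt_mono hχ b le_rfl hy
  simpa [KInt] using this

/-- The density is at most `2 / z`, and the cutoff ends at `2 B₀`. -/
theorem KInf_sub_le {χ : ℝ → ℝ} (hχ : IsCutoff χ) (i : Par) {y : ℝ} (hy : 0 < y) :
    KInf χ i.b - KInt χ i.b y ≤ 4 / (i.t * y) := by
  have ht := i.t_pos
  rcases le_total (2 / i.t) y with h | h
  · rw [KInf_eq hχ i h, sub_self]; positivity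
  · rw [KInf_eq hχ i le_rfl, KInt_sub hχ]
    have h1 := intervalIntegral.norm_integral_le_of_norm_le_const (a := y) (b := 2 / i.t)
      (f := fun z => kD z * cut χ (B0 i.b) z) (C := 2 / y) (fun z hz => by
        rw [Set.uIoc_of_le h] at hz
        have hz0 : 0 < z := hy.trans hz.1
        rw [Real.norm_eq_abs, abs_of_nonneg (mul_nonneg (kD_nonneg hz0.le) (cut_nonneg hχ _ _))]
        calc kD z * cut χ (B0 i.b) z ≤ 2 / z * 1 :=
              mul_le_mul (kD_le hz0) (cut_le_one hχ _ _) (cut_nonneg hχ _ _) (by positivity)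
          _ ≤ 2 / y := by rw [mul_one]; exact div_le_div_of_nonneg_left (by norm_num) hy hz.1.le)
    refine (le_abs_self _).trans (h1.trans ?_)
    rw [abs_of_nonneg (by linarith)]
    calc 2 / y * (2 / i.t - y) ≤ 2 / y * (2 / i.t) := by gcongr; linarith
      _ = 4 / (i.t * y) := by field_simp; norm_num

theorem Par.log_inv (i : Par) : Real.log (1 / i.t ^ 2) = i.L := by
  rw [i.t_sq, one_div, Real.log_inv, i.L_eq]

/-- The logarithmic divergence of the square norm of the resonance. -/
theorem abs_KInf_sub_le {χ : ℝ → ℝ} (hχ : IsCutoff χ) (i : Par) : |KInf χ i.b - i.L| ≤ 4 := by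
  have ht := i.t_pos
  have ht1 := i.t_lt_one
  have hint : ∀ y, IntervalIntegrable (fun z => kD z * cut χ (B0 i.b) z)
    MeasureTheory.volume 0 y := fun y => (continuous_kD_cut hχ _).intervalIntegrable _ _
  have hpf : ∀ y, 0 < pf y ∧ pf y ≤ 1 := fun y =>
    ⟨by unfold pf; positivity, inv_le_one_of_one_le₀ (by nlinarith [sq_nonneg y])⟩
  have low : i.L - 1 ≤ KInf χ i.b := by
    have h1 : KInt χ i.b (1 / i.t) = ∫ z in (0 : ℝ)..1 / i.t, kD z := by
      refine intervalIntegral.integral_congr fun z hz => ?_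
      rw [Set.uIcc_of_le (by positivity)] at hz
      rw [cut_B0, hχ.eq_one _ ((le_div_iff₀ ht).1 hz.2), mul_one]
    have h2 := KInt_le_KInf hχ i (y := 1 / i.t) (by positivity)
    rw [h1, integral_kD] at h2
    have h3 : Real.log (1 / i.t ^ 2) ≤ Real.log (1 + (1 / i.t) ^ 2) :=
      Real.log_le_log (by positivity) (by rw [div_pow]; simp)
    rw [i.log_inv] at h3
    linarith [(hpf (1 / i.t)).1]
  have up : KInf χ i.b ≤ i.L + 4 := by
    rw [KInf_eq hχ i le_rfl]
    have h1 : KInt χ i.b (2 / i.t) ≤ ∫ z in (0 : ℝ)..2 / i.t, kD z := by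
      refine intervalIntegral.integral_mono_on (by positivity) (hint _)
        (continuous_kD.intervalIntegrable _ _) fun z hz => ?_
      exact mul_le_of_le_one_right (kD_nonneg hz.1) (cut_le_one hχ _ _)
    rw [integral_kD] at h1
    have h2 : Real.log (1 + (2 / i.t) ^ 2) ≤ Real.log (5 * (1 / i.t ^ 2)) := by
      refine Real.log_le_log (by positivity) ?_
      have : 1 ≤ 1 / i.t ^ 2 := by
        rw [one_le_div (by positivity)]; nlinarith
      rw [div_pow]
      have e : (2 : ℝ) ^ 2 / i.t ^ 2 = 4 * (1 / i.t ^ 2) := by ring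
      linarith
    rw [Real.log_mul (by norm_num) (by positivity), i.log_inv] at h2
    have h3 := Real.log_le_sub_one_of_pos (show (0 : ℝ) < 5 by norm_num)
    linarith [(hpf (2 / i.t)).2]
  rw [abs_le]
  constructor <;> linarith

theorem KInf_ge {χ : ℝ → ℝ} (hχ : IsCutoff χ) (i : Par) : i.L / 2 ≤ KInf χ i.b := by
  have := abs_le.1 (abs_KInf_sub_le hχ i)
  linarith [i.L_gt]

theorem KInf_le {χ : ℝ → ℝ} (hχ : IsCutoff χ) (i : Par) : KInf χ i.b ≤ 2 * i.L := by
  have := abs_le.1 (abs_KInf_sub_le hχ i)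
  linarith [i.L_gt]

theorem KInf_pos {χ : ℝ → ℝ} (hχ : IsCutoff χ) (i : Par) : 0 < KInf χ i.b :=
  (half_pos i.L_pos).trans_le (KInf_ge hχ i)

theorem hasDerivAt_one_sub_pf_sq (y : ℝ) :
    HasDerivAt (fun y => (1 - pf y) ^ 2) (Lam 0 halfyQ y * halfyQ y * y) y := by
  refine (((hasDerivAt_pf y).const_sub 1).pow 2).congr_deriv ?_
  have : Lam 0 halfyQ y * halfyQ y * y = y ^ 3 / 2 * pf y * Q y ^ 2 := by
    rw [Lam_halfyQ]; unfold halfyQ; ring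
  rw [this, Q_sq, pf]
  have h : (1 + y ^ 2) ≠ 0 := by positivity
  have e : 1 - (1 + y ^ 2)⁻¹ = y ^ 2 / (1 + y ^ 2) := by field_simp; ring
  simp only [e, show (2 : ℕ) - 1 = 1 from rfl, pow_one, Nat.cast_ofNat]
  field_simp
  ring

/-- The integrand is an exact derivative: `½ y Q` just fails to be square integrable, and the
scaling identity leaves its boundary term at infinity. -/
theorem ipR_Lam_halfyQ : ipR (Lam 0 halfyQ) halfyQ = 2 * Real.pi := by
  have hlim : Filter.Tendsto (fun y : ℝ => (1 - pf y) ^ 2) Filter.atTop (nhds 1) := by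
    have h1 : Filter.Tendsto pf Filter.atTop (nhds 0) := by
      refine Filter.Tendsto.inv_tendsto_atTop ?_
      exact Filter.tendsto_atTop_add_const_left _ _ (Filter.tendsto_pow_atTop two_ne_zero)
    have h2 := (h1.const_sub 1).pow 2
    simpa using h2
  have h := MeasureTheory.integral_Ioi_of_hasDerivAt_of_nonneg' (a := 0)
    (fun y _ => hasDerivAt_one_sub_pf_sq y) (fun y (hy : 0 < y) => by
      rw [Lam_halfyQ]
      unfold halfyQ pf
      have := Q_pos y
      positivity) hlim
  rw [ipR, h]
  simp [pf]

theorem cb_eq {χ : ℝ → ℝ} (i : Par) : cb χ i.b = 1 / KInf χ i.b := by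
  rw [cb, ipR_Lam_halfyQ, ipR]
  have : (∫ r in Set.Ioi (0 : ℝ), halfyQ r * cut χ (B0 i.b) r * halfyQ r * r) = KInf χ i.b := by
    unfold KInf
    congr 1
    funext r
    unfold kD
    ring
  rw [this, div_mul_eq_div_div, div_self (by positivity)]

theorem abs_cb_sub_le {χ : ℝ → ℝ} (hχ : IsCutoff χ) (i : Par) :
    |cb χ i.b - 1 / i.L| ≤ 8 / i.L ^ 2 := by
  have h1 := abs_KInf_sub_le hχ i
  have h2 := KInf_ge hχ i
  have hL := i.L_pos
  have hK := KInf_pos hχ i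
  rw [cb_eq, div_sub_div _ _ hK.ne' hL.ne', abs_div, one_mul, mul_one, abs_sub_comm,
    abs_of_pos (mul_pos hK hL), div_le_div_iff₀ (mul_pos hK hL) (by positivity)]
  calc |KInf χ i.b - i.L| * i.L ^ 2 ≤ 4 * i.L ^ 2 := by gcongr
    _ = 8 * (i.L / 2 * i.L) := by ring
    _ ≤ 8 * (KInf χ i.b * i.L) := by gcongr

theorem cb_pos {χ : ℝ → ℝ} (hχ : IsCutoff χ) (i : Par) : 0 < cb χ i.b := by
  rw [cb_eq]; exact one_div_pos.2 (KInf_pos hχ i)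

theorem cb_le {χ : ℝ → ℝ} (hχ : IsCutoff χ) (i : Par) : cb χ i.b ≤ 2 * i.L⁻¹ := by
  rw [cb_eq, ← div_eq_mul_inv, div_le_div_iff₀ (KInf_pos hχ i) i.L_pos]
  linarith [KInf_ge hχ i]

theorem sy_cb {χ : ℝ → ℝ} (hχ : IsCutoff χ) {S : Region Par} :
    Sy S 0 0 0 1 (fun i _ => cb χ i.b) :=
  Sy.scalar ⟨2, fun i => by
    rw [Real.norm_eq_abs, abs_of_pos (cb_pos hχ i)]
    simpa [Par.c] using cb_le hχ i⟩

/-! ### The source `g₂` and the profiles built from it -/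

theorem g2_eq (χ : ℝ → ℝ) (b y : ℝ) :
    g2 χ b y = Lam 0 halfyQ y - cb χ b * (halfyQ y * cut χ (B0 b) y) := rfl

variable {χ : ℝ → ℝ} {S : Region Par}

theorem sy_cb_fcut (hχ : IsCutoff χ) :
    Sy S 1 (-2) 0 1 (fun i y => cb χ i.b * (halfyQ y * cut χ (B0 i.b) y)) := by
  have h1 : Sy S 1 (-2) 0 0 (fun i y => halfyQ y * cut χ (B0 i.b) y) := Sy.mul sy_f hχ.sy0
  exact Sy.mul (sy_cb hχ) h1

theorem sy_g2 (hχ : IsCutoff χ) : Sy S 1 (-2) 0 0 (fun i => g2 χ i.b) :=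
  (sy_Lamf.le).sub (sy_cb_fcut hχ).le

theorem adm_g2 (hχ : IsCutoff χ) (i : Par) : Adm (g2 χ i.b) :=
  (sy_g2 hχ).adm le_rfl i

/-- The cancellation in `∫ z J g₂` that the choice of `c_b` is made for is visible here: the bracket
tends to `1 - 1 = 0` at infinity. -/
theorem JInt_g2 (hχ : IsCutoff χ) (i : Par) (y : ℝ) :
    JInt (g2 χ i.b) y = 2 * ((1 - pf y) ^ 2 - cb χ i.b * KInt χ i.b y) := by
  have e : (fun z => z * J z * g2 χ i.b z) = fun z => 2 * (Lam 0 halfyQ z * halfyQ z * z) -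
      2 * cb χ i.b * (kD z * cut χ (B0 i.b) z) := by
    funext z
    rw [g2_eq]
    unfold J kD halfyQ
    ring
  have hc : Continuous fun z => Lam 0 halfyQ z * halfyQ z * z := by
    have : Continuous (Lam 0 halfyQ) := by
      have hp : Continuous pf := continuous_iff_continuousAt.2 fun y =>
        (hasDerivAt_pf y).continuousAt
      have e : Lam 0 halfyQ = fun y => 2 * (halfyQ y * pf y) := funext Lam_halfyQ
      rw [e]
      exact continuous_const.mul (continuous_halfyQ.mul hp)
    exact (this.mul continuous_halfyQ).mul continuous_id
  have h1 := intervalIntegral.integral_eq_sub_of_hasDerivAt (a := 0) (b := y)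
    (fun z _ => hasDerivAt_one_sub_pf_sq z) (hc.intervalIntegrable _ _)
  rw [JInt, e, intervalIntegral.integral_sub ((hc.intervalIntegrable _ _).const_mul _)
    (((continuous_kD_cut hχ _).intervalIntegrable _ _).const_mul _),
    intervalIntegral.integral_const_mul, intervalIntegral.integral_const_mul, h1, ← KInt]
  simp [pf]
  ring

theorem pf_le {y : ℝ} (hy : 0 < y) : pf y ≤ y⁻¹ := by
  refine inv_anti₀ hy ?_
  nlinarith [sq_nonneg (y - 1)]

theorem pf_pos (y : ℝ) : 0 < pf y := by unfold pf; positivity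
theorem pf_le_one (y : ℝ) : pf y ≤ 1 := inv_le_one_of_one_le₀ (by nlinarith [sq_nonneg y])

theorem cb_mul_KInt (hχ : IsCutoff χ) (i : Par) {y : ℝ} (hy : 0 ≤ y) :
    0 ≤ cb χ i.b * KInt χ i.b y ∧ cb χ i.b * KInt χ i.b y ≤ 1 := by
  refine ⟨mul_nonneg (cb_pos hχ i).le (KInt_nonneg hχ _ hy), ?_⟩
  rw [cb_eq, one_div, inv_mul_le_iff₀ (KInf_pos hχ i), mul_one]
  exact KInt_le_KInf hχ i hy

theorem jInt_near {m n : ℤ} {F : Par → ℝ → ℝ} (h : Sy RAll 1 (-2) m n F) :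
    ∃ C, 0 ≤ C ∧ ∀ i : Par, ∀ y, 0 < y → |JInt (F i) y| ≤ C * y ^ 4 * i.c m n := by
  obtain ⟨C, hC⟩ := (h.le (p' := 1) (q' := -1) (m' := m) (n' := n)).bd
  refine ⟨3 * |C|, by positivity, fun i y hy => ?_⟩
  have hc := (i.c_pos m n).le
  refine (JInt_le (C := |C| * i.c m n) (by positivity) hy fun z hz =>
    (hC i z hz.1).trans ?_).trans (le_of_eq (by ring))
  have hz0 := hz.1
  have h1 : W 1 (-1) m n i z ≤ z * i.c m n := by
    simp only [W, zpow_one, zpow_neg_one]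
    exact mul_le_mul_of_nonneg_right
      (mul_le_of_le_one_right hz0.le (inv_le_one_of_one_le₀ (by linarith))) hc
  calc C * W 1 (-1) m n i z ≤ |C| * W 1 (-1) m n i z :=
        mul_le_mul_of_nonneg_right (le_abs_self _) (W_pos hz0).le
    _ ≤ |C| * (z * i.c m n) := mul_le_mul_of_nonneg_left h1 (abs_nonneg _)
    _ = |C| * i.c m n * z := by ring

theorem JInt_g2_le_near (hχ : IsCutoff χ) :
    ∃ C, 0 ≤ C ∧ ∀ i : Par, ∀ y, 0 < y → |JInt (g2 χ i.b) y| ≤ C * y ^ 4 := by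
  obtain ⟨C, hC0, hC⟩ := jInt_near (sy_g2 hχ)
  exact ⟨C, hC0, fun i y hy => by simpa [Par.c_zero] using hC i y hy⟩

theorem pow_four_le {y : ℝ} (hy : 0 < y) (h1 : y ≤ 1) : y ^ 4 ≤ y ^ (3 : ℤ) := by
  rw [show (3 : ℤ) = ((3 : ℕ) : ℤ) from rfl, zpow_natCast]
  exact pow_le_pow_of_le_one hy.le h1 (by norm_num)

theorem bd_JInt_g2 (hχ : IsCutoff χ) : Bd S (W 3 (-3) 0 0) (fun i => JInt (g2 χ i.b)) := by
  obtain ⟨C, hC0, hC⟩ := JInt_g2_le_near hχ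
  refine Bd.of_split (C + 4) (fun i y hy h1 => ?_) fun i y hy h1 => ?_
  · have hy0 := S.pos i y hy
    rw [Par.c_zero, mul_one]
    refine (hC i y hy0).trans ?_
    have := pow_four_le hy0 h1
    have := (zpow_pos hy0 3).le
    nlinarith
  · have hy0 := S.pos i y hy
    obtain ⟨h2, h3⟩ := cb_mul_KInt hχ i hy0.le
    have h4 := pf_pos y
    have h5 := pf_le_one y
    have h6 : |JInt (g2 χ i.b) y| ≤ 4 := by
      rw [JInt_g2 hχ, abs_le]
      constructor <;> nlinarith
    rw [Par.c_zero]
    simpa using h6.trans (by linarith : (4 : ℝ) ≤ C + 4)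

/-- The gain of `B₀ / (L y)` over the crude bound. -/
theorem bd_JInt_g2' (hχ : IsCutoff χ) : Bd S (W 3 (-4) (-1) 1) (fun i => JInt (g2 χ i.b)) := by
  obtain ⟨C, hC0, hC⟩ := JInt_g2_le_near hχ
  obtain ⟨K, hK0, hK⟩ := Par.c_le (m := 0) (n := 0) (m' := -1) (n' := 1) (by omega)
  simp only [Par.c_zero] at hK
  refine Bd.of_split (C * K + (4 * K + 16)) (fun i y hy h1 => ?_) fun i y hy h1 => ?_
  · have hy0 := S.pos i y hy
    refine (hC i y hy0).trans ?_
    have h2 := pow_four_le hy0 h1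
    have h3 := (zpow_pos hy0 3).le
    have h4 := (i.c_pos (-1) 1).le
    have h5 := hK i
    calc C * y ^ 4 ≤ C * y ^ (3 : ℤ) * 1 := by rw [mul_one]; gcongr
      _ ≤ C * y ^ (3 : ℤ) * (K * i.c (-1) 1) := by gcongr
      _ ≤ C * y ^ (3 : ℤ) * (K * i.c (-1) 1) + (4 * K + 16) * (y ^ (3 : ℤ) * i.c (-1) 1) :=
          le_add_of_nonneg_right (by positivity)
      _ = _ := by ring
  · have hy0 := S.pos i y hy
    have h2 := KInf_sub_le hχ i hy0
    have h3 := cb_pos hχ i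
    have h4 := cb_le hχ i
    have hp := pf_pos y
    have hp1 := pf_le_one y
    have hp2 := pf_le hy0
    have hone : cb χ i.b * KInf χ i.b = 1 := by
      rw [cb_eq, one_div, inv_mul_cancel₀ (KInf_pos hχ i).ne']
    have h5 : 0 ≤ cb χ i.b * (KInf χ i.b - KInt χ i.b y) :=
      mul_nonneg h3.le (sub_nonneg.2 (KInt_le_KInf hχ i hy0.le))
    have hL := i.L_pos
    have ht := i.t_pos
    have h6 : cb χ i.b * (KInf χ i.b - KInt χ i.b y) ≤ 8 * (y⁻¹ * i.c (-1) 1) := by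
      calc cb χ i.b * (KInf χ i.b - KInt χ i.b y) ≤ (2 * i.L⁻¹) * (4 / (i.t * y)) :=
            mul_le_mul h4 h2 (sub_nonneg.2 (KInt_le_KInf hχ i hy0.le)) (by positivity)
        _ = _ := by simp only [Par.c, zpow_neg_one]; field_simp; norm_num
    have h7 : pf y ≤ K * (y⁻¹ * i.c (-1) 1) := by
      calc pf y ≤ y⁻¹ * 1 := by rw [mul_one]; exact hp2
        _ ≤ y⁻¹ * (K * i.c (-1) 1) := by gcongr; exact hK i
        _ = _ := by ring
    have e : JInt (g2 χ i.b) y = 2 * (cb χ i.b * (KInf χ i.b - KInt χ i.b y) -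
        (2 * pf y - pf y ^ 2)) := by
      rw [JInt_g2 hχ]; linear_combination (-2) * hone
    have h8 : |JInt (g2 χ i.b) y| ≤ (4 * K + 16) * (y⁻¹ * i.c (-1) 1) := by
      rw [e, abs_le]
      constructor <;> nlinarith
    have h9 : (0 : ℝ) ≤ C * K * (y⁻¹ * i.c (-1) 1) := by
      have := (i.c_pos (-1) 1).le
      positivity
    rw [show (3 : ℤ) + -4 = -1 by norm_num, zpow_neg_one]
    linarith

theorem sy_JInt_g2 (hχ : IsCutoff χ) (hS : S.Initial) :
    Sy S 3 (-3) 0 0 (fun i => JInt (g2 χ i.b)) := by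
  have h1 : Sy S 3 (-4) 0 0 (fun i y => y * J y * g2 χ i.b y) := Sy.mul sy_zJ (sy_g2 hχ)
  exact (sy_g2 hχ).jInt_of_bd hS (bd_JInt_g2 hχ) (Sy.mul Sy.id h1)

theorem sy_JInt_g2' (hχ : IsCutoff χ) :
    Sy RA0 3 (-4) (-1) 1 (fun i => JInt (g2 χ i.b)) := by
  have h1 : Sy RA0 3 (-6) 0 0 (fun _ y => y * J y * Lam 0 halfyQ y) := Sy.mul sy_zJ sy_Lamf
  have h2 : Sy RA0 3 (-4) 0 1 (fun i y => y * J y *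
      (cb χ i.b * (halfyQ y * cut χ (B0 i.b) y))) := Sy.mul sy_zJ (sy_cb_fcut hχ)
  have h3 : Sy RA0 3 (-4) (-1) 1 (fun _ y => y * (y * J y * Lam 0 halfyQ y)) :=
    Sy.mul Sy.id h1
  have h4 : Sy RA0 4 (-4) 0 1 (fun i y => y * (y * J y *
      (cb χ i.b * (halfyQ y * cut χ (B0 i.b) y)))) := Sy.mul Sy.id h2
  have h5 : Sy RA0 3 (-4) (-1) 1 (fun i y => y * (y * J y *
      (cb χ i.b * (halfyQ y * cut χ (B0 i.b) y)))) := h4.leB0 RA0.leB0 1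
  refine (sy_g2 hχ).jInt_of_bd RA0.initial (bd_JInt_g2' hχ) ((h3.sub h5).congr fun i y _ => ?_)
  rw [g2_eq]
  ring

theorem U2_eq (hχ : IsCutoff χ) (i : Par) {y : ℝ} (hy : 0 < y) :
    U2 χ i.b y = Uop (g2 χ i.b) y := (adm_g2 hχ i).Aop_outHinv hy

theorem sy_U2 (hχ : IsCutoff χ) (hS : S.Initial) : Sy S 1 (-1) 0 0 (fun i => U2 χ i.b) :=
  ((sy_JInt_g2 hχ hS).uop : Sy S 1 (-1) 0 0 _).congr fun i y hy =>
    (U2_eq hχ i (S.pos i y hy)).symm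

/-- Below `2 B₀` one power of `y` is gained at the price of `B₀ / L`. -/
theorem sy_U2' (hχ : IsCutoff χ) : Sy RA0 1 (-2) (-1) 1 (fun i => U2 χ i.b) :=
  ((sy_JInt_g2' hχ).uop : Sy RA0 1 (-2) (-1) 1 _).congr fun i y hy =>
    (U2_eq hχ i (RA0.pos i y hy)).symm

theorem sy_T20 (hχ : IsCutoff χ) (hS : S.Initial) : Sy S 2 (-1) 0 0 (fun i => T20 χ i.b) :=
  Sy.outHinv (adm_g2 hχ) ((sy_JInt_g2 hχ hS).uop : Sy S 1 (-1) 0 0 _) hS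

theorem sy_T20' (hχ : IsCutoff χ) : Sy RA0 2 (-2) (-1) 1 (fun i => T20 χ i.b) :=
  Sy.outHinv (adm_g2 hχ) ((sy_JInt_g2' hχ).uop : Sy RA0 1 (-2) (-1) 1 _) RA0.initial

theorem hasDerivAt_T20 (hχ : IsCutoff χ) (i : Par) {y : ℝ} (hy : 0 < y) :
    HasDerivAt (T20 χ i.b) (phi1 y / y * T20 χ i.b y + U2 χ i.b y) y := by
  rw [U2_eq hχ i hy]
  exact (adm_g2 hχ i).hasDerivAt_outHinv hy

theorem hasDerivAt_U2 (hχ : IsCutoff χ) (i : Par) {y : ℝ} (hy : 0 < y) :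
    HasDerivAt (U2 χ i.b) (-g2 χ i.b y - 2 * pf y / y * U2 χ i.b y) y := by
  rw [U2_eq hχ i hy]
  refine ((adm_g2 hχ i).hasDerivAt_Uop hy).congr_of_eventuallyEq ?_
  filter_upwards [Ioi_mem_nhds hy] with z hz using U2_eq hχ i hz

/-- The nonlocal factor `∫_0^y (Q T_{2,0} + ⅛ z³ Q²)`. -/
def nInt (χ : ℝ → ℝ) (b y : ℝ) : ℝ := ∫ z in (0 : ℝ)..y, (Q z * T20 χ b z + z ^ 3 / 8 * Q z ^ 2)

theorem sy_nDens (hχ : IsCutoff χ) (hS : S.Initial) :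
    Sy S 2 (-2) 0 0 (fun i z => Q z * T20 χ i.b z + z ^ 3 / 8 * Q z ^ 2) := by
  have h1 : Sy S 2 (-2) 0 0 (fun i z => Q z * T20 χ i.b z) := Sy.mul sy_Q (sy_T20 hχ hS)
  have h2 : Sy S 2 (-2) 0 0 (fun _ z => qf z * halfyQ z) := Sy.mul sy_qf sy_f
  exact (h1.add h2).congr fun i y _ => by unfold qf halfyQ; ring

theorem sy_nInt (hχ : IsCutoff χ) (hS : S.Initial) : Sy S 3 (-2) 0 0 (fun i => nInt χ i.b) :=
  (sy_nDens hχ hS).primitive hS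

theorem hasDerivAt_nInt (hχ : IsCutoff χ) (i : Par) {y : ℝ} (hy : 0 < y) :
    HasDerivAt (nInt χ i.b) (Q y * T20 χ i.b y + y ^ 3 / 8 * Q y ^ 2) y :=
  Sym.hasDerivAt_integral RAll.initial (sy_nDens hχ RAll.initial)
    ((sy_nDens hχ RAll.initial).bd.local RAll.initial (by norm_num)) (i := i) hy

theorem g30_eq (hχ : IsCutoff χ) (i : Par) {y : ℝ} (hy : 0 < y) :
    g30 χ i.b y = phi1 y * T20 χ i.b y + y * U2 χ i.b y - nInt χ i.b y * halfyQ y := by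
  rw [g30, Lam, (hasDerivAt_T20 hχ i hy).deriv, nInt]
  have := hy.ne'
  simp only [smul_eq_mul]
  field_simp
  ring_nf

theorem sy_g30 (hχ : IsCutoff χ) (hS : S.Initial) : Sy S 2 (-1) 0 0 (fun i => g30 χ i.b) := by
  have h1 : Sy S 2 (-1) 0 0 (fun i y => phi1 y * T20 χ i.b y) := Sy.mul sy_phi1 (sy_T20 hχ hS)
  have h2 : Sy S 2 (-1) 0 0 (fun i y => y * U2 χ i.b y) := Sy.mul Sy.id (sy_U2 hχ hS)
  have h3 : Sy S 2 (-1) 0 0 (fun i y => nInt χ i.b y * halfyQ y) :=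
    Sy.mul (sy_nInt hχ hS) sy_f
  exact ((h1.add h2).sub h3).congr fun i y hy => (g30_eq hχ i (S.pos i y hy)).symm

theorem sy_g30' (hχ : IsCutoff χ) : Sy RA0 2 (-2) (-1) 1 (fun i => g30 χ i.b) := by
  have h1 : Sy RA0 2 (-2) (-1) 1 (fun i y => phi1 y * T20 χ i.b y) :=
    Sy.mul sy_phi1 (sy_T20' hχ)
  have h2 : Sy RA0 2 (-2) (-1) 1 (fun i y => y * U2 χ i.b y) := Sy.mul Sy.id (sy_U2' hχ)
  have h3 : Sy RA0 2 (-2) (-1) 1 (fun i y => nInt χ i.b y * halfyQ y) :=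
    Sy.mul (sy_nInt hχ RA0.initial) sy_f
  exact ((h1.add h2).sub h3).congr fun i y hy => (g30_eq hχ i (RA0.pos i y hy)).symm

theorem adm_g30 (hχ : IsCutoff χ) (i : Par) : Adm (g30 χ i.b) :=
  (sy_g30 hχ RAll.initial).adm (by norm_num) i

theorem U30_eq (hχ : IsCutoff χ) (i : Par) {y : ℝ} (hy : 0 < y) :
    U30 χ i.b y = Uop (g30 χ i.b) y := (adm_g30 hχ i).Aop_outHinv hy

theorem hasDerivAt_U30 (hχ : IsCutoff χ) (i : Par) {y : ℝ} (hy : 0 < y) :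
    HasDerivAt (U30 χ i.b) (-g30 χ i.b y - 2 * pf y / y * U30 χ i.b y) y := by
  rw [U30_eq hχ i hy]
  refine ((adm_g30 hχ i).hasDerivAt_Uop hy).congr_of_eventuallyEq ?_
  filter_upwards [Ioi_mem_nhds hy] with z hz using U30_eq hχ i hz

theorem sy_U30 (hχ : IsCutoff χ) (hS : S.Initial) : Sy S 3 (-1) 0 0 (fun i => U30 χ i.b) := by
  have h1 : Sy S 5 (-3) 0 0 (fun i => JInt (g30 χ i.b)) := (sy_g30 hχ hS).jInt hS
  exact (h1.uop : Sy S 3 (-1) 0 0 _).congr fun i y hy => (U30_eq hχ i (S.pos i y hy)).symm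

theorem sy_U30' (hχ : IsCutoff χ) : Sy RA0 3 (-2) (-1) 1 (fun i => U30 χ i.b) := by
  have h1 : Sy RA0 5 (-4) (-1) 1 (fun i => JInt (g30 χ i.b)) := (sy_g30' hχ).jInt RA0.initial
  exact (h1.uop : Sy RA0 3 (-2) (-1) 1 _).congr fun i y hy =>
    (U30_eq hχ i (RA0.pos i y hy)).symm

/-! ### Derivatives with respect to `b` -/

theorem Par.eventually (i : Par) : ∀ᶠ b in nhds i.b, ∃ j : Par, j.b = b := by
  filter_upwards [Ioo_mem_nhds i.pos i.small] with b hb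
  exact ⟨⟨b, 0, hb.1, hb.2, by rw [abs_zero]; exact div_nonneg hb.1.le (abs_nonneg _)⟩, rfl⟩

theorem Par.eventually_c (i : Par) (m n : ℤ) :
    ∃ K : ℝ, ∀ᶠ b in nhds i.b, ∀ j : Par, j.b = b → j.c m n ≤ K := by
  have h0 : Real.log i.b ≠ 0 := (Real.log_neg i.pos i.b_lt_one).ne
  have hcont : ContinuousAt (fun b : ℝ => √b ^ m * |Real.log b| ^ (-n)) i.b := by
    refine ContinuousAt.mul ?_ ?_
    · exact (Real.continuous_sqrt.continuousAt).zpow₀ m (Or.inl i.t_pos.ne')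
    · exact ((Real.continuousAt_log i.pos.ne').abs).zpow₀ (-n) (Or.inl (abs_ne_zero.2 h0))
  refine ⟨√i.b ^ m * |Real.log i.b| ^ (-n) + 1, ?_⟩
  filter_upwards [hcont.eventually_lt continuousAt_const (lt_add_one _)] with b hb j hj
  subst hj
  exact hb.le

/-- Differentiation under the integral sign for families of symbols. -/
theorem hasDerivAt_integral_par {Φ Φ' : ℝ → ℝ → ℝ} {p q m n p' q' m' n' : ℤ}
    (hΦ : Sy RAll p q m n (fun i => Φ i.b)) (hp : 0 ≤ p)
    (hΦ' : Sy RAll p' q' m' n' (fun i => Φ' i.b)) (hp' : 0 ≤ p')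
    (hd : ∀ i : Par, ∀ z, 0 < z → HasDerivAt (fun b => Φ b z) (Φ' i.b z) i.b)
    (i : Par) {y : ℝ} (hy : 0 < y) :
    HasDerivAt (fun b => ∫ z in (0 : ℝ)..y, Φ b z) (∫ z in (0 : ℝ)..y, Φ' i.b z) i.b := by
  obtain ⟨K, hK⟩ := i.eventually_c m' n'
  obtain ⟨C, hC⟩ := (hΦ'.le (p' := p') (q' := max q' (-p')) (m' := m') (n' := n')).bd
  obtain ⟨s, hs, hs'⟩ := (hK.and i.eventually).exists_mem
  obtain ⟨C0, hC0⟩ := hΦ.bd.local RAll.initial hp i y hy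
  have hcont : ∀ j : Par, ContinuousOn (Φ j.b) (Set.Ioc 0 y) := fun j =>
    (Sym.continuousOn hΦ j).mono fun z hz => hz.1
  refine (intervalIntegral.hasDerivAt_integral_of_dominated_loc_of_deriv_le (s := s)
    (bound := fun _ => |C| * (y ^ p' * (1 + y) ^ max q' (-p') * K)) hs ?_
    (intervalIntegrable_of_bdd hy (hcont i) hC0) ?_ ?_ (by simp) ?_).2
  · filter_upwards [hs] with b hb
    obtain ⟨j, rfl⟩ := (hs' b hb).2
    rw [Set.uIoc_of_le hy.le]
    exact (hcont j).aestronglyMeasurable measurableSet_Ioc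
  · rw [Set.uIoc_of_le hy.le]
    exact ((Sym.continuousOn hΦ' i).mono fun z hz => hz.1).aestronglyMeasurable measurableSet_Ioc
  · refine MeasureTheory.ae_of_all _ fun z hz b hb => ?_
    rw [Set.uIoc_of_le hy.le] at hz
    obtain ⟨h1, j, rfl⟩ := hs' b hb
    refine (hC j z hz.1).trans ?_
    calc C * W p' (max q' (-p')) m' n' j z ≤ |C| * W p' (max q' (-p')) m' n' j z :=
          mul_le_mul_of_nonneg_right (le_abs_self _) (W_pos hz.1).le
      _ ≤ |C| * (y ^ p' * (1 + y) ^ max q' (-p') * K) := by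
          refine mul_le_mul_of_nonneg_left ?_ (abs_nonneg _)
          refine mul_le_mul (weight_mono hp' (by omega) hz.1 hz.2) (h1 j rfl) (j.c_pos _ _).le ?_
          exact mul_nonneg (zpow_nonneg hy.le _) (zpow_nonneg (by linarith) _)
  · refine MeasureTheory.ae_of_all _ fun z hz b hb => ?_
    rw [Set.uIoc_of_le hy.le] at hz
    obtain ⟨-, j, rfl⟩ := hs' b hb
    exact hd j z hz.1

variable {χ : ℝ → ℝ} {S : Region Par}

/-- `∂_b χ_{B₀}`. -/
def dcut0 (χ : ℝ → ℝ) (b y : ℝ) : ℝ := 1 / (2 * b) * cut (euler χ) (B0 b) y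

/-- `∂_b χ_{B₁}`. -/
def dcut1 (χ : ℝ → ℝ) (b y : ℝ) : ℝ :=
  1 / b * (1 / 2 + 1 / |Real.log b|) * cut (euler χ) (B1 b) y

theorem IsCutoff.hasDerivAt (hχ : IsCutoff χ) (x : ℝ) : HasDerivAt χ (deriv χ x) x :=
  (hχ.smooth.differentiable (by simp) x).hasDerivAt

theorem hasDerivAt_cut0 (hχ : IsCutoff χ) (i : Par) (z : ℝ) :
    HasDerivAt (fun b => cut χ (B0 b) z) (dcut0 χ i.b z) i.b := by
  have h1 : HasDerivAt (fun b : ℝ => z * √b) (z * (1 / (2 * √i.b))) i.b :=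
    (Real.hasDerivAt_sqrt i.pos.ne').const_mul z
  have h2 := (hχ.hasDerivAt (z * √i.b)).comp i.b h1
  have h3 : HasDerivAt (fun b => cut χ (B0 b) z) (deriv χ (z * √i.b) * (z * (1 / (2 * √i.b))))
      i.b := by
    refine h2.congr_of_eventuallyEq ?_
    filter_upwards [i.eventually] with b ⟨j, hj⟩
    rw [← hj, cut_B0]; rfl
  refine h3.congr_deriv ?_
  have ht := i.t_pos.ne'
  have hb : i.b = i.t ^ 2 := i.t_sq.symm
  rw [dcut0, cut_B0, euler, smul_eq_mul, ← Par.t, hb]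
  field_simp

theorem hasDerivAt_cut1 (hχ : IsCutoff χ) (i : Par) (z : ℝ) :
    HasDerivAt (fun b => cut χ (B1 b) z) (dcut1 χ i.b z) i.b := by
  have hlog : -Real.log i.b ≠ 0 := by rw [← i.L_eq]; exact i.L_pos.ne'
  have ht := i.t_pos.ne'
  have h1 : HasDerivAt (fun b : ℝ => z * (√b / (-Real.log b)))
      (z * ((1 / (2 * √i.b) * (-Real.log i.b) - √i.b * (-(i.b)⁻¹)) / (-Real.log i.b) ^ 2)) i.b :=
    ((Real.hasDerivAt_sqrt i.pos.ne').div (Real.hasDerivAt_log i.pos.ne').neg hlog).const_mul z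
  have h2 := (hχ.hasDerivAt (z * (√i.b / (-Real.log i.b)))).comp i.b h1
  have h3 := h2.congr_of_eventuallyEq (f₁ := fun b => cut χ (B1 b) z) (by
    filter_upwards [i.eventually] with b ⟨j, hj⟩
    rw [← hj, cut_B1, j.L_eq]; rfl)
  refine h3.congr_deriv ?_
  rw [dcut1, cut_B1, euler, smul_eq_mul, ← Par.L, ← i.L_eq, ← Par.t]
  have hL := i.L_pos.ne'
  have hb : i.b = i.t ^ 2 := i.t_sq.symm
  rw [hb]
  field_simp
  ring

theorem IsCutoff.euler_support (hχ : IsCutoff χ) : ∀ x, 2 < x → euler χ x = 0 :=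
  CSS.euler_support hχ.support

theorem IsCutoff.euler_eq_zero (hχ : IsCutoff χ) {x : ℝ} (hx : x < 1) : euler χ x = 0 := by
  have : χ =ᶠ[nhds x] fun _ => 1 := by
    filter_upwards [isOpen_Iio.mem_nhds hx] with z hz using hχ.eq_one z (le_of_lt hz)
  rw [euler, this.deriv_eq]
  simp

theorem sy_b : Sy S 0 0 2 0 (fun i _ => i.b) :=
  Sy.scalar ⟨1, fun i => by
    rw [Real.norm_eq_abs, abs_of_pos i.pos, ← i.t_sq]
    simp [Par.c]⟩

theorem sy_dcut0 (hχ : IsCutoff χ) : Sy S 0 0 (-2) 0 (fun i => dcut0 χ i.b) := by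
  have h1 : Sy S 0 0 (-2) 0 (fun i _ => 1 / (2 * i.b)) := Sy.scalar ⟨1, fun i => by
    have ht := i.t_pos
    rw [Real.norm_eq_abs, abs_of_pos (by have := i.pos; positivity), ← i.t_sq]
    simp only [Par.c, zpow_neg, neg_zero, zpow_zero, mul_one, one_mul]
    norm_cast
    rw [one_div, mul_inv]
    have : (0 : ℝ) < (i.t ^ 2)⁻¹ := by positivity
    linarith⟩
  exact Sy.mul h1 (sy_cut0 (contDiff_euler hχ.smooth) hχ.euler_support)

theorem sy_dcut1 (hχ : IsCutoff χ) : Sy S 0 0 (-2) 0 (fun i => dcut1 χ i.b) := by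
  have h1 : Sy S 0 0 (-2) 0 (fun i _ => 1 / i.b * (1 / 2 + 1 / |Real.log i.b|)) :=
    Sy.scalar ⟨1, fun i => by
      have ht := i.t_pos
      have hL := i.L_gt
      have hb := i.pos
      change ‖1 / i.b * (1 / 2 + 1 / i.L)‖ ≤ _
      rw [Real.norm_eq_abs, abs_of_pos (by positivity), ← i.t_sq]
      simp only [Par.c, zpow_neg, neg_zero, zpow_zero, mul_one, one_mul]
      norm_cast
      rw [one_div]
      refine mul_le_of_le_one_right (by positivity) ?_
      have : 1 / i.L ≤ 1 / 16 := one_div_le_one_div_of_le (by norm_num) hL.le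
      linarith⟩
  exact Sy.mul h1 (sy_cut1 (contDiff_euler hχ.smooth) hχ.euler_support)

theorem sy_kD : Sy S 3 (-4) 0 0 (fun _ y => kD y) := by
  have h : Sy S 2 (-4) 0 0 (fun _ y => halfyQ y * halfyQ y) := Sy.mul sy_f sy_f
  exact Sy.mul h Sy.id

/-- `∂_b` of `KInt`. -/
def KIntB (χ : ℝ → ℝ) (b y : ℝ) : ℝ := ∫ z in (0 : ℝ)..y, kD z * dcut0 χ b z

theorem hasDerivAt_KInt (hχ : IsCutoff χ) (i : Par) {y : ℝ} (hy : 0 < y) :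
    HasDerivAt (fun b => KInt χ b y) (KIntB χ i.b y) i.b :=
  hasDerivAt_integral_par (Φ := fun b z => kD z * cut χ (B0 b) z)
    (Φ' := fun b z => kD z * dcut0 χ b z)
    (Sy.mul sy_kD hχ.sy0 : Sy RAll 3 (-4) 0 0 _) (by norm_num)
    (Sy.mul sy_kD (sy_dcut0 hχ) : Sy RAll 3 (-4) (-2) 0 _) (by norm_num)
    (fun j z _ => (hasDerivAt_cut0 hχ j z).const_mul _) i hy

theorem continuous_dcut0 (hχ : IsCutoff χ) (b : ℝ) : Continuous (dcut0 χ b) :=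
  continuous_const.mul ((contDiff_euler hχ.smooth).continuous.comp (continuous_id.div_const _))

/-- No logarithm appears, since `∂_b χ_{B₀}` lives on `[B₀, 2 B₀]`. -/
theorem abs_KIntB_le (hχ : IsCutoff χ) :
    ∃ C, 0 ≤ C ∧ ∀ i : Par, ∀ y, 0 < y → |KIntB χ i.b y| ≤ C * i.c (-2) 0 := by
  obtain ⟨C, hC⟩ := bounded_of_support (contDiff_euler hχ.smooth).continuous hχ.euler_support
  have hC0 : 0 ≤ C := (abs_nonneg _).trans (hC 1 one_pos)
  have hpt : ∀ i : Par, ∀ z, 0 < z → |kD z * dcut0 χ i.b z| ≤ C / i.t := by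
    intro i z hz
    have ht := i.t_pos
    rcases lt_or_ge (z * i.t) 1 with h | h
    · rw [dcut0, cut_B0, hχ.euler_eq_zero h]; simp; positivity
    · rw [dcut0, cut_B0, abs_mul, abs_of_nonneg (kD_nonneg hz.le), abs_mul, ← i.t_sq,
        abs_of_pos (by positivity)]
      have h1 : kD z ≤ 2 * i.t := (kD_le hz).trans (by rw [div_le_iff₀ hz]; linarith)
      calc kD z * (1 / (2 * i.t ^ 2) * |euler χ (z * i.t)|)
          ≤ (2 * i.t) * (1 / (2 * i.t ^ 2) * C) := by
            have := hC (z * i.t) (by positivity)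
            gcongr
        _ = C / i.t := by field_simp
  refine ⟨2 * C, by positivity, fun i y hy => ?_⟩
  have ht := i.t_pos
  have hc : i.c (-2) 0 = 1 / i.t / i.t := by
    simp only [Par.c, zpow_neg, neg_zero, zpow_zero, mul_one]
    norm_cast
    field_simp
  have key : ∀ y, 0 < y → y ≤ 2 / i.t → |KIntB χ i.b y| ≤ 2 * C * i.c (-2) 0 := by
    intro y hy h
    refine (norm_integral_le_of_bdd hy fun z hz => hpt i z hz.1).trans ?_
    calc C / i.t * y ≤ C / i.t * (2 / i.t) := by gcongr
      _ = _ := by rw [hc]; ring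
  rcases le_total y (2 / i.t) with h | h
  · exact key y hy h
  · have hi : ∀ a b, IntervalIntegrable (fun z => kD z * dcut0 χ i.b z) MeasureTheory.volume a b :=
      fun a b => (continuous_kD.mul (continuous_dcut0 hχ _)).intervalIntegrable a b
    have h2 : ∫ z in (2 / i.t)..y, kD z * dcut0 χ i.b z = 0 := by
      refine intervalIntegral.integral_zero_ae (MeasureTheory.ae_of_all _ fun z hz => ?_)
      rw [Set.uIoc_of_le h] at hz
      rw [dcut0, cut_B0, hχ.euler_support _ ((div_lt_iff₀ ht).1 hz.1)]
      simp
    have h3 := intervalIntegral.integral_add_adjacent_intervals (hi 0 (2 / i.t)) (hi (2 / i.t) y)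
    rw [KIntB, ← h3, h2, add_zero]
    exact key _ (by positivity) le_rfl

/-- The derivative of `c_b`. -/
def cbD (χ : ℝ → ℝ) (b : ℝ) : ℝ := -(cb χ b ^ 2 * KIntB χ b (4 / √b))

theorem hasDerivAt_cb (hχ : IsCutoff χ) (i : Par) : HasDerivAt (cb χ) (cbD χ i.b) i.b := by
  have hR : 0 < 4 / i.t := div_pos (by norm_num) i.t_pos
  have hle : ∀ᶠ b in nhds i.b, 2 / √b < 4 / i.t := by
    have hc : ContinuousAt (fun b : ℝ => 2 / √b) i.b :=
      continuousAt_const.div Real.continuous_sqrt.continuousAt i.t_pos.ne'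
    refine hc.eventually_lt continuousAt_const ?_
    exact div_lt_div_of_pos_right (by norm_num) i.t_pos
  have h1 : HasDerivAt (fun b => 1 / KInt χ b (4 / i.t)) _ i.b :=
    (hasDerivAt_const i.b (1 : ℝ)).div (hasDerivAt_KInt hχ i hR) (by
      rw [← KInf_eq hχ i hle.self_of_nhds.le]; exact (KInf_pos hχ i).ne')
  have h2 := h1.congr_of_eventuallyEq (f₁ := cb χ) (by
    filter_upwards [hle, i.eventually] with b hb ⟨j, hj⟩
    subst hj
    rw [cb_eq, KInf_eq hχ j hb.le])
  refine h2.congr_deriv ?_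
  rw [cbD, cb_eq, KInf_eq hχ i hle.self_of_nhds.le, ← Par.t, zero_mul, one_mul]
  ring

theorem abs_cbD_le (hχ : IsCutoff χ) : ∃ C, 0 ≤ C ∧ ∀ i : Par, |cbD χ i.b| ≤ C * i.c (-2) 2 := by
  obtain ⟨C, hC0, hC⟩ := abs_KIntB_le hχ
  refine ⟨4 * C, by positivity, fun i => ?_⟩
  rw [cbD, abs_neg, abs_mul, abs_of_pos (pow_pos (cb_pos hχ i) 2)]
  have hL := i.L_pos
  have hc := (i.c_pos (-2) 0).le
  have e : i.c (-2) 2 = i.L⁻¹ ^ 2 * i.c (-2) 0 := by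
    simp only [Par.c, zpow_neg, neg_zero, zpow_zero, mul_one]
    norm_cast
    rw [inv_pow]; ring
  calc cb χ i.b ^ 2 * |KIntB χ i.b (4 / √i.b)| ≤ (2 * i.L⁻¹) ^ 2 * (C * i.c (-2) 0) := by
        refine mul_le_mul (pow_le_pow_left₀ (cb_pos hχ i).le (cb_le hχ i) 2)
          (hC i _ (div_pos (by norm_num) i.t_pos)) (abs_nonneg _) (by positivity)
    _ = _ := by rw [e]; ring

theorem sy_cbD (hχ : IsCutoff χ) : Sy S 0 0 (-2) 2 (fun i _ => cbD χ i.b) := by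
  obtain ⟨C, -, hC⟩ := abs_cbD_le hχ
  exact Sy.scalar ⟨C, hC⟩

/-- `∂_b g₂`. -/
def g2b (χ : ℝ → ℝ) (b y : ℝ) : ℝ :=
  -(cbD χ b * (halfyQ y * cut χ (B0 b) y) + cb χ b * (halfyQ y * dcut0 χ b y))

theorem sy_g2b (hχ : IsCutoff χ) : Sy S 1 (-2) (-2) 1 (fun i => g2b χ i.b) := by
  have h1 : Sy S 1 (-2) 0 0 (fun i y => halfyQ y * cut χ (B0 i.b) y) := Sy.mul sy_f hχ.sy0
  have h2 : Sy S 1 (-2) (-2) 0 (fun i y => halfyQ y * dcut0 χ i.b y) :=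
    Sy.mul sy_f (sy_dcut0 hχ)
  have h3 : Sy S 1 (-2) (-2) 1 (fun i y => cbD χ i.b * (halfyQ y * cut χ (B0 i.b) y)) :=
    Sy.mul (sy_cbD hχ) h1
  have h4 : Sy S 1 (-2) (-2) 1 (fun i y => cb χ i.b * (halfyQ y * dcut0 χ i.b y)) :=
    Sy.mul (sy_cb hχ) h2
  exact (h3.add h4).neg

theorem sy_g2b_inner (hχ : IsCutoff χ) : Sy R0 1 (-2) (-2) 2 (fun i => g2b χ i.b) := by
  have h1 : Sy R0 1 (-2) 0 0 (fun i y => halfyQ y * cut χ (B0 i.b) y) := Sy.mul sy_f hχ.sy0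
  have h3 : Sy R0 1 (-2) (-2) 2 (fun i y => cbD χ i.b * (halfyQ y * cut χ (B0 i.b) y)) :=
    Sy.mul (sy_cbD hχ) h1
  refine h3.neg.congr fun i y hy => ?_
  rw [g2b, dcut0, cut_B0 (euler χ), hχ.euler_eq_zero ((lt_div_iff₀ i.t_pos).1 hy.2)]
  ring

theorem adm_g2b (hχ : IsCutoff χ) (i : Par) : Adm (g2b χ i.b) := (sy_g2b hχ).adm le_rfl i

theorem JInt_g2b (hχ : IsCutoff χ) (b y : ℝ) :
    JInt (g2b χ b) y = -(2 * (cbD χ b * KInt χ b y + cb χ b * KIntB χ b y)) := by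
  have e : (fun z => z * J z * g2b χ b z) = fun z =>
      -2 * cbD χ b * (kD z * cut χ (B0 b) z) + -2 * cb χ b * (kD z * dcut0 χ b z) := by
    funext z
    unfold g2b J kD halfyQ
    ring
  have hk : Continuous fun z => kD z * dcut0 χ b z := continuous_kD.mul (continuous_dcut0 hχ b)
  rw [JInt, e, intervalIntegral.integral_add
    (((continuous_kD_cut hχ _).intervalIntegrable _ _).const_mul _)
    ((hk.intervalIntegrable _ _).const_mul _),
    intervalIntegral.integral_const_mul, intervalIntegral.integral_const_mul, ← KInt, ← KIntB]
  ring

/-- The derivative of `c_b` is `O(b⁻¹ L⁻²)` and multiplies an integral of size `L`; `c_b` is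
`O(L⁻¹)` and multiplies one of size `b⁻¹`. -/
theorem bd_JInt_g2b (hχ : IsCutoff χ) : Bd S (W 3 (-3) (-2) 1) (fun i => JInt (g2b χ i.b)) := by
  obtain ⟨C, hC0, hC⟩ := jInt_near (sy_g2b hχ)
  obtain ⟨C1, hC1, h1⟩ := abs_KIntB_le hχ
  obtain ⟨C2, hC2, h2⟩ := abs_cbD_le hχ
  refine Bd.of_split (C + 4 * C2 + 4 * C1) (fun i y hy hy1 => ?_) fun i y hy hy1 => ?_
  · have hy0 := S.pos i y hy
    refine (hC i y hy0).trans ?_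
    have h3 := pow_four_le hy0 hy1
    have h4 := (zpow_pos hy0 3).le
    have h5 := (i.c_pos (-2) 1).le
    rw [mul_assoc]
    calc C * (y ^ 4 * i.c (-2) 1) ≤ C * (y ^ (3 : ℤ) * i.c (-2) 1) := by gcongr
      _ ≤ _ := by gcongr; linarith
  · have hy0 := S.pos i y hy
    have hL := i.L_pos
    have h5 := (i.c_pos (-2) 1).le
    have e1 : i.c (-2) 2 * i.L = i.c (-2) 1 := by
      have : i.L = i.c 0 (-1) := by simp [Par.c]
      rw [this, Par.c_mul]; norm_num
    have e2 : i.c (-2) 0 * i.L⁻¹ = i.c (-2) 1 := by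
      have : i.L⁻¹ = i.c 0 1 := by simp [Par.c]
      rw [this, Par.c_mul]; norm_num
    have a1 : |cbD χ i.b * KInt χ i.b y| ≤ 2 * C2 * i.c (-2) 1 := by
      rw [abs_mul, abs_of_nonneg (KInt_nonneg hχ _ hy0.le)]
      calc |cbD χ i.b| * KInt χ i.b y ≤ (C2 * i.c (-2) 2) * (2 * i.L) :=
            mul_le_mul (h2 i) ((KInt_le_KInf hχ i hy0.le).trans (KInf_le hχ i))
              (KInt_nonneg hχ _ hy0.le) (mul_nonneg hC2 (i.c_pos _ _).le)
        _ = 2 * C2 * (i.c (-2) 2 * i.L) := by ring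
        _ = _ := by rw [e1]
    have a2 : |cb χ i.b * KIntB χ i.b y| ≤ 2 * C1 * i.c (-2) 1 := by
      rw [abs_mul, abs_of_pos (cb_pos hχ i)]
      calc cb χ i.b * |KIntB χ i.b y| ≤ (2 * i.L⁻¹) * (C1 * i.c (-2) 0) :=
            mul_le_mul (cb_le hχ i) (h1 i y hy0) (abs_nonneg _) (by positivity)
        _ = 2 * C1 * (i.c (-2) 0 * i.L⁻¹) := by ring
        _ = _ := by rw [e2]
    rw [JInt_g2b hχ, abs_neg, abs_mul, abs_two]
    have a3 := abs_add_le (cbD χ i.b * KInt χ i.b y) (cb χ i.b * KIntB χ i.b y)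
    rw [show (3 : ℤ) + -3 = 0 by norm_num, zpow_zero, one_mul]
    nlinarith [mul_nonneg hC0 h5]

/-- `∂_b U₂`. -/
def U2b (χ : ℝ → ℝ) (b : ℝ) : ℝ → ℝ := Uop (g2b χ b)

/-- `∂_b T_{2,0}`. -/
def T20b (χ : ℝ → ℝ) (b : ℝ) : ℝ → ℝ := outHinv (g2b χ b)

/-- `∂_b` of `nInt`. -/
def nIntb (χ : ℝ → ℝ) (b y : ℝ) : ℝ := ∫ z in (0 : ℝ)..y, Q z * T20b χ b z

/-- `∂_b g_{3,0}`. -/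
def g30b (χ : ℝ → ℝ) (b y : ℝ) : ℝ :=
  phi1 y * T20b χ b y + y * U2b χ b y - nIntb χ b y * halfyQ y

/-- `∂_b U_{3,0}`. -/
def U30b (χ : ℝ → ℝ) (b : ℝ) : ℝ → ℝ := Uop (g30b χ b)

theorem sy_U2b (hχ : IsCutoff χ) (hS : S.Initial) : Sy S 1 (-1) (-2) 1 (fun i => U2b χ i.b) := by
  have h1 : Sy S 3 (-4) (-2) 1 (fun i y => y * J y * g2b χ i.b y) := Sy.mul sy_zJ (sy_g2b hχ)
  have h2 : Sy S 3 (-3) (-2) 1 (fun i => JInt (g2b χ i.b)) :=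
    (sy_g2b hχ).jInt_of_bd hS (bd_JInt_g2b hχ) (Sy.mul Sy.id h1)
  exact h2.uop

theorem sy_T20b (hχ : IsCutoff χ) (hS : S.Initial) : Sy S 2 (-1) (-2) 1 (fun i => T20b χ i.b) :=
  Sy.outHinv (adm_g2b hχ) (sy_U2b hχ hS) hS

theorem sy_nIntb (hχ : IsCutoff χ) (hS : S.Initial) :
    Sy S 3 (-2) (-2) 1 (fun i => nIntb χ i.b) :=
  (Sy.mul sy_Q (sy_T20b hχ hS) : Sy S 2 (-2) (-2) 1 _).primitive hS

theorem sy_g30b (hχ : IsCutoff χ) (hS : S.Initial) : Sy S 2 (-1) (-2) 1 (fun i => g30b χ i.b) := by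
  have h1 : Sy S 2 (-1) (-2) 1 (fun i y => phi1 y * T20b χ i.b y) :=
    Sy.mul sy_phi1 (sy_T20b hχ hS)
  have h2 : Sy S 2 (-1) (-2) 1 (fun i y => y * U2b χ i.b y) := Sy.mul Sy.id (sy_U2b hχ hS)
  have h3 : Sy S 2 (-1) (-2) 1 (fun i y => nIntb χ i.b y * halfyQ y) :=
    Sy.mul (sy_nIntb hχ hS) sy_f
  exact (h1.add h2).sub h3

theorem sy_U30b (hχ : IsCutoff χ) (hS : S.Initial) : Sy S 3 (-1) (-2) 1 (fun i => U30b χ i.b) := by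
  have h1 : Sy S 5 (-3) (-2) 1 (fun i => JInt (g30b χ i.b)) := (sy_g30b hχ hS).jInt hS
  exact h1.uop

theorem hasDerivAt_U2_b (hχ : IsCutoff χ) (i : Par) {y : ℝ} (hy : 0 < y) :
    HasDerivAt (fun b => U2 χ b y) (U2b χ i.b y) i.b := by
  have h1 := (((((hasDerivAt_cb hχ i).mul (hasDerivAt_KInt hχ i hy)).const_sub
    ((1 - pf y) ^ 2)).const_mul 2).const_mul (y * J y)⁻¹).neg
  have h2 := h1.congr_of_eventuallyEq (f₁ := fun b => U2 χ b y) (by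
    filter_upwards [i.eventually] with b ⟨j, hj⟩
    subst hj
    rw [U2_eq hχ j hy, Uop, JInt_g2 hχ]
    rfl)
  refine h2.congr_deriv ?_
  rw [U2b, Uop, JInt_g2b hχ]
  ring

theorem hasDerivAt_T20_b (hχ : IsCutoff χ) (i : Par) {y : ℝ} (hy : 0 < y) :
    HasDerivAt (fun b => T20 χ b y) (T20b χ i.b y) i.b := by
  have hU : Sy RAll 0 1 0 0 (fun i y => U2 χ i.b y / J y) :=
    (Sy.mul (sy_U2 hχ RAll.initial) sy_Jinv : Sy RAll 0 1 0 0 _).congr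
      fun i y _ => (div_eq_mul_inv _ _).symm
  have hU' : Sy RAll 0 1 (-2) 1 (fun i y => U2b χ i.b y / J y) :=
    (Sy.mul (sy_U2b hχ RAll.initial) sy_Jinv : Sy RAll 0 1 (-2) 1 _).congr
      fun i y _ => (div_eq_mul_inv _ _).symm
  have h1 := (hasDerivAt_integral_par (Φ := fun b y => U2 χ b y / J y)
    (Φ' := fun b y => U2b χ b y / J y) hU le_rfl hU' le_rfl
    (fun j z hz => (hasDerivAt_U2_b hχ j hz).div_const _) i hy).const_mul (J y)
  have h2 := h1.congr_of_eventuallyEq (f₁ := fun b => T20 χ b y) (by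
    filter_upwards [i.eventually] with b ⟨j, hj⟩
    subst hj
    rw [T20, (adm_g2 hχ j).outHinv_eq_integral hy]
    congr 1
    refine intervalIntegral.integral_congr_ae (MeasureTheory.ae_of_all _ fun z hz => ?_)
    rw [Set.uIoc_of_le hy.le] at hz
    rw [U2_eq hχ j hz.1])
  refine h2.congr_deriv ?_
  rw [T20b, (adm_g2b hχ i).outHinv_eq_integral hy]
  rfl

theorem hasDerivAt_nInt_b (hχ : IsCutoff χ) (i : Par) {y : ℝ} (hy : 0 < y) :
    HasDerivAt (fun b => nInt χ b y) (nIntb χ i.b y) i.b :=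
  hasDerivAt_integral_par (Φ := fun b z => Q z * T20 χ b z + z ^ 3 / 8 * Q z ^ 2)
    (Φ' := fun b z => Q z * T20b χ b z)
    (sy_nDens hχ RAll.initial) (by norm_num)
    (Sy.mul sy_Q (sy_T20b hχ RAll.initial) : Sy RAll 2 (-2) (-2) 1 _) (by norm_num)
    (fun j z hz => ((hasDerivAt_T20_b hχ j hz).const_mul _).add_const _) i hy

theorem hasDerivAt_g30_b (hχ : IsCutoff χ) (i : Par) {y : ℝ} (hy : 0 < y) :
    HasDerivAt (fun b => g30 χ b y) (g30b χ i.b y) i.b := by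
  have h1 := (((hasDerivAt_T20_b hχ i hy).const_mul (phi1 y)).add
    ((hasDerivAt_U2_b hχ i hy).const_mul y)).sub
    ((hasDerivAt_nInt_b hχ i hy).mul_const (halfyQ y))
  refine h1.congr_of_eventuallyEq ?_
  filter_upwards [i.eventually] with b ⟨j, hj⟩
  subst hj
  exact g30_eq hχ j hy

theorem hasDerivAt_U30_b (hχ : IsCutoff χ) (i : Par) {y : ℝ} (hy : 0 < y) :
    HasDerivAt (fun b => U30 χ b y) (U30b χ i.b y) i.b := by
  have h0 : HasDerivAt (fun b => JInt (g30 χ b) y) (JInt (g30b χ i.b) y) i.b :=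
    hasDerivAt_integral_par (Φ := fun b z => z * J z * g30 χ b z)
      (Φ' := fun b z => z * J z * g30b χ b z)
      (Sy.mul sy_zJ (sy_g30 hχ RAll.initial) : Sy RAll 4 (-3) 0 0 _) (by norm_num)
      (Sy.mul sy_zJ (sy_g30b hχ RAll.initial) : Sy RAll 4 (-3) (-2) 1 _) (by norm_num)
      (fun j z hz => (hasDerivAt_g30_b hχ j hz).const_mul _) i hy
  have h1 := (h0.const_mul (y * J y)⁻¹).neg
  refine h1.congr_of_eventuallyEq ?_
  filter_upwards [i.eventually] with b ⟨j, hj⟩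
  subst hj
  exact U30_eq hχ j hy

section

variable {χ : ℝ → ℝ} {S : Region Par}

/-! ### Parameter derivatives of the profiles -/

theorem Sy.times {E : Type*} [NormedRing E] [NormedAlgebra ℝ E] {p₁ q₁ m₁ n₁ p₂ q₂ m₂ n₂ : ℤ}
    {F G : Par → ℝ → E} (h : Sy S p₁ q₁ m₁ n₁ F) (h' : Sy S p₂ q₂ m₂ n₂ G) :
    Sy S (p₁ + p₂) (q₁ + q₂) (m₁ + m₂) (n₁ + n₂) (fun i y => F i y * G i y) :=
  Sy.mul h h'

theorem sy_I : Sy S 0 0 0 0 (fun _ _ => Complex.I) := Sy.number _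

theorem sy_bC : Sy S 0 0 2 0 (fun i _ => (i.b : ℂ)) := sy_b.ofReal

theorem sy_eta : Sy S 0 0 2 1 (fun i _ => (i.eta : ℂ)) :=
  (Sy.scalar ⟨1, fun i => by
    rw [Real.norm_eq_abs, one_mul]
    refine i.abs_eta_le.trans (le_of_eq ?_)
    simp [Par.c]⟩ : Sy S 0 0 2 1 (fun i _ => i.eta)).ofReal

/-- The complex parameter `b - iη`. -/
def Par.be (i : Par) : ℂ := i.b - Complex.I * i.eta

theorem sy_be : Sy S 0 0 2 0 (fun i _ => i.be) :=
  Sy.sub sy_bC (sy_I.times sy_eta).le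

theorem IsCutoff.syC0 (hχ : IsCutoff χ) : Sy S 0 0 0 0 (fun i y => (cut χ (B0 i.b) y : ℂ)) :=
  hχ.sy0.ofReal

theorem IsCutoff.syC1 (hχ : IsCutoff χ) : Sy S 0 0 0 0 (fun i y => (cut χ (B1 i.b) y : ℂ)) :=
  hχ.sy1.ofReal

/-- The perturbation `P - Q` without its cutoff. -/
def hh (b η y : ℝ) : ℂ := -(Complex.I * b * (qf y : ℂ)) - η * rho y

theorem sy_hh : Sy S 2 (-2) 2 0 (fun i y => hh i.b i.eta y) :=
  Sy.sub (Sy.neg ((sy_I.times sy_bC).times sy_qf.ofReal).le) (sy_eta.times sy_rho.ofReal).le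

theorem P_eq (χ : ℝ → ℝ) (b η y : ℝ) : P χ b η y = Q y + cut χ (B1 b) y * hh b η y := rfl

theorem P1_eq (χ : ℝ → ℝ) (i : Par) (y : ℝ) : P1 χ i.b i.eta y =
    cut χ (B1 i.b) y * (-(Complex.I * i.be * halfyQ y))
      + cut χ (B0 i.b) y * ((i.b : ℂ) ^ 2 * T20 χ i.b y) := by
  have : Complex.I * i.be = Complex.I * i.b + i.eta := by
    rw [Par.be, mul_sub, ← mul_assoc, Complex.I_mul_I]; ring
  rw [P1, this]

theorem P2_eq (χ : ℝ → ℝ) (i : Par) (y : ℝ) : P2 χ i.b i.eta y =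
    cut χ (B0 i.b) y * (i.be ^ 2 * U2 χ i.b y + Complex.I * (i.b : ℂ) ^ 3 * U30 χ i.b y) := by
  have : i.be ^ 2 = (i.b : ℂ) ^ 2 - 2 * Complex.I * i.b * i.eta - (i.eta : ℂ) ^ 2 := by
    rw [Par.be, sub_sq, mul_pow, Complex.I_sq]; ring
  rw [P2, this]

/-- `∂_b P`. -/
def dBP (χ : ℝ → ℝ) (i : Par) (y : ℝ) : ℂ :=
  dcut1 χ i.b y * hh i.b i.eta y + cut χ (B1 i.b) y * (-(Complex.I * qf y))

/-- `∂_b P₁`. -/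
def dBP1 (χ : ℝ → ℝ) (i : Par) (y : ℝ) : ℂ :=
  dcut1 χ i.b y * (-(Complex.I * i.be * halfyQ y)) + cut χ (B1 i.b) y * (-(Complex.I * halfyQ y))
    + dcut0 χ i.b y * ((i.b : ℂ) ^ 2 * T20 χ i.b y)
    + cut χ (B0 i.b) y * (2 * i.b * T20 χ i.b y + (i.b : ℂ) ^ 2 * T20b χ i.b y)

/-- `∂_b P₂`. -/
def dBP2 (χ : ℝ → ℝ) (i : Par) (y : ℝ) : ℂ :=
  dcut0 χ i.b y * (i.be ^ 2 * U2 χ i.b y + Complex.I * (i.b : ℂ) ^ 3 * U30 χ i.b y)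
    + cut χ (B0 i.b) y * (2 * i.be * U2 χ i.b y + i.be ^ 2 * U2b χ i.b y
      + 3 * Complex.I * (i.b : ℂ) ^ 2 * U30 χ i.b y + Complex.I * (i.b : ℂ) ^ 3 * U30b χ i.b y)

theorem dB_P (hχ : IsCutoff χ) (i : Par) (y : ℝ) : dB (P χ) i.b i.eta y = dBP χ i y := by
  have hb : HasDerivAt (fun b : ℝ => (b : ℂ)) 1 i.b := (hasDerivAt_id i.b).ofReal_comp
  have h1 := (hasDerivAt_cut1 hχ i y).ofReal_comp
  have h2 := (h1.mul ((((hb.const_mul Complex.I).mul_const (qf y : ℂ)).neg).sub_const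
    ((i.eta : ℂ) * rho y))).const_add (Q y : ℂ)
  refine (h2.congr_deriv ?_).deriv
  simp only [dBP, hh, Pi.neg_apply]
  ring

theorem dEta_P (χ : ℝ → ℝ) (b η y : ℝ) : dEta (P χ) b η y = -(cut χ (B1 b) y * rho y : ℝ) := by
  have hb : HasDerivAt (fun b : ℝ => (b : ℂ)) 1 η := (hasDerivAt_id η).ofReal_comp
  have h2 := (((hb.mul_const (rho y : ℂ)).const_sub (-(Complex.I * b * (qf y : ℂ)))).const_mul
    (cut χ (B1 b) y : ℂ)).const_add (Q y : ℂ)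
  refine (h2.congr_deriv ?_).deriv
  push_cast
  ring

theorem dB_P1 (hχ : IsCutoff χ) (i : Par) {y : ℝ} (hy : 0 < y) :
    dB (P1 χ) i.b i.eta y = dBP1 χ i y := by
  have hb : HasDerivAt (fun b : ℝ => (b : ℂ)) 1 i.b := (hasDerivAt_id i.b).ofReal_comp
  have h1 := (hasDerivAt_cut1 hχ i y).ofReal_comp
  have h0 := (hasDerivAt_cut0 hχ i y).ofReal_comp
  have hT := (hasDerivAt_T20_b hχ i hy).ofReal_comp
  have h2 := (h1.mul ((((hb.const_mul Complex.I).add_const (i.eta : ℂ)).mul_const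
    (halfyQ y : ℂ)).neg)).add (h0.mul ((hb.pow 2).mul hT))
  refine (h2.congr_deriv ?_).deriv
  have : Complex.I * i.be = Complex.I * i.b + i.eta := by
    rw [Par.be, mul_sub, ← mul_assoc, Complex.I_mul_I]; ring
  simp only [dBP1, this, Pi.mul_apply, Pi.pow_apply, Pi.neg_apply]
  push_cast
  ring

theorem dEta_P1 (χ : ℝ → ℝ) (b η y : ℝ) :
    dEta (P1 χ) b η y = -(cut χ (B1 b) y * halfyQ y : ℝ) := by
  have hb : HasDerivAt (fun b : ℝ => (b : ℂ)) 1 η := (hasDerivAt_id η).ofReal_comp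
  have h2 := (((hb.const_add (Complex.I * b)).mul_const (halfyQ y : ℂ)).neg.const_mul
    (cut χ (B1 b) y : ℂ)).add_const (cut χ (B0 b) y * ((b : ℂ) ^ 2 * T20 χ b y))
  refine (h2.congr_deriv ?_).deriv
  push_cast
  ring

theorem dB_P2 (hχ : IsCutoff χ) (i : Par) {y : ℝ} (hy : 0 < y) :
    dB (P2 χ) i.b i.eta y = dBP2 χ i y := by
  have hb : HasDerivAt (fun b : ℝ => (b : ℂ)) 1 i.b := (hasDerivAt_id i.b).ofReal_comp
  have h0 := (hasDerivAt_cut0 hχ i y).ofReal_comp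
  have hU := (hasDerivAt_U2_b hχ i hy).ofReal_comp
  have hU3 := (hasDerivAt_U30_b hχ i hy).ofReal_comp
  have h2 := h0.mul (((((hb.pow 2).sub (((hb.const_mul (2 * Complex.I))).mul_const
    (i.eta : ℂ))).sub_const ((i.eta : ℂ) ^ 2)).mul hU).add
      (((hb.pow 3).const_mul Complex.I).mul hU3))
  refine (h2.congr_deriv ?_).deriv
  have e2 : i.be ^ 2 = (i.b : ℂ) ^ 2 - 2 * Complex.I * i.b * i.eta - (i.eta : ℂ) ^ 2 := by
    rw [Par.be, sub_sq, mul_pow, Complex.I_sq]; ring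
  simp only [dBP2, e2, Pi.mul_apply, Pi.pow_apply, Pi.add_apply, Pi.sub_apply]
  rw [Par.be]
  push_cast
  ring

theorem dEta_P2 (χ : ℝ → ℝ) (i : Par) (y : ℝ) : dEta (P2 χ) i.b i.eta y =
    cut χ (B0 i.b) y * (-(2 * Complex.I * i.be) * U2 χ i.b y) := by
  have hb : HasDerivAt (fun b : ℝ => (b : ℂ)) 1 i.eta := (hasDerivAt_id i.eta).ofReal_comp
  have h2 := (((((hb.const_mul (2 * Complex.I * i.b)).const_sub ((i.b : ℂ) ^ 2)).sub
    (hb.pow 2)).mul_const (U2 χ i.b y : ℂ)).add_const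
      (Complex.I * (i.b : ℂ) ^ 3 * U30 χ i.b y)).const_mul (cut χ (B0 i.b) y : ℂ)
  refine (h2.congr_deriv ?_).deriv
  have : Complex.I * i.be = Complex.I * i.b + i.eta := by
    rw [Par.be, mul_sub, ← mul_assoc, Complex.I_mul_I]; ring
  simp only [show (2 : ℕ) - 1 = 1 from rfl, pow_one, Nat.cast_ofNat]
  linear_combination (2 * (cut χ (B0 i.b) y : ℂ) * U2 χ i.b y) * this

theorem differentiableAt_ofReal_fst {f : ℝ → ℝ} {b η : ℝ} (h : DifferentiableAt ℝ f b) :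
    DifferentiableAt ℝ (fun p : ℝ × ℝ => (f p.1 : ℂ)) (b, η) :=
  Complex.ofRealCLM.differentiableAt.comp (b, η)
    (DifferentiableAt.comp (b, η) (g := f) h differentiableAt_fst)

theorem differentiableAt_ofReal_snd {b η : ℝ} :
    DifferentiableAt ℝ (fun p : ℝ × ℝ => (p.2 : ℂ)) (b, η) :=
  Complex.ofRealCLM.differentiableAt.comp (b, η) differentiableAt_snd

theorem differentiableAt_P (hχ : IsCutoff χ) (i : Par) (y : ℝ) :
    DifferentiableAt ℝ (fun p : ℝ × ℝ => P χ p.1 p.2 y) (i.b, i.eta) := by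
  have h1 := differentiableAt_ofReal_fst (η := i.eta) (hasDerivAt_cut1 hχ i y).differentiableAt
  have hb := differentiableAt_ofReal_fst (η := i.eta) (differentiableAt_id (𝕜 := ℝ) (x := i.b))
  have he := differentiableAt_ofReal_snd (b := i.b) (η := i.eta)
  exact (h1.mul (((hb.const_mul Complex.I).mul_const _).neg.sub (he.mul_const _))).const_add _

theorem differentiableAt_P1 (hχ : IsCutoff χ) (i : Par) {y : ℝ} (hy : 0 < y) :
    DifferentiableAt ℝ (fun p : ℝ × ℝ => P1 χ p.1 p.2 y) (i.b, i.eta) := by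
  have h1 := differentiableAt_ofReal_fst (η := i.eta) (hasDerivAt_cut1 hχ i y).differentiableAt
  have h0 := differentiableAt_ofReal_fst (η := i.eta) (hasDerivAt_cut0 hχ i y).differentiableAt
  have hT := differentiableAt_ofReal_fst (η := i.eta) (hasDerivAt_T20_b hχ i hy).differentiableAt
  have hb := differentiableAt_ofReal_fst (η := i.eta) (differentiableAt_id (𝕜 := ℝ) (x := i.b))
  have he := differentiableAt_ofReal_snd (b := i.b) (η := i.eta)
  exact (h1.mul (((hb.const_mul Complex.I).add he).mul_const _).neg).add
    (h0.mul ((hb.pow 2).mul hT))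

theorem differentiableAt_P2 (hχ : IsCutoff χ) (i : Par) {y : ℝ} (hy : 0 < y) :
    DifferentiableAt ℝ (fun p : ℝ × ℝ => P2 χ p.1 p.2 y) (i.b, i.eta) := by
  have h0 := differentiableAt_ofReal_fst (η := i.eta) (hasDerivAt_cut0 hχ i y).differentiableAt
  have hU := differentiableAt_ofReal_fst (η := i.eta) (hasDerivAt_U2_b hχ i hy).differentiableAt
  have hU3 := differentiableAt_ofReal_fst (η := i.eta) (hasDerivAt_U30_b hχ i hy).differentiableAt
  have hb := differentiableAt_ofReal_fst (η := i.eta) (differentiableAt_id (𝕜 := ℝ) (x := i.b))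
  have he := differentiableAt_ofReal_snd (b := i.b) (η := i.eta)
  exact h0.mul (((((hb.pow 2).sub ((hb.const_mul _).mul he)).sub (he.pow 2)).mul hU).add
    (((hb.pow 3).const_mul _).mul hU3))

/-- The chain rule along a curve of parameters. -/
theorem deriv_along_curve {F : ℝ → ℝ → ℝ → ℂ} {b η y s : ℝ} {bc ec : ℝ → ℝ}
    (hF : DifferentiableAt ℝ (fun p : ℝ × ℝ => F p.1 p.2 y) (b, η))
    (hbc : DifferentiableAt ℝ bc s) (hec : DifferentiableAt ℝ ec s) (hb : bc s = b)
    (he : ec s = η) :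
    deriv (fun s' => F (bc s') (ec s') y) s
      = ((deriv bc s : ℝ) : ℂ) * dB F b η y + ((deriv ec s : ℝ) : ℂ) * dEta F b η y := by
  obtain ⟨D, hD⟩ := hF
  have e1 : dB F b η y = D (1, 0) :=
    (HasFDerivAt.comp_hasDerivAt (f := fun x : ℝ => (x, η)) b hD
      ((hasDerivAt_id b).prodMk (hasDerivAt_const b η))).deriv
  have e2 : dEta F b η y = D (0, 1) :=
    (HasFDerivAt.comp_hasDerivAt (f := fun x : ℝ => (b, x)) η hD
      ((hasDerivAt_const η b).prodMk (hasDerivAt_id η))).deriv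
  have e3 : deriv (fun s' => F (bc s') (ec s') y) s = D (deriv bc s, deriv ec s) := by
    subst hb he
    exact (HasFDerivAt.comp_hasDerivAt (f := fun x : ℝ => (bc x, ec x)) s hD
      (hbc.hasDerivAt.prodMk hec.hasDerivAt)).deriv
  have e4 : ((deriv bc s, deriv ec s) : ℝ × ℝ) = deriv bc s • (1, 0) + deriv ec s • (0, 1) := by
    simp
  rw [e1, e2, e3, e4, map_add, map_smul, map_smul]
  simp

theorem sy_P (hχ : IsCutoff χ) : Sy S 0 0 0 0 (fun i => P χ i.b i.eta) :=
  Sy.add (sy_Q.ofReal.le) (hχ.syC1.times sy_hh).le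

theorem sy_P1_all (hχ : IsCutoff χ) (hS : S.Initial) :
    Sy S 1 0 2 0 (fun i => P1 χ i.b i.eta) := by
  have h : Sy S 1 0 2 0 (fun i y => cut χ (B1 i.b) y * (-(Complex.I * i.be * halfyQ y))
      + cut χ (B0 i.b) y * ((i.b : ℂ) ^ 2 * T20 χ i.b y)) := by
    simp only [sq]
    exact Sy.add (hχ.syC1.times (Sy.neg ((sy_I.times sy_be).times sy_f.ofReal))).le
      (hχ.syC0.times ((sy_bC.times sy_bC).times (sy_T20 hχ hS).ofReal)).le
  exact h.congr fun i y _ => (P1_eq χ i y).symm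

theorem sy_P2_all (hχ : IsCutoff χ) (hS : S.Initial) :
    Sy S 1 1 4 0 (fun i => P2 χ i.b i.eta) := by
  have h : Sy S 1 1 4 0 (fun i y => cut χ (B0 i.b) y *
      (i.be ^ 2 * U2 χ i.b y + Complex.I * (i.b : ℂ) ^ 3 * U30 χ i.b y)) := by
    have h1 : Sy S 1 1 4 0 (fun i y => i.be ^ 2 * (U2 χ i.b y : ℂ)) := by
      simp only [sq]
      exact ((sy_be.times sy_be).times (sy_U2 hχ hS).ofReal).le
    have h2 : Sy S 1 1 4 0 (fun i y => Complex.I * (i.b : ℂ) ^ 3 * (U30 χ i.b y : ℂ)) := by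
      simp only [pow_succ, pow_zero, one_mul]
      exact ((sy_I.times ((sy_bC.times sy_bC).times sy_bC)).times (sy_U30 hχ hS).ofReal).le
    exact (hχ.syC0.times (h1.add h2)).le
  exact h.congr fun i y _ => (P2_eq χ i y).symm

theorem sy_dBP (hχ : IsCutoff χ) : Sy S 2 (-2) 0 0 (fun i => dBP χ i) :=
  Sy.add ((sy_dcut1 hχ).ofReal.times sy_hh).le
    (hχ.syC1.times (Sy.neg (sy_I.times sy_qf.ofReal))).le

theorem sy_dBP1_all (hχ : IsCutoff χ) (hS : S.Initial) : Sy S 1 0 0 0 (fun i => dBP1 χ i) := by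
  unfold dBP1
  simp only [sq]
  have hT := (sy_T20 hχ hS).ofReal
  refine Sy.add (Sy.add (Sy.add ?_ ?_) ?_) ?_
  · exact ((sy_dcut1 hχ).ofReal.times (Sy.neg ((sy_I.times sy_be).times sy_f.ofReal))).le
  · exact (hχ.syC1.times (Sy.neg (sy_I.times sy_f.ofReal))).le
  · exact ((sy_dcut0 hχ).ofReal.times ((sy_bC.times sy_bC).times hT)).le
  · refine (hχ.syC0.times (Sy.add (p := 1) (q := 0) (m := 2) (n := 0) ?_ ?_)).le
    · exact (((Sy.number 2).times sy_bC).times hT).le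
    · exact ((sy_bC.times sy_bC).times (sy_T20b hχ hS).ofReal).le

theorem sy_dBP2_all (hχ : IsCutoff χ) (hS : S.Initial) : Sy S 1 1 2 0 (fun i => dBP2 χ i) := by
  unfold dBP2
  simp only [pow_succ, pow_zero, one_mul]
  have hU := (sy_U2 hχ hS).ofReal
  have hU3 := (sy_U30 hχ hS).ofReal
  have hb3 : Sy S 0 0 6 0 (fun i _ => (i.b * i.b * i.b : ℂ)) :=
    ((sy_bC.times sy_bC).times sy_bC).le
  refine Sy.add ?_ ?_
  · refine ((sy_dcut0 hχ).ofReal.times (Sy.add (p := 1) (q := 1) (m := 4) (n := 0) ?_ ?_)).le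
    · exact ((sy_be.times sy_be).times hU).le
    · exact ((sy_I.times hb3).times hU3).le
  · refine (hχ.syC0.times (Sy.add (p := 1) (q := 1) (m := 2) (n := 0)
      (Sy.add (Sy.add ?_ ?_) ?_) ?_)).le
    · exact (((Sy.number 2).times sy_be).times hU).le
    · exact ((sy_be.times sy_be).times (sy_U2b hχ hS).ofReal).le
    · exact ((((Sy.number 3).times sy_I).times (sy_bC.times sy_bC)).times hU3).le
    · exact ((sy_I.times hb3).times (sy_U30b hχ hS).ofReal).le

theorem smoothProfile_P (hχ : IsCutoff χ) (i : Par) : SmoothProfile (P χ) i.b i.eta := by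
  refine ⟨Sym.contDiffOn (S := RAll) (sy_P hχ) i, fun y _ => differentiableAt_P hχ i y, ?_, ?_⟩
  · exact (Sym.contDiffOn (S := RAll) (sy_dBP hχ) i).congr fun y _ => dB_P hχ i y
  · exact (Sym.contDiffOn (S := RAll) (Sy.neg (hχ.sy1.times sy_rho).ofReal) i).congr
      fun y _ => dEta_P χ i.b i.eta y

theorem smoothProfile_P1 (hχ : IsCutoff χ) (i : Par) : SmoothProfile (P1 χ) i.b i.eta := by
  refine ⟨Sym.contDiffOn (sy_P1_all hχ RAll.initial) i,
    fun y hy => differentiableAt_P1 hχ i hy, ?_, ?_⟩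
  · exact (Sym.contDiffOn (sy_dBP1_all hχ RAll.initial) i).congr fun y hy => dB_P1 hχ i hy
  · exact (Sym.contDiffOn (S := RAll) (Sy.neg (hχ.sy1.times sy_f).ofReal) i).congr
      fun y _ => dEta_P1 χ i.b i.eta y

theorem smoothProfile_P2 (hχ : IsCutoff χ) (i : Par) : SmoothProfile (P2 χ) i.b i.eta := by
  refine ⟨Sym.contDiffOn (sy_P2_all hχ RAll.initial) i,
    fun y hy => differentiableAt_P2 hχ i hy, ?_, ?_⟩
  · exact (Sym.contDiffOn (sy_dBP2_all hχ RAll.initial) i).congr fun y hy => dB_P2 hχ i hy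
  · exact (Sym.contDiffOn (S := RAll) (hχ.syC0.times
      (((Sy.neg (((Sy.number 2).times sy_I).times sy_be)).times
        (sy_U2 hχ RAll.initial).ofReal))) i).congr fun y _ => dEta_P2 χ i y

end

section

variable {χ : ℝ → ℝ} {S : Region Par} {p q m n : ℤ} {F : Par → ℝ → ℂ}

/-! ### The gauge potential of the profile -/

theorem sy_bR : Sy S 0 0 2 0 (fun i _ => i.b) := sy_b

theorem sy_etaR : Sy S 0 0 2 1 (fun i _ => i.eta) :=
  Sy.scalar ⟨1, fun i => by
    rw [Real.norm_eq_abs, one_mul]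
    refine i.abs_eta_le.trans (le_of_eq ?_)
    simp [Par.c]⟩

/-- The real part of `P`. -/
def reP (χ : ℝ → ℝ) (i : Par) (y : ℝ) : ℝ := Q y - i.eta * (cut χ (B1 i.b) y * rho y)

/-- The imaginary part of `P`. -/
def imP (χ : ℝ → ℝ) (i : Par) (y : ℝ) : ℝ := -(i.b * (cut χ (B1 i.b) y * qf y))

theorem P_re_im (χ : ℝ → ℝ) (i : Par) (y : ℝ) :
    P χ i.b i.eta y = (reP χ i y : ℂ) + (imP χ i y : ℂ) * Complex.I := by
  rw [P_eq, hh, reP, imP]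
  push_cast
  ring

/-- The part of `(|P|² - Q²) y / 2` that is linear in `P - Q`. -/
def aDens1 (χ : ℝ → ℝ) (i : Par) (y : ℝ) : ℝ :=
  -(i.eta * (cut χ (B1 i.b) y * (Q y * rho y * y)))

/-- The part of `(|P|² - Q²) y / 2` that is quadratic in `P - Q`. -/
def aDens2 (χ : ℝ → ℝ) (i : Par) (y : ℝ) : ℝ :=
  1 / 2 * (cut χ (B1 i.b) y * cut χ (B1 i.b) y *
    ((i.eta * i.eta * (rho y * rho y) + i.b * i.b * (qf y * qf y)) * y))

/-- The primitive of `aDens1`. -/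
def aInt1 (χ : ℝ → ℝ) (i : Par) (y : ℝ) : ℝ := ∫ z in (0 : ℝ)..y, aDens1 χ i z

/-- The primitive of `aDens2`. -/
def aInt2 (χ : ℝ → ℝ) (i : Par) (y : ℝ) : ℝ := ∫ z in (0 : ℝ)..y, aDens2 χ i z

/-- The difference `A_θ[Q] - A_θ[P]`. -/
def aInt (χ : ℝ → ℝ) (i : Par) (y : ℝ) : ℝ := aInt1 χ i y + aInt2 χ i y

theorem sy_aDens1 (hχ : IsCutoff χ) : Sy S 3 (-4) 2 1 (aDens1 χ) :=
  Sy.neg (sy_etaR.times (hχ.sy1.times ((sy_Q.times sy_rho).times Sy.id))).le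

theorem sy_aDens2 (hχ : IsCutoff χ) : Sy S 5 (-4) 4 0 (aDens2 χ) := by
  have h1 : Sy S 4 (-4) 4 0 (fun i y => i.eta * i.eta * (rho y * rho y)) :=
    ((sy_etaR.times sy_etaR).times (sy_rho.times sy_rho)).le
  have h2 : Sy S 4 (-4) 4 0 (fun i y => i.b * i.b * (qf y * qf y)) :=
    ((sy_bR.times sy_bR).times (sy_qf.times sy_qf)).le
  exact ((Sy.number (1 / 2)).times ((hχ.sy1.times hχ.sy1).times ((h1.add h2).times Sy.id))).le

theorem sy_aInt1 (hχ : IsCutoff χ) (hS : S.Initial) : Sy S 4 (-3) 2 1 (aInt1 χ) :=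
  ((sy_aDens1 hχ).le : Sy S 3 (-3) 2 1 (aDens1 χ)).primitive hS

theorem sy_aInt2 (hχ : IsCutoff χ) (hS : S.Initial) : Sy S 6 (-4) 4 0 (aInt2 χ) :=
  (sy_aDens2 hχ).primitive hS

theorem hasDerivAt_aInt1 (hχ : IsCutoff χ) (i : Par) {y : ℝ} (hy : 0 < y) :
    HasDerivAt (aInt1 χ i) (aDens1 χ i y) y :=
  Sym.hasDerivAt_integral RAll.initial (sy_aDens1 hχ)
    ((sy_aDens1 hχ).bd.local RAll.initial (by norm_num)) (i := i) hy

theorem hasDerivAt_aInt2 (hχ : IsCutoff χ) (i : Par) {y : ℝ} (hy : 0 < y) :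
    HasDerivAt (aInt2 χ i) (aDens2 χ i y) y :=
  Sym.hasDerivAt_integral RAll.initial (sy_aDens2 hχ)
    ((sy_aDens2 hχ).bd.local RAll.initial (by norm_num)) (i := i) hy

theorem Sy.intervalIntegrable {F : Par → ℝ → ℝ} (h : Sy RAll p q m n F) (hp : 0 ≤ p) (i : Par)
    {y : ℝ} (hy : 0 < y) : IntervalIntegrable (F i) MeasureTheory.volume 0 y := by
  obtain ⟨C, hC⟩ := h.bd.local RAll.initial hp i y hy
  exact intervalIntegrable_of_bdd hy ((Sym.continuousOn h i).mono fun z hz => hz.1) hC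

theorem Atheta_Qc_eq {y : ℝ} (hy : 0 < y) : Atheta Qc y = phi1 y - 1 := by
  rw [Atheta_Qc hy, phi1]
  field_simp
  ring

/-- The gauge potential is that of `Q`, corrected by the primitive of `(|P|² - Q²) / 2`. -/
theorem Atheta_P (hχ : IsCutoff χ) (i : Par) {y : ℝ} (hy : 0 < y) :
    Atheta (P χ i.b i.eta) y = phi1 y - 1 - aInt χ i y := by
  have e : (fun r => ‖P χ i.b i.eta r‖ ^ 2 * r) = fun r =>
      ‖Qc r‖ ^ 2 * r + 2 * (aDens1 χ i r + aDens2 χ i r) := by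
    funext r
    rw [P_re_im, ← Complex.normSq_eq_norm_sq, Complex.normSq_add_mul_I]
    simp only [Qc, Complex.norm_real, Real.norm_eq_abs, sq_abs, reP, imP, aDens1, aDens2]
    ring
  have hc : Continuous fun z => ‖Qc z‖ ^ 2 * z := by
    unfold Qc
    exact ((Complex.continuous_ofReal.comp continuous_Q).norm.pow 2).mul continuous_id
  have h1 := (sy_aDens1 hχ).intervalIntegrable (by norm_num) i hy
  have h2 := (sy_aDens2 hχ).intervalIntegrable (by norm_num) i hy
  rw [← Atheta_Qc_eq hy, Atheta, e, intervalIntegral.integral_add (hc.intervalIntegrable _ _)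
    ((h1.add h2).const_mul 2), intervalIntegral.integral_const_mul,
    intervalIntegral.integral_add h1 h2, Atheta, aInt, aInt1, aInt2]
  ring

theorem sy_aInt1' (hχ : IsCutoff χ) (hS : ∀ i, S i ⊆ RA1 i) : Sy S 4 (-3) 2 1 (aInt1 χ) :=
  (sy_aInt1 hχ RA1.initial).restrict hS

theorem sy_aInt2' (hχ : IsCutoff χ) (hS : ∀ i, S i ⊆ RA1 i) : Sy S 6 (-4) 4 0 (aInt2 χ) :=
  (sy_aInt2 hχ RA1.initial).restrict hS

theorem Region.leB1_of_sub (hS : ∀ i, S i ⊆ RA1 i) : S.LeB1 := fun i y hy => RA1.leB1 i y (hS i hy)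

theorem sy_aInt (hχ : IsCutoff χ) (hS : ∀ i, S i ⊆ RA1 i) : Sy S 0 0 0 0 (aInt χ) :=
  Sy.add ((sy_aInt1' hχ hS).leB1 (Region.leB1_of_sub hS) 1)
    ((sy_aInt2' hχ hS).leB1 (Region.leB1_of_sub hS) 2)

theorem sy_Atheta (hχ : IsCutoff χ) (hS : ∀ i, S i ⊆ RA1 i) :
    Sy S 0 0 0 0 (fun i => Atheta (P χ i.b i.eta)) :=
  (Sy.sub (Sy.sub sy_phi1 (Sy.number 1)) (sy_aInt hχ hS)).congr
    fun i y hy => (Atheta_P hχ i (S.pos i y hy)).symm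

/-! ### The covariant operators -/

theorem CR_eq_euler {k : ℝ} {v w : ℝ → ℂ} {y : ℝ} (hy : y ≠ 0) :
    CR k v w y = ((y⁻¹ : ℝ) : ℂ) * (euler w y - ((k + Atheta v y : ℝ) : ℂ) * w y) := by
  have : (y : ℂ) ≠ 0 := by exact_mod_cast hy
  rw [CR, euler, Complex.real_smul, Complex.real_smul]
  push_cast
  field_simp

theorem CRadj_eq_euler {k : ℝ} {v w : ℝ → ℂ} {y : ℝ} (hy : y ≠ 0) :
    CRadj k v w y = -(((y⁻¹ : ℝ) : ℂ) * (euler w y + ((k + 1 + Atheta v y : ℝ) : ℂ) * w y)) := by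
  have : (y : ℂ) ≠ 0 := by exact_mod_cast hy
  rw [CRadj, euler, Complex.real_smul, Complex.real_smul]
  push_cast
  field_simp
  ring

theorem Sy.CR (hχ : IsCutoff χ) (hS : ∀ i, S i ⊆ RA1 i) (h : Sy S p q m n F) (k : ℝ) :
    Sy S (p - 1) q m n (fun i => CR k (P χ i.b i.eta) (F i)) := by
  have hA : Sy S 0 0 0 0 (fun i y => ((k + Atheta (P χ i.b i.eta) y : ℝ) : ℂ)) :=
    (Sy.add (Sy.number k) (sy_Atheta hχ hS)).ofReal
  have h1 : Sy S p q m n (fun i y => CSS.euler (F i) y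
      - ((k + Atheta (P χ i.b i.eta) y : ℝ) : ℂ) * F i y) := h.euler.sub (Sy.mul hA h)
  have h2 : Sy S (p - 1) q m n (fun i y => ((y⁻¹ : ℝ) : ℂ) * (CSS.euler (F i) y
      - ((k + Atheta (P χ i.b i.eta) y : ℝ) : ℂ) * F i y)) := Sy.mul sy_inv.ofReal h1
  exact h2.congr fun i y hy => (CR_eq_euler (S.pos i y hy).ne').symm

theorem Sy.CRadj (hχ : IsCutoff χ) (hS : ∀ i, S i ⊆ RA1 i) (h : Sy S p q m n F) (k : ℝ) :
    Sy S (p - 1) q m n (fun i => CRadj k (P χ i.b i.eta) (F i)) := by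
  have hA : Sy S 0 0 0 0 (fun i y => ((k + 1 + Atheta (P χ i.b i.eta) y : ℝ) : ℂ)) :=
    (Sy.add (Sy.number (k + 1)) (sy_Atheta hχ hS)).ofReal
  have h1 : Sy S p q m n (fun i y => CSS.euler (F i) y
      + ((k + 1 + Atheta (P χ i.b i.eta) y : ℝ) : ℂ) * F i y) := h.euler.add (Sy.mul hA h)
  have h2 : Sy S (p - 1) q m n (fun i y => ((y⁻¹ : ℝ) : ℂ) * (CSS.euler (F i) y
      + ((k + 1 + Atheta (P χ i.b i.eta) y : ℝ) : ℂ) * F i y)) := Sy.mul sy_inv.ofReal h1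
  exact h2.neg.congr fun i y hy => (CRadj_eq_euler (S.pos i y hy).ne').symm

theorem Sy.lam (h : Sy S p q m n F) (s : ℝ) : Sy S p q m n (fun i => Lam s (F i)) := by
  have h1 : Sy S p q m n (fun i y => ((1 - s : ℝ) : ℂ) * F i y) := h.constMul _
  exact (h1.add h.euler).congr fun i y _ => by
    rw [Lam, CSS.euler, Complex.real_smul, Complex.real_smul]

/-! ### The nonlocal coefficient -/

/-- The part of `Re(P̄ P₁)` that is linear in the parameters. -/
def nDens1 (χ : ℝ → ℝ) (i : Par) (y : ℝ) : ℝ :=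
  -(i.eta * (cut χ (B1 i.b) y * (Q y * halfyQ y)))

/-- The part of `Re(P̄ P₁)` that contains `b² Q T_{2,0}`. -/
def nDensT (χ : ℝ → ℝ) (i : Par) (y : ℝ) : ℝ :=
  cut χ (B0 i.b) y * (i.b * i.b * (Q y * T20 χ i.b y))

/-- The part of `Re(P̄ P₁)` that is quadratic in the parameters and local. -/
def nDensQ (χ : ℝ → ℝ) (i : Par) (y : ℝ) : ℝ :=
  cut χ (B1 i.b) y * cut χ (B1 i.b) y *
    (i.b * i.b * (qf y * halfyQ y) + i.eta * i.eta * (rho y * halfyQ y))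

/-- The cubic part of `Re(P̄ P₁)`. -/
def nDensC (χ : ℝ → ℝ) (i : Par) (y : ℝ) : ℝ :=
  -(cut χ (B1 i.b) y * cut χ (B0 i.b) y * (i.eta * (i.b * i.b) * (rho y * T20 χ i.b y)))

/-- The part of `Re(P̄ P₁)` of higher order. -/
def nDens2 (χ : ℝ → ℝ) (i : Par) (y : ℝ) : ℝ := nDensT χ i y + nDensQ χ i y + nDensC χ i y

/-- The density of the nonlocal coefficient, split into its part of order `b / |log b|` and the
rest. -/
theorem re_star_P_mul_P1 (χ : ℝ → ℝ) (i : Par) (y : ℝ) :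
    (star (P χ i.b i.eta y) * P1 χ i.b i.eta y).re = nDens1 χ i y + nDens2 χ i y := by
  have e : P1 χ i.b i.eta y = ((-(i.eta * (cut χ (B1 i.b) y * halfyQ y))
      + cut χ (B0 i.b) y * (i.b ^ 2 * T20 χ i.b y) : ℝ) : ℂ)
      + ((-(i.b * (cut χ (B1 i.b) y * halfyQ y)) : ℝ) : ℂ) * Complex.I := by
    rw [P1]
    push_cast
    ring
  rw [P_re_im, e]
  simp only [Complex.star_def, map_add, map_mul, Complex.conj_ofReal, Complex.conj_I,
    Complex.mul_re, Complex.add_re, Complex.add_im, Complex.ofReal_re, Complex.ofReal_im,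
    Complex.mul_im, Complex.neg_re, Complex.neg_im, Complex.I_re, Complex.I_im, nDens1, nDens2,
    nDensT, nDensQ, nDensC, reP, imP]
  ring

theorem sy_nDens1 (hχ : IsCutoff χ) : Sy S 1 (-4) 2 1 (nDens1 χ) :=
  Sy.neg (sy_etaR.times (hχ.sy1.times (sy_Q.times sy_f))).le

theorem sy_nDensT (hχ : IsCutoff χ) (hS : S.Initial) : Sy S 2 (-3) 4 0 (nDensT χ) :=
  (hχ.sy0.times ((sy_bR.times sy_bR).times (sy_Q.times (sy_T20 hχ hS)))).le

theorem sy_nDensQ (hχ : IsCutoff χ) : Sy S 3 (-4) 4 0 (nDensQ χ) := by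
  have h1 : Sy S 3 (-4) 4 0 (fun i y => i.b * i.b * (qf y * halfyQ y)) :=
    ((sy_bR.times sy_bR).times (sy_qf.times sy_f)).le
  have h2 : Sy S 3 (-4) 4 0 (fun i y => i.eta * i.eta * (rho y * halfyQ y)) :=
    ((sy_etaR.times sy_etaR).times (sy_rho.times sy_f)).le
  exact ((hχ.sy1.times hχ.sy1).times (h1.add h2)).le

theorem sy_nDensC (hχ : IsCutoff χ) (hS : S.Initial) : Sy S 4 (-3) 6 1 (nDensC χ) :=
  Sy.neg ((hχ.sy1.times hχ.sy0).times ((sy_etaR.times (sy_bR.times sy_bR)).times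
    (sy_rho.times (sy_T20 hχ hS)))).le

theorem sy_nDens2_all (hχ : IsCutoff χ) (hS : S.Initial) : Sy S 2 (-1) 4 0 (nDens2 χ) :=
  Sy.add (Sy.add (sy_nDensT hχ hS).le (sy_nDensQ hχ).le) (sy_nDensC hχ hS).le

theorem sy_nDens2 (hχ : IsCutoff χ) (hS : ∀ i, S i ⊆ RA1 i) : Sy S 2 (-2) 4 0 (nDens2 χ) := by
  have h : Sy RA1 2 (-2) 4 0 (nDens2 χ) :=
    Sy.add (Sy.add (sy_nDensT hχ RA1.initial).le (sy_nDensQ hχ).le)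
      ((sy_nDensC hχ RA1.initial).leB1 RA1.leB1 1)
  exact h.restrict hS

/-- The primitive of `nDens1`. -/
def nonloc1 (χ : ℝ → ℝ) (i : Par) (y : ℝ) : ℝ := ∫ z in (0 : ℝ)..y, nDens1 χ i z

/-- The primitive of `nDens2`. -/
def nonloc2 (χ : ℝ → ℝ) (i : Par) (y : ℝ) : ℝ := ∫ z in (0 : ℝ)..y, nDens2 χ i z

theorem nonloc_eq (hχ : IsCutoff χ) (i : Par) {y : ℝ} (hy : 0 < y) :
    nonloc χ i.b i.eta y = nonloc1 χ i y + nonloc2 χ i y := by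
  simp only [nonloc, re_star_P_mul_P1]
  exact intervalIntegral.integral_add ((sy_nDens1 hχ).intervalIntegrable (by norm_num) i hy)
    ((sy_nDens2_all hχ RAll.initial).intervalIntegrable (by norm_num) i hy)

theorem sy_nonloc1 (hχ : IsCutoff χ) (hS : S.Initial) : Sy S 2 (-2) 2 1 (nonloc1 χ) :=
  (sy_nDens1 hχ).primitive_decay hS

theorem sy_nonloc2 (hχ : IsCutoff χ) (hS : ∀ i, S i ⊆ RA1 i) : Sy S 3 (-2) 4 0 (nonloc2 χ) :=
  ((sy_nDens2 hχ fun _ => subset_rfl).primitive RA1.initial : Sy RA1 3 (-2) 4 0 _).restrict hS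

theorem sy_nonloc (hχ : IsCutoff χ) (hS : ∀ i, S i ⊆ RA1 i) :
    Sy S 0 0 2 0 (fun i => nonloc χ i.b i.eta) := by
  have h1 : Sy S 0 0 2 0 (nonloc1 χ) :=
    ((sy_nonloc1 hχ RA1.initial).le : Sy RA1 0 0 2 0 _).restrict hS
  have h2 : Sy S 0 0 2 0 (nonloc2 χ) := (sy_nonloc2 hχ hS).leB1 (Region.leB1_of_sub hS) 1
  exact (Sy.add h1 h2).congr fun i y hy => (nonloc_eq hχ i (S.pos i y hy)).symm

/-! ### Symbol classes of the profiles on the regions -/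

/-- The region lies beyond the support of `χ_{B₀}`. -/
def Region.Out (S : Region Par) : Prop := ∀ i, ∀ y ∈ S i, 2 < y * i.t

theorem R2.out : R2.Out := fun i _ hy => (div_lt_iff₀ i.t_pos).1 hy.1

theorem R3.out : R3.Out := fun i y hy => by
  have h := (div_lt_iff₀ i.t_pos).1 hy.1
  linarith [i.L_gt]

theorem R4.out : R4.Out := fun i y hy => by
  have h := (div_lt_iff₀ i.t_pos).1 (show 2 * i.L / i.t < y from hy)
  linarith [i.L_gt]

theorem Region.Out.geB0 (hS : S.Out) : S.GeB0 := fun i y hy => by linarith [hS i y hy]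

theorem Region.Out.cut0 (hχ : IsCutoff χ) (hS : S.Out) {i : Par} {y : ℝ} (hy : y ∈ S i) :
    cut χ (B0 i.b) y = 0 := by
  rw [cut_B0]; exact hχ.eq_zero _ (hS i y hy).le

theorem Region.Out.dcut0 (hχ : IsCutoff χ) (hS : S.Out) {i : Par} {y : ℝ} (hy : y ∈ S i) :
    dcut0 χ i.b y = 0 := by
  rw [CSS.dcut0, cut_B0, hχ.euler_support _ (hS i y hy), mul_zero]

theorem cut1_eq_one (hχ : IsCutoff χ) {i : Par} {y : ℝ} (hy : y * i.t ≤ i.L) :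
    cut χ (B1 i.b) y = 1 := by
  rw [cut_B1]
  refine hχ.eq_one _ ?_
  rw [← mul_div_assoc]
  exact (div_le_one i.L_pos).2 hy

theorem cut0_eq_one (hχ : IsCutoff χ) {i : Par} {y : ℝ} (hy : y * i.t ≤ 1) :
    cut χ (B0 i.b) y = 1 := by
  rw [cut_B0]; exact hχ.eq_one _ hy

theorem dcut1_eq_zero (hχ : IsCutoff χ) {i : Par} {y : ℝ} (hy : y * i.t < i.L) :
    dcut1 χ i.b y = 0 := by
  rw [dcut1, cut_B1, hχ.euler_eq_zero, mul_zero]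
  rw [← mul_div_assoc]
  exact (div_lt_one i.L_pos).2 hy

theorem dcut0_eq_zero (hχ : IsCutoff χ) {i : Par} {y : ℝ} (hy : y * i.t < 1) :
    dcut0 χ i.b y = 0 := by
  rw [dcut0, cut_B0, hχ.euler_eq_zero hy, mul_zero]

theorem R0.lt {i : Par} {y : ℝ} (hy : y ∈ R0 i) : y * i.t < 1 := (lt_div_iff₀ i.t_pos).1 hy.2

theorem RA0.lt {i : Par} {y : ℝ} (hy : y ∈ RA0 i) : y * i.t < i.L :=
  ((lt_div_iff₀ i.t_pos).1 hy.2).trans (by linarith [i.L_gt])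

theorem R2.lt {i : Par} {y : ℝ} (hy : y ∈ R2 i) : y * i.t < i.L := (lt_div_iff₀ i.t_pos).1 hy.2

theorem R4.cut1 (hχ : IsCutoff χ) {i : Par} {y : ℝ} (hy : y ∈ R4 i) : cut χ (B1 i.b) y = 0 := by
  rw [cut_B1]
  refine hχ.eq_zero _ ?_
  rw [← mul_div_assoc, le_div_iff₀ i.L_pos]
  exact ((div_lt_iff₀ i.t_pos).1 (show 2 * i.L / i.t < y from hy)).le

theorem R4.dcut1 (hχ : IsCutoff χ) {i : Par} {y : ℝ} (hy : y ∈ R4 i) : dcut1 χ i.b y = 0 := by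
  rw [CSS.dcut1, cut_B1, hχ.euler_support, mul_zero]
  rw [← mul_div_assoc, lt_div_iff₀ i.L_pos]
  exact (div_lt_iff₀ i.t_pos).1 hy

/-- The outgoing part `χ_{B₀} b² T_{2,0}` of `P₁`. -/
def P1T (χ : ℝ → ℝ) (i : Par) (y : ℝ) : ℂ :=
  cut χ (B0 i.b) y * (i.b * i.b * T20 χ i.b y)

theorem P1_split (χ : ℝ → ℝ) (i : Par) (y : ℝ) : P1 χ i.b i.eta y =
    cut χ (B1 i.b) y * (-(Complex.I * i.be * halfyQ y)) + P1T χ i y := by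
  rw [P1_eq, P1T, sq]

theorem sy_P1T (hχ : IsCutoff χ) (hS : S.Initial) : Sy S 2 (-1) 4 0 (P1T χ) :=
  (hχ.syC0.times ((sy_bC.times sy_bC).times (sy_T20 hχ hS).ofReal)).le

theorem sy_P1T' (hχ : IsCutoff χ) : Sy RA0 2 (-2) 3 1 (P1T χ) :=
  (hχ.syC0.times ((sy_bC.times sy_bC).times (sy_T20' hχ).ofReal)).le

theorem sy_P1f (hχ : IsCutoff χ) :
    Sy S 1 (-2) 2 0 (fun i y => (cut χ (B1 i.b) y : ℂ) * (-(Complex.I * i.be * halfyQ y))) :=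
  (hχ.syC1.times (Sy.neg ((sy_I.times sy_be).times sy_f.ofReal))).le

theorem sy_P1 (hχ : IsCutoff χ) (hS : ∀ i, S i ⊆ RA0 i) :
    Sy S 1 (-2) 2 0 (fun i => P1 χ i.b i.eta) := by
  have h : Sy RA0 1 (-2) 2 0 (fun i => P1 χ i.b i.eta) :=
    (Sy.add (sy_P1f hχ) ((sy_P1T' hχ).leB0 RA0.leB0 1)).congr fun i y _ => (P1_split χ i y).symm
  exact h.restrict hS

theorem sy_P1_out (hχ : IsCutoff χ) (hS : S.Out) :
    Sy S 1 (-2) 2 0 (fun i => P1 χ i.b i.eta) :=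
  (sy_P1f hχ).congr fun i y hy => by
    rw [P1_split, P1T, hS.cut0 hχ hy]; simp

theorem P2_out (hχ : IsCutoff χ) (hS : S.Out) {i : Par} {y : ℝ} (hy : y ∈ S i) :
    P2 χ i.b i.eta y = 0 := by
  rw [P2_eq, hS.cut0 hχ hy]; simp

theorem P1_R4 (hχ : IsCutoff χ) {i : Par} {y : ℝ} (hy : y ∈ R4 i) : P1 χ i.b i.eta y = 0 := by
  rw [P1_eq, R4.out.cut0 hχ hy, R4.cut1 hχ hy]; simp

/-- The contribution of `U_{3,0}` to `P₂`. -/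
def P2r (χ : ℝ → ℝ) (i : Par) (y : ℝ) : ℂ := Complex.I * (i.b * i.b * i.b) * U30 χ i.b y

theorem sy_P2r (hχ : IsCutoff χ) : Sy RA0 3 (-2) 5 1 (P2r χ) :=
  ((sy_I.times ((sy_bC.times sy_bC).times sy_bC)).times (sy_U30' hχ).ofReal).le

theorem sy_be2 : Sy S 0 0 4 0 (fun i _ => i.be * i.be) := (sy_be.times sy_be).le

theorem P2_split (χ : ℝ → ℝ) (i : Par) (y : ℝ) : P2 χ i.b i.eta y =
    cut χ (B0 i.b) y * (i.be * i.be * U2 χ i.b y + P2r χ i y) := by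
  rw [P2_eq, P2r]; ring

theorem sy_P2 (hχ : IsCutoff χ) (hS : ∀ i, S i ⊆ RA0 i) :
    Sy S 1 (-1) 4 0 (fun i => P2 χ i.b i.eta) := by
  have h1 : Sy RA0 1 (-1) 4 0 (fun i y => i.be * i.be * (U2 χ i.b y : ℂ) + P2r χ i y) :=
    Sy.add (sy_be2.times (sy_U2 hχ RA0.initial).ofReal).le ((sy_P2r hχ).leB0 RA0.leB0 1)
  have h : Sy RA0 1 (-1) 4 0 (fun i => P2 χ i.b i.eta) :=
    ((hχ.syC0.times h1).le : Sy RA0 1 (-1) 4 0 _).congr fun i y _ => (P2_split χ i y).symm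
  exact h.restrict hS

theorem sy_P2_R1 (hχ : IsCutoff χ) : Sy R1 1 (-1) 4 1 (fun i => P2 χ i.b i.eta) := by
  have h2 : Sy R1 1 (-1) 4 1 (fun i y => i.be * i.be * (U2 χ i.b y : ℂ)) :=
    Sy.geB0 ((sy_be2.times ((sy_U2' hχ).restrict R1.sub_RA0).ofReal) : Sy R1 _ _ _ _ _) R1.geB0 1
  have h1 : Sy R1 1 (-1) 4 1 (fun i y => i.be * i.be * (U2 χ i.b y : ℂ) + P2r χ i y) :=
    Sy.add h2 (((sy_P2r hχ).restrict R1.sub_RA0).leB0 R1.leB0 1)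
  exact ((hχ.syC0.times h1).le : Sy R1 1 (-1) 4 1 _).congr fun i y _ => (P2_split χ i y).symm

theorem sy_dBP1 (hχ : IsCutoff χ) (hS : ∀ i, S i ⊆ RA0 i) : Sy S 1 (-2) 0 0 (dBP1 χ) := by
  have h : Sy RA0 1 (-2) 0 0 (dBP1 χ) := by
    unfold dBP1
    simp only [sq]
    refine Sy.add (Sy.add (Sy.add ?_ ?_) ?_) ?_
    · exact ((sy_dcut1 hχ).ofReal.times (Sy.neg ((sy_I.times sy_be).times sy_f.ofReal))).le
    · exact (hχ.syC1.times (Sy.neg (sy_I.times sy_f.ofReal))).le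
    · exact ((sy_dcut0 hχ).ofReal.times ((sy_bC.times sy_bC).times
        (sy_T20 hχ RA0.initial).ofReal)).leB0 RA0.leB0 2
    · refine Sy.leB0 (p := 2) (q := -1) (m := 2) (n := 0) ?_ RA0.leB0 2
      refine (hχ.syC0.times (Sy.add (p := 2) (q := -1) (m := 2) (n := 0) ?_ ?_)).le
      · exact (((Sy.number 2).times sy_bC).times (sy_T20 hχ RA0.initial).ofReal).le
      · exact ((sy_bC.times sy_bC).times (sy_T20b hχ RA0.initial).ofReal).le
  exact h.restrict hS

theorem sy_dBP1_out (hχ : IsCutoff χ) (hS : S.Out) : Sy S 1 (-2) 0 0 (dBP1 χ) := by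
  have h : Sy S 1 (-2) 0 0 (fun i y => (dcut1 χ i.b y : ℂ) * (-(Complex.I * i.be * halfyQ y))
      + cut χ (B1 i.b) y * (-(Complex.I * halfyQ y))) :=
    Sy.add ((sy_dcut1 hχ).ofReal.times (Sy.neg ((sy_I.times sy_be).times sy_f.ofReal))).le
      (hχ.syC1.times (Sy.neg (sy_I.times sy_f.ofReal))).le
  exact h.congr fun i y hy => by
    rw [dBP1, hS.cut0 hχ hy, hS.dcut0 hχ hy]; simp

end

/-! ### Radial `L²` norms of explicit functions -/

open MeasureTheory in
theorem normL2_le_of_lintegral {g : ℝ → ℝ} (hg : Measurable g) {c : ℝ} (hc : 0 ≤ c)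
    (h : ∫⁻ r in Set.Ioi (0 : ℝ), ENNReal.ofReal (2 * Real.pi * r * g r ^ 2)
      ≤ ENNReal.ofReal (c ^ 2)) : normL2 g ≤ ENNReal.ofReal c := by
  have hd : Measurable fun r : ℝ => ENNReal.ofReal (2 * Real.pi * r) := by fun_prop
  have h1 : ∫⁻ r, ‖g r‖ₑ ^ (2 : ℝ) ∂radialMeasure ≤ ENNReal.ofReal (c ^ 2) := by
    rw [radialMeasure, lintegral_withDensity_eq_lintegral_mul _ hd (by fun_prop)]
    refine le_trans (le_of_eq ?_) h
    refine setLIntegral_congr_fun measurableSet_Ioi fun r hr => ?_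
    have hr : 0 < r := hr
    simp only [Pi.mul_apply]
    rw [Real.enorm_eq_ofReal_abs, ENNReal.rpow_ofNat, ← ENNReal.ofReal_pow (abs_nonneg _), sq_abs,
      ← ENNReal.ofReal_mul (by positivity)]
  rw [normL2, eLpNorm_eq_lintegral_rpow_enorm_toReal (by norm_num) (by norm_num)]
  simp only [ENNReal.toReal_ofNat]
  calc (∫⁻ r, ‖g r‖ₑ ^ (2 : ℝ) ∂radialMeasure) ^ (1 / (2 : ℝ))
      ≤ (ENNReal.ofReal (c ^ 2)) ^ (1 / (2 : ℝ)) := ENNReal.rpow_le_rpow h1 (by norm_num)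
    _ = ENNReal.ofReal c := by
        rw [ENNReal.ofReal_rpow_of_nonneg (by positivity) (by norm_num), ← Real.sqrt_eq_rpow,
          Real.sqrt_sq hc]

theorem normL2_mono {E : Type*} [NormedAddCommGroup E] {f : ℝ → E} {g : ℝ → ℝ}
    (h : ∀ᵐ y ∂(MeasureTheory.volume.restrict (Set.Ioi (0 : ℝ))), ‖f y‖ ≤ g y) :
    normL2 f ≤ normL2 g :=
  MeasureTheory.eLpNorm_mono_ae_real
    ((MeasureTheory.withDensity_absolutelyContinuous _ _).ae_le h)

theorem normL2_add_le {f g : ℝ → ℝ} (hf : Measurable f) (hg : Measurable g) {a b : ℝ}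
    (ha : 0 ≤ a) (hb : 0 ≤ b) (h1 : normL2 f ≤ ENNReal.ofReal a)
    (h2 : normL2 g ≤ ENNReal.ofReal b) :
    normL2 (fun y => f y + g y) ≤ ENNReal.ofReal (a + b) := by
  rw [ENNReal.ofReal_add ha hb]
  exact (MeasureTheory.eLpNorm_add_le hf.aestronglyMeasurable hg.aestronglyMeasurable
    (by norm_num)).trans (add_le_add h1 h2)

theorem normL2_const_mul {f : ℝ → ℝ} {a c : ℝ} (hc : 0 ≤ c) (h : normL2 f ≤ ENNReal.ofReal a) :
    normL2 (fun y => c * f y) ≤ ENNReal.ofReal (c * a) := by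
  rw [ENNReal.ofReal_mul hc]
  have := MeasureTheory.eLpNorm_const_smul_le (c := c) (f := f) (p := 2) (μ := radialMeasure)
  refine this.trans ?_
  rw [Real.enorm_eq_ofReal_abs, abs_of_nonneg hc]
  gcongr
  exact h

open MeasureTheory in
theorem lintegral_Ioi_le_of_deriv {G g : ℝ → ℝ} {a l : ℝ}
    (hG : ∀ x, a ≤ x → HasDerivAt G (g x) x) (hg : ∀ x, a < x → 0 ≤ g x)
    (hl : Filter.Tendsto G Filter.atTop (nhds l)) :
    ∫⁻ x in Set.Ioi a, ENNReal.ofReal (g x) ≤ ENNReal.ofReal (l - G a) := by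
  have h1 := integrableOn_Ioi_deriv_of_nonneg' (fun x hx => hG x hx) hg hl
  have h2 := integral_Ioi_of_hasDerivAt_of_nonneg' (fun x hx => hG x hx) hg hl
  rw [← h2, ofReal_integral_eq_lintegral_ofReal h1]
  exact (ae_restrict_iff' measurableSet_Ioi).2 (ae_of_all _ fun x hx => hg x hx)

open MeasureTheory in
theorem lintegral_Ioc_le_of_deriv {G g : ℝ → ℝ} {a b : ℝ} (hab : a ≤ b)
    (hG : ∀ x ∈ Set.Icc a b, HasDerivAt G (g x) x) (hc : ContinuousOn g (Set.Icc a b))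
    (hg : ∀ x ∈ Set.Icc a b, 0 ≤ g x) :
    ∫⁻ x in Set.Ioc a b, ENNReal.ofReal (g x) ≤ ENNReal.ofReal (G b - G a) := by
  have hc' : ContinuousOn g (Set.uIcc a b) := by rwa [Set.uIcc_of_le hab]
  have h2 := intervalIntegral.integral_eq_sub_of_hasDerivAt (f := G) (f' := g) (a := a) (b := b)
    (by rw [Set.uIcc_of_le hab]; exact hG) hc'.intervalIntegrable
  have hi : IntegrableOn g (Set.Ioc a b) :=
    (hc.integrableOn_Icc).mono_set Set.Ioc_subset_Icc_self
  rw [← h2, intervalIntegral.integral_of_le hab, ofReal_integral_eq_lintegral_ofReal hi]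
  exact (ae_restrict_iff' measurableSet_Ioc).2
    (ae_of_all _ fun x hx => hg x (Set.Ioc_subset_Icc_self hx))

/-- A convenient form of the radial `L²` bound: the density is dominated by a multiple of `k`. -/
theorem normL2_le_of_density {g k : ℝ → ℝ} (hg : Measurable g) {C I : ℝ} (hC : 0 ≤ C)
    (hI : 0 ≤ I) (hgk : ∀ r, 0 < r → r * g r ^ 2 ≤ C * k r)
    (h : ∫⁻ r in Set.Ioi (0 : ℝ), ENNReal.ofReal (k r) ≤ ENNReal.ofReal I) :
    normL2 g ≤ ENNReal.ofReal √(2 * Real.pi * C * I) := by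
  refine normL2_le_of_lintegral hg (Real.sqrt_nonneg _) ?_
  rw [Real.sq_sqrt (by positivity)]
  calc ∫⁻ r in Set.Ioi (0 : ℝ), ENNReal.ofReal (2 * Real.pi * r * g r ^ 2)
      ≤ ∫⁻ r in Set.Ioi (0 : ℝ), ENNReal.ofReal (2 * Real.pi * C) * ENNReal.ofReal (k r) := by
        refine MeasureTheory.setLIntegral_mono' measurableSet_Ioi fun r hr => ?_
        rw [← ENNReal.ofReal_mul (by positivity)]
        refine ENNReal.ofReal_le_ofReal ?_
        have := mul_le_mul_of_nonneg_left (hgk r hr) (by positivity : 0 ≤ 2 * Real.pi)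
        linarith
    _ = ENNReal.ofReal (2 * Real.pi * C) * ∫⁻ r in Set.Ioi (0 : ℝ), ENNReal.ofReal (k r) :=
        MeasureTheory.lintegral_const_mul' _ _ ENNReal.ofReal_ne_top
    _ ≤ _ := by
        rw [ENNReal.ofReal_mul (p := 2 * Real.pi * C) (by positivity)]
        gcongr

theorem lintegral_inv_sq :
    ∫⁻ r in Set.Ioi (0 : ℝ), ENNReal.ofReal (1 / (1 + r) ^ 2) ≤ ENNReal.ofReal 1 := by
  have h := lintegral_Ioi_le_of_deriv (G := fun r : ℝ => -(1 + r)⁻¹) (g := fun r => 1 / (1 + r) ^ 2)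
    (a := 0) (l := -0) (fun x hx => by
      have h1 : (1 + x) ≠ 0 := by positivity
      refine (((hasDerivAt_id x).const_add 1).inv h1).neg.congr_deriv ?_
      simp only [id, neg_div, neg_neg])
    (fun x hx => by positivity)
    ((tendsto_inv_atTop_zero.comp (Filter.tendsto_atTop_add_const_left _ 1 Filter.tendsto_id)).neg)
  simpa using h

theorem lintegral_log_sq : ∫⁻ r in Set.Ioi (0 : ℝ),
    ENNReal.ofReal (1 / (1 + Real.log (1 + r) ^ 2) * (1 / (1 + r))) ≤
      ENNReal.ofReal (Real.pi / 2) := by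
  have h := lintegral_Ioi_le_of_deriv (G := fun r : ℝ => Real.arctan (Real.log (1 + r)))
    (g := fun r => 1 / (1 + Real.log (1 + r) ^ 2) * (1 / (1 + r))) (a := 0) (l := Real.pi / 2)
    (fun x hx => by
      have h1 : (1 + x) ≠ 0 := by positivity
      exact (((hasDerivAt_id x).const_add 1).log h1).arctan)
    (fun x hx => by positivity)
    (((Real.tendsto_arctan_atTop.mono_right nhdsWithin_le_nhds).comp
      (Real.tendsto_log_atTop.comp
        (Filter.tendsto_atTop_add_const_left _ 1 Filter.tendsto_id))))
  simpa using h

theorem lintegral_indicator_inv {R : ℝ} (hR : 0 ≤ R) : ∫⁻ r in Set.Ioi (0 : ℝ),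
    ENNReal.ofReal ((Set.Iic R).indicator (fun r => 1 / (1 + r)) r)
      ≤ ENNReal.ofReal (Real.log (1 + R)) := by
  have h := lintegral_Ioc_le_of_deriv (G := fun r : ℝ => Real.log (1 + r))
    (g := fun r => 1 / (1 + r)) hR
    (fun x hx => by
      have h1 : (1 + x) ≠ 0 := by have := hx.1; positivity
      exact ((hasDerivAt_id x).const_add 1).log h1)
    (ContinuousOn.div (by fun_prop) (by fun_prop) fun x hx => by have := hx.1; positivity)
    (fun x hx => by have := hx.1; positivity)
  simp only [add_zero, Real.log_one, sub_zero] at h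
  refine le_trans (le_of_eq ?_) h
  have e : (fun r => ENNReal.ofReal ((Set.Iic R).indicator (fun r => 1 / (1 + r)) r)) =
      (Set.Iic R).indicator (fun r => ENNReal.ofReal (1 / (1 + r))) := by
    funext r
    by_cases hr : r ∈ Set.Iic R <;> simp [hr]
  rw [e, MeasureTheory.lintegral_indicator measurableSet_Iic,
    MeasureTheory.Measure.restrict_restrict measurableSet_Iic, Set.Iic_inter_Ioi]

theorem lintegral_indicator_one {R : ℝ} (hR : 0 ≤ R) : ∫⁻ r in Set.Ioi (0 : ℝ),
    ENNReal.ofReal ((Set.Iic R).indicator (fun _ => (1 : ℝ)) r) ≤ ENNReal.ofReal R := by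
  have h := lintegral_Ioc_le_of_deriv (G := fun r : ℝ => r) (g := fun _ => 1) hR
    (fun x hx => hasDerivAt_id x) continuousOn_const (fun x hx => zero_le_one)
  rw [sub_zero] at h
  refine le_trans (le_of_eq ?_) h
  have e : (fun r => ENNReal.ofReal ((Set.Iic R).indicator (fun _ => (1 : ℝ)) r)) =
      (Set.Iic R).indicator (fun r => ENNReal.ofReal 1) := by
    funext r
    by_cases hr : r ∈ Set.Iic R <;> simp [hr]
  rw [e, MeasureTheory.lintegral_indicator measurableSet_Iic,
    MeasureTheory.Measure.restrict_restrict measurableSet_Iic, Set.Iic_inter_Ioi]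

theorem lintegral_indicator_cube {R : ℝ} (hR : 0 < R) : ∫⁻ r in Set.Ioi (0 : ℝ),
    ENNReal.ofReal ((Set.Ioi R).indicator (fun r => 2 / r ^ 3) r) ≤ ENNReal.ofReal ((R ^ 2)⁻¹) := by
  have h := lintegral_Ioi_le_of_deriv (G := fun r : ℝ => -(r ^ 2)⁻¹) (g := fun r => 2 / r ^ 3)
    (a := R) (l := -0) (fun x hx => by
      have h1 : 0 < x := hR.trans_le hx
      refine ((hasDerivAt_pow 2 x).inv (by positivity)).neg.congr_deriv ?_
      field_simp
      norm_num [mul_comm])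
    (fun x hx => by have : 0 < x := hR.trans hx; positivity)
    ((tendsto_inv_atTop_zero.comp (Filter.tendsto_pow_atTop two_ne_zero)).neg)
  simp only [neg_zero, zero_sub, neg_neg] at h
  refine le_trans (le_of_eq ?_) h
  have e : (fun r => ENNReal.ofReal ((Set.Ioi R).indicator (fun r => 2 / r ^ 3) r)) =
      (Set.Ioi R).indicator (fun r => ENNReal.ofReal (2 / r ^ 3)) := by
    funext r
    by_cases hr : r ∈ Set.Ioi R <;> simp [hr]
  rw [e, MeasureTheory.lintegral_indicator measurableSet_Ioi,
    MeasureTheory.Measure.restrict_restrict measurableSet_Ioi, Set.Ioi_inter_Ioi,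
    max_eq_left hR.le]

theorem measurable_jb : Measurable jb := by unfold jb; fun_prop

theorem measurable_logPlus : Measurable logPlus := measurable_const.max Real.measurable_log

theorem jb_pos (x : ℝ) : 0 < jb x := Real.sqrt_pos.2 (by positivity)

theorem jb_sq (x : ℝ) : jb x ^ 2 = 1 + x ^ 2 := Real.sq_sqrt (by positivity)

theorem one_le_jb (x : ℝ) : 1 ≤ jb x := by
  rw [jb]
  exact Real.one_le_sqrt.2 (by nlinarith [sq_nonneg x])

theorem logPlus_nonneg (y : ℝ) : 0 ≤ logPlus y := le_max_left _ _

theorem log_one_add_le {y : ℝ} (hy : 0 < y) : Real.log (1 + y) ≤ 1 + logPlus y := by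
  rcases le_total y 1 with h | h
  · have := Real.log_le_sub_one_of_pos (show 0 < 1 + y by linarith)
    linarith [logPlus_nonneg y]
  · have h1 : Real.log (1 + y) ≤ Real.log (2 * y) := Real.log_le_log (by linarith) (by linarith)
    rw [Real.log_mul two_ne_zero hy.ne'] at h1
    have h2 : Real.log y ≤ logPlus y := le_max_right _ _
    linarith [Real.log_two_lt_d9]

theorem logPlus_le_log {y : ℝ} (hy : 0 < y) : logPlus y ≤ Real.log (1 + y) :=
  max_le (Real.log_nonneg (by linarith)) (Real.log_le_log hy (by linarith))

theorem normL2_inv_sq : ∃ C, 0 ≤ C ∧ normL2 (fun y : ℝ => 1 / (1 + y) ^ 2) ≤ ENNReal.ofReal C := by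
  refine ⟨_, Real.sqrt_nonneg _, normL2_le_of_density (k := fun r => 1 / (1 + r) ^ 2) (C := 1)
    (I := 1) (by fun_prop) zero_le_one zero_le_one (fun r hr => ?_) lintegral_inv_sq⟩
  rw [one_mul, div_pow, one_pow, mul_one_div, div_le_div_iff₀ (by positivity) (by positivity)]
  nlinarith [sq_nonneg (1 + r), mul_nonneg (sq_nonneg (1 + r)) hr.le,
    mul_nonneg (sq_nonneg (1 + r)) (sq_nonneg r)]

theorem normL2_inv_log : ∃ C, 0 ≤ C ∧
    normL2 (fun y : ℝ => 1 / (1 + y) * (jb (logPlus y))⁻¹) ≤ ENNReal.ofReal C := by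
  have hm : Measurable fun y : ℝ => 1 / (1 + y) * (jb (logPlus y))⁻¹ :=
    Measurable.mul (by fun_prop) (measurable_jb.comp measurable_logPlus).inv
  refine ⟨_, Real.sqrt_nonneg _, normL2_le_of_density
    (k := fun r => 1 / (1 + Real.log (1 + r) ^ 2) * (1 / (1 + r))) (C := 3) (I := Real.pi / 2)
    hm (by norm_num) (by positivity) (fun r hr => ?_) lintegral_log_sq⟩
  have h1 := log_one_add_le hr
  have h2 : 0 ≤ Real.log (1 + r) := Real.log_nonneg (by linarith)
  rw [mul_pow, inv_pow, jb_sq]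
  have h3 : (1 + logPlus r ^ 2)⁻¹ ≤ 3 * (1 / (1 + Real.log (1 + r) ^ 2)) := by
    rw [mul_one_div, inv_eq_one_div, div_le_div_iff₀ (by positivity) (by positivity)]
    nlinarith [sq_nonneg (logPlus r - 1), pow_le_pow_left₀ h2 h1 2]
  have h4 : r * (1 / (1 + r)) ^ 2 ≤ 1 / (1 + r) := by
    rw [div_pow, one_pow, mul_one_div, div_le_div_iff₀ (by positivity) (by positivity)]
    nlinarith
  calc r * ((1 / (1 + r)) ^ 2 * (1 + logPlus r ^ 2)⁻¹)
      = (r * (1 / (1 + r)) ^ 2) * (1 + logPlus r ^ 2)⁻¹ := by ring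
    _ ≤ (1 / (1 + r)) * (3 * (1 / (1 + Real.log (1 + r) ^ 2))) :=
        mul_le_mul h4 h3 (by positivity) (by positivity)
    _ = _ := by ring

theorem normL2_indicator_inv {R : ℝ} (hR : 0 ≤ R) :
    normL2 ((Set.Iic R).indicator fun y : ℝ => 1 / (1 + y)) ≤
      ENNReal.ofReal √(2 * Real.pi * 1 * Real.log (1 + R)) := by
  refine normL2_le_of_density (k := (Set.Iic R).indicator fun y : ℝ => 1 / (1 + y)) (C := 1)
    ((by fun_prop : Measurable fun y : ℝ => 1 / (1 + y)).indicator measurableSet_Iic) zero_le_one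
    (Real.log_nonneg (by linarith)) (fun r hr => ?_) (lintegral_indicator_inv hR)
  by_cases h : r ∈ Set.Iic R
  · simp only [Set.indicator_of_mem h, one_mul]
    rw [div_pow, one_pow, mul_one_div, div_le_div_iff₀ (by positivity) (by positivity)]
    nlinarith
  · simp [Set.indicator_of_notMem h]

theorem normL2_indicator_one {R : ℝ} (hR : 0 ≤ R) :
    normL2 ((Set.Iic R).indicator fun _ : ℝ => (1 : ℝ)) ≤ ENNReal.ofReal (3 * R) := by
  refine (normL2_le_of_density (k := (Set.Iic R).indicator fun _ : ℝ => (1 : ℝ)) (C := R)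
    (measurable_const.indicator measurableSet_Iic) hR hR (fun r hr => ?_)
    (lintegral_indicator_one hR)).trans (ENNReal.ofReal_le_ofReal ?_)
  · by_cases h : r ∈ Set.Iic R
    · simpa [Set.indicator_of_mem h] using h
    · simp [Set.indicator_of_notMem h]
  · refine Real.sqrt_le_iff.2 ⟨by positivity, ?_⟩
    nlinarith [Real.pi_lt_four, mul_nonneg hR hR, Real.pi_pos]

theorem normL2_indicator_sq {R : ℝ} (hR : 0 < R) :
    normL2 ((Set.Ioi R).indicator fun y : ℝ => 1 / y ^ 2) ≤ ENNReal.ofReal (2 / R) := by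
  refine (normL2_le_of_density (k := (Set.Ioi R).indicator fun y : ℝ => 2 / y ^ 3) (C := 1 / 2)
    ((by fun_prop : Measurable fun y : ℝ => 1 / y ^ 2).indicator measurableSet_Ioi) (by norm_num)
    (by positivity) (fun r hr => ?_)
    (lintegral_indicator_cube hR)).trans (ENNReal.ofReal_le_ofReal ?_)
  · by_cases h : r ∈ Set.Ioi R
    · simp only [Set.indicator_of_mem h]
      field_simp
      exact le_rfl
    · simp [Set.indicator_of_notMem h]
  · refine Real.sqrt_le_iff.2 ⟨by positivity, ?_⟩
    rw [div_pow, ← div_eq_mul_inv]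
    gcongr
    linarith [Real.pi_lt_four]

section

variable {S : Region Par} {F : Par → ℝ → ℂ}

theorem log_one_add_le_L (i : Par) : Real.log (1 + 2 * i.L / i.t) ≤ 5 * i.L := by
  have hL := i.L_gt
  have ht := i.t_pos
  have ht1 := i.t_lt_one
  have h1 : 1 + 2 * i.L / i.t ≤ 3 * i.L / i.t := by
    rw [← sub_nonneg]
    have : 3 * i.L / i.t - (1 + 2 * i.L / i.t) = (i.L - i.t) / i.t := by field_simp; ring
    rw [this]
    exact div_nonneg (by linarith) ht.le
  have h2 := Real.log_le_log (by positivity) h1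
  rw [Real.log_div (by positivity) ht.ne'] at h2
  have h3 : Real.log i.t = -(i.L / 2) := by rw [i.t_eq, Real.log_exp]
  have h4 := Real.log_le_sub_one_of_pos (show 0 < 3 * i.L by positivity)
  linarith

/-! ### Profiles of the norms -/

/-- The profile of `∂_y F` for families in `𝓗̇¹₂`. -/
def hd (i : Par) (y : ℝ) : ℝ :=
  1 / (1 + y) ^ 2 + (i.L⁻¹ * (Set.Iic (2 * i.L / i.t)).indicator (fun y => 1 / (1 + y)) y
    + i.t * (Set.Iic (2 / i.t)).indicator (fun _ => 1) y)

/-- The profile of `y⁻¹ F` for families in `𝓗̇¹₂`. -/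
def hw (i : Par) (y : ℝ) : ℝ := 1 / (1 + y) + i.t * (Set.Iic (2 / i.t)).indicator (fun _ => 1) y

/-- The tail `B₁ y⁻²` beyond `B₁`. -/
def hTail (i : Par) (y : ℝ) : ℝ :=
  i.L / i.t * (Set.Ioi (i.L / i.t)).indicator (fun y => 1 / y ^ 2) y

theorem measurable_indicator_inv (R : ℝ) :
    Measurable ((Set.Iic R).indicator fun y : ℝ => 1 / (1 + y)) :=
  (by fun_prop : Measurable fun y : ℝ => 1 / (1 + y)).indicator measurableSet_Iic

theorem measurable_indicator_one (R : ℝ) : Measurable ((Set.Iic R).indicator fun _ => (1 : ℝ)) :=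
  measurable_const.indicator measurableSet_Iic

theorem measurable_hd (i : Par) : Measurable (hd i) :=
  (by fun_prop : Measurable fun y : ℝ => 1 / (1 + y) ^ 2).add
    (((measurable_indicator_inv _).const_mul _).add ((measurable_indicator_one _).const_mul _))

theorem measurable_hTail (i : Par) : Measurable (hTail i) :=
  ((by fun_prop : Measurable fun y : ℝ => 1 / y ^ 2).indicator measurableSet_Ioi).const_mul _

theorem indicator_one_nonneg (R y : ℝ) : 0 ≤ (Set.Iic R).indicator (fun _ => (1 : ℝ)) y :=
  Set.indicator_nonneg (fun _ _ => zero_le_one) _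

theorem indicator_inv_nonneg (R : ℝ) {y : ℝ} (hy : 0 < y) :
    0 ≤ (Set.Iic R).indicator (fun y : ℝ => 1 / (1 + y)) y := by
  by_cases h : y ∈ Set.Iic R
  · rw [Set.indicator_of_mem h]; positivity
  · rw [Set.indicator_of_notMem h]

theorem hd_nonneg (i : Par) {y : ℝ} (hy : 0 < y) : 0 ≤ hd i y := by
  have h1 := indicator_inv_nonneg (2 * i.L / i.t) hy
  have h2 := indicator_one_nonneg (2 / i.t) y
  have := i.L_pos
  have := i.t_pos
  unfold hd
  positivity

theorem hw_nonneg (i : Par) {y : ℝ} (hy : 0 < y) : 0 ≤ hw i y := by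
  have h2 := indicator_one_nonneg (2 / i.t) y
  have := i.t_pos
  unfold hw
  positivity

theorem hTail_nonneg (i : Par) (y : ℝ) : 0 ≤ hTail i y := by
  have := i.L_pos
  have := i.t_pos
  exact mul_nonneg (by positivity) (Set.indicator_nonneg (fun _ _ => by positivity) _)

theorem normL2_t_indicator (i : Par) :
    normL2 (fun y => i.t * (Set.Iic (2 / i.t)).indicator (fun _ => (1 : ℝ)) y)
      ≤ ENNReal.ofReal 6 := by
  have ht := i.t_pos
  refine (normL2_const_mul ht.le (normL2_indicator_one (R := 2 / i.t) (by positivity))).trans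
    (le_of_eq ?_)
  congr 1
  field_simp
  norm_num

theorem normL2_indicator_inv_le (i : Par) :
    normL2 ((Set.Iic (2 * i.L / i.t)).indicator fun y : ℝ => 1 / (1 + y))
      ≤ ENNReal.ofReal (7 * i.L) := by
  have hL := i.L_gt
  have ht := i.t_pos
  refine (normL2_indicator_inv (by positivity)).trans (ENNReal.ofReal_le_ofReal ?_)
  refine Real.sqrt_le_iff.2 ⟨by positivity, ?_⟩
  have h := log_one_add_le_L i
  have h0 : 0 ≤ Real.log (1 + 2 * i.L / i.t) := Real.log_nonneg (by
    have : 0 ≤ 2 * i.L / i.t := by positivity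
    linarith)
  nlinarith [Real.pi_lt_four, Real.pi_pos]

theorem normL2_hd : ∃ C, 0 ≤ C ∧ ∀ i, normL2 (hd i) ≤ ENNReal.ofReal C := by
  obtain ⟨C, hC, h1⟩ := normL2_inv_sq
  refine ⟨C + (7 + 6), by positivity, fun i => ?_⟩
  have hL := i.L_pos
  have h2 : normL2 (fun y => i.L⁻¹ * (Set.Iic (2 * i.L / i.t)).indicator (fun y => 1 / (1 + y)) y)
      ≤ ENNReal.ofReal 7 := by
    refine (normL2_const_mul (by positivity) (normL2_indicator_inv_le i)).trans (le_of_eq ?_)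
    congr 1
    field_simp
  exact normL2_add_le (by fun_prop)
    (((measurable_indicator_inv _).const_mul _).add ((measurable_indicator_one _).const_mul _)) hC
    (by norm_num) h1 (normL2_add_le ((measurable_indicator_inv _).const_mul _)
      ((measurable_indicator_one _).const_mul _) (by norm_num) (by norm_num) h2
      (normL2_t_indicator i))

theorem normL2_hw : ∃ C, 0 ≤ C ∧ ∀ i,
    normL2 (fun y => (jb (logPlus y))⁻¹ * hw i y) ≤ ENNReal.ofReal C := by
  obtain ⟨C, hC, h1⟩ := normL2_inv_log
  refine ⟨C + 6, by positivity, fun i => ?_⟩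
  have h := normL2_add_le (f := fun y => 1 / (1 + y) * (jb (logPlus y))⁻¹)
    (Measurable.mul (by fun_prop) (measurable_jb.comp measurable_logPlus).inv)
    ((measurable_indicator_one _).const_mul _) hC (by norm_num) h1 (normL2_t_indicator i)
  refine (normL2_mono ?_).trans h
  refine (MeasureTheory.ae_restrict_iff' measurableSet_Ioi).2
    (MeasureTheory.ae_of_all _ fun y hy => ?_)
  have hy : 0 < y := hy
  have hj := jb_pos (logPlus y)
  rw [Real.norm_eq_abs, abs_of_nonneg (mul_nonneg (inv_nonneg.2 hj.le) (hw_nonneg i hy)), hw,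
    mul_add, mul_comm]
  refine add_le_add le_rfl (mul_le_of_le_one_left ?_ (inv_le_one_of_one_le₀ (one_le_jb _)))
  exact mul_nonneg i.t_pos.le (indicator_one_nonneg _ _)

theorem measurable_jb_hw (i : Par) : Measurable fun y => (jb (logPlus y))⁻¹ * hw i y :=
  (measurable_jb.comp measurable_logPlus).inv.mul
    ((by fun_prop : Measurable fun y : ℝ => 1 / (1 + y)).add
      ((measurable_indicator_one _).const_mul _))

theorem normL2_hTail (i : Par) : normL2 (hTail i) ≤ ENNReal.ofReal 2 := by
  have hL := i.L_pos
  have ht := i.t_pos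
  refine (normL2_const_mul (by positivity) (normL2_indicator_sq (R := i.L / i.t)
    (by positivity))).trans (le_of_eq ?_)
  congr 1
  field_simp

/-! ### Pointwise bounds on the regions control the norms -/

/-- The five regions cover the half line up to the four scales. -/
theorem ae_regions (i : Par) : ∀ᵐ y ∂(MeasureTheory.volume.restrict (Set.Ioi (0 : ℝ))),
    0 < y ∧ (y ∈ R0 i ∨ y ∈ R1 i ∨ y ∈ R2 i ∨ y ∈ R3 i ∨ y ∈ R4 i) := by
  have hfin : ({1 / i.t, 2 / i.t, i.L / i.t, 2 * i.L / i.t} : Set ℝ).Finite := Set.toFinite _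
  rw [MeasureTheory.ae_restrict_iff' measurableSet_Ioi]
  filter_upwards [MeasureTheory.compl_mem_ae_iff.2 (hfin.measure_zero MeasureTheory.volume)]
    with y hy hy0
  simp only [Set.mem_compl_iff, Set.mem_insert_iff, Set.mem_singleton_iff, not_or] at hy
  obtain ⟨h1, h2, h3, h4⟩ := hy
  refine ⟨hy0, ?_⟩
  change y ∈ Set.Ioo _ _ ∨ y ∈ Set.Ioo _ _ ∨ y ∈ Set.Ioo _ _ ∨ y ∈ Set.Ioo _ _ ∨ y ∈ Set.Ioi _
  simp only [Set.mem_Ioo, Set.mem_Ioi]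
  have hy0 : 0 < y := hy0
  rcases lt_or_gt_of_ne h1 with h1 | h1
  · exact Or.inl ⟨hy0, h1⟩
  rcases lt_or_gt_of_ne h2 with h2 | h2
  · exact Or.inr (Or.inl ⟨h1, h2⟩)
  rcases lt_or_gt_of_ne h3 with h3 | h3
  · exact Or.inr (Or.inr (Or.inl ⟨h2, h3⟩))
  rcases lt_or_gt_of_ne h4 with h4 | h4
  · exact Or.inr (Or.inr (Or.inr (Or.inl ⟨h3, h4⟩)))
  · exact Or.inr (Or.inr (Or.inr (Or.inr h4)))

/-- The bound holds on each of the five regions. -/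
def BdAll (m : Par → ℝ → ℝ) (F : Par → ℝ → ℂ) : Prop :=
  Bd R0 m F ∧ Bd R1 m F ∧ Bd R2 m F ∧ Bd R3 m F ∧ Bd R4 m F

theorem BdAll.ae {m : Par → ℝ → ℝ} (h : BdAll m F) (hm : ∀ i, ∀ y, 0 < y → 0 ≤ m i y) :
    ∃ K, 0 ≤ K ∧ ∀ i, ∀ᵐ y ∂(MeasureTheory.volume.restrict (Set.Ioi (0 : ℝ))),
      0 < y ∧ ‖F i y‖ ≤ K * m i y := by
  obtain ⟨⟨C0, h0⟩, ⟨C1, h1⟩, ⟨C2, h2⟩, ⟨C3, h3⟩, ⟨C4, h4⟩⟩ := h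
  have a0 := abs_nonneg C0
  have a1 := abs_nonneg C1
  have a2 := abs_nonneg C2
  have a3 := abs_nonneg C3
  have a4 := abs_nonneg C4
  refine ⟨|C0| + |C1| + |C2| + |C3| + |C4|, by positivity, fun i => ?_⟩
  filter_upwards [ae_regions i] with y hy
  obtain ⟨hy0, hy⟩ := hy
  have hmy := hm i y hy0
  refine ⟨hy0, ?_⟩
  rcases hy with hy | hy | hy | hy | hy
  · exact (h0 i y hy).trans (mul_le_mul_of_nonneg_right (by linarith [le_abs_self C0]) hmy)
  · exact (h1 i y hy).trans (mul_le_mul_of_nonneg_right (by linarith [le_abs_self C1]) hmy)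
  · exact (h2 i y hy).trans (mul_le_mul_of_nonneg_right (by linarith [le_abs_self C2]) hmy)
  · exact (h3 i y hy).trans (mul_le_mul_of_nonneg_right (by linarith [le_abs_self C3]) hmy)
  · exact (h4 i y hy).trans (mul_le_mul_of_nonneg_right (by linarith [le_abs_self C4]) hmy)

theorem Bd.of_zero {m : Par → ℝ → ℝ} (h : ∀ i, ∀ y ∈ S i, F i y = 0) : Bd S m F :=
  ⟨0, fun i y hy => by rw [h i y hy]; simp⟩

/-- The weight of the families in `𝓗̇¹₂`. -/
def HW (m n : ℤ) (i : Par) (y : ℝ) : ℝ := i.c m n * (y * hw i y)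

/-- The weight of the Euler derivatives of the families in `𝓗̇¹₂`. -/
def HD (m n : ℤ) (i : Par) (y : ℝ) : ℝ := i.c m n * (y * hd i y)

theorem normH12_le {m n : ℤ} (h : BdAll (HW m n) F) (h' : BdAll (HD m n) (fun i => euler (F i))) :
    ∃ K, 0 ≤ K ∧ ∀ i, normH12 (F i) ≤ ENNReal.ofReal (K * i.c m n) := by
  obtain ⟨K, hK, h⟩ := h.ae fun i y hy =>
    mul_nonneg (i.c_pos _ _).le (mul_nonneg hy.le (hw_nonneg i hy))
  obtain ⟨K', hK', h'⟩ := h'.ae fun i y hy =>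
    mul_nonneg (i.c_pos _ _).le (mul_nonneg hy.le (hd_nonneg i hy))
  obtain ⟨C, hC, hCw⟩ := normL2_hw
  obtain ⟨C', hC', hCd⟩ := normL2_hd
  refine ⟨K' * C' + K * C, by positivity, fun i => ?_⟩
  have hc := (i.c_pos m n).le
  have e : (K' * C' + K * C) * i.c m n = K' * i.c m n * C' + K * i.c m n * C := by ring
  rw [e, ENNReal.ofReal_add (by positivity) (by positivity)]
  refine add_le_add ?_ ?_
  · refine (normL2_mono ?_).trans (normL2_const_mul (by positivity) (hCd i))
    filter_upwards [h' i] with y ⟨hy, hb⟩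
    rw [HD, euler, norm_smul, Real.norm_eq_abs, abs_of_pos hy] at hb
    refine le_of_mul_le_mul_left (hb.trans (le_of_eq ?_)) hy
    ring
  · refine (normL2_mono ?_).trans (normL2_const_mul (by positivity) (hCw i))
    filter_upwards [h i] with y ⟨hy, hb⟩
    have hj := jb_pos (logPlus y)
    rw [norm_smul, Real.norm_eq_abs, abs_of_pos (by positivity)]
    calc y⁻¹ * (jb (logPlus y))⁻¹ * ‖F i y‖ ≤ y⁻¹ * (jb (logPlus y))⁻¹ * (K * HW m n i y) := by
          gcongr
      _ = _ := by rw [HW]; field_simp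

/-- The profile of `X` weights. -/
theorem normL2_weightX : ∃ C, 0 ≤ C ∧
    normL2 (fun y : ℝ => (jb y ^ 2)⁻¹ * jb (logPlus y)) ≤ ENNReal.ofReal C := by
  have hm : Measurable fun y : ℝ => (jb y ^ 2)⁻¹ * jb (logPlus y) :=
    (measurable_jb.pow_const 2).inv.mul (measurable_jb.comp measurable_logPlus)
  refine ⟨_, Real.sqrt_nonneg _, normL2_le_of_density (k := fun r => 1 / (1 + r) ^ 2) (C := 8)
    (I := 1) hm (by norm_num) zero_le_one (fun r hr => ?_) lintegral_inv_sq⟩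
  rw [mul_pow, jb_sq, jb_sq, inv_pow, mul_one_div]
  have h0 := logPlus_nonneg r
  have h1 : logPlus r ^ 2 ≤ 1 + r := by
    have hs : 0 ≤ √(1 + r) := Real.sqrt_nonneg _
    have hs2 : √(1 + r) ^ 2 = 1 + r := Real.sq_sqrt (by linarith)
    have h2 : Real.log (1 + r) ≤ √(1 + r) := by
      rw [Real.log_le_iff_le_exp (by linarith)]
      have hx : Real.exp √(1 + r) = Real.exp (√(1 + r) / 2) * Real.exp (√(1 + r) / 2) := by
        rw [← Real.exp_add]; ring_nf
      have hq2 := Real.quadratic_le_exp_of_nonneg (x := √(1 + r) / 2) (by positivity)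
      rw [hx]
      have hpos : 0 ≤ 1 + √(1 + r) / 2 + (√(1 + r) / 2) ^ 2 / 2 := by positivity
      have := mul_le_mul hq2 hq2 hpos (Real.exp_nonneg _)
      nlinarith [sq_nonneg (√(1 + r)), mul_nonneg hs (sq_nonneg (√(1 + r)))]
    have h3 := (logPlus_le_log hr).trans h2
    nlinarith
  rw [div_eq_mul_inv, ← inv_pow]
  have h4 : ((1 + r ^ 2)⁻¹) ^ 2 ≤ (2 * ((1 + r)⁻¹) ^ 2) ^ 2 := by
    refine pow_le_pow_left₀ (by positivity) ?_ 2
    rw [inv_pow, inv_eq_one_div, ← div_eq_mul_inv, div_le_div_iff₀ (by positivity)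
      (by positivity)]
    nlinarith [sq_nonneg (r - 1)]
  have h5 : r * (1 + logPlus r ^ 2) ≤ 2 * (1 + r) ^ 2 := by nlinarith
  have hu : (1 + r) * (1 + r)⁻¹ = 1 := mul_inv_cancel₀ (by positivity)
  calc r * (((1 + r ^ 2)⁻¹) ^ 2 * (1 + logPlus r ^ 2))
      = ((1 + r ^ 2)⁻¹) ^ 2 * (r * (1 + logPlus r ^ 2)) := by ring
    _ ≤ (2 * ((1 + r)⁻¹) ^ 2) ^ 2 * (2 * (1 + r) ^ 2) :=
        mul_le_mul h4 h5 (by positivity) (by positivity)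
    _ = 8 * ((1 + r) * (1 + r)⁻¹) ^ 2 * ((1 + r)⁻¹) ^ 2 := by ring
    _ = 8 * ((1 + r) ^ 2)⁻¹ := by rw [hu, inv_pow]; ring

theorem normX_le_of_bdd {m n : ℤ} (h : BdAll (fun i _ => i.c m n) F) :
    ∃ K, 0 ≤ K ∧ ∀ i, normX (F i) ≤ ENNReal.ofReal (K * i.c m n) := by
  obtain ⟨K, hK, h⟩ := h.ae fun i y hy => (i.c_pos _ _).le
  obtain ⟨C, hC, hCw⟩ := normL2_weightX
  refine ⟨K * C, by positivity, fun i => ?_⟩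
  have hc := (i.c_pos m n).le
  rw [show K * C * i.c m n = K * i.c m n * C by ring]
  refine (normL2_mono ?_).trans (normL2_const_mul (by positivity) hCw)
  filter_upwards [h i] with y ⟨hy, hb⟩
  have hj := jb_pos (logPlus y)
  have hj' := jb_pos y
  rw [norm_smul, Real.norm_eq_abs, abs_of_pos (by positivity), mul_comm]
  gcongr

/-- The weight `(1 + y)` cut off at `2 B₁`. -/
def XW (m n : ℤ) (i : Par) (y : ℝ) : ℝ :=
  i.c m n * (Set.Iic (2 * i.L / i.t)).indicator (fun y => 1 + y) y

theorem XW_nonneg (m n : ℤ) (i : Par) {y : ℝ} (hy : 0 < y) : 0 ≤ XW m n i y := by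
  refine mul_nonneg (i.c_pos _ _).le ?_
  by_cases h : y ∈ Set.Iic (2 * i.L / i.t)
  · rw [Set.indicator_of_mem h]; positivity
  · rw [Set.indicator_of_notMem h]

/-- One factor `L` is the weight `⟨log₊ y⟩`; the other bounds the `L²` norm of `y⁻¹` on `[1, 2
B₁]`, which the growth `1 + y` leaves. -/
theorem normX_le {m n : ℤ} (h : BdAll (XW m n) F) :
    ∃ K, 0 ≤ K ∧ ∀ i, normX (F i) ≤ ENNReal.ofReal (K * (i.c m n * i.L ^ 2)) := by
  obtain ⟨K, hK, h⟩ := h.ae fun i y hy => XW_nonneg m n i hy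
  refine ⟨K * 84, by positivity, fun i => ?_⟩
  have hc := (i.c_pos m n).le
  have hL := i.L_gt
  rw [show K * 84 * (i.c m n * i.L ^ 2) = K * i.c m n * (12 * i.L) * (7 * i.L) by ring]
  refine (normL2_mono ?_).trans (normL2_const_mul (by positivity) (normL2_indicator_inv_le i))
  filter_upwards [h i] with y ⟨hy, hb⟩
  have hj := jb_pos (logPlus y)
  have hj' := jb_pos y
  rw [norm_smul, Real.norm_eq_abs, abs_of_pos (by positivity)]
  rw [XW] at hb
  by_cases h : y ∈ Set.Iic (2 * i.L / i.t)
  · rw [Set.indicator_of_mem h] at hb ⊢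
    have h1 : jb (logPlus y) ≤ 6 * i.L := by
      refine Real.sqrt_le_iff.2 ⟨by positivity, ?_⟩
      have h2 : Real.log (1 + y) ≤ 5 * i.L :=
        (Real.log_le_log (by linarith) (by linarith [show y ≤ _ from h])).trans
          (log_one_add_le_L i)
      have h3 := (logPlus_le_log hy).trans h2
      nlinarith [logPlus_nonneg y]
    have h4 : (jb y ^ 2)⁻¹ * (1 + y) ≤ 2 * (1 / (1 + y)) := by
      rw [jb_sq, inv_mul_le_iff₀ (by positivity), mul_one_div, mul_div_assoc',
        le_div_iff₀ (by positivity)]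
      nlinarith [sq_nonneg (y - 1)]
    calc (jb y ^ 2)⁻¹ * jb (logPlus y) * ‖F i y‖
        ≤ (jb y ^ 2)⁻¹ * (6 * i.L) * (K * (i.c m n * (1 + y))) := by gcongr
      _ = K * i.c m n * (6 * i.L) * ((jb y ^ 2)⁻¹ * (1 + y)) := by ring
      _ ≤ K * i.c m n * (6 * i.L) * (2 * (1 / (1 + y))) := by gcongr
      _ = _ := by ring
  · rw [Set.indicator_of_notMem h] at hb ⊢
    have : ‖F i y‖ = 0 := le_antisymm (by simpa using hb) (norm_nonneg _)
    rw [this]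
    simp

/-- The weight of `v` and `y ∂_y v` for `𝓗̇²₁`. -/
def EW (i : Par) (y : ℝ) : ℝ := i.b ^ 2 * (y ^ 2 * (hw i y + hTail i y))

/-- The weight of `y² ∂_yy v` for `𝓗̇²₁`. -/
def ED (i : Par) (y : ℝ) : ℝ := i.b ^ 2 * (y ^ 2 * (hd i y + hTail i y))

theorem normH21_le (h : BdAll EW F) (h' : BdAll EW (fun i => euler (F i)))
    (h'' : BdAll ED (fun i y => y ^ 2 • deriv (deriv (F i)) y)) :
    ∃ K, 0 ≤ K ∧ ∀ i, normH21 (F i) ≤ ENNReal.ofReal (K * i.b ^ 2) := by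
  have hEW : ∀ i : Par, ∀ y, 0 < y → 0 ≤ EW i y := fun i y hy => by
    have := hw_nonneg i hy
    have := hTail_nonneg i y
    unfold EW
    positivity
  obtain ⟨K, hK, h⟩ := h.ae hEW
  obtain ⟨K', hK', h'⟩ := h'.ae hEW
  obtain ⟨K2, hK2, h''⟩ := h''.ae fun i y hy => by
    have := hd_nonneg i hy
    have := hTail_nonneg i y
    unfold ED
    positivity
  obtain ⟨C, hC, hCw⟩ := normL2_hw
  obtain ⟨C', hC', hCd⟩ := normL2_hd
  refine ⟨K2 * (C' + 2) + (K + K') * (C + 2), by positivity, fun i => ?_⟩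
  have hb := i.pos
  have e : (K2 * (C' + 2) + (K + K') * (C + 2)) * i.b ^ 2
      = K2 * i.b ^ 2 * (C' + 2) + (K + K') * i.b ^ 2 * (C + 2) := by ring
  rw [e, ENNReal.ofReal_add (by positivity) (by positivity)]
  have n1 := normL2_add_le (measurable_hd i) (measurable_hTail i) hC' (by norm_num) (hCd i)
    (normL2_hTail i)
  have n2 := normL2_add_le (measurable_jb_hw i) (measurable_hTail i) hC (by norm_num) (hCw i)
    (normL2_hTail i)
  refine add_le_add ?_ ?_
  · refine (normL2_mono ?_).trans (normL2_const_mul (by positivity) n1)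
    filter_upwards [h'' i] with y ⟨hy, hb⟩
    rw [ED, norm_smul, Real.norm_eq_abs, abs_of_pos (by positivity)] at hb
    refine le_of_mul_le_mul_left (hb.trans (le_of_eq ?_)) (show 0 < y ^ 2 by positivity)
    ring
  · refine (normL2_mono ?_).trans (normL2_const_mul (by positivity) n2)
    filter_upwards [h i, h' i] with y ⟨hy, h1⟩ ⟨_, h2⟩
    have hj := jb_pos (logPlus y)
    have hj' := jb_pos (Real.log y)
    have hle : (jb (Real.log y))⁻¹ ≤ (jb (logPlus y))⁻¹ := by
      refine inv_anti₀ hj (Real.sqrt_le_sqrt ?_)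
      have : logPlus y ^ 2 ≤ Real.log y ^ 2 := by
        unfold logPlus
        rcases le_total 0 (Real.log y) with h | h
        · rw [max_eq_right h]
        · rw [max_eq_left h, zero_pow two_ne_zero]; positivity
      linarith
    have hT := hTail_nonneg i y
    have hH := hw_nonneg i hy
    have habs : absNegOne (F i) y ≤ y⁻¹ * ((K + K') * EW i y) := by
      refine max_le ?_ ?_
      · rw [euler, norm_smul, Real.norm_eq_abs, abs_of_pos hy] at h2
        rw [le_inv_mul_iff₀ hy]
        exact h2.trans (mul_le_mul_of_nonneg_right (by linarith) (hEW i y hy))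
      · refine mul_le_mul_of_nonneg_left ?_ (inv_nonneg.2 hy.le)
        exact h1.trans (mul_le_mul_of_nonneg_right (by linarith) (hEW i y hy))
    have habs0 : 0 ≤ absNegOne (F i) y := le_max_of_le_left (norm_nonneg _)
    have hpos : 0 ≤ y⁻¹ * (jb (Real.log y))⁻¹ * absNegOne (F i) y := by positivity
    rw [Real.norm_eq_abs, abs_of_nonneg hpos]
    calc y⁻¹ * (jb (Real.log y))⁻¹ * absNegOne (F i) y
        ≤ y⁻¹ * (jb (logPlus y))⁻¹ * (y⁻¹ * ((K + K') * EW i y)) := by gcongr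
      _ = (K + K') * i.b ^ 2 * ((jb (logPlus y))⁻¹ * hw i y
            + (jb (logPlus y))⁻¹ * hTail i y) := by rw [EW]; field_simp
      _ ≤ _ := by
        gcongr
        exact mul_le_of_le_one_left hT (inv_le_one_of_one_le₀ (one_le_jb _))

/-- The weight of the error of the first compatibility relation for `L²`. -/
def LW (i : Par) (y : ℝ) : ℝ :=
  i.b * (i.t * (Set.Iic (2 / i.t)).indicator (fun _ => 1) y
    + (i.t ^ 2 * (Set.Iic (2 * i.L / i.t)).indicator (fun _ => 1) y + hTail i y))

theorem normL2_le (h : BdAll LW F) :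
    ∃ K, 0 ≤ K ∧ ∀ i, normL2 (F i) ≤ ENNReal.ofReal (K * i.b) := by
  obtain ⟨K, hK, h⟩ := h.ae fun i y hy => by
    have h1 := indicator_one_nonneg (2 / i.t) y
    have h2 := indicator_one_nonneg (2 * i.L / i.t) y
    have := hTail_nonneg i y
    have := i.pos
    have := i.t_pos
    unfold LW
    positivity
  refine ⟨K * (6 + (12 + 2)), by positivity, fun i => ?_⟩
  have ht := i.t_pos
  have hL := i.L_pos
  have hb := i.pos
  have n1 : normL2 (fun y => i.t ^ 2 * (Set.Iic (2 * i.L / i.t)).indicator (fun _ => (1 : ℝ)) y)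
      ≤ ENNReal.ofReal 12 := by
    refine (normL2_const_mul (by positivity) (normL2_indicator_one (R := 2 * i.L / i.t)
      (by positivity))).trans (ENNReal.ofReal_le_ofReal ?_)
    have h := i.t_mul_L_pow 1
    norm_num at h
    have e : i.t ^ 2 * (3 * (2 * i.L / i.t)) = 6 * (i.t * i.L) := by field_simp; norm_num
    rw [e]; linarith
  have n2 := normL2_add_le ((measurable_indicator_one _).const_mul _)
    (((measurable_indicator_one _).const_mul _).add (measurable_hTail i)) (by norm_num)
    (by norm_num) (normL2_t_indicator i) (normL2_add_le ((measurable_indicator_one _).const_mul _)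
      (measurable_hTail i) (by norm_num) (by norm_num) n1 (normL2_hTail i))
  rw [show K * (6 + (12 + 2)) * i.b = K * i.b * (6 + (12 + 2)) by ring]
  refine (normL2_mono ?_).trans (normL2_const_mul (by positivity) n2)
  filter_upwards [h i] with y ⟨hy, h1⟩
  refine h1.trans (le_of_eq ?_)
  rw [LW, mul_assoc]
  rfl

end

section

variable {χ : ℝ → ℝ} {S S' : Region Par} {m n : ℤ} {F G : Par → ℝ → ℂ}

/-! ### Families bounded in `𝓗̇¹₂` -/

theorem euler_add {f g : ℝ → ℂ} {y : ℝ} (hf : DifferentiableAt ℝ f y)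
    (hg : DifferentiableAt ℝ g y) : euler (fun y => f y + g y) y = euler f y + euler g y := by
  rw [euler, deriv_fun_add hf hg, smul_add]; rfl

theorem euler_const_mul {f : ℝ → ℂ} {y : ℝ} (c : ℂ) (hf : DifferentiableAt ℝ f y) :
    euler (fun y => c * f y) y = c * euler f y := by
  rw [euler, deriv_const_mul c hf, euler, mul_smul_comm]

theorem euler_ofReal {f : ℝ → ℝ} {y : ℝ} (hf : DifferentiableAt ℝ f y) :
    euler (fun y => (f y : ℂ)) y = ((euler f y : ℝ) : ℂ) := by
  rw [euler, hf.hasDerivAt.ofReal_comp.deriv, euler, Complex.real_smul, smul_eq_mul]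
  push_cast
  rfl

/-- The pointwise bounds on a region that place a family in `𝓗̇¹₂` with norm `O(t^m L^{-n})`. -/
structure HCls (S : Region Par) (m n : ℤ) (F : Par → ℝ → ℂ) : Prop where
  diff : ∀ i, ∀ y ∈ S i, DifferentiableAt ℝ (F i) y
  bd : Bd S (HW m n) F
  bd' : Bd S (HD m n) (fun i => euler (F i))

theorem HCls.add (h : HCls S m n F) (h' : HCls S m n G) : HCls S m n (fun i y => F i y + G i y) :=
  ⟨fun i y hy => (h.diff i y hy).add (h'.diff i y hy), h.bd.add h'.bd,
    (h.bd'.add h'.bd').congr fun i y hy => (euler_add (h.diff i y hy) (h'.diff i y hy)).symm⟩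

theorem HCls.congr (h : HCls S m n F) (e : ∀ i, ∀ y ∈ S i, F i y = G i y) : HCls S m n G :=
  ⟨fun i y hy => (h.diff i y hy).congr_of_eventuallyEq (eventuallyEq_of_region e hy).symm,
    h.bd.congr e, h.bd'.congr fun _ _ hy => euler_congr e hy⟩

theorem HCls.zero (h : ∀ i, ∀ y ∈ S i, F i y = 0) : HCls S m n F := by
  have h0 : HCls S m n (fun _ _ => (0 : ℂ)) :=
    ⟨fun _ _ _ => differentiableAt_const _, Bd.of_zero fun _ _ _ => rfl,
      Bd.of_zero fun _ _ _ => by simp [euler]⟩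
  exact h0.congr fun i y hy => (h i y hy).symm

theorem HCls.scalar {m' n' : ℤ} (h : HCls S m n F) {c : Par → ℂ}
    (hc : Sy RAll 0 0 m' n' (fun i _ => c i)) :
    HCls S (m + m') (n + n') (fun i y => c i * F i y) := by
  obtain ⟨C, hC⟩ := hc.bd
  have hC' : ∀ i, ‖c i‖ ≤ |C| * i.c m' n' := fun i => by
    have h1 := hC i 1 (Set.mem_Ioi.2 one_pos)
    simp only [W, zpow_zero, mul_one, one_mul] at h1
    exact h1.trans (mul_le_mul_of_nonneg_right (le_abs_self _) (i.c_pos _ _).le)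
  have key : ∀ {w : Par → ℝ → ℝ} {H : Par → ℝ → ℂ}, Bd S (fun i y => i.c m n * w i y) H →
      Bd S (fun i y => i.c (m + m') (n + n') * w i y) (fun i y => c i * H i y) := by
    rintro w H ⟨K, hK⟩
    refine ⟨|C| * K, fun i y hy => ?_⟩
    change _ ≤ |C| * K * (i.c (m + m') (n + n') * w i y)
    rw [norm_mul, ← Par.c_mul]
    calc ‖c i‖ * ‖H i y‖ ≤ (|C| * i.c m' n') * (K * (i.c m n * w i y)) :=
          mul_le_mul (hC' i) (hK i y hy) (norm_nonneg _)
            (mul_nonneg (abs_nonneg _) (i.c_pos _ _).le)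
      _ = _ := by ring
  exact ⟨fun i y hy => (h.diff i y hy).const_mul _, key h.bd, (key h.bd').congr
    fun i y hy => (euler_const_mul _ (h.diff i y hy)).symm⟩

theorem W_decay_le {i : Par} {y : ℝ} (hy : 0 < y) : W 1 (-2) m n i y ≤ HD m n i y := by
  have h1 := indicator_inv_nonneg (2 * i.L / i.t) hy
  have h2 := indicator_one_nonneg (2 / i.t) y
  have hL := i.L_pos
  have ht := i.t_pos
  have e : W 1 (-2) m n i y = i.c m n * (y * (1 / (1 + y) ^ 2)) := by
    rw [W, zpow_one, zpow_neg, zpow_ofNat]; ring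
  rw [e, HD]
  refine mul_le_mul_of_nonneg_left (mul_le_mul_of_nonneg_left ?_ hy.le) (i.c_pos _ _).le
  rw [hd]
  have : 0 ≤ i.L⁻¹ * (Set.Iic (2 * i.L / i.t)).indicator (fun y => 1 / (1 + y)) y
    + i.t * (Set.Iic (2 / i.t)).indicator (fun _ => 1) y := by positivity
  linarith

theorem W_one_neg_one_le {i : Par} {y : ℝ} (hy : 0 < y) : W 1 (-1) m n i y ≤ HW m n i y := by
  have h2 := indicator_one_nonneg (2 / i.t) y
  have ht := i.t_pos
  have e : W 1 (-1) m n i y = i.c m n * (y * (1 / (1 + y))) := by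
    rw [W, zpow_one, zpow_neg_one]; ring
  rw [e, HW]
  refine mul_le_mul_of_nonneg_left (mul_le_mul_of_nonneg_left ?_ hy.le) (i.c_pos _ _).le
  rw [hw]
  have : 0 ≤ i.t * (Set.Iic (2 / i.t)).indicator (fun _ => 1) y := by positivity
  linarith

theorem W_log_le {i : Par} {y : ℝ} (hy : 0 < y) (hR : y ∈ RA1 i) :
    W 1 (-1) m (n + 1) i y ≤ HD m n i y := by
  have h2 := indicator_one_nonneg (2 / i.t) y
  have hL := i.L_pos
  have ht := i.t_pos
  have e : W 1 (-1) m (n + 1) i y = i.c m n * (y * (i.L⁻¹ * (1 / (1 + y)))) := by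
    have : i.c m (n + 1) = i.c m n * i.L⁻¹ := by
      have h : i.L⁻¹ = i.c 0 1 := by simp [Par.c]
      rw [h, Par.c_mul, add_zero]
    rw [W, zpow_one, zpow_neg_one, this]; ring
  rw [e, HD]
  refine mul_le_mul_of_nonneg_left (mul_le_mul_of_nonneg_left ?_ hy.le) (i.c_pos _ _).le
  rw [hd, Set.indicator_of_mem (show y ∈ Set.Iic (2 * i.L / i.t) from hR.2.le)]
  have : 0 ≤ i.t * (Set.Iic (2 / i.t)).indicator (fun _ => 1) y := by positivity
  have : 0 ≤ 1 / (1 + y) ^ 2 := by positivity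
  linarith

theorem W_inner_eq {i : Par} {y : ℝ} (hR : y ∈ RA0 i) : W 1 0 (m + 1) n i y =
    i.c m n * (y * (i.t * (Set.Iic (2 / i.t)).indicator (fun _ => 1) y)) := by
  have : i.c (m + 1) n = i.c m n * i.t := by
    have h : i.t = i.c 1 0 := by simp [Par.c]
    rw [h, Par.c_mul, add_zero]
  rw [Set.indicator_of_mem (show y ∈ Set.Iic (2 / i.t) from hR.2.le), W, zpow_one, zpow_zero, this]
  ring

theorem W_inner_le_HW {i : Par} {y : ℝ} (hy : 0 < y) (hR : y ∈ RA0 i) :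
    W 1 0 (m + 1) n i y ≤ HW m n i y := by
  rw [W_inner_eq hR, HW]
  refine mul_le_mul_of_nonneg_left (mul_le_mul_of_nonneg_left ?_ hy.le) (i.c_pos _ _).le
  rw [hw]
  have : 0 ≤ 1 / (1 + y) := by positivity
  linarith

theorem W_inner_le_HD {i : Par} {y : ℝ} (hy : 0 < y) (hR : y ∈ RA0 i) :
    W 1 0 (m + 1) n i y ≤ HD m n i y := by
  rw [W_inner_eq hR, HD]
  refine mul_le_mul_of_nonneg_left (mul_le_mul_of_nonneg_left ?_ hy.le) (i.c_pos _ _).le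
  rw [hd]
  have := indicator_inv_nonneg (2 * i.L / i.t) hy
  have := i.L_pos
  have : 0 ≤ 1 / (1 + y) ^ 2
    + i.L⁻¹ * (Set.Iic (2 * i.L / i.t)).indicator (fun y => 1 / (1 + y)) y := by positivity
  linarith

theorem Bd.of_le {w w' : Par → ℝ → ℝ} (h : Bd S w F) (hw : ∀ i, ∀ y ∈ S i, |w i y| ≤ w' i y) :
    Bd S w' F :=
  h.mono ⟨1, fun i y hy => by rw [one_mul]; exact hw i y hy⟩

/-- Symbols that decay at infinity. -/
theorem HCls.of_decay (h : Sy S 1 (-2) m n F) : HCls S m n F := by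
  refine ⟨fun i y hy => Sym.diff h hy, ?_, ?_⟩
  · have h1 : Sy S 1 (-1) m n F := h.le
    refine h1.bd.of_le fun i y hy => ?_
    rw [abs_of_pos (W_pos (S.pos i y hy))]
    exact W_one_neg_one_le (S.pos i y hy)
  · refine h.euler.bd.of_le fun i y hy => ?_
    rw [abs_of_pos (W_pos (S.pos i y hy))]
    exact W_decay_le (S.pos i y hy)

/-- Bounded symbols with a logarithmic gain. -/
theorem HCls.of_log (hS : ∀ i, S i ⊆ RA1 i) (h : Sy S 1 (-1) m (n + 1) F) : HCls S m n F := by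
  refine ⟨fun i y hy => Sym.diff h hy, ?_, ?_⟩
  · have h1 : Sy S 1 (-1) m n F := h.le
    refine h1.bd.of_le fun i y hy => ?_
    rw [abs_of_pos (W_pos (S.pos i y hy))]
    exact W_one_neg_one_le (S.pos i y hy)
  · refine h.euler.bd.of_le fun i y hy => ?_
    rw [abs_of_pos (W_pos (S.pos i y hy))]
    exact W_log_le (S.pos i y hy) (hS i hy)

/-- Symbols supported below `2 B₀`. -/
theorem HCls.of_inner (hS : ∀ i, S i ⊆ RA0 i) (h : Sy S 1 0 (m + 1) n F) : HCls S m n F := by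
  refine ⟨fun i y hy => Sym.diff h hy, ?_, ?_⟩
  · refine h.bd.of_le fun i y hy => ?_
    rw [abs_of_pos (W_pos (S.pos i y hy))]
    exact W_inner_le_HW (S.pos i y hy) (hS i hy)
  · refine h.euler.bd.of_le fun i y hy => ?_
    rw [abs_of_pos (W_pos (S.pos i y hy))]
    exact W_inner_le_HD (S.pos i y hy) (hS i hy)

/-- Bounded symbols whose Euler derivative decays up to a logarithmic gain. -/
theorem HCls.of_euler {A B : Par → ℝ → ℂ} (hS : ∀ i, S i ⊆ RA1 i) (h : Sy S 1 (-1) m n F)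
    (hA : Sy S 1 (-2) m n A) (hB : Sy S 1 (-1) m (n + 1) B)
    (e : ∀ i, ∀ y ∈ S i, euler (F i) y = A i y + B i y) : HCls S m n F := by
  refine ⟨fun i y hy => Sym.diff h hy, h.bd.of_le fun i y hy => ?_, ?_⟩
  · rw [abs_of_pos (W_pos (S.pos i y hy))]
    exact W_one_neg_one_le (S.pos i y hy)
  · have h1 : Bd S (HD m n) A := hA.bd.of_le fun i y hy => by
      rw [abs_of_pos (W_pos (S.pos i y hy))]
      exact W_decay_le (S.pos i y hy)
    have h2 : Bd S (HD m n) B := hB.bd.of_le fun i y hy => by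
      rw [abs_of_pos (W_pos (S.pos i y hy))]
      exact W_log_le (S.pos i y hy) (hS i hy)
    exact (h1.add h2).congr fun i y hy => (e i y hy).symm

/-- Membership in the class on all of the regions, with support below `2 B₁`. -/
structure HAll (m n : ℤ) (F : Par → ℝ → ℂ) : Prop where
  r0 : HCls R0 m n F
  r1 : HCls R1 m n F
  r2 : HCls R2 m n F
  r3 : HCls R3 m n F
  r4 : ∀ i, ∀ y ∈ R4 i, F i y = 0

theorem HAll.norm_le (h : HAll m n F) :
    ∃ K, 0 ≤ K ∧ ∀ i, normH12 (F i) ≤ ENNReal.ofReal (K * i.c m n) :=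
  have h4 : HCls R4 m n F := HCls.zero h.r4
  normH12_le ⟨h.r0.bd, h.r1.bd, h.r2.bd, h.r3.bd, h4.bd⟩
    ⟨h.r0.bd', h.r1.bd', h.r2.bd', h.r3.bd', h4.bd'⟩

/-! ### The class of `P₂` -/

/-- The decaying part of `y ∂_y U₂`. -/
def eU2a (χ : ℝ → ℝ) (b y : ℝ) : ℝ := -(y * Lam 0 halfyQ y) - 2 * (pf y * U2 χ b y)

/-- The part of `y ∂_y U₂` with a logarithmic gain. -/
def eU2b (χ : ℝ → ℝ) (b y : ℝ) : ℝ := cb χ b * (y * (halfyQ y * cut χ (B0 b) y))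

theorem euler_U2 (hχ : IsCutoff χ) (i : Par) {y : ℝ} (hy : 0 < y) :
    euler (U2 χ i.b) y = eU2a χ i.b y + eU2b χ i.b y := by
  rw [euler, (hasDerivAt_U2 hχ i hy).deriv, eU2a, eU2b, g2_eq, smul_eq_mul]
  field_simp
  ring

theorem sy_eU2a (hχ : IsCutoff χ) (hS : S.Initial) : Sy S 1 (-2) 0 0 (fun i => eU2a χ i.b) :=
  Sy.sub (Sy.neg (Sy.id.times sy_Lamf)).le
    ((Sy.number 2).times (sy_pf.times (sy_U2 hχ hS))).le

theorem sy_eU2b (hχ : IsCutoff χ) : Sy S 1 (-1) 0 1 (fun i => eU2b χ i.b) :=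
  ((sy_cb hχ).times (Sy.id.times (sy_f.times hχ.sy0))).le

theorem hCls_U2 (hχ : IsCutoff χ) : HCls R0 0 0 (fun i y => (U2 χ i.b y : ℂ)) :=
  HCls.of_euler R0.sub_RA1 (sy_U2 hχ R0.initial).ofReal (sy_eU2a hχ R0.initial).ofReal
    (sy_eU2b hχ).ofReal fun i y hy => by
      have hy0 := R0.pos i y hy
      rw [euler_ofReal (hasDerivAt_U2 hχ i hy0).differentiableAt, euler_U2 hχ i hy0]
      push_cast
      rfl

theorem hCls_euler_U2 (hχ : IsCutoff χ) :
    HCls R0 0 0 (fun i y => ((euler (U2 χ i.b) y : ℝ) : ℂ)) :=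
  ((HCls.of_decay (sy_eU2a hχ R0.initial).ofReal).add
    (HCls.of_log R0.sub_RA1 (sy_eU2b hχ).ofReal)).congr fun i y hy => by
      rw [euler_U2 hχ i (R0.pos i y hy)]; push_cast; rfl

theorem hCls_U2b (hχ : IsCutoff χ) : HCls R0 (-2) 1 (fun i y => (U2b χ i.b y : ℂ)) := by
  have hU := sy_U2b hχ R0.initial
  have hA : Sy R0 1 (-2) (-2) 1 (fun i y => -2 * (pf y * U2b χ i.b y)) :=
    ((Sy.number (-2)).times (sy_pf.times hU)).le
  have hB : Sy R0 1 (-1) (-2) (1 + 1) (fun i y => -(y * g2b χ i.b y)) :=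
    Sy.neg (Sy.id.times (sy_g2b_inner hχ)).le
  refine HCls.of_euler R0.sub_RA1 hU.ofReal hA.ofReal hB.ofReal fun i y hy => ?_
  have hy0 := R0.pos i y hy
  have hd := (adm_g2b hχ i).hasDerivAt_Uop hy0
  rw [U2b, euler_ofReal hd.differentiableAt, euler, hd.deriv, smul_eq_mul]
  push_cast
  have : (y : ℂ) ≠ 0 := by exact_mod_cast hy0.ne'
  field_simp
  ring

theorem P2_inner (hχ : IsCutoff χ) (i : Par) {y : ℝ} (hy : y ∈ R0 i) :
    P2 χ i.b i.eta y = i.be * i.be * U2 χ i.b y + P2r χ i y := by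
  rw [P2_split, cut0_eq_one hχ (R0.lt hy).le, Complex.ofReal_one, one_mul]

theorem sy_P2r_R0 (hχ : IsCutoff χ) : Sy R0 3 (-2) 5 1 (P2r χ) := (sy_P2r hχ).restrict R0.sub_RA0

theorem hCls_P2_R0 (hχ : IsCutoff χ) : HCls R0 4 0 (fun i => P2 χ i.b i.eta) :=
  (((hCls_U2 hχ).scalar sy_be2).add (HCls.of_inner R0.sub_RA0 (sy_P2r_R0 hχ).le)).congr
    fun i _ hy => (P2_inner hχ i hy).symm

theorem euler_P2_inner (hχ : IsCutoff χ) (i : Par) {y : ℝ} (hy : y ∈ R0 i) :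
    euler (P2 χ i.b i.eta) y
      = i.be * i.be * ((euler (U2 χ i.b) y : ℝ) : ℂ) + euler (P2r χ i) y := by
  have hU := (hasDerivAt_U2 hχ i (R0.pos i y hy)).differentiableAt
  rw [euler_congr (S := R0) (F := fun i => P2 χ i.b i.eta) (fun i y hy => P2_inner hχ i hy) hy,
    euler_add ((hU.hasDerivAt.ofReal_comp.differentiableAt).const_mul _)
      (Sym.diff (sy_P2r_R0 hχ) hy),
    euler_const_mul _ hU.hasDerivAt.ofReal_comp.differentiableAt, euler_ofReal hU]

theorem hCls_euler_P2_R0 (hχ : IsCutoff χ) : HCls R0 4 0 (fun i => euler (P2 χ i.b i.eta)) :=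
  (((hCls_euler_U2 hχ).scalar sy_be2).add
    (HCls.of_inner R0.sub_RA0 (sy_P2r_R0 hχ).euler.le)).congr
    fun i _ hy => (euler_P2_inner hχ i hy).symm

theorem sy_const (c : ℂ) : Sy S 0 0 0 0 (fun _ _ => c) := Sy.number c

theorem hAll_I_P2 (hχ : IsCutoff χ) : HAll 4 0 (fun i y => Complex.I * P2 χ i.b i.eta y) where
  r0 := (hCls_P2_R0 hχ).scalar sy_I
  r1 := HCls.of_log R1.sub_RA1 (Sy.constMul (sy_P2_R1 hχ) _)
  r2 := HCls.zero fun i y hy => by rw [P2_out hχ R2.out hy, mul_zero]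
  r3 := HCls.zero fun i y hy => by rw [P2_out hχ R3.out hy, mul_zero]
  r4 := fun i y hy => by rw [P2_out hχ R4.out hy, mul_zero]

theorem Lam_eq_zero {s : ℝ} (h : ∀ i, ∀ y ∈ S i, F i y = 0) {i : Par} {y : ℝ} (hy : y ∈ S i) :
    Lam s (F i) y = 0 := by
  have e := euler_congr (G := fun _ _ => (0 : ℂ)) h hy
  rw [Lam, h i y hy, smul_zero, zero_add]
  change euler (F i) y = 0
  rw [e]
  simp [euler]

theorem hAll_Lam_P2 (hχ : IsCutoff χ) : HAll 4 0 (fun i => Lam (-2) (P2 χ i.b i.eta)) where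
  r0 := (((hCls_P2_R0 hχ).scalar (sy_const (3 : ℂ))).add (hCls_euler_P2_R0 hχ)).congr
    fun i y _ => by
      rw [Lam, Complex.real_smul]
      norm_num
      rfl
  r1 := HCls.of_log R1.sub_RA1 ((sy_P2_R1 hχ).lam _)
  r2 := HCls.zero fun i y hy => Lam_eq_zero (F := fun i => P2 χ i.b i.eta)
    (fun i y hy => P2_out hχ R2.out hy) hy
  r3 := HCls.zero fun i y hy => Lam_eq_zero (F := fun i => P2 χ i.b i.eta)
    (fun i y hy => P2_out hχ R3.out hy) hy
  r4 := fun i y hy => Lam_eq_zero (F := fun i => P2 χ i.b i.eta)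
    (fun i y hy => P2_out hχ R4.out hy) hy

theorem hCls_dBP2_R0 (hχ : IsCutoff χ) : HCls R0 2 0 (dBP2 χ) := by
  have h1 : HCls R0 2 0 (fun i y => 2 * i.be * (U2 χ i.b y : ℂ)) :=
    (hCls_U2 hχ).scalar (((sy_const 2).times sy_be).le : Sy RAll 0 0 2 0 _)
  have h2 : Sy R0 1 (-1) 2 1 (fun i y => i.be * i.be * (U2b χ i.b y : ℂ)) :=
    (sy_be2.times (sy_U2b hχ R0.initial).ofReal).le
  have h3 : Sy R0 1 0 3 0 (fun i y => 3 * Complex.I * (i.b * i.b) * (U30 χ i.b y : ℂ)) :=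
    ((((sy_const 3).times sy_I).times (sy_bC.times sy_bC)).times
      ((sy_U30' hχ).restrict R0.sub_RA0).ofReal).le
  have h4 : Sy R0 1 0 3 0 (fun i y => Complex.I * (i.b * i.b * i.b) * (U30b χ i.b y : ℂ)) :=
    ((sy_I.times ((sy_bC.times sy_bC).times sy_bC)).times
      (sy_U30b hχ R0.initial).ofReal).leB0 R0.leB0 1
  refine ((h1.add (HCls.of_log R0.sub_RA1 h2)).add
    (HCls.of_inner R0.sub_RA0 (Sy.add h3 h4))).congr fun i y hy => ?_
  rw [dBP2, dcut0_eq_zero hχ (R0.lt hy), cut0_eq_one hχ (R0.lt hy).le]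
  push_cast
  ring

theorem sy_dBP2_R1 (hχ : IsCutoff χ) : Sy R1 1 (-1) 2 1 (dBP2 χ) := by
  have hU : Sy R1 1 (-1) 0 1 (fun i y => (U2 χ i.b y : ℂ)) :=
    ((sy_U2' hχ).restrict R1.sub_RA0).ofReal.geB0 R1.geB0 1
  have hU3 : Sy R1 1 (-1) (-2) 1 (fun i y => (U30 χ i.b y : ℂ)) :=
    ((sy_U30' hχ).restrict R1.sub_RA0).ofReal.leB0 R1.leB0 1
  have hUb : Sy R1 1 (-1) (-2) 1 (fun i y => (U2b χ i.b y : ℂ)) :=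
    ((sy_U2b hχ RA0.initial).restrict R1.sub_RA0).ofReal
  have hU3b : Sy R1 1 (-1) (-4) 1 (fun i y => (U30b χ i.b y : ℂ)) :=
    ((sy_U30b hχ RA0.initial).restrict R1.sub_RA0).ofReal.leB0 R1.leB0 2
  have hb3 : Sy R1 0 0 6 0 (fun i _ => (i.b : ℂ) ^ 3) := by
    simp only [pow_succ, pow_zero, one_mul]
    exact ((sy_bC.times sy_bC).times sy_bC).le
  have hb2 : Sy R1 0 0 4 0 (fun i _ => (i.b : ℂ) ^ 2) := by
    simp only [sq]
    exact (sy_bC.times sy_bC).le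
  have hbe2 : Sy R1 0 0 4 0 (fun i _ => i.be ^ 2) := by
    simp only [sq]
    exact sy_be2
  unfold dBP2
  refine Sy.add ((sy_dcut0 hχ).ofReal.times (Sy.add (p := 1) (q := -1) (m := 4) (n := 1)
    (hbe2.times hU).le ((sy_I.times hb3).times hU3).le)).le (hχ.syC0.times (Sy.add (p := 1)
      (q := -1) (m := 2) (n := 1) (Sy.add (Sy.add ?_ ?_) ?_) ?_)).le
  · exact (((sy_const 2).times sy_be).times hU).le
  · exact (hbe2.times hUb).le
  · exact ((((sy_const 3).times sy_I).times hb2).times hU3).le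
  · exact ((sy_I.times hb3).times hU3b).le

theorem dBP2_out (hχ : IsCutoff χ) (hS : S.Out) {i : Par} {y : ℝ} (hy : y ∈ S i) :
    dBP2 χ i y = 0 := by
  rw [dBP2, hS.cut0 hχ hy, hS.dcut0 hχ hy]; simp

theorem hAll_dBP2 (hχ : IsCutoff χ) : HAll 2 0 (fun i => dB (P2 χ) i.b i.eta) where
  r0 := (hCls_dBP2_R0 hχ).congr fun i y hy => (dB_P2 hχ i (R0.pos i y hy)).symm
  r1 := (HCls.of_log R1.sub_RA1 (sy_dBP2_R1 hχ)).congr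
    fun i y hy => (dB_P2 hχ i (R1.pos i y hy)).symm
  r2 := HCls.zero fun i y hy => by rw [dB_P2 hχ i (R2.pos i y hy), dBP2_out hχ R2.out hy]
  r3 := HCls.zero fun i y hy => by rw [dB_P2 hχ i (R3.pos i y hy), dBP2_out hχ R3.out hy]
  r4 := fun i y hy => by rw [dB_P2 hχ i (R4.pos i y hy), dBP2_out hχ R4.out hy]

theorem sy_dEtaP2_coeff : Sy S 0 0 2 0 (fun i _ => -(2 * Complex.I * i.be)) :=
  Sy.neg (((sy_const 2).times sy_I).times sy_be).le

theorem sy_dEtaP2_R1 (hχ : IsCutoff χ) : Sy R1 1 (-1) 2 1 (fun i => dEta (P2 χ) i.b i.eta) := by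
  have hU : Sy R1 1 (-1) 0 1 (fun i y => (U2 χ i.b y : ℂ)) :=
    ((sy_U2' hχ).restrict R1.sub_RA0).ofReal.geB0 R1.geB0 1
  exact ((hχ.syC0.times (sy_dEtaP2_coeff.times hU)).le : Sy R1 1 (-1) 2 1 _).congr
    fun i y _ => (dEta_P2 χ i y).symm

theorem dEta_P2_out (hχ : IsCutoff χ) (hS : S.Out) {i : Par} {y : ℝ} (hy : y ∈ S i) :
    dEta (P2 χ) i.b i.eta y = 0 := by
  rw [dEta_P2, hS.cut0 hχ hy]; simp

theorem hAll_dEtaP2 (hχ : IsCutoff χ) : HAll 2 0 (fun i => dEta (P2 χ) i.b i.eta) where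
  r0 := ((hCls_U2 hχ).scalar (sy_dEtaP2_coeff)).congr fun i y hy => by
    rw [dEta_P2, cut0_eq_one hχ (R0.lt hy).le, Complex.ofReal_one, one_mul]
  r1 := HCls.of_log R1.sub_RA1 (sy_dEtaP2_R1 hχ)
  r2 := HCls.zero fun i y hy => dEta_P2_out hχ R2.out hy
  r3 := HCls.zero fun i y hy => dEta_P2_out hχ R3.out hy
  r4 := fun i y hy => dEta_P2_out hχ R4.out hy

/-! ### The modulation vectors of `P₁` in `X` -/

theorem Sy.bd_const (h : Sy S 0 0 m n F) : Bd S (fun i _ => i.c m n) F :=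
  h.bd.of_le fun i y _ => by
    simp only [W, zpow_zero, one_mul]
    rw [abs_of_pos (i.c_pos _ _)]

theorem Sy.bd_XW (h : Sy S 0 1 m n F) (hS : ∀ i, S i ⊆ RA1 i) : Bd S (XW m n) F :=
  h.bd.of_le fun i y hy => by
    rw [abs_of_pos (W_pos (S.pos i y hy)), XW,
      Set.indicator_of_mem (show y ∈ Set.Iic (2 * i.L / i.t) from (hS i hy).2.le), W, zpow_zero,
      zpow_one, one_mul, mul_comm]

theorem bdAll_I_P1 (hχ : IsCutoff χ) :
    BdAll (fun i _ => i.c 2 0) (fun i y => Complex.I * P1 χ i.b i.eta y) := by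
  have key : ∀ {S : Region Par}, Sy S 1 (-2) 2 0 (fun i => P1 χ i.b i.eta) →
      Bd S (fun i _ => i.c 2 0) (fun i y => Complex.I * P1 χ i.b i.eta y) := fun h =>
    ((Sy.constMul h Complex.I).le : Sy _ 0 0 2 0 _).bd_const
  exact ⟨key (sy_P1 hχ R0.sub_RA0), key (sy_P1 hχ R1.sub_RA0), key (sy_P1_out hχ R2.out),
    key (sy_P1_out hχ R3.out), key (sy_P1_out hχ R4.out)⟩

theorem bdAll_Lam_P1 (hχ : IsCutoff χ) :
    BdAll (fun i _ => i.c 2 0) (fun i => Lam (-1) (P1 χ i.b i.eta)) := by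
  have key : ∀ {S : Region Par}, Sy S 1 (-2) 2 0 (fun i => P1 χ i.b i.eta) →
      Bd S (fun i _ => i.c 2 0) (fun i => Lam (-1) (P1 χ i.b i.eta)) := fun h =>
    ((Sy.lam h (-1)).le : Sy _ 0 0 2 0 _).bd_const
  exact ⟨key (sy_P1 hχ R0.sub_RA0), key (sy_P1 hχ R1.sub_RA0), key (sy_P1_out hχ R2.out),
    key (sy_P1_out hχ R3.out), key (sy_P1_out hχ R4.out)⟩

theorem bdAll_dB_P1 (hχ : IsCutoff χ) : BdAll (XW 2 0)
    (fun i y => dB (P1 χ) i.b i.eta y + cut χ (B1 i.b) y * (Complex.I * halfyQ y)) := by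
  have h0 : Sy RA0 0 1 2 0
      (fun i y => dB (P1 χ) i.b i.eta y + cut χ (B1 i.b) y * (Complex.I * halfyQ y)) := by
    have hT := (sy_T20 hχ RA0.initial).ofReal
    have h1 : Sy RA0 0 1 2 0 (fun i y => (dcut0 χ i.b y : ℂ) * (i.b * i.b * T20 χ i.b y)) :=
      ((sy_dcut0 hχ).ofReal.times ((sy_bC.times sy_bC).times hT)).le
    have h2 : Sy RA0 0 1 2 0 (fun i y => (cut χ (B0 i.b) y : ℂ) *
        (2 * i.b * T20 χ i.b y + i.b * i.b * T20b χ i.b y)) := by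
      refine (hχ.syC0.times (Sy.add (p := 0) (q := 1) (m := 2) (n := 0) ?_ ?_)).le
      · exact (((Sy.number 2).times sy_bC).times hT).le
      · exact ((sy_bC.times sy_bC).times (sy_T20b hχ RA0.initial).ofReal).le
    refine (h1.add h2).congr fun i y hy => ?_
    rw [dB_P1 hχ i (RA0.pos i y hy), dBP1, dcut1_eq_zero hχ (RA0.lt hy)]
    push_cast
    ring
  have hout : ∀ {S : Region Par}, S.Out → Sy S 0 1 2 0
      (fun i y => dB (P1 χ) i.b i.eta y + cut χ (B1 i.b) y * (Complex.I * halfyQ y)) := by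
    intro S hS
    have h1 : Sy S 0 1 2 0 (fun i y => (dcut1 χ i.b y : ℂ) * (-(Complex.I * i.be * halfyQ y))) :=
      ((sy_dcut1 hχ).ofReal.times (Sy.neg ((sy_I.times sy_be).times sy_f.ofReal))).geB0 hS.geB0 2
    refine h1.congr fun i y hy => ?_
    rw [dB_P1 hχ i (S.pos i y hy), dBP1, hS.cut0 hχ hy, hS.dcut0 hχ hy]
    push_cast
    ring
  refine ⟨(h0.restrict R0.sub_RA0).bd_XW R0.sub_RA1, (h0.restrict R1.sub_RA0).bd_XW R1.sub_RA1,
    (hout R2.out).bd_XW R2.sub_RA1, (hout R3.out).bd_XW R3.sub_RA1, Bd.of_zero fun i y hy => ?_⟩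
  rw [dB_P1 hχ i (R4.pos i y hy), dBP1, R4.out.cut0 hχ hy, R4.out.dcut0 hχ hy, R4.cut1 hχ hy,
    R4.dcut1 hχ hy]
  simp

end

section

variable {χ : ℝ → ℝ} {S : Region Par} {m n : ℤ} {F G : Par → ℝ → ℂ}

/-! ### The residuals of the evolution equations -/

/-- The quadratic correction `b² + η² + c_b (b² - η²)` in the law of `b`. -/
def sg (χ : ℝ → ℝ) (i : Par) : ℝ := i.b ^ 2 + i.eta ^ 2 + cb χ i.b * (i.b ^ 2 - i.eta ^ 2)

/-- The quadratic correction `2 c_b b η` in the law of `η`. -/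
def ta (χ : ℝ → ℝ) (i : Par) : ℝ := 2 * cb χ i.b * i.b * i.eta

/-- The residual of the equation for `P`. -/
def Psi0 (χ : ℝ → ℝ) (i : Par) (y : ℝ) : ℂ :=
  -Complex.I * (Complex.I * Ladj (P χ i.b i.eta) (P1 χ i.b i.eta) y
    + i.b * Lam 0 (P χ i.b i.eta) y + Complex.I * i.eta * P χ i.b i.eta y
    - ((i.b ^ 2 + i.eta ^ 2 : ℝ) : ℂ) * dB (P χ) i.b i.eta y)

/-- The residual of the equation for `P₁`. -/
def Psi1 (χ : ℝ → ℝ) (i : Par) (y : ℝ) : ℂ :=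
  -Complex.I * (Complex.I * Aadj (P χ i.b i.eta) (P2 χ i.b i.eta) y
    - (nonloc χ i.b i.eta y : ℂ) * Complex.I * P1 χ i.b i.eta y
    + i.b * Lam (-1) (P1 χ i.b i.eta) y - Complex.I * i.eta * P1 χ i.b i.eta y
    - (sg χ i : ℂ) * dB (P1 χ) i.b i.eta y - (ta χ i : ℂ) * dEta (P1 χ) i.b i.eta y)

/-- The residual of the equation for `P₂`. -/
def Psi2 (χ : ℝ → ℝ) (i : Par) (y : ℝ) : ℂ :=
  -Complex.I * (Complex.I * Aop (P χ i.b i.eta) (Aadj (P χ i.b i.eta) (P2 χ i.b i.eta)) y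
    - (nonloc χ i.b i.eta y : ℂ) * Complex.I * P2 χ i.b i.eta y
    - Complex.I * star (P χ i.b i.eta y) * P1 χ i.b i.eta y ^ 2
    + i.b * Lam (-2) (P2 χ i.b i.eta) y - Complex.I * i.eta * P2 χ i.b i.eta y
    - (sg χ i : ℂ) * dB (P2 χ) i.b i.eta y - (ta χ i : ℂ) * dEta (P2 χ) i.b i.eta y)

theorem sy_b2 : Sy S 0 0 4 0 (fun i _ => i.b ^ 2) := by
  simp only [sq]; exact (sy_bR.times sy_bR).le

theorem sy_eta2 : Sy S 0 0 4 1 (fun i _ => i.eta ^ 2) := by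
  simp only [sq]; exact (sy_etaR.times sy_etaR).le

/-- The part of `sg` that gains a logarithm over `b²`. -/
def sg' (χ : ℝ → ℝ) (i : Par) : ℝ := i.eta ^ 2 + cb χ i.b * (i.b ^ 2 - i.eta ^ 2)

theorem sg_eq (χ : ℝ → ℝ) (i : Par) : sg χ i = i.b ^ 2 + sg' χ i := by rw [sg, sg']; ring

theorem sy_sg' (hχ : IsCutoff χ) : Sy S 0 0 4 1 (fun i _ => (sg' χ i : ℂ)) :=
  (Sy.add sy_eta2 ((sy_cb hχ).times (Sy.sub sy_b2 sy_eta2.le)).le).ofReal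

theorem sy_sg (hχ : IsCutoff χ) : Sy S 0 0 4 0 (fun i _ => (sg χ i : ℂ)) :=
  (Sy.add sy_b2.ofReal (sy_sg' hχ).le).congr fun i _ _ => by rw [sg_eq]; push_cast; rfl

theorem sy_ta (hχ : IsCutoff χ) : Sy S 0 0 4 2 (fun i _ => (ta χ i : ℂ)) :=
  Sy.ofReal ((((Sy.number 2).times (sy_cb hχ)).times sy_bR).times sy_etaR).le

theorem hasDerivAt_aInt (hχ : IsCutoff χ) (i : Par) {y : ℝ} (hy : 0 < y) :
    HasDerivAt (aInt χ i) (aDens1 χ i y + aDens2 χ i y) y :=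
  (hasDerivAt_aInt1 hχ i hy).add (hasDerivAt_aInt2 hχ i hy)

theorem one_add_Atheta_P (hχ : IsCutoff χ) (i : Par) {y : ℝ} (hy : 0 < y) :
    1 + Atheta (P χ i.b i.eta) y = phi1 y - aInt χ i y := by
  rw [Atheta_P hχ i hy]; ring

/-! ### The profiles below `B₀` -/

theorem P1_inner (hχ : IsCutoff χ) (i : Par) {y : ℝ} (hy : y ∈ R0 i) :
    P1 χ i.b i.eta y = -(Complex.I * i.be * halfyQ y) + i.b * i.b * T20 χ i.b y := by
  have h1 : y * i.t ≤ i.L := (RA0.lt (R0.sub_RA0 i hy)).le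
  rw [P1_split, P1T, cut0_eq_one hχ (R0.lt hy).le, cut1_eq_one hχ h1]
  simp

theorem hasDerivAt_P2_inner (hχ : IsCutoff χ) (i : Par) {y : ℝ} (hy : y ∈ R0 i) :
    HasDerivAt (P2 χ i.b i.eta)
      (i.be * i.be * ((-g2 χ i.b y - 2 * pf y / y * U2 χ i.b y : ℝ) : ℂ)
        + Complex.I * (i.b * i.b * i.b)
          * ((-g30 χ i.b y - 2 * pf y / y * U30 χ i.b y : ℝ) : ℂ)) y := by
  have hy0 := R0.pos i y hy
  have h := ((hasDerivAt_U2 hχ i hy0).ofReal_comp.const_mul (i.be * i.be)).add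
    ((hasDerivAt_U30 hχ i hy0).ofReal_comp.const_mul (Complex.I * (i.b * i.b * i.b)))
  refine h.congr_of_eventuallyEq ?_
  exact eventuallyEq_of_region (S := R0) (F := fun i => P2 χ i.b i.eta)
    (fun i y hy => P2_inner hχ i hy) hy

/-- `A_P^* P₂`. -/
def AP2 (χ : ℝ → ℝ) (i : Par) : ℝ → ℂ := Aadj (P χ i.b i.eta) (P2 χ i.b i.eta)

/-- The equations `A_Q^* U₂ = g₂` and `A_Q^* U_{3,0} = g_{3,0}` determine `A_P^* P₂` up to the
correction of the gauge potential. -/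
theorem AP2_inner (hχ : IsCutoff χ) (i : Par) {y : ℝ} (hy : y ∈ R0 i) :
    AP2 χ i y = i.be * i.be * g2 χ i.b y + Complex.I * (i.b * i.b * i.b) * g30 χ i.b y
      + ((aInt χ i y / y : ℝ) : ℂ) * P2 χ i.b i.eta y := by
  have hy0 := R0.pos i y hy
  have hyC : (y : ℂ) ≠ 0 := by exact_mod_cast hy0.ne'
  have e : (1 + 1 + Atheta (P χ i.b i.eta) y) / y = (2 * pf y - aInt χ i y) / y := by
    rw [add_assoc, one_add_Atheta_P hχ i hy0, phi1_eq]; ring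
  rw [AP2, Aadj, CRadj, (hasDerivAt_P2_inner hχ i hy).deriv, e, P2_inner hχ i hy,
    Complex.real_smul, P2r]
  push_cast
  field_simp
  ring

/-- `A_Q g₂ = -Q (½ y Q)²` below `B₀`. The multiple of `½ y Q` in `g₂` is annihilated by `A_Q`, so
`c_b` leaves no trace. -/
theorem hasDerivAt_g2_inner (hχ : IsCutoff χ) (i : Par) {y : ℝ} (hy : y ∈ R0 i) :
    HasDerivAt (g2 χ i.b) (phi1 y / y * g2 χ i.b y - Q y * halfyQ y ^ 2) y := by
  have hy0 := R0.pos i y hy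
  have e : ∀ j : Par, ∀ z ∈ R0 j, g2 χ j.b z = 2 * (halfyQ z * pf z) - cb χ j.b * halfyQ z := by
    intro j z hz
    rw [g2_eq, Lam_halfyQ, cut0_eq_one hχ (R0.lt hz).le, mul_one]
  have h := (((hasDerivAt_halfyQ y).mul (hasDerivAt_pf y)).const_mul 2).sub
    ((hasDerivAt_halfyQ y).const_mul (cb χ i.b))
  have h2 := h.congr_of_eventuallyEq
    (eventuallyEq_of_region (S := R0) (F := fun i => g2 χ i.b) e hy)
  refine h2.congr_deriv ?_
  have hf : halfyQ y = y / 2 * Q y := rfl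
  have hQ : Q y ^ 2 = 8 * pf y ^ 2 := by rw [Q_sq, pf]; field_simp
  rw [e i y hy, hf]
  field_simp
  linear_combination (Q y * y ^ 2) * hQ

/-- `A_Q g_{3,0}`. The nonlocal integral multiplies `½ y Q`, which `A_Q` annihilates, so that only
the derivative of the integral is left. -/
theorem hasDerivAt_g30_inner (hχ : IsCutoff χ) (i : Par) {y : ℝ} (hy : 0 < y) :
    HasDerivAt (g30 χ i.b) (phi1 y / y * g30 χ i.b y + (euler (U2 χ i.b) y + U2 χ i.b y
      - 2 * (Q y * halfyQ y * T20 χ i.b y) - qf y * halfyQ y ^ 2)) y := by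
  have hU := hasDerivAt_U2 hχ i hy
  have h := (((hasDerivAt_phi1 y).mul (hasDerivAt_T20 hχ i hy)).add
    ((hasDerivAt_id y).mul hU)).sub
    ((hasDerivAt_nInt hχ i hy).mul (hasDerivAt_halfyQ y))
  have h2 := h.congr_of_eventuallyEq (f₁ := g30 χ i.b) (by
    filter_upwards [isOpen_Ioi.mem_nhds hy] with z hz
    exact g30_eq hχ i hz)
  refine h2.congr_deriv ?_
  have hf : halfyQ y = y / 2 * Q y := rfl
  have hq : qf y = y ^ 2 / 4 * Q y := rfl
  have hQ : Q y ^ 2 = 8 * pf y ^ 2 := by rw [Q_sq, pf]; field_simp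
  have hp : -4 * y / (1 + y ^ 2) ^ 2 = -(Q y * halfyQ y) := by
    rw [hf, show Q y * (y / 2 * Q y) = y / 2 * Q y ^ 2 by ring, Q_sq]
    field_simp
    norm_num
  rw [g30_eq hχ i hy, euler, hU.deriv, hp, hf, hq, smul_eq_mul]
  simp only [id]
  field_simp
  ring

/-- The contribution of a coefficient `α` of `A_θ[Q] - A_θ[P]` to `A_P A_P^* P₂`. -/
def XA (χ : ℝ → ℝ) (α α' : Par → ℝ → ℝ) (i : Par) (y : ℝ) : ℂ :=
  ((y⁻¹ : ℝ) : ℂ) * (((y⁻¹ : ℝ) : ℂ) * (((y * α' i y - α i y : ℝ) : ℂ) * P2 χ i.b i.eta y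
    + (α i y : ℂ) * (euler (P2 χ i.b i.eta) y - (phi1 y : ℂ) * P2 χ i.b i.eta y)))
    + ((y⁻¹ : ℝ) : ℂ) * ((α i y : ℂ) * AP2 χ i y)

theorem sy_AP2 (hχ : IsCutoff χ) (hS : ∀ i, S i ⊆ RA0 i) : Sy S 0 (-1) 4 0 (AP2 χ) :=
  (Sy.CRadj hχ (fun i => (hS i).trans (RA0.sub_RA1 i)) (sy_P2 hχ hS) 1).le

theorem sy_XA (hχ : IsCutoff χ) (hS : ∀ i, S i ⊆ RA0 i) {p q : ℤ} {α α' : Par → ℝ → ℝ}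
    (hα : Sy S p q m n α) (hα' : Sy S (p - 1) q m n α') :
    Sy S (p - 1) (q - 1) (m + 4) n (XA χ α α') := by
  have hP := sy_P2 hχ hS
  have h1 : Sy S p q m n (fun i y => y * α' i y - α i y) := Sy.sub (Sy.id.times hα').le hα
  have h2 : Sy S 1 (-1) 4 0 (fun i y => euler (P2 χ i.b i.eta) y
      - (phi1 y : ℂ) * P2 χ i.b i.eta y) := hP.euler.sub (Sy.mul sy_phi1.ofReal hP)
  have h3 : Sy S (p + 1) (q - 1) (m + 4) n
      (fun i y => ((y * α' i y - α i y : ℝ) : ℂ) * P2 χ i.b i.eta y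
        + (α i y : ℂ) * (euler (P2 χ i.b i.eta) y - (phi1 y : ℂ) * P2 χ i.b i.eta y)) :=
    Sy.add (h1.ofReal.times hP).le (hα.ofReal.times h2).le
  have h4 : Sy S (p - 1) (q - 1) (m + 4) n
      (fun i y => ((y⁻¹ : ℝ) : ℂ) * ((α i y : ℂ) * AP2 χ i y)) :=
    (sy_inv.ofReal.times (hα.ofReal.times (sy_AP2 hχ hS))).le
  exact Sy.add (sy_inv.ofReal.times (sy_inv.ofReal.times h3)).le h4

/-- The main terms of `A_P A_P^* P₂`; the two terms `XA` collect the corrections of the gauge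
potential. -/
theorem Aop_AP2_inner (hχ : IsCutoff χ) (i : Par) {y : ℝ} (hy : y ∈ R0 i) :
    Aop (P χ i.b i.eta) (AP2 χ i) y = -(i.be * i.be * (Q y * halfyQ y ^ 2))
      + Complex.I * (i.b * i.b * i.b) * (((euler (U2 χ i.b) y : ℝ) : ℂ) + U2 χ i.b y
        - 2 * (Q y * halfyQ y * T20 χ i.b y) - qf y * halfyQ y ^ 2)
      + (XA χ (aInt1 χ) (aDens1 χ) i y + XA χ (aInt2 χ) (aDens2 χ) i y) := by
  have hy0 := R0.pos i y hy
  have hyC : (y : ℂ) ≠ 0 := by exact_mod_cast hy0.ne'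
  have hP2 := (Sym.diff (sy_P2 hχ R0.sub_RA0) hy).hasDerivAt
  have ha : HasDerivAt (fun y => aInt χ i y / y) (((aDens1 χ i y + aDens2 χ i y) * y
      - aInt χ i y * 1) / y ^ 2) y :=
    (hasDerivAt_aInt hχ i hy0).div (hasDerivAt_id y) hy0.ne'
  have h := (((hasDerivAt_g2_inner hχ i hy).ofReal_comp.const_mul (i.be * i.be)).add
    ((hasDerivAt_g30_inner hχ i hy0).ofReal_comp.const_mul (Complex.I * (i.b * i.b * i.b)))).add
    (ha.ofReal_comp.mul hP2)
  have h2 := h.congr_of_eventuallyEq (eventuallyEq_of_region (S := R0) (F := AP2 χ)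
    (fun i y hy => AP2_inner hχ i hy) hy)
  have he : euler (P2 χ i.b i.eta) y = (y : ℂ) * deriv (P2 χ i.b i.eta) y := Complex.real_smul
  rw [Aop, CR, h2.deriv, one_add_Atheta_P hχ i hy0, Complex.real_smul, XA, XA, AP2_inner hχ i hy,
    he, aInt]
  push_cast
  field_simp
  ring

end

section

variable {χ : ℝ → ℝ} {S : Region Par} {m n : ℤ} {F G : Par → ℝ → ℂ}

/-! ### The residual of the equation for `P₂` -/

/-- The complex conjugate of `P - Q` without its cutoff. -/
def hc (i : Par) (y : ℝ) : ℂ := Complex.I * i.b * qf y - i.eta * rho y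

theorem sy_hc : Sy S 2 (-2) 2 0 hc :=
  Sy.sub ((sy_I.times sy_bC).times sy_qf.ofReal).le (sy_eta.times sy_rho.ofReal).le

theorem star_P (χ : ℝ → ℝ) (i : Par) (y : ℝ) :
    star (P χ i.b i.eta y) = Q y + cut χ (B1 i.b) y * hc i y := by
  rw [P_eq, hh, hc]
  simp only [Complex.star_def, map_add, map_mul, map_sub, map_neg, Complex.conj_ofReal,
    Complex.conj_I]
  ring

theorem star_P_inner (hχ : IsCutoff χ) (i : Par) {y : ℝ} (hy : y ∈ R0 i) :
    star (P χ i.b i.eta y) = Q y + hc i y := by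
  rw [star_P, cut1_eq_one hχ (RA0.lt (R0.sub_RA0 i hy)).le, Complex.ofReal_one, one_mul]

theorem nonloc1_inner (hχ : IsCutoff χ) (i : Par) {y : ℝ} (hy : y ∈ R0 i) :
    nonloc1 χ i y = -2 * i.eta * (1 - pf y) := by
  have hy0 := R0.pos i y hy
  have e : ∀ z ∈ Set.uIcc 0 y, nDens1 χ i z = -i.eta * (Q z * halfyQ z) := by
    intro z hz
    rw [Set.uIcc_of_le hy0.le] at hz
    have h := R0.lt hy
    have h1 : z * i.t ≤ y * i.t := mul_le_mul_of_nonneg_right hz.2 i.t_pos.le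
    rw [nDens1, cut1_eq_one hχ (by linarith [i.L_gt])]
    ring
  have hd : ∀ z ∈ Set.uIcc 0 y,
      HasDerivAt (fun z => -2 * i.eta * (1 - pf z)) (-i.eta * (Q z * halfyQ z)) z := by
    intro z _
    refine (((hasDerivAt_pf z).const_sub 1).const_mul (-2 * i.eta)).congr_deriv ?_
    have hQ : Q z ^ 2 = 8 * pf z ^ 2 := by rw [Q_sq, pf]; field_simp
    rw [show Q z * halfyQ z = z / 2 * Q z ^ 2 by rw [halfyQ]; ring, hQ]
    ring
  rw [nonloc1, intervalIntegral.integral_congr e, intervalIntegral.integral_eq_sub_of_hasDerivAt hd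
    ((continuous_const.mul (continuous_Q.mul continuous_halfyQ)).intervalIntegrable _ _)]
  simp [pf]

theorem Lam_P2_inner (hχ : IsCutoff χ) (i : Par) {y : ℝ} (hy : y ∈ R0 i) :
    Lam (-2) (P2 χ i.b i.eta) y = 3 * P2 χ i.b i.eta y
      + (i.be * i.be * ((euler (U2 χ i.b) y : ℝ) : ℂ) + euler (P2r χ i) y) := by
  rw [← euler_P2_inner hχ i hy, Lam, euler, Complex.real_smul]
  norm_num

theorem dBP2_inner (hχ : IsCutoff χ) (i : Par) {y : ℝ} (hy : y ∈ R0 i) :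
    dB (P2 χ) i.b i.eta y = 2 * i.be * U2 χ i.b y + i.be * i.be * U2b χ i.b y
      + 3 * Complex.I * (i.b * i.b) * U30 χ i.b y
      + Complex.I * (i.b * i.b * i.b) * U30b χ i.b y := by
  rw [dB_P2 hχ i (R0.pos i y hy), dBP2, dcut0_eq_zero hχ (R0.lt hy), cut0_eq_one hχ (R0.lt hy).le]
  push_cast
  ring

theorem dEtaP2_inner (hχ : IsCutoff χ) (i : Par) {y : ℝ} (hy : y ∈ R0 i) :
    dEta (P2 χ) i.b i.eta y = -(2 * Complex.I * i.be) * U2 χ i.b y := by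
  rw [dEta_P2, cut0_eq_one hχ (R0.lt hy).le, Complex.ofReal_one, one_mul]

/-- The coefficient of `U₂` in the residual. -/
def zetaU (χ : ℝ → ℝ) (i : Par) : ℂ :=
  -(Complex.I * i.eta * i.b * (3 * i.be + i.b)) + Complex.I * i.eta * (i.be * i.be)
    - 2 * sg' χ i * i.be + 2 * Complex.I * ta χ i * i.be

/-- The coefficient of `y ∂_y U₂` in the residual. -/
def zetaE (i : Par) : ℂ := -(Complex.I * i.eta * i.b * (i.be + i.b))

/-- The part of the residual that decays at infinity. -/
def Psi2D (χ : ℝ → ℝ) (i : Par) (y : ℝ) : ℂ :=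
  -(2 * Complex.I * i.eta * (pf y * P2 χ i.b i.eta y))
    + 2 * Complex.I * (i.b * i.b * i.eta) * (Q y * (halfyQ y * T20 χ i.b y))
    + Complex.I * i.eta * i.b * (i.be + i.b) * (qf y * (halfyQ y * halfyQ y))
    - Complex.I * i.eta * (i.be * i.be) * (rho y * (halfyQ y * halfyQ y))
    + Complex.I * XA χ (aInt1 χ) (aDens1 χ) i y

/-- The part of the residual that is small below `B₀` but grows there. -/
def Psi2N (χ : ℝ → ℝ) (i : Par) (y : ℝ) : ℂ :=
  (Complex.I * i.eta + 3 * i.b) * P2r χ i y + i.b * euler (P2r χ i) y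
    - Complex.I * (nonloc2 χ i y * P2 χ i.b i.eta y)
    + Complex.I * XA χ (aInt2 χ) (aDens2 χ) i y
    - Complex.I * (i.b * i.b * (i.b * i.b)) * (Q y * (T20 χ i.b y * T20 χ i.b y))
    - Complex.I * (hc i y * (-(2 * Complex.I * i.be * (i.b * i.b) * (halfyQ y * T20 χ i.b y))
      + i.b * i.b * (i.b * i.b) * (T20 χ i.b y * T20 χ i.b y)))
    - sg χ i * (3 * Complex.I * (i.b * i.b) * U30 χ i.b y
      + Complex.I * (i.b * i.b * i.b) * U30b χ i.b y)

/-- The residual below `B₀`. The term `-(b - iη)² Q (½ y Q)²` of `A_P A_P^* P₂` cancels the leading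
part of `P̄ P₁²`, and `A_Q g_{3,0}` those terms `b³ U₂` and `b³ y ∂_y U₂` that the scaling and
`∂_b` leave; each coefficient of `U₂` and `y ∂_y U₂` that is left carries a factor `η` or `c_b`. -/
theorem Psi2_inner (hχ : IsCutoff χ) (i : Par) {y : ℝ} (hy : y ∈ R0 i) :
    Psi2 χ i y = -Complex.I * (zetaU χ i * U2 χ i.b y
      + zetaE i * ((euler (U2 χ i.b) y : ℝ) : ℂ)
      + -(sg χ i * (i.be * i.be)) * U2b χ i.b y + Psi2D χ i y + Psi2N χ i y) := by
  have hA : Aop (P χ i.b i.eta) (Aadj (P χ i.b i.eta) (P2 χ i.b i.eta)) y = _ :=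
    Aop_AP2_inner hχ i hy
  rw [Psi2, hA, nonloc_eq hχ i (R0.pos i y hy), nonloc1_inner hχ i hy, star_P_inner hχ i hy,
    P1_inner hχ i hy, Lam_P2_inner hχ i hy, dBP2_inner hχ i hy, dEtaP2_inner hχ i hy,
    zetaU, zetaE, Psi2D, Psi2N, sg_eq, P2_inner hχ i hy]
  generalize XA χ (aInt1 χ) (aDens1 χ) i y = X1
  generalize XA χ (aInt2 χ) (aDens2 χ) i y = X2
  generalize euler (P2r χ i) y = E1
  generalize ((euler (U2 χ i.b) y : ℝ) : ℂ) = E2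
  rw [P2r, hc, Par.be]
  push_cast
  -- Written in these atoms, the claim is a polynomial identity modulo `I² = -1`.
  generalize (U2 χ i.b y : ℂ) = u
  generalize (U2b χ i.b y : ℂ) = ub
  generalize (U30 χ i.b y : ℂ) = v
  generalize (U30b χ i.b y : ℂ) = vb
  generalize (T20 χ i.b y : ℂ) = T
  generalize (halfyQ y : ℂ) = f
  generalize (qf y : ℂ) = q
  generalize (rho y : ℂ) = r
  generalize (Q y : ℂ) = Qv
  generalize (pf y : ℂ) = p
  congr 1
  have h2 := Complex.I_sq
  have h3 : Complex.I ^ 3 = -Complex.I := by rw [pow_succ, h2]; ring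
  have h4 : Complex.I ^ 4 = 1 := by rw [pow_succ, h3, neg_mul, Complex.I_mul_I]; ring
  have h5 : Complex.I ^ 5 = Complex.I := by rw [pow_succ, h4, one_mul]
  have h6 : Complex.I ^ 6 = -1 := by rw [pow_succ, h5, Complex.I_mul_I]
  ring_nf
  simp only [h2, h3, h4, h5, h6]
  ring

theorem sy_zetaU (hχ : IsCutoff χ) : Sy S 0 0 6 1 (fun i _ => zetaU χ i) := by
  have h1 : Sy S 0 0 2 0 (fun i _ => 3 * i.be + i.b) :=
    Sy.add ((sy_const 3).times sy_be).le sy_bC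
  unfold zetaU
  refine Sy.add (Sy.sub (Sy.add (Sy.neg ?_) ?_) ?_) ?_
  · exact (((sy_I.times sy_eta).times sy_bC).times h1).le
  · exact ((sy_I.times sy_eta).times sy_be2).le
  · exact (((sy_const 2).times (sy_sg' hχ)).times sy_be).le
  · exact ((((sy_const 2).times sy_I).times (sy_ta hχ)).times sy_be).le

theorem sy_be_add_b : Sy S 0 0 2 0 (fun i _ => i.be + i.b) := Sy.add sy_be sy_bC

theorem sy_zetaE : Sy S 0 0 6 1 (fun i _ => zetaE i) :=
  Sy.neg (((sy_I.times sy_eta).times sy_bC).times sy_be_add_b).le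

theorem sy_Psi2D (hχ : IsCutoff χ) : Sy R0 1 (-2) 6 1 (Psi2D χ) := by
  have hT := (sy_T20 hχ R0.initial).ofReal
  have hf := (sy_f (S := R0)).ofReal
  have h2I := (sy_const (S := R0) 2).times sy_I
  unfold Psi2D
  refine Sy.add (Sy.sub (Sy.add (Sy.add (Sy.neg ?_) ?_) ?_) ?_) ?_
  · exact ((h2I.times sy_eta).times (sy_pf.ofReal.times (sy_P2 hχ R0.sub_RA0))).le
  · exact ((h2I.times ((sy_bC.times sy_bC).times sy_eta)).times
      (sy_Q.ofReal.times (hf.times hT))).le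
  · exact ((((sy_I.times sy_eta).times sy_bC).times sy_be_add_b).times
      (sy_qf.ofReal.times (hf.times hf))).le
  · exact (((sy_I.times sy_eta).times sy_be2).times (sy_rho.ofReal.times (hf.times hf))).le
  · exact (Sy.constMul (sy_XA hχ R0.sub_RA0 (sy_aInt1 hχ R0.initial) (sy_aDens1 hχ).le) _).le

theorem sy_Psi2N (hχ : IsCutoff χ) : Sy R0 1 0 7 1 (Psi2N χ) := by
  have hT0 := (sy_T20 hχ R0.initial).ofReal
  have hT := ((sy_T20' hχ).restrict R0.sub_RA0).ofReal
  have hf := (sy_f (S := R0)).ofReal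
  have hb4 : Sy R0 0 0 8 0 (fun i _ => (i.b : ℂ) * i.b * (i.b * i.b)) :=
    ((sy_bC.times sy_bC).times (sy_bC.times sy_bC)).le
  have hr := sy_P2r_R0 hχ
  have hU := ((sy_U30' hχ).restrict R0.sub_RA0).ofReal
  unfold Psi2N
  refine Sy.sub (Sy.sub (Sy.sub (Sy.add (Sy.sub (Sy.add ?_ ?_) ?_) ?_) ?_) ?_) ?_
  · have h : Sy R0 0 0 2 0 (fun i _ => Complex.I * i.eta + 3 * i.b) :=
      Sy.add (sy_I.times sy_eta).le ((sy_const 3).times sy_bC).le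
    exact (h.times hr).le
  · exact (sy_bC.times hr.euler).le
  · exact (sy_I.times ((sy_nonloc2 hχ R0.sub_RA1).ofReal.times (sy_P2 hχ R0.sub_RA0))).le
  · exact (Sy.constMul (sy_XA hχ R0.sub_RA0 (sy_aInt2 hχ R0.initial) (sy_aDens2 hχ)) _).le
  · exact ((sy_I.times hb4).times (sy_Q.ofReal.times (hT0.times hT0))).le
  · have h : Sy R0 3 (-3) 5 1 (fun i y => -(2 * Complex.I * i.be * (i.b * i.b) *
        ((halfyQ y : ℂ) * T20 χ i.b y))
        + i.b * i.b * (i.b * i.b) * ((T20 χ i.b y : ℂ) * T20 χ i.b y)) := by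
      refine Sy.add (Sy.neg ?_) ?_
      · exact (((((sy_const 2).times sy_I).times sy_be).times (sy_bC.times sy_bC)).times
          (hf.times hT)).le
      · exact (hb4.times (hT.times hT)).leB0 R0.leB0 1
    exact (sy_I.times (sy_hc.times h)).le
  · have h : Sy R0 3 (-2) 3 1 (fun i y => 3 * Complex.I * (i.b * i.b) * (U30 χ i.b y : ℂ)
        + Complex.I * (i.b * i.b * i.b) * (U30b χ i.b y : ℂ)) := by
      refine Sy.add ?_ ?_
      · exact ((((sy_const 3).times sy_I).times (sy_bC.times sy_bC)).times hU).le
      · exact ((sy_I.times ((sy_bC.times sy_bC).times sy_bC)).times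
          (sy_U30b hχ R0.initial).ofReal).leB0 R0.leB0 1
    exact ((sy_sg hχ).times h).le

theorem hCls_Psi2_R0 (hχ : IsCutoff χ) : HCls R0 6 1 (Psi2 χ) := by
  have h1 : HCls R0 6 1 (fun i y => zetaU χ i * (U2 χ i.b y : ℂ)) :=
    (hCls_U2 hχ).scalar (sy_zetaU hχ)
  have h2 : HCls R0 6 1 (fun i y => zetaE i * ((euler (U2 χ i.b) y : ℝ) : ℂ)) :=
    (hCls_euler_U2 hχ).scalar sy_zetaE
  have h3 : HCls R0 6 1 (fun i y => -(sg χ i * (i.be * i.be)) * (U2b χ i.b y : ℂ)) :=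
    (hCls_U2b hχ).scalar (Sy.neg ((sy_sg hχ).times sy_be2) : Sy RAll 0 0 8 0 _)
  have h : HCls R0 6 1 _ := ((((h1.add h2).add h3).add (HCls.of_decay (sy_Psi2D hχ))).add
    (HCls.of_inner R0.sub_RA0 (sy_Psi2N hχ))).scalar (sy_const (-Complex.I))
  exact h.congr fun i y hy => (Psi2_inner hχ i hy).symm

theorem CR_eq_zero {k : ℝ} {v : Par → ℝ → ℂ} (h : ∀ i, ∀ y ∈ S i, F i y = 0) {i : Par} {y : ℝ}
    (hy : y ∈ S i) : CR k (v i) (F i) y = 0 := by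
  have e := euler_congr (G := fun _ _ => (0 : ℂ)) h hy
  rw [CR_eq_euler (S.pos i y hy).ne', e, h i y hy]
  simp [euler]

theorem CRadj_eq_zero {k : ℝ} {v : Par → ℝ → ℂ} (h : ∀ i, ∀ y ∈ S i, F i y = 0) {i : Par} {y : ℝ}
    (hy : y ∈ S i) : CRadj k (v i) (F i) y = 0 := by
  have e := euler_congr (G := fun _ _ => (0 : ℂ)) h hy
  rw [CRadj_eq_euler (S.pos i y hy).ne', e, h i y hy]
  simp [euler]

/-- On `(B₀, 2 B₀)` there is no cancellation, but `P₂` carries a factor `1 / L` there. -/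
theorem hCls_Psi2_R1 (hχ : IsCutoff χ) : HCls R1 6 1 (Psi2 χ) := by
  have hP2 := sy_P2_R1 hχ
  have hP1 := sy_P1 hχ R1.sub_RA0
  refine HCls.of_inner R1.sub_RA0 ?_
  have hA : Sy R1 1 0 7 1 (fun i => Aop (P χ i.b i.eta)
      (Aadj (P χ i.b i.eta) (P2 χ i.b i.eta))) :=
    Sy.geB0 (Sy.CR hχ R1.sub_RA1 (Sy.CRadj hχ R1.sub_RA1 hP2 1) 1) R1.geB0 3
  have hP : Sy R1 1 0 7 1 (fun i y => star (P χ i.b i.eta y) * P1 χ i.b i.eta y ^ 2) := by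
    simp only [star_P, sq, add_mul]
    refine Sy.add ?_ ?_
    · exact (sy_Q.ofReal.times (hP1.times hP1)).geB0 R1.geB0 4
    · exact ((hχ.syC1.times sy_hc).times (hP1.times hP1)).geB0 R1.geB0 2
  have hN : Sy R1 1 0 7 1 (fun i y => (nonloc χ i.b i.eta y : ℂ) * P2 χ i.b i.eta y) :=
    ((sy_nonloc hχ R1.sub_RA1).ofReal.times hP2).geB0 R1.geB0 1
  have hL : Sy R1 1 0 7 1 (fun i y => (i.b : ℂ) * Lam (-2) (P2 χ i.b i.eta) y) :=
    (sy_bC.times (hP2.lam (-2))).geB0 R1.geB0 1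
  have hE : Sy R1 1 0 7 1 (fun i y => (i.eta : ℂ) * P2 χ i.b i.eta y) :=
    (sy_eta.times hP2).geB0 R1.geB0 1
  have hB : Sy R1 1 0 7 1 (fun i y => (sg χ i : ℂ) * dB (P2 χ) i.b i.eta y) :=
    (((sy_sg hχ).times (sy_dBP2_R1 hχ)).geB0 R1.geB0 1 : Sy R1 1 0 7 1 _).congr
      fun i y hy => by rw [dB_P2 hχ i (R1.pos i y hy)]
  have hT : Sy R1 1 0 7 1 (fun i y => (ta χ i : ℂ) * dEta (P2 χ) i.b i.eta y) :=
    ((sy_ta hχ).times (sy_dEtaP2_R1 hχ)).geB0 R1.geB0 1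
  exact ((((Sy.sub (Sy.sub (Sy.add (Sy.sub (Sy.sub (hA.constMul Complex.I)
    (hN.constMul Complex.I)) (hP.constMul Complex.I)) hL) (hE.constMul Complex.I)) hB).sub
    hT)).constMul (-Complex.I)).congr fun i y _ => by rw [Psi2]; ring

/-- Beyond `2 B₀` the profile `P₂` vanishes and only `P̄ P₁²` contributes. -/
theorem hCls_Psi2_out (hχ : IsCutoff χ) (hS : S.Out) : HCls S 6 1 (Psi2 χ) := by
  have hP1 := sy_P1_out hχ hS
  have hP : Sy S 1 (-2) 6 1 (fun i y => star (P χ i.b i.eta y) * P1 χ i.b i.eta y ^ 2) := by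
    simp only [star_P, sq, add_mul]
    refine Sy.add ?_ ?_
    · exact (sy_Q.ofReal.times (hP1.times hP1)).geB0 hS.geB0 3
    · exact ((hχ.syC1.times sy_hc).times (hP1.times hP1)).geB0 hS.geB0 1
  refine HCls.of_decay ((hP.constMul (-1)).congr fun i y hy => ?_)
  have hz : ∀ i, ∀ y ∈ S i, P2 χ i.b i.eta y = 0 := fun i y hy => P2_out hχ hS hy
  have h1 : Aop (P χ i.b i.eta) (Aadj (P χ i.b i.eta) (P2 χ i.b i.eta)) y = 0 :=
    CR_eq_zero (S := S) (v := fun i => P χ i.b i.eta)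
      (fun i y hy => CRadj_eq_zero (F := fun i => P2 χ i.b i.eta) (v := fun i => P χ i.b i.eta)
        hz hy) hy
  have h2 : Lam (-2) (P2 χ i.b i.eta) y = 0 := Lam_eq_zero (F := fun i => P2 χ i.b i.eta) hz hy
  rw [Psi2, h1, h2, hz i y hy, dB_P2 hχ i (S.pos i y hy), dBP2_out hχ hS hy, dEta_P2_out hχ hS hy]
  ring_nf
  rw [Complex.I_sq]
  ring

theorem hAll_Psi2 (hχ : IsCutoff χ) : HAll 6 1 (Psi2 χ) where
  r0 := hCls_Psi2_R0 hχ
  r1 := hCls_Psi2_R1 hχ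
  r2 := hCls_Psi2_out hχ R2.out
  r3 := hCls_Psi2_out hχ R3.out
  r4 := fun i y hy => by
    have hz : ∀ i, ∀ y ∈ R4 i, P2 χ i.b i.eta y = 0 := fun i y hy => P2_out hχ R4.out hy
    have h1 : Aop (P χ i.b i.eta) (Aadj (P χ i.b i.eta) (P2 χ i.b i.eta)) y = 0 :=
      CR_eq_zero (S := R4) (v := fun i => P χ i.b i.eta)
        (fun i y hy => CRadj_eq_zero (F := fun i => P2 χ i.b i.eta) (v := fun i => P χ i.b i.eta)
          hz hy) hy
    have h2 : Lam (-2) (P2 χ i.b i.eta) y = 0 := Lam_eq_zero (F := fun i => P2 χ i.b i.eta) hz hy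
    rw [Psi2, h1, h2, hz i y hy, dB_P2 hχ i (R4.pos i y hy), dBP2_out hχ R4.out hy,
      dEta_P2_out hχ R4.out hy, P1_R4 hχ hy]
    ring

end

section

variable {χ : ℝ → ℝ} {S : Region Par} {m n : ℤ} {F G : Par → ℝ → ℂ}

/-! ### The residual of the equation for `P₁` -/

theorem hasDerivAt_P1_inner (hχ : IsCutoff χ) (i : Par) {y : ℝ} (hy : y ∈ R0 i) :
    HasDerivAt (P1 χ i.b i.eta) (-(Complex.I * i.be * ((Q y / 2 * phi1 y : ℝ) : ℂ))
      + i.b * i.b * ((phi1 y / y * T20 χ i.b y + U2 χ i.b y : ℝ) : ℂ)) y := by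
  have hy0 := R0.pos i y hy
  have h := ((hasDerivAt_halfyQ y).ofReal_comp.const_mul (Complex.I * i.be)).neg.add
    ((hasDerivAt_T20 hχ i hy0).ofReal_comp.const_mul ((i.b : ℂ) * i.b))
  refine h.congr_of_eventuallyEq ?_
  exact eventuallyEq_of_region (S := R0) (F := fun i => P1 χ i.b i.eta)
    (fun i y hy => P1_inner hχ i hy) hy

theorem dBP1_inner (hχ : IsCutoff χ) (i : Par) {y : ℝ} (hy : y ∈ R0 i) :
    dB (P1 χ) i.b i.eta y = -(Complex.I * halfyQ y)
      + (2 * i.b * T20 χ i.b y + i.b * i.b * T20b χ i.b y) := by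
  rw [dB_P1 hχ i (R0.pos i y hy), dBP1, dcut0_eq_zero hχ (R0.lt hy), cut0_eq_one hχ (R0.lt hy).le,
    dcut1_eq_zero hχ (RA0.lt (R0.sub_RA0 i hy)), cut1_eq_one hχ (RA0.lt (R0.sub_RA0 i hy)).le]
  push_cast
  ring

theorem dEtaP1_inner (hχ : IsCutoff χ) (i : Par) {y : ℝ} (hy : y ∈ R0 i) :
    dEta (P1 χ) i.b i.eta y = -halfyQ y := by
  rw [dEta_P1, cut1_eq_one hχ (RA0.lt (R0.sub_RA0 i hy)).le, one_mul]

theorem g2_inner (hχ : IsCutoff χ) (i : Par) {y : ℝ} (hy : y ∈ R0 i) :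
    g2 χ i.b y = 2 * (halfyQ y * pf y) - cb χ i.b * halfyQ y := by
  rw [g2_eq, Lam_halfyQ, cut0_eq_one hχ (R0.lt hy).le, mul_one]

/-- The residual below `B₀`, free of terms of order `b²`: `(b - iη)² g₂` cancels the contributions
of `½ y Q`, including those multiplied by `c_b`. Likewise `b³ g_{3,0}` cancels the derivative of
`T_{2,0}` in `b³ Λ_{-1} T_{2,0}`. -/
theorem Psi1_inner (hχ : IsCutoff χ) (i : Par) {y : ℝ} (hy : y ∈ R0 i) :
    Psi1 χ i y = -Complex.I * (i.b * i.b * i.b * (2 * T20 χ i.b y + nInt χ i.b y * halfyQ y)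
      + Complex.I * (((y⁻¹ * aInt χ i y : ℝ) : ℂ) * P2 χ i.b i.eta y)
      - Complex.I * (i.b * i.b * ((nonloc1 χ i y : ℂ) * T20 χ i.b y))
      - Complex.I * (nonloc2 χ i y * P1 χ i.b i.eta y)
      - Complex.I * i.eta * (i.b * i.b) * T20 χ i.b y
      - sg χ i * (2 * i.b * T20 χ i.b y + i.b * i.b * T20b χ i.b y)) := by
  have hy0 := R0.pos i y hy
  have hyC : (y : ℂ) ≠ 0 := by exact_mod_cast hy0.ne'
  have hA : Aadj (P χ i.b i.eta) (P2 χ i.b i.eta) y = _ := AP2_inner hχ i hy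
  have hL : Lam (-1) (P1 χ i.b i.eta) y = 2 * P1 χ i.b i.eta y
      + (y : ℂ) * (-(Complex.I * i.be * ((Q y / 2 * phi1 y : ℝ) : ℂ))
      + i.b * i.b * ((phi1 y / y * T20 χ i.b y + U2 χ i.b y : ℝ) : ℂ)) := by
    rw [Lam, (hasDerivAt_P1_inner hχ i hy).deriv, Complex.real_smul, Complex.real_smul]
    norm_num
  rw [Psi1, hA, hL, nonloc_eq hχ i hy0, nonloc1_inner hχ i hy,
    P1_inner hχ i hy, dBP1_inner hχ i hy, dEtaP1_inner hχ i hy, g2_inner hχ i hy, g30_eq hχ i hy0,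
    sg, ta, phi1_eq]
  generalize P2 χ i.b i.eta y = X
  rw [Par.be]
  have e : (Q y : ℂ) = 2 * halfyQ y / y := by
    rw [halfyQ]; push_cast; field_simp
  push_cast
  rw [e]
  -- Written in these atoms, the claim is a polynomial identity modulo `I² = -1`.
  generalize (U2 χ i.b y : ℂ) = u
  generalize (T20b χ i.b y : ℂ) = Tb
  generalize (T20 χ i.b y : ℂ) = T
  generalize (nInt χ i.b y : ℂ) = N
  generalize (halfyQ y : ℂ) = f
  generalize (pf y : ℂ) = p
  congr 1
  have h2 := Complex.I_sq
  have h3 : Complex.I ^ 3 = -Complex.I := by rw [pow_succ, h2]; ring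
  field_simp
  ring_nf
  simp only [h2, h3]
  ring

theorem sy_Psi1_R0 (hχ : IsCutoff χ) : Sy R0 0 1 6 0 (Psi1 χ) := by
  have hT := (sy_T20 hχ R0.initial).ofReal
  have hb2 := (sy_bC (S := R0)).times sy_bC
  refine Sy.congr (Sy.constMul (p := 0) (q := 1) (m := 6) (n := 0) ?_ (-Complex.I))
    fun i y hy => (Psi1_inner hχ i hy).symm
  refine Sy.sub (Sy.sub (Sy.sub (Sy.sub (Sy.add ?_ ?_) ?_) ?_) ?_) ?_
  · have h : Sy R0 2 (-1) 0 0 (fun i y => 2 * (T20 χ i.b y : ℂ) + nInt χ i.b y * halfyQ y) :=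
      Sy.add ((sy_const 2).times hT).le
        ((sy_nInt hχ R0.initial).ofReal.times sy_f.ofReal).le
    exact ((hb2.times sy_bC).times h).le
  · have h : Sy R0 3 (-2) 2 0 (fun i y => y⁻¹ * aInt χ i y) :=
      (sy_inv.times (Sy.add (p := 4) (q := -2) (m := 2) (n := 0) (sy_aInt1 hχ R0.initial).le
        ((sy_aInt2 hχ R0.initial).leB0 R0.leB0 1))).le
    exact (Sy.constMul (h.ofReal.times (sy_P2 hχ R0.sub_RA0)) _).le
  · exact (Sy.constMul (hb2.times ((sy_nonloc1 hχ R0.initial).ofReal.times hT)) _).le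
  · exact (Sy.constMul ((sy_nonloc2 hχ R0.sub_RA1).ofReal.times (sy_P1 hχ R0.sub_RA0)) _).le
  · exact (((sy_I.times sy_eta).times hb2).times hT).le
  · have h : Sy R0 2 (-1) 2 0 (fun i y => 2 * (i.b : ℂ) * T20 χ i.b y
        + i.b * i.b * T20b χ i.b y) :=
      Sy.add (((sy_const 2).times sy_bC).times hT).le
        (hb2.times (sy_T20b hχ R0.initial).ofReal).le
    exact ((sy_sg hχ).times h).le

/-- Beyond `B₀` every term has the required size by itself. -/
theorem sy_Psi1_outer (hχ : IsCutoff χ) (hS : ∀ i, S i ⊆ RA1 i) (hG : S.GeB0)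
    (hP : Sy S 1 (-2) 2 0 (fun i => P1 χ i.b i.eta)) (hB : Sy S 1 (-2) 0 0 (dBP1 χ))
    (hA : Sy S 0 1 6 0 (fun i => Aadj (P χ i.b i.eta) (P2 χ i.b i.eta))) :
    Sy S 0 1 6 0 (Psi1 χ) := by
  have hN : Sy S 0 1 6 0 (fun i y => (nonloc χ i.b i.eta y : ℂ) * P1 χ i.b i.eta y) :=
    ((sy_nonloc hχ hS).ofReal.times hP).geB0 hG 2
  have hL : Sy S 0 1 6 0 (fun i y => (i.b : ℂ) * Lam (-1) (P1 χ i.b i.eta) y) :=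
    (sy_bC.times (hP.lam (-1))).geB0 hG 2
  have hE : Sy S 0 1 6 0 (fun i y => (i.eta : ℂ) * P1 χ i.b i.eta y) :=
    (sy_eta.times hP).geB0 hG 2
  have hB : Sy S 0 1 6 0 (fun i y => (sg χ i : ℂ) * dB (P1 χ) i.b i.eta y) :=
    (((sy_sg hχ).times hB).geB0 hG 2 : Sy S 0 1 6 0 _).congr
      fun i y hy => by rw [dB_P1 hχ i (S.pos i y hy)]
  have hT : Sy S 0 1 6 0 (fun i y => (ta χ i : ℂ) * dEta (P1 χ) i.b i.eta y) :=
    (((sy_ta hχ).times (Sy.neg (hχ.sy1.times sy_f).ofReal)).geB0 hG 2 :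
      Sy S 0 1 6 0 _).congr fun i y _ => by rw [dEta_P1]
  exact (Sy.constMul (((Sy.sub (Sy.add (Sy.sub (hA.constMul Complex.I) (hN.constMul Complex.I)) hL)
    (hE.constMul Complex.I)).sub hB).sub hT) (-Complex.I)).congr fun i y _ => by rw [Psi1]; ring

theorem sy_Psi1_out (hχ : IsCutoff χ) (hS : ∀ i, S i ⊆ RA1 i) (hO : S.Out) :
    Sy S 0 1 6 0 (Psi1 χ) :=
  sy_Psi1_outer hχ hS hO.geB0 (sy_P1_out hχ hO) (sy_dBP1_out hχ hO)
    (Sym.zero fun _ _ hy => CRadj_eq_zero (S := S) (F := fun i => P2 χ i.b i.eta)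
      (v := fun i => P χ i.b i.eta) (fun _ _ hy => P2_out hχ hO hy) hy)

theorem bdAll_Psi1 (hχ : IsCutoff χ) : BdAll (XW 6 0) (Psi1 χ) := by
  refine ⟨(sy_Psi1_R0 hχ).bd_XW R0.sub_RA1, (sy_Psi1_outer hχ R1.sub_RA1 R1.geB0
    (sy_P1 hχ R1.sub_RA0) (sy_dBP1 hχ R1.sub_RA0) ?_).bd_XW R1.sub_RA1,
    (sy_Psi1_out hχ R2.sub_RA1 R2.out).bd_XW R2.sub_RA1,
    (sy_Psi1_out hχ R3.sub_RA1 R3.out).bd_XW R3.sub_RA1, Bd.of_zero fun i y hy => ?_⟩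
  · exact Sy.geB0 (Sy.CRadj hχ R1.sub_RA1 (sy_P2_R1 hχ) 1) R1.geB0 2
  · have hz : ∀ i, ∀ y ∈ R4 i, P1 χ i.b i.eta y = 0 := fun i y hy => P1_R4 hχ hy
    have h1 : Aadj (P χ i.b i.eta) (P2 χ i.b i.eta) y = 0 :=
      CRadj_eq_zero (S := R4) (F := fun i => P2 χ i.b i.eta) (v := fun i => P χ i.b i.eta)
        (fun i y hy => P2_out hχ R4.out hy) hy
    have h2 : Lam (-1) (P1 χ i.b i.eta) y = 0 := Lam_eq_zero (F := fun i => P1 χ i.b i.eta) hz hy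
    rw [Psi1, h1, h2, hz i y hy, dB_P1 hχ i (R4.pos i y hy), dBP1, R4.cut1 hχ hy, R4.dcut1 hχ hy,
      R4.out.cut0 hχ hy, R4.out.dcut0 hχ hy, dEta_P1, R4.cut1 hχ hy]
    simp

/-! ### The second compatibility relation -/

/-- The part of `A_P P₁` that comes from the cutoff and from `A_θ[P] - A_θ[Q]` acting on the
resonance. -/
def AP1c (χ : ℝ → ℝ) (i : Par) (y : ℝ) : ℂ :=
  ((y⁻¹ * (euler (cut χ (B1 i.b)) y) : ℝ) : ℂ) * (-(Complex.I * i.be * halfyQ y))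
    + ((y⁻¹ * aInt1 χ i y : ℝ) : ℂ) * (cut χ (B1 i.b) y * (-(Complex.I * i.be * halfyQ y)))
    + ((y⁻¹ * aInt2 χ i y : ℝ) : ℂ) * (cut χ (B1 i.b) y * (-(Complex.I * i.be * halfyQ y)))

theorem Aop_P1 (hχ : IsCutoff χ) (i : Par) {y : ℝ} (hy : 0 < y) :
    Aop (P χ i.b i.eta) (P1 χ i.b i.eta) y
      = AP1c χ i y + Aop (P χ i.b i.eta) (P1T χ i) y := by
  have hyC : (y : ℂ) ≠ 0 := by exact_mod_cast hy.ne'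
  have hc := (Sym.diff (S := RAll) (hχ.sy1) (i := i) (y := y) hy).hasDerivAt
  have hT := (Sym.diff (S := RAll) (sy_P1T hχ RAll.initial) (i := i) (y := y) hy).hasDerivAt
  have h := (hc.ofReal_comp.mul ((hasDerivAt_halfyQ y).ofReal_comp.const_mul
    (Complex.I * i.be)).neg).add hT
  have h2 := h.congr_of_eventuallyEq (f₁ := P1 χ i.b i.eta)
    (Filter.Eventually.of_forall fun z => P1_split χ i z)
  have hd := h2.deriv
  have e : (Q y : ℂ) = 2 * halfyQ y / y := by
    rw [halfyQ]; push_cast; field_simp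
  simp only [Aop, CR]
  rw [hd, one_add_Atheta_P hχ i hy, AP1c, P1_split, euler, aInt]
  simp only [Complex.real_smul, smul_eq_mul, Pi.neg_apply]
  push_cast
  rw [e]
  field_simp
  ring

theorem sy_AP1c1 (hχ : IsCutoff χ) (hS : ∀ i, S i ⊆ RA1 i) : Sy S 1 (-2) 4 1 (fun i y =>
    ((y⁻¹ * aInt1 χ i y : ℝ) : ℂ) * (cut χ (B1 i.b) y * (-(Complex.I * i.be * halfyQ y)))) :=
  ((sy_inv.times (sy_aInt1' hχ hS)).ofReal.times (sy_P1f hχ)).le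

theorem sy_AP1c2 (hχ : IsCutoff χ) (hS : ∀ i, S i ⊆ RA1 i) : Sy S 1 (-1) 4 2 (fun i y =>
    ((y⁻¹ * aInt2 χ i y : ℝ) : ℂ) * (cut χ (B1 i.b) y * (-(Complex.I * i.be * halfyQ y)))) := by
  have h := (sy_inv.times (sy_aInt2' hχ hS)).ofReal.times (sy_P1f (S := S) hχ)
  exact (Sy.leB1 h (Region.leB1_of_sub hS) 1 : Sy S 1 (-1) 5 (-1) _).le

theorem euler_cut1_eq_zero (hχ : IsCutoff χ) {i : Par} {y : ℝ} (hy : y * i.t < i.L) :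
    euler (cut χ (B1 i.b)) y = 0 := by
  have h : cut χ (B1 i.b) =ᶠ[nhds y] fun _ => (1 : ℝ) := by
    have : ∀ᶠ z in nhds y, z * i.t < i.L :=
      (continuous_id.mul continuous_const).continuousAt.eventually (gt_mem_nhds hy)
    filter_upwards [this] with z hz
    exact cut1_eq_one hχ hz.le
  rw [euler, h.deriv_eq, deriv_const, smul_zero]

theorem hCls_AP1c_lt (hχ : IsCutoff χ) (hS : ∀ i, S i ⊆ RA1 i)
    (hlt : ∀ i, ∀ y ∈ S i, y * i.t < i.L) : HCls S 4 1 (AP1c χ) :=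
  ((HCls.of_decay (sy_AP1c1 hχ hS)).add (HCls.of_log hS (sy_AP1c2 hχ hS))).congr
    fun i y hy => by
      rw [AP1c, euler_cut1_eq_zero hχ (hlt i y hy), mul_zero, Complex.ofReal_zero, zero_mul,
        zero_add]

theorem hCls_AP1c_R3 (hχ : IsCutoff χ) : HCls R3 4 1 (AP1c χ) := by
  have h : Sy R3 1 (-1) 4 2 (fun i y => ((y⁻¹ * (euler (cut χ (B1 i.b)) y) : ℝ) : ℂ)
      * (-(Complex.I * i.be * halfyQ y))) :=
    ((sy_inv.times hχ.sy1.euler).ofReal.times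
      (Sy.neg ((sy_I.times sy_be).times sy_f.ofReal))).geB1 R3.geB1 2
  exact ((HCls.of_log R3.sub_RA1 h).add (HCls.of_decay (sy_AP1c1 hχ R3.sub_RA1))).add
    (HCls.of_log R3.sub_RA1 (sy_AP1c2 hχ R3.sub_RA1))

theorem Aop_P1T_inner (hχ : IsCutoff χ) (i : Par) {y : ℝ} (hy : y ∈ R0 i) :
    Aop (P χ i.b i.eta) (P1T χ i) y
      = i.b * i.b * U2 χ i.b y + ((y⁻¹ * aInt χ i y : ℝ) : ℂ) * P1T χ i y := by
  have hy0 := R0.pos i y hy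
  have hyC : (y : ℂ) ≠ 0 := by exact_mod_cast hy0.ne'
  have e : ∀ i, ∀ y ∈ R0 i, P1T χ i y = (i.b : ℂ) * i.b * T20 χ i.b y := fun i y hy => by
    rw [P1T, cut0_eq_one hχ (R0.lt hy).le, Complex.ofReal_one, one_mul]
  have h :=
    ((hasDerivAt_T20 hχ i hy0).ofReal_comp.const_mul ((i.b : ℂ) * i.b)).congr_of_eventuallyEq
    (eventuallyEq_of_region (S := R0) (F := P1T χ) e hy)
  rw [Aop, CR, h.deriv, one_add_Atheta_P hχ i hy0, e i y hy, Complex.real_smul]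
  push_cast
  field_simp
  ring

theorem hCls_compat_R0 (hχ : IsCutoff χ) : HCls R0 4 1
    (fun i y => Aop (P χ i.b i.eta) (P1 χ i.b i.eta) y - P2 χ i.b i.eta y) := by
  have h1 : HCls R0 4 1 (fun i y => Complex.I * i.eta * (i.be + i.b) * (U2 χ i.b y : ℂ)) :=
    (hCls_U2 hχ).scalar (((sy_I.times sy_eta).times sy_be_add_b).le : Sy RAll 0 0 4 1 _)
  have h2 : HCls R0 4 1 (fun i y => -P2r χ i y) :=
    HCls.of_inner R0.sub_RA0 (Sy.neg (sy_P2r_R0 hχ)).le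
  have h3 : HCls R0 4 1 (fun i y => ((y⁻¹ * aInt χ i y : ℝ) : ℂ) * P1T χ i y) := by
    refine HCls.of_inner R0.sub_RA0 ?_
    have h : Sy R0 3 (-2) 2 0 (fun i y => y⁻¹ * aInt χ i y) :=
      (sy_inv.times (Sy.add (p := 4) (q := -2) (m := 2) (n := 0) (sy_aInt1 hχ R0.initial).le
        ((sy_aInt2 hχ R0.initial).leB0 R0.leB0 1))).le
    exact (h.ofReal.times ((sy_P1T' hχ).restrict R0.sub_RA0)).le
  refine (((hCls_AP1c_lt hχ R0.sub_RA1 fun i y hy => RA0.lt (R0.sub_RA0 i hy)).add h1).add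
    (h2.add h3)).congr fun i y hy => ?_
  rw [Aop_P1 hχ i (R0.pos i y hy), Aop_P1T_inner hχ i hy, P2_inner hχ i hy, Par.be]
  ring

theorem hCls_compat_R1 (hχ : IsCutoff χ) : HCls R1 4 1
    (fun i y => Aop (P χ i.b i.eta) (P1 χ i.b i.eta) y - P2 χ i.b i.eta y) := by
  have h1 : Sy R1 1 0 (4 + 1) 1 (fun i => Aop (P χ i.b i.eta) (P1T χ i)) :=
    Sy.geB0 (Sy.CR hχ R1.sub_RA1 ((sy_P1T' hχ).restrict R1.sub_RA0) 1) R1.geB0 2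
  have h2 : Sy R1 1 0 (4 + 1) 1 (fun i y => -P2 χ i.b i.eta y) :=
    (Sy.neg (sy_P2_R1 hχ)).geB0 R1.geB0 1
  exact (((hCls_AP1c_lt hχ R1.sub_RA1 fun i y hy => RA0.lt (R1.sub_RA0 i hy)).add
    (HCls.of_inner R1.sub_RA0 h1)).add (HCls.of_inner R1.sub_RA0 h2)).congr fun i y hy => by
      rw [Aop_P1 hχ i (R1.pos i y hy)]; ring

theorem compat_out (hχ : IsCutoff χ) (hS : S.Out) {i : Par} {y : ℝ} (hy : y ∈ S i) :
    Aop (P χ i.b i.eta) (P1 χ i.b i.eta) y - P2 χ i.b i.eta y = AP1c χ i y := by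
  have h : Aop (P χ i.b i.eta) (P1T χ i) y = 0 :=
    CR_eq_zero (S := S) (F := P1T χ) (v := fun i => P χ i.b i.eta)
      (fun i y hy => by rw [P1T, hS.cut0 hχ hy]; simp) hy
  rw [Aop_P1 hχ i (S.pos i y hy), h, P2_out hχ hS hy]
  ring

theorem hAll_compat (hχ : IsCutoff χ) : HAll 4 1
    (fun i y => Aop (P χ i.b i.eta) (P1 χ i.b i.eta) y - P2 χ i.b i.eta y) where
  r0 := hCls_compat_R0 hχ
  r1 := hCls_compat_R1 hχ
  r2 := (hCls_AP1c_lt hχ R2.sub_RA1 fun _ _ hy => R2.lt hy).congr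
    fun _ _ hy => (compat_out hχ R2.out hy).symm
  r3 := (hCls_AP1c_R3 hχ).congr fun _ _ hy => (compat_out hχ R3.out hy).symm
  r4 := fun i y hy => by
    have h1 : Aop (P χ i.b i.eta) (P1 χ i.b i.eta) y = 0 :=
      CR_eq_zero (S := R4) (F := fun i => P1 χ i.b i.eta) (v := fun i => P χ i.b i.eta)
        (fun i y hy => P1_R4 hχ hy) hy
    rw [h1, P2_out hχ R4.out hy, sub_zero]

end

section

variable {χ : ℝ → ℝ} {S : Region Par} {m n : ℤ} {F G : Par → ℝ → ℂ}

/-! ### Symbol classes inside the weights of the first compatibility relation -/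

/-- The region lies beyond `B₁`. -/
def Region.Tail (S : Region Par) : Prop := ∀ i, ∀ y ∈ S i, i.L / i.t < y

theorem R3.tail : R3.Tail := fun _ _ hy => hy.1

theorem R4.tail : R4.Tail := fun i y hy => by
  refine lt_trans ?_ (show 2 * i.L / i.t < y from hy)
  exact div_lt_div_of_pos_right (by linarith [i.L_pos]) i.t_pos

theorem Par.b_eq (i : Par) : i.b = i.t ^ 2 := i.t_sq.symm

theorem hTail_eq (hS : S.Tail) {i : Par} {y : ℝ} (hy : y ∈ S i) :
    hTail i y = i.L / i.t * (1 / y ^ 2) := by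
  rw [hTail, Set.indicator_of_mem (show y ∈ Set.Ioi (i.L / i.t) from hS i y hy)]

theorem indicator_one_RA0 (hS : ∀ i, S i ⊆ RA0 i) {i : Par} {y : ℝ} (hy : y ∈ S i) :
    (Set.Iic (2 / i.t)).indicator (fun _ => (1 : ℝ)) y = 1 :=
  Set.indicator_of_mem (show y ∈ Set.Iic (2 / i.t) from (hS i hy).2.le) _

theorem Bd.of_sy {p q : ℤ} {w : Par → ℝ → ℝ} (h : Sy S p q m n F)
    (hw : ∀ i, ∀ y ∈ S i, W p q m n i y ≤ w i y) : Bd S w F :=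
  h.bd.of_le fun i y hy => by rw [abs_of_pos (W_pos (S.pos i y hy))]; exact hw i y hy

theorem Sy.bd_EW (h : Sy S 2 (-1) 4 0 F) : Bd S EW F := Bd.of_sy h fun i y hy => by
  have hy0 := S.pos i y hy
  have h1 := indicator_one_nonneg (2 / i.t) y
  have h2 := hTail_nonneg i y
  have ht := i.t_pos
  have e : W 2 (-1) 4 0 i y = i.b ^ 2 * (y ^ 2 * (1 / (1 + y))) := by
    rw [W, Par.c, i.b_eq, zpow_neg_one, neg_zero, zpow_zero]; norm_cast; ring
  rw [e, EW, hw]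
  gcongr
  have : 0 ≤ i.t * (Set.Iic (2 / i.t)).indicator (fun _ => 1) y := by positivity
  linarith

theorem W_tail_eq (hS : S.Tail) {i : Par} {y : ℝ} (hy : y ∈ S i) :
    W 0 0 3 (-1) i y = i.b ^ 2 * (y ^ 2 * hTail i y) := by
  have hy0 := S.pos i y hy
  have ht := i.t_pos
  rw [hTail_eq hS hy, W, Par.c, i.b_eq, neg_neg, zpow_zero, zpow_one]
  norm_cast
  field_simp

theorem Sy.bd_EW_tail (h : Sy S 0 0 3 (-1) F) (hS : S.Tail) : Bd S EW F :=
  Bd.of_sy h fun i y hy => by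
    rw [W_tail_eq hS hy, EW]
    have := hw_nonneg i (S.pos i y hy)
    gcongr
    linarith

theorem Sy.bd_ED_tail (h : Sy S 0 0 3 (-1) F) (hS : S.Tail) : Bd S ED F :=
  Bd.of_sy h fun i y hy => by
    rw [W_tail_eq hS hy, ED]
    have := hd_nonneg i (S.pos i y hy)
    gcongr
    linarith

theorem Sy.bd_ED (h : Sy S 2 (-2) 4 0 F) : Bd S ED F := Bd.of_sy h fun i y hy => by
  have hy0 := S.pos i y hy
  have h1 := indicator_one_nonneg (2 / i.t) y
  have h2 := hTail_nonneg i y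
  have h3 := indicator_inv_nonneg (2 * i.L / i.t) hy0
  have ht := i.t_pos
  have hL := i.L_pos
  have e : W 2 (-2) 4 0 i y = i.b ^ 2 * (y ^ 2 * (1 / (1 + y) ^ 2)) := by
    rw [W, Par.c, i.b_eq, zpow_neg, neg_zero, zpow_zero]; norm_cast; ring
  rw [e, ED, hd]
  gcongr
  have : 0 ≤ i.L⁻¹ * (Set.Iic (2 * i.L / i.t)).indicator (fun y => 1 / (1 + y)) y
    + i.t * (Set.Iic (2 / i.t)).indicator (fun _ => 1) y := by positivity
  linarith

theorem Sy.bd_ED_log (h : Sy S 2 (-1) 4 1 F) (hS : ∀ i, S i ⊆ RA1 i) : Bd S ED F :=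
  Bd.of_sy h fun i y hy => by
    have hy0 := S.pos i y hy
    have h1 := indicator_one_nonneg (2 / i.t) y
    have h2 := hTail_nonneg i y
    have ht := i.t_pos
    have e : W 2 (-1) 4 1 i y = i.b ^ 2 * (y ^ 2 * (i.L⁻¹ * (1 / (1 + y)))) := by
      rw [W, Par.c, i.b_eq, zpow_neg_one, zpow_neg_one]; norm_cast; ring
    rw [e, ED, hd,
      Set.indicator_of_mem (show y ∈ Set.Iic (2 * i.L / i.t) from (hS i hy).2.le)]
    gcongr
    have : 0 ≤ i.t * (Set.Iic (2 / i.t)).indicator (fun _ => 1) y := by positivity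
    have : 0 ≤ 1 / (1 + y) ^ 2 := by positivity
    linarith

theorem Sy.bd_ED_inner (h : Sy S 2 0 5 0 F) (hS : ∀ i, S i ⊆ RA0 i) : Bd S ED F :=
  Bd.of_sy h fun i y hy => by
    have hy0 := S.pos i y hy
    have h2 := hTail_nonneg i y
    have h3 := indicator_inv_nonneg (2 * i.L / i.t) hy0
    have ht := i.t_pos
    have hL := i.L_pos
    have e : W 2 0 5 0 i y = i.b ^ 2 * (y ^ 2 * i.t) := by
      rw [W, Par.c, i.b_eq, neg_zero, zpow_zero, zpow_zero]; norm_cast; ring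
    rw [e, ED, hd, indicator_one_RA0 hS hy]
    gcongr
    have : 0 ≤ i.L⁻¹ * (Set.Iic (2 * i.L / i.t)).indicator (fun y => 1 / (1 + y)) y := by
      positivity
    have : 0 ≤ 1 / (1 + y) ^ 2 := by positivity
    linarith

theorem Sy.bd_LW_inner (h : Sy S 0 0 3 0 F) (hS : ∀ i, S i ⊆ RA0 i) : Bd S LW F :=
  Bd.of_sy h fun i y hy => by
    have h2 := hTail_nonneg i y
    have h3 := indicator_one_nonneg (2 * i.L / i.t) y
    have ht := i.t_pos
    have e : W 0 0 3 0 i y = i.b * i.t := by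
      rw [W, Par.c, i.b_eq, neg_zero, zpow_zero, zpow_zero]; norm_cast; ring
    rw [e, LW, indicator_one_RA0 hS hy]
    have := i.pos
    gcongr
    have : 0 ≤ i.t ^ 2 * (Set.Iic (2 * i.L / i.t)).indicator (fun _ => 1) y := by positivity
    linarith

theorem Sy.bd_LW (h : Sy S 0 0 4 0 F) (hS : ∀ i, S i ⊆ RA1 i) : Bd S LW F :=
  Bd.of_sy h fun i y hy => by
    have h2 := hTail_nonneg i y
    have h1 := indicator_one_nonneg (2 / i.t) y
    have ht := i.t_pos
    have e : W 0 0 4 0 i y = i.b * i.t ^ 2 := by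
      rw [W, Par.c, i.b_eq, neg_zero, zpow_zero, zpow_zero]; norm_cast; ring
    rw [e, LW, Set.indicator_of_mem (show y ∈ Set.Iic (2 * i.L / i.t) from (hS i hy).2.le)]
    have := i.pos
    gcongr
    have : 0 ≤ i.t * (Set.Iic (2 / i.t)).indicator (fun _ => 1) y := by positivity
    linarith

theorem Sy.bd_LW_tail (h : Sy S (-2) 0 1 (-1) F) (hS : S.Tail) : Bd S LW F :=
  Bd.of_sy h fun i y hy => by
    have hy0 := S.pos i y hy
    have h1 := indicator_one_nonneg (2 / i.t) y
    have h3 := indicator_one_nonneg (2 * i.L / i.t) y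
    have ht := i.t_pos
    have hp := i.pos
    have e : W (-2) 0 1 (-1) i y = i.b * hTail i y := by
      rw [hTail_eq hS hy, W, Par.c, i.b_eq, zpow_neg, neg_neg, zpow_zero, zpow_one]
      norm_cast
      field_simp
    rw [e, LW]
    gcongr
    have : 0 ≤ i.t * (Set.Iic (2 / i.t)).indicator (fun _ => 1) y
      + i.t ^ 2 * (Set.Iic (2 * i.L / i.t)).indicator (fun _ => 1) y := by positivity
    linarith

/-! ### The first compatibility relation -/

/-- `∫_0^y Q ρ y' dy'`. -/
def qrInt (y : ℝ) : ℝ := ∫ z in (0 : ℝ)..y, Q z * rho z * z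

theorem sy_qrInt (hS : S.Initial) : Sy S 4 (-3) 0 0 (fun _ y => qrInt y) :=
  ((((sy_Q.times sy_rho).times Sy.id).le : Sy S 3 (-3) 0 0 _)).primitive hS

theorem rhoFlux_eq_sub {y : ℝ} (hy : 0 < y) : rhoFlux y = y ^ 2 / 2 - qrInt y := by
  have hsub := intervalIntegral.integral_sub
    ((continuous_id (X := ℝ)).intervalIntegrable (μ := MeasureTheory.volume) 0 y)
    (continuous_Q_mul_rho_mul.intervalIntegrable (μ := MeasureTheory.volume) 0 y)
  simp only [id] at hsub
  rw [rhoFlux_eq hy, hsub, integral_id, qrInt]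
  ring

/-- The part of `𝐃_P P - P₁` that is left when `b² T_{2,0}` is removed from `P₁`. -/
def Ecore (χ : ℝ → ℝ) (i : Par) (y : ℝ) : ℂ :=
  ((y⁻¹ : ℝ) : ℂ) * ((euler (cut χ (B1 i.b)) y : ℝ) * hh i.b i.eta y
    + ((cut χ (B1 i.b) y * (i.eta * qrInt y) + aInt1 χ i y : ℝ) : ℂ) * Q y
    + (aInt2 χ i y : ℂ) * Q y + (aInt χ i y : ℂ) * (cut χ (B1 i.b) y * hh i.b i.eta y))

/-- The terms linear in `(b, η)` cancel wherever `χ_{B₁} = 1`, by the equation for `ρ`. -/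
theorem compat_first (hχ : IsCutoff χ) (i : Par) {y : ℝ} (hy : 0 < y) :
    Dop (P χ i.b i.eta) (P χ i.b i.eta) y - P1 χ i.b i.eta y = Ecore χ i y - P1T χ i y := by
  have hyC : (y : ℂ) ≠ 0 := by exact_mod_cast hy.ne'
  have hc := (Sym.diff (S := RAll) (hχ.sy1) (i := i) (y := y) hy).hasDerivAt
  have hq : HasDerivAt qf (2 * y / 4 * Q y + y ^ 2 / 4 * (-(2 * y / (1 + y ^ 2)) * Q y)) y := by
    refine ((((hasDerivAt_pow 2 y).div_const 4)).mul (hasDerivAt_Q y)).congr_deriv ?_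
    norm_num
  have hh' := ((hq.ofReal_comp.const_mul (Complex.I * i.b)).neg).sub
    ((hasDerivAt_rho hy).ofReal_comp.const_mul (i.eta : ℂ))
  have h := ((hasDerivAt_Q y).ofReal_comp).add (hc.ofReal_comp.mul hh')
  have h2 := h.congr_of_eventuallyEq (f₁ := P χ i.b i.eta)
    (Filter.Eventually.of_forall fun z => P_eq χ i.b i.eta z)
  have hp : (y : ℂ) ^ 2 * (pf y : ℂ) = 1 - pf y := by
    rw [pf]
    push_cast
    have : (1 + (y : ℂ) ^ 2) ≠ 0 := by exact_mod_cast (by positivity : (1 + y ^ 2 : ℝ) ≠ 0)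
    field_simp
    ring
  have hA : 0 + Atheta (P χ i.b i.eta) y = 2 * pf y - 2 - aInt χ i y := by
    rw [Atheta_P hχ i hy, phi1_eq]; ring
  simp only [Dop, CR]
  rw [h2.deriv, hA, P1_split, P_eq, Ecore, hh, Par.be, rhoFlux_eq_sub hy, aInt, halfyQ, euler]
  simp only [Complex.real_smul, smul_eq_mul, Pi.neg_apply, Pi.sub_apply, qf]
  rw [show 2 * y / (1 + y ^ 2) = 2 * y * pf y by rw [pf]; rfl]
  push_cast
  -- Written in these atoms, the claim is a polynomial identity modulo `I² = -1`.
  generalize (Q y : ℂ) = q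
  generalize (rho y : ℂ) = r
  generalize (cut χ (B1 i.b) y : ℂ) = c
  generalize (qrInt y : ℂ) = k
  generalize (((deriv (cut χ (B1 i.b)) y : ℝ)) : ℂ) = c'
  generalize P1T χ i y = T
  generalize (aInt1 χ i y : ℂ) = a1
  generalize (aInt2 χ i y : ℂ) = a2
  generalize (pf y : ℂ) = p at *
  have h3 := Complex.I_sq
  field_simp
  linear_combination (-16 * q + 16 * i.eta * r * c + 4 * Complex.I * i.b * c * q * y ^ 2) * hp
    + (-4 * y ^ 2 * q * i.eta * c) * h3

/-- Below `B₁` this is the nonlocal term in the equation for `ρ`. -/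
theorem aInt1_eq (hχ : IsCutoff χ) {i : Par} {y : ℝ} (hy : 0 < y) (hlt : y * i.t < i.L) :
    aInt1 χ i y = -(i.eta * qrInt y) := by
  have e : ∀ z ∈ Set.uIcc 0 y, aDens1 χ i z = -i.eta * (Q z * rho z * z) := by
    intro z hz
    rw [Set.uIcc_of_le hy.le] at hz
    have h1 : z * i.t ≤ y * i.t := mul_le_mul_of_nonneg_right hz.2 i.t_pos.le
    rw [aDens1, cut1_eq_one hχ (h1.trans hlt.le)]
    ring
  rw [aInt1, intervalIntegral.integral_congr e, intervalIntegral.integral_const_mul, qrInt]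
  ring

theorem sy_Ecore_lt (hχ : IsCutoff χ) (hS : ∀ i, S i ⊆ RA1 i)
    (hlt : ∀ i, ∀ y ∈ S i, y * i.t < i.L) : Sy S 4 (-4) 4 0 (Ecore χ) := by
  have h1 : Sy S 4 (-4) 4 0 (fun i y => ((y⁻¹ : ℝ) : ℂ) * ((aInt2 χ i y : ℂ) * Q y)) :=
    (sy_inv.ofReal.times ((sy_aInt2' hχ hS).ofReal.times sy_Q.ofReal)).le
  have h2 : Sy S 4 (-4) 4 0 (fun i y => ((y⁻¹ : ℝ) : ℂ) * ((aInt1 χ i y : ℂ) *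
      (cut χ (B1 i.b) y * hh i.b i.eta y))) :=
    (sy_inv.ofReal.times ((sy_aInt1' hχ hS).ofReal.times (hχ.syC1.times sy_hh))).le
  have h3 : Sy S 4 (-4) 4 0 (fun i y => ((y⁻¹ : ℝ) : ℂ) * ((aInt2 χ i y : ℂ) *
      (cut χ (B1 i.b) y * hh i.b i.eta y))) := by
    have h := sy_inv.ofReal.times ((sy_aInt2' hχ hS).ofReal.times
      ((hχ.syC1 (S := S)).times sy_hh))
    exact (Sy.leB1 h (Region.leB1_of_sub hS) 1 : Sy S 4 (-4) 5 (-1) _).le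
  refine ((h1.add h2).add h3).congr fun i y hy => ?_
  rw [Ecore, euler_cut1_eq_zero hχ (hlt i y hy), aInt1_eq hχ (S.pos i y hy) (hlt i y hy),
    cut1_eq_one hχ (hlt i y hy).le, aInt, aInt1_eq hχ (S.pos i y hy) (hlt i y hy)]
  push_cast
  ring

theorem sy_Ecore_R3 (hχ : IsCutoff χ) : Sy R3 1 (-2) 2 0 (Ecore χ) := by
  have hS := R3.sub_RA1
  have hk : Sy R3 4 (-3) 0 0 (fun _ y => qrInt y) := (sy_qrInt RAll.initial).restrict R3.sub_all
  have h1 : Sy R3 2 (-2) 2 0 (fun i y => ((euler (cut χ (B1 i.b)) y : ℝ) : ℂ) * hh i.b i.eta y) :=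
    (hχ.sy1.euler.ofReal.times sy_hh).le
  have h2 : Sy R3 2 (-2) 2 0 (fun i y =>
      ((cut χ (B1 i.b) y * (i.eta * qrInt y) + aInt1 χ i y : ℝ) : ℂ) * Q y) :=
    ((Sy.add (p := 4) (q := -3) (m := 2) (n := 1) (hχ.sy1.times (sy_etaR.times hk)).le
      (sy_aInt1' hχ hS)).ofReal.times sy_Q.ofReal).le
  have h3 : Sy R3 2 (-2) 2 0 (fun i y => (aInt2 χ i y : ℂ) * Q y) :=
    ((sy_aInt2' hχ hS).ofReal.times sy_Q.ofReal).le
  have h4 : Sy R3 2 (-2) 2 0 (fun i y => (aInt χ i y : ℂ) *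
      (cut χ (B1 i.b) y * hh i.b i.eta y)) :=
    ((sy_aInt hχ hS).ofReal.times (hχ.syC1.times sy_hh)).le
  exact (sy_inv.ofReal.times (((h1.add h2).add h3).add h4)).le

theorem aInt_R4 (hχ : IsCutoff χ) {i : Par} {y : ℝ} (hy : y ∈ R4 i) :
    aInt χ i y = aInt χ i (2 * i.L / i.t) := by
  have hR : 0 < 2 * i.L / i.t := div_pos (mul_pos two_pos i.L_pos) i.t_pos
  have hy' : 2 * i.L / i.t < y := hy
  have hy0 := hR.trans hy'
  have hz : ∀ z ∈ Set.uIcc (2 * i.L / i.t) y, cut χ (B1 i.b) z = 0 := by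
    intro z hz
    rw [Set.uIcc_of_le hy'.le] at hz
    rw [cut_B1]
    refine hχ.eq_zero _ ?_
    rw [← mul_div_assoc, le_div_iff₀ i.L_pos]
    exact (div_le_iff₀ i.t_pos).1 hz.1
  have h1 : aInt1 χ i y - aInt1 χ i (2 * i.L / i.t) = 0 := by
    rw [aInt1, aInt1, intervalIntegral.integral_interval_sub_left
      ((sy_aDens1 hχ).intervalIntegrable (by norm_num) i hy0)
      ((sy_aDens1 hχ).intervalIntegrable (by norm_num) i hR),
      intervalIntegral.integral_congr (g := fun _ => 0) fun z h => by
        simp [aDens1, hz z h]]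
    simp
  have h2 : aInt2 χ i y - aInt2 χ i (2 * i.L / i.t) = 0 := by
    rw [aInt2, aInt2, intervalIntegral.integral_interval_sub_left
      ((sy_aDens2 hχ).intervalIntegrable (by norm_num) i hy0)
      ((sy_aDens2 hχ).intervalIntegrable (by norm_num) i hR),
      intervalIntegral.integral_congr (g := fun _ => 0) fun z h => by
        simp [aDens2, hz z h]]
    simp
  rw [aInt, aInt]
  linarith

/-- Beyond `2 B₁` the densities vanish and the correction of the gauge potential is constant, of
this size. -/
theorem abs_aInt_le (hχ : IsCutoff χ) :
    ∃ C, ∀ i : Par, |aInt χ i (2 * i.L / i.t)| ≤ C * i.t := by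
  obtain ⟨C1, h1⟩ := ((sy_aInt1 hχ RAll.initial).le : Sy RAll 1 0 2 1 (aInt1 χ)).bd
  obtain ⟨C2, h2⟩ := ((sy_aInt2 hχ RAll.initial).le : Sy RAll 2 0 4 0 (aInt2 χ)).bd
  refine ⟨2 * |C1| + 32 * |C2|, fun i => ?_⟩
  have hL := i.L_pos
  have ht := i.t_pos
  have hR : 0 < 2 * i.L / i.t := div_pos (mul_pos two_pos hL) ht
  have e1 := h1 i _ hR
  have e2 := h2 i _ hR
  have w1 : W 1 0 2 1 i (2 * i.L / i.t) = 2 * i.t := by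
    rw [W, Par.c, zpow_one, zpow_zero, zpow_neg_one]
    norm_cast
    field_simp
  have w2 : W 2 0 4 0 i (2 * i.L / i.t) = 4 * (i.t * i.L ^ 2) * i.t := by
    rw [W, Par.c, zpow_zero, neg_zero, zpow_zero]
    norm_cast
    field_simp
    norm_num
  have hk := i.t_mul_L_pow 2
  norm_num [Nat.factorial] at hk
  rw [w1] at e1
  rw [w2] at e2
  have e1' : |aInt1 χ i (2 * i.L / i.t)| ≤ |C1| * (2 * i.t) :=
    e1.trans (mul_le_mul_of_nonneg_right (le_abs_self _) (by positivity))
  have e2' : |aInt2 χ i (2 * i.L / i.t)| ≤ |C2| * (4 * 8 * i.t) := by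
    refine e2.trans ((mul_le_mul_of_nonneg_right (le_abs_self _) (by positivity)).trans ?_)
    gcongr
  rw [aInt]
  refine (abs_add_le _ _).trans ((add_le_add e1' e2').trans (le_of_eq ?_))
  ring

theorem sy_Ecore_R4 (hχ : IsCutoff χ) :
    Sy R4 (-1) (-2) 1 0 (fun i y => Ecore χ i y - P1T χ i y) := by
  -- beyond `2 B₁` the field is `a_∞ Q / y` with a constant `a_∞`
  have ha : Sy R4 0 0 1 0 (fun i _ => aInt χ i (2 * i.L / i.t)) := by
    obtain ⟨C, hC⟩ := abs_aInt_le hχ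
    refine Sy.scalar ⟨C, fun i => ?_⟩
    have := hC i
    simpa [Par.c] using this
  have h : Sy R4 (-1) (-2) 1 0 (fun i y => ((y⁻¹ : ℝ) : ℂ) *
      ((aInt χ i (2 * i.L / i.t) : ℂ) * Q y)) :=
    (sy_inv.ofReal.times (ha.ofReal.times sy_Q.ofReal)).le
  refine h.congr fun i y hy => ?_
  have hz : ∀ i, ∀ y ∈ R4 i, (fun _ : Par => cut χ (B1 i.b)) i y = 0 := fun i y hy =>
    R4.cut1 hχ hy
  have he : euler (cut χ (B1 i.b)) y = 0 := by
    have e := euler_congr (F := fun i => cut χ (B1 i.b)) (G := fun _ _ => (0 : ℝ)) (S := R4)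
      hz hy
    rw [e]
    simp [euler]
  rw [Ecore, he, P1T, R4.out.cut0 hχ hy, R4.cut1 hχ hy, ← aInt_R4 hχ hy, aInt]
  push_cast
  ring

end

section

variable {χ : ℝ → ℝ} {S : Region Par} {m n : ℤ} {F G : Par → ℝ → ℂ}

/-! ### The second derivative of `T_{2,0}` -/

/-- The combination `y U₂ - 2 T_{2,0}`, which is bounded up to a part smaller than its terms by a
factor `1 / L`. -/
def W0 (χ : ℝ → ℝ) (b y : ℝ) : ℝ := y * U2 χ b y - 2 * T20 χ b y

theorem hasDerivAt_mul_W0 (hχ : IsCutoff χ) (i : Par) {y : ℝ} (hy : 0 < y) :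
    HasDerivAt (fun y => y * W0 χ i.b y)
      (-(2 * pf y * (y * U2 χ i.b y + 2 * T20 χ i.b y)) - y ^ 2 * g2 χ i.b y) y := by
  have h := (hasDerivAt_id y).mul (((hasDerivAt_id y).mul (hasDerivAt_U2 hχ i hy)).sub
    ((hasDerivAt_T20 hχ i hy).const_mul 2))
  refine h.congr_deriv ?_
  simp only [id, Pi.mul_apply, Pi.sub_apply, phi1_eq]
  field_simp
  ring

/-- The decaying part of the derivative of `y (y U₂ - 2 T_{2,0})`. -/
def w0a (χ : ℝ → ℝ) (b y : ℝ) : ℝ :=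
  -(2 * pf y * (y * U2 χ b y + 2 * T20 χ b y)) - y ^ 2 * (2 * (halfyQ y * pf y))

/-- The part of the derivative of `y (y U₂ - 2 T_{2,0})` with a logarithmic gain. -/
def w0b (χ : ℝ → ℝ) (b y : ℝ) : ℝ := cb χ b * (y ^ 2 * (halfyQ y * cut χ (B0 b) y))

theorem sy_sq : Sy S 2 0 0 0 (fun _ (y : ℝ) => y ^ 2) := by
  simp only [sq]; exact (Sy.id.times Sy.id).le

theorem sy_w0a (hχ : IsCutoff χ) (hS : S.Initial) : Sy S 2 (-2) 0 0 (fun i => w0a χ i.b) := by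
  have h : Sy S 2 (-1) 0 0 (fun i y => y * U2 χ i.b y + 2 * T20 χ i.b y) :=
    Sy.add (Sy.id.times (sy_U2 hχ hS)).le ((Sy.number 2).times (sy_T20 hχ hS)).le
  exact Sy.sub (Sy.neg (((Sy.number 2).times sy_pf).times h)).le
    (sy_sq.times ((Sy.number 2).times (sy_f.times sy_pf))).le

theorem sy_w0b (hχ : IsCutoff χ) : Sy S 3 (-2) 0 1 (fun i => w0b χ i.b) :=
  ((sy_cb hχ).times (sy_sq.times (sy_f.times hχ.sy0))).le

theorem W0_eq (hχ : IsCutoff χ) (i : Par) {y : ℝ} (hy : 0 < y) :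
    W0 χ i.b y = y⁻¹ * (∫ z in (0 : ℝ)..y, w0a χ i.b z) + y⁻¹ * ∫ z in (0 : ℝ)..y, w0b χ i.b z := by
  have ha := (sy_w0a hχ RAll.initial).intervalIntegrable (by norm_num) i hy
  have hb := (sy_w0b hχ).intervalIntegrable (by norm_num) i hy
  have hd : ∀ z ∈ Set.Ioo 0 y,
      HasDerivAt (fun y => y * W0 χ i.b y) (w0a χ i.b z + w0b χ i.b z) z := by
    intro z hz
    refine (hasDerivAt_mul_W0 hχ i hz.1).congr_deriv ?_
    rw [w0a, w0b, g2_eq, Lam_halfyQ]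
    ring
  have hW : Sy RAll 1 0 0 0 (fun i => W0 χ i.b) :=
    Sy.sub (Sy.id.times (sy_U2 hχ RAll.initial)).le
      ((Sy.number 2).times (sy_T20 hχ RAll.initial)).le
  obtain ⟨C, hC⟩ := hW.bd.local RAll.initial (by norm_num) i y hy
  have hcont : ContinuousOn (fun y => y * W0 χ i.b y) (Set.Icc 0 y) := by
    intro z hz
    rcases hz.1.eq_or_lt with h0 | h0
    · subst h0
      rw [ContinuousWithinAt, zero_mul]
      refine squeeze_zero_norm' (a := fun z => z * C) ?_ ?_
      · filter_upwards [self_mem_nhdsWithin] with z hz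
        rcases hz.1.eq_or_lt with h1 | h1
        · subst h1; simp
        · rw [norm_mul, Real.norm_eq_abs, Real.norm_eq_abs, abs_of_pos h1]
          exact mul_le_mul_of_nonneg_left (hC z ⟨h1, hz.2⟩) h1.le
      · have : Filter.Tendsto (fun z : ℝ => z * C) (nhds 0) (nhds (0 * C)) :=
          (continuous_id.mul continuous_const).tendsto 0
        rw [zero_mul] at this
        exact this.mono_left nhdsWithin_le_nhds
    · exact (hasDerivAt_mul_W0 hχ i h0).continuousAt.continuousWithinAt
  have hI := intervalIntegral.integral_eq_sub_of_hasDerivAt_of_le hy.le hcont hd (ha.add hb)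
  rw [intervalIntegral.integral_add ha hb, zero_mul, sub_zero] at hI
  rw [← mul_add, hI]
  field_simp

theorem sy_w0aInt (hχ : IsCutoff χ) (hS : S.Initial) :
    Sy S 2 (-2) 0 0 (fun i y => y⁻¹ * ∫ z in (0 : ℝ)..y, w0a χ i.b z) :=
  (sy_inv.times ((sy_w0a hχ hS).primitive hS : Sy S 3 (-2) 0 0 _)).le

theorem sy_w0bInt (hχ : IsCutoff χ) (hS : S.Initial) :
    Sy S 2 (-1) 0 1 (fun i y => y⁻¹ * ∫ z in (0 : ℝ)..y, w0b χ i.b z) :=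
  (sy_inv.times ((sy_w0b hχ).primitive hS : Sy S 4 (-2) 0 1 _)).le

theorem hasDerivAt_deriv_T20 (hχ : IsCutoff χ) (i : Par) {y : ℝ} (hy : 0 < y) :
    HasDerivAt (fun y => phi1 y / y * T20 χ i.b y + U2 χ i.b y)
      ((y ^ 2)⁻¹ * (-W0 χ i.b y - y ^ 2 * g2 χ i.b y
        + (8 * pf y ^ 2 - 10 * pf y) * T20 χ i.b y)) y := by
  have h := (((hasDerivAt_phi1 y).div (hasDerivAt_id y) hy.ne').mul
    (hasDerivAt_T20 hχ i hy)).add (hasDerivAt_U2 hχ i hy)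
  refine h.congr_deriv ?_
  simp only [id, Pi.div_apply, phi1_eq, W0]
  have hp : -4 * y / (1 + y ^ 2) ^ 2 = -4 * y * pf y ^ 2 := by rw [pf]; field_simp
  have hp2 : y ^ 2 * pf y = 1 - pf y := by rw [pf]; field_simp; ring
  rw [hp]
  field_simp
  linear_combination (-4 * T20 χ i.b y * pf y) * hp2

theorem deriv_deriv_P1T (hχ : IsCutoff χ) (i : Par) {y : ℝ} (hy : y ∈ R0 i) :
    y ^ 2 • deriv (deriv (P1T χ i)) y = i.b * i.b * ((-W0 χ i.b y - y ^ 2 * g2 χ i.b y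
        + (8 * pf y ^ 2 - 10 * pf y) * T20 χ i.b y : ℝ) : ℂ) := by
  have e : ∀ i, ∀ y ∈ R0 i, P1T χ i y = (i.b : ℂ) * i.b * T20 χ i.b y := fun i y hy => by
    rw [P1T, cut0_eq_one hχ (R0.lt hy).le, Complex.ofReal_one, one_mul]
  have e1 : ∀ i, ∀ y ∈ R0 i, deriv (P1T χ i) y
      = (i.b : ℂ) * i.b * ((phi1 y / y * T20 χ i.b y + U2 χ i.b y : ℝ) : ℂ) := fun i y hy =>
    (((hasDerivAt_T20 hχ i (R0.pos i y hy)).ofReal_comp.const_mul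
      ((i.b : ℂ) * i.b)).congr_of_eventuallyEq
        (eventuallyEq_of_region (S := R0) (F := P1T χ) e hy)).deriv
  have h := ((hasDerivAt_deriv_T20 hχ i (R0.pos i y hy)).ofReal_comp.const_mul
      ((i.b : ℂ) * i.b)).congr_of_eventuallyEq
        (eventuallyEq_of_region (S := R0) (F := fun i => deriv (P1T χ i)) e1 hy)
  have hyC : (y : ℂ) ≠ 0 := by exact_mod_cast (R0.pos i y hy).ne'
  rw [h.deriv, Complex.real_smul]
  push_cast
  field_simp

/-- Although `T_{2,0}` grows linearly, its second derivative is `O(⟨y⟩⁻²)` up to a part of size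
`L⁻¹ ⟨y⟩⁻¹`, and both are controlled by the weight `ED`. -/
theorem bd_ED_P1T_R0 (hχ : IsCutoff χ) :
    Bd R0 ED (fun i y => y ^ 2 • deriv (deriv (P1T χ i)) y) := by
  have hS := R0.initial
  have hb := (sy_bC (S := R0)).times sy_bC
  have h1 : Sy R0 2 (-2) 0 0 (fun i y => -(y⁻¹ * ∫ z in (0 : ℝ)..y, w0a χ i.b z)
      - y ^ 2 * (2 * (halfyQ y * pf y)) + (8 * (pf y * pf y) - 10 * pf y) * T20 χ i.b y) := by
    refine Sy.add (Sy.sub (Sy.neg (sy_w0aInt hχ hS)) ?_) ?_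
    · exact (sy_sq.times ((Sy.number 2).times (sy_f.times sy_pf))).le
    · have h : Sy R0 0 (-2) 0 0 (fun _ y => 8 * (pf y * pf y) - 10 * pf y) :=
        Sy.sub ((Sy.number 8).times (sy_pf.times sy_pf)).le ((Sy.number 10).times sy_pf).le
      exact (h.times (sy_T20 hχ hS)).le
  have h2 : Sy R0 2 (-1) 0 1 (fun i y => -(y⁻¹ * ∫ z in (0 : ℝ)..y, w0b χ i.b z)
      + cb χ i.b * (y ^ 2 * halfyQ y)) :=
    Sy.add (Sy.neg (sy_w0bInt hχ hS)) ((sy_cb hχ).times (sy_sq.times sy_f)).le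
  have k1 : Sy R0 2 (-2) 4 0 _ := (hb.times h1.ofReal).le
  have k2 : Sy R0 2 (-1) 4 1 _ := (hb.times h2.ofReal).le
  refine (k1.bd_ED.add (k2.bd_ED_log R0.sub_RA1)).congr fun i y hy => ?_
  rw [deriv_deriv_P1T hχ i hy, W0_eq hχ i (R0.pos i y hy), g2_inner hχ i hy]
  push_cast
  ring

/-! ### The first compatibility relation in norm -/

theorem dd_sub {m₁ m₂ : Par → ℝ → ℝ} (hF : Sym S m₁ F) (hG : Sym S m₂ G) {i : Par} {y : ℝ}
    (hy : y ∈ S i) : y ^ 2 • deriv (deriv (F i)) y - y ^ 2 • deriv (deriv (G i)) y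
      = y ^ 2 • deriv (deriv (fun y => F i y - G i y)) y := by
  have e : ∀ i, ∀ y ∈ S i, deriv (fun y => F i y - G i y) y = deriv (F i) y - deriv (G i) y :=
    fun i y hy => deriv_fun_sub (hF.diff hy) (hG.diff hy)
  have hd : ∀ {H : Par → ℝ → ℂ} {m : Par → ℝ → ℝ}, Sym S m H →
      DifferentiableAt ℝ (deriv (H i)) y := by
    intro H m hH
    have h1 : ContDiffOn ℝ 2 (H i) (S i) := contDiffOn_infty.1 (hH.contDiffOn i) 2
    exact (((contDiffOn_succ_iff_deriv_of_isOpen (n := 1) (S.isOpen i)).1 h1).2.2.differentiableOn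
      (by norm_num)).differentiableAt (S.mem_nhds hy)
  have h := eventuallyEq_of_region (S := S) (F := fun i => deriv (fun y => F i y - G i y))
    (G := fun i y => deriv (F i) y - deriv (G i) y) e hy
  rw [h.deriv_eq, deriv_fun_sub (hd hF) (hd hG), smul_sub]

theorem Sy.dd {p q : ℤ} (h : Sy S p q m n F) :
    Sy S p q m n (fun i y => y ^ 2 • deriv (deriv (F i)) y) :=
  (Sy.sub h.euler.euler h.euler).congr fun _ _ hy => (Sym.deriv_deriv h hy).symm

theorem Bd.sub {w : Par → ℝ → ℝ} (h : Bd S w F) (h' : Bd S w G) :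
    Bd S w (fun i y => F i y - G i y) := by
  simpa only [sub_eq_add_neg] using h.add h'.neg

theorem sy_E_R2 (hχ : IsCutoff χ) :
    Sy R2 4 (-4) 4 0 (fun i y => Ecore χ i y - P1T χ i y) :=
  (sy_Ecore_lt hχ R2.sub_RA1 fun _ _ hy => R2.lt hy).congr fun i y hy => by
    rw [P1T, R2.out.cut0 hχ hy]; simp

theorem sy_E_R3 (hχ : IsCutoff χ) :
    Sy R3 1 (-2) 2 0 (fun i y => Ecore χ i y - P1T χ i y) :=
  (sy_Ecore_R3 hχ).congr fun i y hy => by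
    rw [P1T, R3.out.cut0 hχ hy]; simp

theorem sy_E_RA0 (hχ : IsCutoff χ) :
    Sy RA0 2 (-1) 4 0 (fun i y => Ecore χ i y - P1T χ i y) :=
  Sy.sub (sy_Ecore_lt hχ RA0.sub_RA1 fun _ _ hy => RA0.lt hy).le (sy_P1T hχ RA0.initial)

theorem bdAll_EW (hχ : IsCutoff χ) : BdAll EW (fun i y => Ecore χ i y - P1T χ i y) :=
  ⟨((sy_E_RA0 hχ).restrict R0.sub_RA0).bd_EW, ((sy_E_RA0 hχ).restrict R1.sub_RA0).bd_EW,
    ((sy_E_R2 hχ).le : Sy R2 2 (-1) 4 0 _).bd_EW,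
    ((Sy.geB1 (sy_E_R3 hχ) R3.geB1 1 : Sy R3 0 0 3 1 _).le : Sy R3 0 0 3 (-1) _).bd_EW_tail R3.tail,
    ((Sy.geB1 (sy_Ecore_R4 hχ) R4.geB1 2 : Sy R4 0 0 3 2 _).le :
      Sy R4 0 0 3 (-1) _).bd_EW_tail R4.tail⟩

theorem bdAll_EW_euler (hχ : IsCutoff χ) :
    BdAll EW (fun i => euler (fun y => Ecore χ i y - P1T χ i y)) :=
  ⟨((sy_E_RA0 hχ).restrict R0.sub_RA0).euler.bd_EW,
    ((sy_E_RA0 hχ).restrict R1.sub_RA0).euler.bd_EW,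
    ((sy_E_R2 hχ).euler.le : Sy R2 2 (-1) 4 0 _).bd_EW,
    ((Sy.geB1 (sy_E_R3 hχ).euler R3.geB1 1 : Sy R3 0 0 3 1 _).le :
      Sy R3 0 0 3 (-1) _).bd_EW_tail R3.tail,
    ((Sy.geB1 (sy_Ecore_R4 hχ).euler R4.geB1 2 : Sy R4 0 0 3 2 _).le :
      Sy R4 0 0 3 (-1) _).bd_EW_tail R4.tail⟩

theorem bdAll_ED (hχ : IsCutoff χ) :
    BdAll ED (fun i y => y ^ 2 • deriv (deriv (fun y => Ecore χ i y - P1T χ i y)) y) := by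
  have hc : Sy RA0 2 (-2) 4 0 (Ecore χ) :=
    (sy_Ecore_lt hχ RA0.sub_RA1 fun _ _ hy => RA0.lt hy).le
  refine ⟨?_, ?_, ((sy_E_R2 hχ).dd.le : Sy R2 2 (-2) 4 0 _).bd_ED,
    ((Sy.geB1 (sy_E_R3 hχ).dd R3.geB1 1 : Sy R3 0 0 3 1 _).le :
      Sy R3 0 0 3 (-1) _).bd_ED_tail R3.tail,
    ((Sy.geB1 (sy_Ecore_R4 hχ).dd R4.geB1 2 : Sy R4 0 0 3 2 _).le :
      Sy R4 0 0 3 (-1) _).bd_ED_tail R4.tail⟩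
  · exact ((hc.restrict R0.sub_RA0).dd.bd_ED.sub (bd_ED_P1T_R0 hχ)).congr fun i y hy =>
      dd_sub (hc.restrict R0.sub_RA0) (sy_P1T hχ R0.initial) hy
  · have hT : Sy R1 2 0 5 0 (P1T χ) :=
      ((Sy.geB0 ((sy_P1T' hχ).restrict R1.sub_RA0) R1.geB0 2 : Sy R1 2 0 5 1 _).le)
    exact ((hc.restrict R1.sub_RA0).dd.bd_ED.sub (hT.dd.bd_ED_inner R1.sub_RA0)).congr
      fun i y hy => dd_sub (hc.restrict R1.sub_RA0) hT hy

theorem bdAll_LW (hχ : IsCutoff χ) : BdAll LW (fun i y => Ecore χ i y - P1T χ i y) := by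
  have h : Sy RA0 0 0 3 0 (fun i y => Ecore χ i y - P1T χ i y) :=
    (sy_E_RA0 hχ).leB0 RA0.leB0 1
  exact ⟨(h.restrict R0.sub_RA0).bd_LW_inner R0.sub_RA0,
    (h.restrict R1.sub_RA0).bd_LW_inner R1.sub_RA0,
    ((sy_E_R2 hχ).le : Sy R2 0 0 4 0 _).bd_LW R2.sub_RA1,
    ((Sy.leB1 (sy_E_R3 hχ) R3.leB1 1 : Sy R3 1 (-3) 1 (-1) _).le :
      Sy R3 (-2) 0 1 (-1) _).bd_LW_tail R3.tail,
    ((sy_Ecore_R4 hχ).le : Sy R4 (-2) 0 1 (-1) _).bd_LW_tail R4.tail⟩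

end

section

variable {χ : ℝ → ℝ} {S : Region Par} {m n : ℤ} {F G : Par → ℝ → ℂ}

/-! ### The residual of the equation for `P` -/

/-- The deviation of `∫_y^∞ Re(P̄ P₁)` from its main part `-2η / (1 + y²)`. -/
def tailInt (χ : ℝ → ℝ) (i : Par) (y : ℝ) : ℝ :=
  (∫ r in Set.Ioi y, (star (P χ i.b i.eta r) * P1 χ i.b i.eta r).re) + 2 * i.eta * pf y

/-- The density of the deviation. -/
def tailDens (χ : ℝ → ℝ) (i : Par) (y : ℝ) : ℝ :=
  nDens1 χ i y + i.eta * (Q y * halfyQ y) + nDens2 χ i y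

/-- The points beyond `B₀`. -/
def RG : Region Par := ⟨fun i => Set.Ioi (1 / i.t), fun _ => isOpen_Ioi, fun i _ hy =>
  (one_div_pos.2 i.t_pos).trans hy⟩

theorem RG.geB0 : RG.GeB0 := fun i _ hy => ((div_lt_iff₀ i.t_pos).1 hy).le

theorem W_nonneg_le {p q : ℤ} {H : Par → ℝ → ℝ} (h : Bd S (W p q m n) H) :
    ∃ C, 0 ≤ C ∧ ∀ i, ∀ y ∈ S i, |H i y| ≤ C * W p q m n i y := by
  obtain ⟨C, hC⟩ := h
  exact ⟨|C|, abs_nonneg _, fun i y hy => (hC i y hy).trans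
    (mul_le_mul_of_nonneg_right (le_abs_self _) (W_pos (S.pos i y hy)).le)⟩

/-- The linear part of the density of `Re(P̄ P₁)` is `-η χ_{B₁} Q (½ y Q)`; it cancels up to `B₁`,
and beyond `B₀` each of the two terms has the required size. -/
theorem tailDens_le (hχ : IsCutoff χ) : ∃ C, 0 ≤ C ∧ ∀ i : Par, ∀ y, 0 < y →
    |tailDens χ i y| ≤ C * W 0 (-1) 4 0 i y := by
  have s1 : Sy RG 0 (-1) 4 0 (fun i y => nDens1 χ i y + i.eta * (Q y * halfyQ y)) := by
    have h1 : Sy RG 0 (-1) 4 1 (nDens1 χ) := Sy.geB0 (sy_nDens1 hχ) RG.geB0 2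
    have h2 : Sy RG 0 (-1) 4 1 (fun i y => i.eta * (Q y * halfyQ y)) :=
      Sy.geB0 (sy_etaR.times (sy_Q.times sy_f)) RG.geB0 2
    exact (Sy.add h1 h2).le
  have s2 : Sy RAll 0 (-1) 4 0 (fun i y => nDensT χ i y + nDensQ χ i y) :=
    Sy.add (sy_nDensT hχ RAll.initial).le (sy_nDensQ hχ).le
  have s3 : Sy RA0 0 (-1) 4 0 (nDensC χ) :=
    ((Sy.leB0 (sy_nDensC hχ RA0.initial) RA0.leB0 2 : Sy RA0 4 (-5) 4 1 _)).le
  obtain ⟨C1, h1, b1⟩ := W_nonneg_le s1.bd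
  obtain ⟨C2, h2, b2⟩ := W_nonneg_le s2.bd
  obtain ⟨C3, h3, b3⟩ := W_nonneg_le s3.bd
  refine ⟨C1 + C2 + C3, by positivity, fun i y hy => ?_⟩
  have hw : 0 ≤ W 0 (-1) 4 0 i y := (W_pos hy).le
  have k1 : |nDens1 χ i y + i.eta * (Q y * halfyQ y)| ≤ C1 * W 0 (-1) 4 0 i y := by
    rcases le_or_gt (y * i.t) i.L with h | h
    · rw [nDens1, cut1_eq_one hχ h]
      have : -(i.eta * (1 * (Q y * halfyQ y))) + i.eta * (Q y * halfyQ y) = 0 := by ring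
      rw [this, abs_zero]
      positivity
    · exact b1 i y ((div_lt_iff₀ i.t_pos).2 (by linarith [i.L_gt]))
  have k3 : |nDensC χ i y| ≤ C3 * W 0 (-1) 4 0 i y := by
    rcases lt_or_ge (y * i.t) 2 with h | h
    · exact b3 i y ⟨hy, (lt_div_iff₀ i.t_pos).2 h⟩
    · rw [nDensC, cut_B0, hχ.eq_zero _ h]
      simp only [mul_zero, zero_mul, neg_zero, abs_zero]
      positivity
  have k2 := b2 i y hy
  rw [tailDens, nDens2]
  calc |nDens1 χ i y + i.eta * (Q y * halfyQ y) + (nDensT χ i y + nDensQ χ i y + nDensC χ i y)|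
      ≤ |nDens1 χ i y + i.eta * (Q y * halfyQ y)|
        + (|nDensT χ i y + nDensQ χ i y| + |nDensC χ i y|) :=
        (abs_add_le _ _).trans (add_le_add_right (abs_add_le _ _) _)
    _ ≤ _ := by linarith

/-- Integrating inwards from the end of the support turns the integral to infinity into a finite
one. -/
theorem tailInt_eq (hχ : IsCutoff χ) (i : Par) {y : ℝ} (hy : y ∈ RA1 i) :
    tailInt χ i y = (∫ z in y..(2 * i.L / i.t), tailDens χ i z)
      + 2 * i.eta * pf (2 * i.L / i.t) := by
  have hR : 0 < 2 * i.L / i.t := hy.1.trans hy.2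
  have hsupp : ∀ z, 2 * i.L / i.t < z →
      (star (P χ i.b i.eta z) * P1 χ i.b i.eta z).re = 0 := fun z hz => by
    rw [P1_R4 hχ (show z ∈ R4 i from hz), mul_zero, Complex.zero_re]
  have n1 := ((sy_nDens1 hχ).intervalIntegrable (by norm_num) i hy.1).symm.trans
    ((sy_nDens1 hχ).intervalIntegrable (by norm_num) i hR)
  have n2 := ((sy_nDens2_all hχ RAll.initial).intervalIntegrable (by norm_num) i hy.1).symm.trans
    ((sy_nDens2_all hχ RAll.initial).intervalIntegrable (by norm_num) i hR)
  have hc : Continuous fun z => i.eta * (Q z * halfyQ z) :=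
    continuous_const.mul (continuous_Q.mul continuous_halfyQ)
  have n3 := hc.intervalIntegrable (μ := MeasureTheory.volume) y (2 * i.L / i.t)
  have hd : ∀ z ∈ Set.uIcc y (2 * i.L / i.t),
      HasDerivAt (fun z => -2 * i.eta * pf z) (i.eta * (Q z * halfyQ z)) z := by
    intro z _
    refine ((hasDerivAt_pf z).const_mul (-2 * i.eta)).congr_deriv ?_
    have hQ : Q z ^ 2 = 8 * pf z ^ 2 := by rw [Q_sq, pf]; field_simp
    rw [show Q z * halfyQ z = z / 2 * Q z ^ 2 by rw [halfyQ]; ring, hQ]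
    ring
  have hI := intervalIntegral.integral_eq_sub_of_hasDerivAt hd n3
  rw [tailInt, integral_Ioi_eq_of_support hy.2.le hsupp]
  simp only [re_star_P_mul_P1, tailDens]
  rw [intervalIntegral.integral_add (n1.add n3) n2, intervalIntegral.integral_add n1 n3, hI,
    intervalIntegral.integral_add n1 n2]
  ring

theorem abs_tailInt_le (hχ : IsCutoff χ) : ∃ C, 0 ≤ C ∧ ∀ i : Par, ∀ y ∈ RA1 i,
    |tailInt χ i y| ≤ C * (i.b ^ 2 * i.L) := by
  obtain ⟨C, hC, hb⟩ := tailDens_le hχ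
  refine ⟨C * 5 + 2, by positivity, fun i y hy => ?_⟩
  have hR : 0 < 2 * i.L / i.t := hy.1.trans hy.2
  have hL := i.L_gt
  have ht := i.t_pos
  have hp := i.pos
  have hc : i.c 4 0 = i.b ^ 2 := by
    rw [Par.c, i.b_eq, neg_zero, zpow_zero]; norm_cast; ring
  have hd : ∀ z ∈ Set.uIcc y (2 * i.L / i.t),
      HasDerivAt (fun z => C * i.b ^ 2 * Real.log (1 + z)) (C * i.b ^ 2 * (1 + z)⁻¹) z := by
    intro z hz
    rw [Set.uIcc_of_le hy.2.le] at hz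
    have hz0 : 0 < z := hy.1.trans_le hz.1
    have h := (((hasDerivAt_id z).const_add 1).log (by positivity)).const_mul (C * i.b ^ 2)
    simpa using h
  have hint : IntervalIntegrable (fun z : ℝ => C * i.b ^ 2 * (1 + z)⁻¹) MeasureTheory.volume y
      (2 * i.L / i.t) := by
    refine ContinuousOn.intervalIntegrable fun z hz => ?_
    rw [Set.uIcc_of_le hy.2.le] at hz
    have hz0 : 0 < z := hy.1.trans_le hz.1
    have : (1 + z) ≠ 0 := by positivity
    exact (ContinuousAt.mul continuousAt_const
      ((continuousAt_const.add continuousAt_id).inv₀ this)).continuousWithinAt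
  have h1 : ‖∫ z in y..(2 * i.L / i.t), tailDens χ i z‖
      ≤ ∫ z in y..(2 * i.L / i.t), C * i.b ^ 2 * (1 + z)⁻¹ := by
    refine intervalIntegral.norm_integral_le_of_norm_le hy.2.le ?_ hint
    refine MeasureTheory.ae_of_all _ fun z hz => ?_
    have h := hb i z (hy.1.trans hz.1)
    rw [W, hc, zpow_zero, one_mul, zpow_neg_one] at h
    rw [Real.norm_eq_abs]
    linarith
  rw [intervalIntegral.integral_eq_sub_of_hasDerivAt hd hint, Real.norm_eq_abs] at h1
  have h2 : 0 ≤ Real.log (1 + y) := Real.log_nonneg (by linarith [hy.1])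
  have h3 := log_one_add_le_L i
  have h4 : |2 * i.eta * pf (2 * i.L / i.t)| ≤ 2 * (i.b ^ 2 * i.L) := by
    rw [abs_mul, abs_mul, abs_of_pos (pf_pos _), abs_two]
    have e1 : |i.eta| ≤ i.b := i.abs_eta_le.trans (by
      rw [i.t_sq]
      exact mul_le_of_le_one_right hp.le (inv_le_one_of_one_le₀ (by linarith)))
    have e2 : pf (2 * i.L / i.t) ≤ i.b := by
      rw [pf, inv_le_iff_one_le_mul₀ (by positivity), div_pow, i.t_sq]
      have : i.b * (1 + (2 * i.L) ^ 2 / i.b) = i.b + (2 * i.L) ^ 2 := by field_simp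
      rw [this]
      nlinarith
    calc 2 * |i.eta| * pf (2 * i.L / i.t) ≤ 2 * i.b * i.b :=
          mul_le_mul (by linarith) e2 (pf_pos _).le (by positivity)
      _ ≤ 2 * (i.b ^ 2 * i.L) := by nlinarith [sq_nonneg i.b]
  rw [tailInt_eq hχ i hy]
  refine (abs_add_le _ _).trans ((add_le_add h1 h4).trans ?_)
  have h5 : C * i.b ^ 2 * Real.log (1 + 2 * i.L / i.t) ≤ C * i.b ^ 2 * (5 * i.L) := by gcongr
  have h6 : 0 ≤ C * i.b ^ 2 * Real.log (1 + y) := by positivity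
  linarith

/-- The local part of the residual. -/
def Psi0a (χ : ℝ → ℝ) (i : Par) (y : ℝ) : ℂ :=
  Complex.I * (-(i.b * i.b * (y⁻¹ * (2 * phi1 y * T20 χ i.b y) + U2 χ i.b y : ℝ))
    + ((y⁻¹ * aInt χ i y : ℝ) : ℂ) * P1 χ i.b i.eta y
    - 2 * i.eta * (pf y * hh i.b i.eta y))
    + i.b * (hh i.b i.eta y + euler (hh i.b i.eta) y) + Complex.I * i.eta * hh i.b i.eta y
    + Complex.I * ((i.b ^ 2 + i.eta ^ 2 : ℝ) : ℂ) * qf y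

theorem P_inner (hχ : IsCutoff χ) (i : Par) {y : ℝ} (hy : y ∈ R0 i) :
    P χ i.b i.eta y = Q y + hh i.b i.eta y := by
  rw [P_eq, cut1_eq_one hχ (RA0.lt (R0.sub_RA0 i hy)).le, Complex.ofReal_one, one_mul]

theorem euler_Q (y : ℝ) : euler Q y = Q y * (2 * pf y - 2) := by
  rw [euler, (hasDerivAt_Q y).deriv, smul_eq_mul, pf]
  field_simp
  ring

theorem Lam_P_inner (hχ : IsCutoff χ) (i : Par) {y : ℝ} (hy : y ∈ R0 i) :
    Lam 0 (P χ i.b i.eta) y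
      = Lam 0 Qc y + (hh i.b i.eta y + euler (hh i.b i.eta) y) := by
  have hQ : DifferentiableAt ℝ (fun y => (Q y : ℂ)) y :=
    (hasDerivAt_Q y).ofReal_comp.differentiableAt
  have h := euler_congr (S := R0) (F := fun i => P χ i.b i.eta) (fun i y hy => P_inner hχ i hy) hy
  rw [euler_add hQ (Sym.diff (S := R0) sy_hh hy)] at h
  have e : Lam 0 (P χ i.b i.eta) y = P χ i.b i.eta y + euler (P χ i.b i.eta) y := by
    rw [Lam, sub_zero, one_smul]; rfl
  have e' : Lam 0 Qc y = Qc y + euler Qc y := by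
    rw [Lam, sub_zero, one_smul]; rfl
  rw [e, e', h, P_inner hχ i hy]
  change _ = ((Q y : ℂ) + euler (fun y => (Q y : ℂ)) y) + _
  ring

theorem Lam_Qc (y : ℝ) : Lam 0 Qc y = ((Q y * phi1 y : ℝ) : ℂ) := by
  have e' : Lam 0 Qc y = (Q y : ℂ) + euler (fun y => (Q y : ℂ)) y := by
    rw [Lam, sub_zero, one_smul]; rfl
  rw [e', euler_ofReal (hasDerivAt_Q y).differentiableAt, euler_Q, phi1_eq]
  push_cast
  ring

theorem dBP_inner (hχ : IsCutoff χ) (i : Par) {y : ℝ} (hy : y ∈ R0 i) :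
    dB (P χ) i.b i.eta y = -(Complex.I * qf y) := by
  have h := RA0.lt (R0.sub_RA0 i hy)
  rw [dB_P hχ, dBP, dcut1_eq_zero hχ h, cut1_eq_one hχ h.le]
  push_cast
  ring

/-- The residual below `B₀`. The term linear in `η` is compensated by the main part `-2η / (1 +
y²)` of the integral to infinity. -/
theorem Psi0_inner (hχ : IsCutoff χ) (i : Par) {y : ℝ} (hy : y ∈ R0 i) :
    Psi0 χ i y = -Complex.I * (Psi0a χ i y
      + Complex.I * (P χ i.b i.eta y * tailInt χ i y)) := by
  have hy0 := R0.pos i y hy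
  have hyC : (y : ℂ) ≠ 0 := by exact_mod_cast hy0.ne'
  have hR : ((∫ r in Set.Ioi y, (star (P χ i.b i.eta r) * P1 χ i.b i.eta r).re : ℝ) : ℂ)
      = tailInt χ i y - 2 * i.eta * pf y := by
    rw [tailInt]; push_cast; ring
  have hA : 0 + 1 + Atheta (P χ i.b i.eta) y = phi1 y - aInt χ i y := by
    rw [zero_add, one_add_Atheta_P hχ i hy0]
  have e : (halfyQ y : ℂ) = y / 2 * Q y := by rw [halfyQ]; push_cast; rfl
  rw [Psi0, Ladj, CRadj, hR, hA, (hasDerivAt_P1_inner hχ i hy).deriv, Lam_P_inner hχ i hy, Lam_Qc,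
    dBP_inner hχ i hy, Psi0a, P_inner hχ i hy, P1_inner hχ i hy, phi1_eq, Complex.real_smul, Par.be]
  push_cast
  rw [e]
  -- Written in these atoms, the claim is a polynomial identity modulo `I² = -1`.
  generalize hh i.b i.eta y = h
  generalize euler (hh i.b i.eta) y = h'
  generalize (tailInt χ i y : ℂ) = R
  generalize (aInt χ i y : ℂ) = a
  generalize (pf y : ℂ) = p
  generalize (Q y : ℂ) = q
  generalize (T20 χ i.b y : ℂ) = T
  generalize (U2 χ i.b y : ℂ) = u
  have h2 := Complex.I_sq
  have h3 : Complex.I ^ 3 = -Complex.I := by rw [pow_succ, h2]; ring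
  field_simp
  ring_nf
  simp only [h2, h3]
  ring

theorem sy_Psi0a (hχ : IsCutoff χ) : Sy R0 0 0 4 0 (Psi0a χ) := by
  have hS := R0.initial
  have hb := (sy_bC (S := R0)).times sy_bC
  have h1 : Sy R0 0 0 0 0 (fun i y => y⁻¹ * (2 * phi1 y * T20 χ i.b y) + U2 χ i.b y) :=
    Sy.add (sy_inv.times (((Sy.number 2).times sy_phi1).times (sy_T20 hχ hS))).le
      (sy_U2 hχ hS).le
  have ha : Sy R0 3 (-2) 2 0 (fun i y => y⁻¹ * aInt χ i y) :=
    (sy_inv.times (Sy.add (p := 4) (q := -2) (m := 2) (n := 0) (sy_aInt1 hχ R0.initial).le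
      ((sy_aInt2 hχ R0.initial).leB0 R0.leB0 1))).le
  have hp := sy_hh (S := R0)
  unfold Psi0a
  refine Sy.add (Sy.add (Sy.add (Sy.constMul (Sy.sub (Sy.add (Sy.neg ?_) ?_) ?_) _) ?_) ?_) ?_
  · exact (hb.times h1.ofReal).le
  · exact (ha.ofReal.times (sy_P1 hχ R0.sub_RA0)).le
  · exact (((sy_const 2).times sy_eta).times (sy_pf.ofReal.times hp)).le
  · exact (sy_bC.times (hp.add hp.euler)).le
  · exact ((sy_I.times sy_eta).times hp).le
  · have hs : Sy R0 0 0 4 0 (fun i _ => i.b ^ 2 + i.eta ^ 2) := Sy.add sy_b2 sy_eta2.le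
    exact ((sy_I.times hs.ofReal).times sy_qf.ofReal).le

theorem W_const (i : Par) (y : ℝ) : W 0 0 m n i y = i.c m n := by
  rw [W, zpow_zero, zpow_zero, one_mul, one_mul]

theorem Par.c_four (i : Par) : i.c 4 0 = i.b ^ 2 := by
  rw [Par.c, i.b_eq, neg_zero, zpow_zero]; norm_cast; ring

theorem Par.c_two (i : Par) : i.c 2 0 = i.b := by
  rw [Par.c, i.b_eq, neg_zero, zpow_zero]; norm_cast; ring

theorem norm_Psi0_le (hχ : IsCutoff χ) : ∃ C, 0 ≤ C ∧ ∀ i : Par, ∀ y ∈ R0 i,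
    ‖Psi0 χ i y‖ ≤ C * (i.b ^ 2 * i.L) := by
  obtain ⟨C1, h1⟩ := (sy_Psi0a hχ).bd
  obtain ⟨C2, h2⟩ := (sy_P (S := R0) hχ).bd
  obtain ⟨C3, h3, hR⟩ := abs_tailInt_le hχ
  refine ⟨|C1| + |C2| * C3, by positivity, fun i y hy => ?_⟩
  have hp := i.pos
  have hL := i.L_gt
  have e1 := h1 i y hy
  have e2 := h2 i y hy
  rw [W_const, i.c_four] at e1
  rw [W_const, i.c_zero, mul_one] at e2
  have e3 := hR i y (R0.sub_RA1 i hy)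
  have e4 : ‖Psi0a χ i y‖ ≤ |C1| * (i.b ^ 2 * i.L) := by
    refine e1.trans (mul_le_mul (le_abs_self _) ?_ (by positivity) (abs_nonneg _))
    nlinarith [sq_nonneg i.b]
  rw [Psi0_inner hχ i hy, norm_mul, norm_neg, Complex.norm_I, one_mul]
  refine (norm_add_le _ _).trans ?_
  rw [norm_mul, Complex.norm_I, one_mul, norm_mul, Complex.norm_real, Real.norm_eq_abs, add_mul]
  refine add_le_add e4 ?_
  rw [mul_assoc]
  exact mul_le_mul (e2.trans (le_abs_self _)) e3 (abs_nonneg _) (abs_nonneg _)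

theorem norm_hh_le : ∃ C, 0 ≤ C ∧ ∀ i : Par, ∀ y, 0 < y →
    ‖hh i.b i.eta y + euler (hh i.b i.eta) y‖ + ‖hh i.b i.eta y‖ ≤ C * i.b := by
  have h : Sy RAll 0 0 2 0 (fun i => hh i.b i.eta) := sy_hh.le
  obtain ⟨C, hC⟩ := h.bd
  obtain ⟨C', hC'⟩ := (h.add h.euler).bd
  refine ⟨|C'| + |C|, by positivity, fun i y hy => ?_⟩
  have e1 := hC i y hy
  have e2 := hC' i y hy
  rw [W_const, i.c_two] at e1 e2
  have hp := i.pos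
  rw [add_mul]
  exact add_le_add (e2.trans (mul_le_mul_of_nonneg_right (le_abs_self _) hp.le))
    (e1.trans (mul_le_mul_of_nonneg_right (le_abs_self _) hp.le))

end

section

variable {χ : ℝ → ℝ} {S : Region Par} {m n : ℤ} {F G : Par → ℝ → ℂ}

/-! ### Uniform bounds and the evolution equations -/

theorem norms_compat_first (hχ : IsCutoff χ) : ∃ K, 0 ≤ K ∧ ∀ i : Par,
    normL2 (fun y => Dop (P χ i.b i.eta) (P χ i.b i.eta) y - P1 χ i.b i.eta y)
      ≤ ENNReal.ofReal (K * i.b) ∧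
    normH21 (fun y => Dop (P χ i.b i.eta) (P χ i.b i.eta) y - P1 χ i.b i.eta y)
      ≤ ENNReal.ofReal (K * i.b ^ 2) := by
  have e : ∀ (S : Region Par) (i : Par), ∀ y ∈ S i, Ecore χ i y - P1T χ i y
      = Dop (P χ i.b i.eta) (P χ i.b i.eta) y - P1 χ i.b i.eta y :=
    fun S i y hy => (compat_first hχ i (S.pos i y hy)).symm
  have e1 : ∀ (S : Region Par) (i : Par), ∀ y ∈ S i, euler (fun y => Ecore χ i y - P1T χ i y) y
      = euler (fun y => Dop (P χ i.b i.eta) (P χ i.b i.eta) y - P1 χ i.b i.eta y) y :=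
    fun S i y hy => euler_congr (S := S) (F := fun i y => Ecore χ i y - P1T χ i y)
      (G := fun i y => Dop (P χ i.b i.eta) (P χ i.b i.eta) y - P1 χ i.b i.eta y) (e S) hy
  have e2 : ∀ (S : Region Par) (i : Par), ∀ y ∈ S i,
      y ^ 2 • deriv (deriv (fun y => Ecore χ i y - P1T χ i y)) y = y ^ 2 • deriv (deriv
        (fun y => Dop (P χ i.b i.eta) (P χ i.b i.eta) y - P1 χ i.b i.eta y)) y :=
    fun S i y hy => by
      rw [(eventuallyEq_of_region (S := S) (F := fun i y => Ecore χ i y - P1T χ i y)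
        (G := fun i y => Dop (P χ i.b i.eta) (P χ i.b i.eta) y - P1 χ i.b i.eta y)
        (e S) hy).deriv.deriv_eq]
  obtain ⟨a0, a1, a2, a3, a4⟩ := bdAll_LW hχ
  obtain ⟨b0, b1, b2, b3, b4⟩ := bdAll_EW hχ
  obtain ⟨c0, c1, c2, c3, c4⟩ := bdAll_EW_euler hχ
  obtain ⟨d0, d1, d2, d3, d4⟩ := bdAll_ED hχ
  obtain ⟨K1, hK1, h1⟩ := normL2_le (F := fun i y => Dop (P χ i.b i.eta) (P χ i.b i.eta) y
    - P1 χ i.b i.eta y) ⟨a0.congr (e _), a1.congr (e _), a2.congr (e _), a3.congr (e _),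
      a4.congr (e _)⟩
  obtain ⟨K2, hK2, h2⟩ := normH21_le (F := fun i y => Dop (P χ i.b i.eta) (P χ i.b i.eta) y
    - P1 χ i.b i.eta y) ⟨b0.congr (e _), b1.congr (e _), b2.congr (e _), b3.congr (e _),
      b4.congr (e _)⟩
    ⟨c0.congr (e1 _), c1.congr (e1 _), c2.congr (e1 _), c3.congr (e1 _), c4.congr (e1 _)⟩
    ⟨d0.congr (e2 _), d1.congr (e2 _), d2.congr (e2 _), d3.congr (e2 _), d4.congr (e2 _)⟩
  refine ⟨K1 + K2, by positivity, fun i => ⟨(h1 i).trans (ENNReal.ofReal_le_ofReal ?_),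
    (h2 i).trans (ENNReal.ofReal_le_ofReal ?_)⟩⟩
  · exact mul_le_mul_of_nonneg_right (by linarith) i.pos.le
  · exact mul_le_mul_of_nonneg_right (by linarith) (by positivity)

theorem add_le_ofReal {a a' : ENNReal} {k k' x : ℝ} (hk : 0 ≤ k) (hk' : 0 ≤ k') (hx : 0 ≤ x)
    (h : a ≤ ENNReal.ofReal (k * x)) (h' : a' ≤ ENNReal.ofReal (k' * x)) :
    a + a' ≤ ENNReal.ofReal ((k + k') * x) := by
  rw [add_mul, ENNReal.ofReal_add (by positivity) (by positivity)]
  exact add_le_add h h'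

theorem Par.c_six_one (i : Par) : i.c 6 1 = i.b ^ 3 / i.L := by
  rw [Par.c, i.b_eq, zpow_neg_one, div_eq_mul_inv]; norm_cast; ring

theorem Par.c_six (i : Par) : i.c 6 0 = i.b ^ 3 := by
  rw [Par.c, i.b_eq, neg_zero, zpow_zero]; norm_cast; ring

theorem Par.c_four_one (i : Par) : i.c 4 1 = i.b ^ 2 / i.L := by
  rw [Par.c, i.b_eq, zpow_neg_one, div_eq_mul_inv]; norm_cast; ring

theorem normX_dEta_P1 (χ : ℝ → ℝ) (b η : ℝ) :
    normX (fun y => dEta (P1 χ) b η y + cut χ (B1 b) y * halfyQ y) = 0 := by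
  have : (fun y => dEta (P1 χ) b η y + cut χ (B1 b) y * halfyQ y) = fun _ => (0 : ℂ) := by
    funext y
    rw [dEta_P1]
    push_cast
    ring
  rw [this]
  simp [normX, normL2]

theorem sq_le_rpow_four (i : Par) : i.L ^ 2 ≤ i.L ^ (4 : ℝ) := by
  have hL := i.L_gt
  rw [show (4 : ℝ) = ((4 : ℕ) : ℝ) by norm_num, Real.rpow_natCast]
  exact pow_le_pow_right₀ (by linarith) (by norm_num)

/-- The uniform bounds for the modulation vectors, the compatibility errors and the residuals. -/
theorem norms_le (hχ : IsCutoff χ) : ∃ K, 0 ≤ K ∧ ∀ i : Par,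
    normX (Lam (-1) (P1 χ i.b i.eta)) + normX (fun y => Complex.I * P1 χ i.b i.eta y)
      ≤ ENNReal.ofReal (K * i.b) ∧
    normX (fun y => dB (P1 χ) i.b i.eta y + cut χ (B1 i.b) y * (Complex.I * halfyQ y))
        + normX (fun y => dEta (P1 χ) i.b i.eta y + cut χ (B1 i.b) y * halfyQ y)
      ≤ ENNReal.ofReal (K * (i.b * i.L ^ (4 : ℝ))) ∧
    normH12 (Lam (-2) (P2 χ i.b i.eta)) + normH12 (fun y => Complex.I * P2 χ i.b i.eta y)
      ≤ ENNReal.ofReal (K * i.b ^ 2) ∧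
    normH12 (dB (P2 χ) i.b i.eta) + normH12 (dEta (P2 χ) i.b i.eta)
      ≤ ENNReal.ofReal (K * i.b) ∧
    normL2 (fun y => Dop (P χ i.b i.eta) (P χ i.b i.eta) y - P1 χ i.b i.eta y)
      ≤ ENNReal.ofReal (K * i.b) ∧
    normH21 (fun y => Dop (P χ i.b i.eta) (P χ i.b i.eta) y - P1 χ i.b i.eta y)
      ≤ ENNReal.ofReal (K * i.b ^ 2) ∧
    normH12 (fun y => Aop (P χ i.b i.eta) (P1 χ i.b i.eta) y - P2 χ i.b i.eta y)
      ≤ ENNReal.ofReal (K * (i.b ^ 2 / i.L)) ∧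
    normX (Psi1 χ i) ≤ ENNReal.ofReal (K * (i.b ^ 3 * i.L ^ (4 : ℝ))) ∧
    normH12 (Psi2 χ i) ≤ ENNReal.ofReal (K * (i.b ^ 3 / i.L)) := by
  obtain ⟨A1, hA1, a1⟩ := normX_le_of_bdd (bdAll_Lam_P1 hχ)
  obtain ⟨A2, hA2, a2⟩ := normX_le_of_bdd (bdAll_I_P1 hχ)
  obtain ⟨A3, hA3, a3⟩ := normX_le (bdAll_dB_P1 hχ)
  obtain ⟨A4, hA4, a4⟩ := (hAll_Lam_P2 hχ).norm_le
  obtain ⟨A5, hA5, a5⟩ := (hAll_I_P2 hχ).norm_le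
  obtain ⟨A6, hA6, a6⟩ := (hAll_dBP2 hχ).norm_le
  obtain ⟨A7, hA7, a7⟩ := (hAll_dEtaP2 hχ).norm_le
  obtain ⟨A8, hA8, a8⟩ := norms_compat_first hχ
  obtain ⟨A9, hA9, a9⟩ := (hAll_compat hχ).norm_le
  obtain ⟨A10, hA10, a10⟩ := normX_le (bdAll_Psi1 hχ)
  obtain ⟨A11, hA11, a11⟩ := (hAll_Psi2 hχ).norm_le
  refine ⟨A1 + A2 + A3 + A4 + A5 + A6 + A7 + A8 + A9 + A10 + A11, by positivity, fun i => ?_⟩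
  have hb := i.pos
  have hL := i.L_pos
  have hX := sq_le_rpow_four i
  have widen : ∀ {a : ENNReal} {k k' x : ℝ}, a ≤ ENNReal.ofReal (k * x) → k ≤ k' → 0 ≤ x →
      a ≤ ENNReal.ofReal (k' * x) := fun h hk hx =>
    h.trans (ENNReal.ofReal_le_ofReal (mul_le_mul_of_nonneg_right hk hx))
  have b1 := a1 i; have b2 := a2 i; have b3 := a3 i; have b4 := a4 i; have b5 := a5 i
  have b6 := a6 i; have b7 := a7 i; have b9 := a9 i; have b10 := a10 i; have b11 := a11 i
  rw [i.c_two] at b1 b2 b3 b6 b7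
  rw [i.c_four] at b4 b5
  rw [i.c_four_one] at b9
  rw [i.c_six] at b10
  rw [i.c_six_one] at b11
  refine ⟨?_, ?_, ?_, ?_, ?_, ?_, ?_, ?_, ?_⟩
  · exact widen (add_le_ofReal hA1 hA2 hb.le b1 b2) (by linarith) hb.le
  · rw [normX_dEta_P1, add_zero]
    refine (b3.trans (ENNReal.ofReal_le_ofReal ?_)).trans
      (widen le_rfl (show A3 ≤ _ by linarith) (by positivity))
    gcongr
  · exact widen (add_le_ofReal hA4 hA5 (by positivity) b4 b5) (by linarith) (by positivity)
  · exact widen (add_le_ofReal hA6 hA7 hb.le b6 b7) (by linarith) hb.le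
  · exact widen (a8 i).1 (by linarith) hb.le
  · exact widen (a8 i).2 (by linarith) (by positivity)
  · exact widen b9 (by linarith) (by positivity)
  · refine (b10.trans (ENNReal.ofReal_le_ofReal ?_)).trans
      (widen le_rfl (show A10 ≤ _ by linarith) (by positivity))
    gcongr
  · exact widen b11 (by linarith) (by positivity)

theorem modDot_vvec (μ : Fin 4 → ℝ) (k : ℝ) (F : ℝ → ℝ → ℝ → ℂ) (b η y : ℝ) :
    modDot μ (vvec k F b η) y = μ 0 * Lam (-k) (F b η) y - μ 1 * (Complex.I * F b η y)
      - μ 2 * dB F b η y - μ 3 * dEta F b η y := by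
  rw [modDot, Fin.sum_univ_four]
  simp only [vvec, Matrix.cons_val]
  ring

/-- The residual is defined as what the equation leaves over; the content is the chain rule. -/
theorem evolution_P (hχ : IsCutoff χ) (i : Par) {bc ec : ℝ → ℝ} {s ls gs y : ℝ}
    (hbc : DifferentiableAt ℝ bc s) (hec : DifferentiableAt ℝ ec s) (hb : bc s = i.b)
    (he : ec s = i.eta) :
    deriv (fun s' => P χ (bc s') (ec s') y) s - (ls : ℂ) * Lam 0 (P χ i.b i.eta) y
        + (gs : ℂ) * Complex.I * P χ i.b i.eta y
        + Complex.I * Ladj (P χ i.b i.eta) (P1 χ i.b i.eta) y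
      = -modDot (ModVec i.b i.eta ls gs (deriv bc s) (deriv ec s)) (vvec 0 (P χ) i.b i.eta) y
        + Complex.I * Psi0 χ i y := by
  rw [deriv_along_curve (differentiableAt_P hχ i y) hbc hec hb he, modDot_vvec, neg_zero, Psi0]
  simp only [ModVec, Matrix.cons_val]
  push_cast
  ring_nf
  simp only [Complex.I_sq, show Complex.I ^ 3 = -Complex.I by rw [pow_succ, Complex.I_sq]; ring]
  ring

theorem evolution_P1 (hχ : IsCutoff χ) (i : Par) {bc ec : ℝ → ℝ} {s ls gts y : ℝ} (hy : 0 < y)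
    (hbc : DifferentiableAt ℝ bc s) (hec : DifferentiableAt ℝ ec s) (hb : bc s = i.b)
    (he : ec s = i.eta) :
    deriv (fun s' => P1 χ (bc s') (ec s') y) s - (ls : ℂ) * Lam (-1) (P1 χ i.b i.eta) y
        + (gts : ℂ) * Complex.I * P1 χ i.b i.eta y
        + Complex.I * Aadj (P χ i.b i.eta) (P2 χ i.b i.eta) y
        - (nonloc χ i.b i.eta y : ℂ) * Complex.I * P1 χ i.b i.eta y
      = -modDot (ModT χ i.b i.eta ls gts (deriv bc s) (deriv ec s)) (vvec 1 (P1 χ) i.b i.eta) y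
        + Complex.I * Psi1 χ i y := by
  rw [deriv_along_curve (differentiableAt_P1 hχ i hy) hbc hec hb he, modDot_vvec, Psi1, sg, ta]
  simp only [ModT, Matrix.cons_val]
  push_cast
  ring_nf
  simp only [Complex.I_sq, show Complex.I ^ 3 = -Complex.I by rw [pow_succ, Complex.I_sq]; ring]
  ring

theorem evolution_P2 (hχ : IsCutoff χ) (i : Par) {bc ec : ℝ → ℝ} {s ls gts y : ℝ} (hy : 0 < y)
    (hbc : DifferentiableAt ℝ bc s) (hec : DifferentiableAt ℝ ec s) (hb : bc s = i.b)
    (he : ec s = i.eta) :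
    deriv (fun s' => P2 χ (bc s') (ec s') y) s - (ls : ℂ) * Lam (-2) (P2 χ i.b i.eta) y
        + (gts : ℂ) * Complex.I * P2 χ i.b i.eta y
        + Complex.I * Aop (P χ i.b i.eta) (Aadj (P χ i.b i.eta) (P2 χ i.b i.eta)) y
        - (nonloc χ i.b i.eta y : ℂ) * Complex.I * P2 χ i.b i.eta y
        - Complex.I * star (P χ i.b i.eta y) * P1 χ i.b i.eta y ^ 2
      = -modDot (ModT χ i.b i.eta ls gts (deriv bc s) (deriv ec s)) (vvec 2 (P2 χ) i.b i.eta) y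
        + Complex.I * Psi2 χ i y := by
  rw [deriv_along_curve (differentiableAt_P2 hχ i hy) hbc hec hb he, modDot_vvec, Psi2, sg, ta]
  simp only [ModT, Matrix.cons_val]
  push_cast
  ring_nf
  simp only [Complex.I_sq, show Complex.I ^ 3 = -Complex.I by rw [pow_succ, Complex.I_sq]; ring]
  ring

theorem mem_R0 (i : Par) {M y : ℝ} (hb : i.b < 1 / (4 * M ^ 2)) (hM : 0 < M) (hy : 0 < y)
    (hyM : y ≤ 2 * M) : y ∈ R0 i := by
  refine ⟨hy, hyM.trans_lt ?_⟩
  have ht := i.t_pos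
  rw [lt_div_iff₀ (by positivity), ← i.t_sq] at hb
  rw [lt_div_iff₀ ht]
  by_contra! h
  nlinarith

end

end

end CSS

theorem proposition4p2 (χ : ℝ → ℝ) (hχ : IsCutoff χ) :
    ∃ K κ : ℝ, 0 < K ∧ 0 < κ ∧ ∀ M : ℝ, 0 < M → ∃ bstar : ℝ, 0 < bstar ∧
      ∀ b η : ℝ, 0 < b → b < bstar → |η| ≤ b / |Real.log b| →
      -- the size of the logarithmic correction, and the regularity of the profiles
      |cb χ b - (1 / |Real.log b|)| ≤ K / |Real.log b| ^ 2 ∧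
      SmoothProfile (P χ) b η ∧ SmoothProfile (P1 χ) b η ∧ SmoothProfile (P2 χ) b η ∧
      -- modulation vectors
      (∀ y : ℝ, 0 < y → y ≤ 2 * M →
        ‖Lam 0 (P χ b η) y - Lam 0 Qc y‖ + ‖Complex.I * P χ b η y - Complex.I * Qc y‖ ≤ K * b ∧
        ‖dB (P χ) b η y + Complex.I * (y ^ 2 / 4 * Q y : ℝ)‖ + ‖dEta (P χ) b η y + rho y‖ = 0) ∧
      normX (Lam (-1) (P1 χ b η)) + normX (fun y => Complex.I * P1 χ b η y)
        ≤ ENNReal.ofReal (K * b) ∧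
      normX (fun y => dB (P1 χ) b η y + cut χ (B1 b) y * (Complex.I * halfyQ y))
          + normX (fun y => dEta (P1 χ) b η y + cut χ (B1 b) y * halfyQ y)
        ≤ ENNReal.ofReal (K * (b * |Real.log b| ^ κ)) ∧
      normH12 (Lam (-2) (P2 χ b η)) + normH12 (fun y => Complex.I * P2 χ b η y)
        ≤ ENNReal.ofReal (K * b ^ 2) ∧
      normH12 (dB (P2 χ) b η) + normH12 (dEta (P2 χ) b η) ≤ ENNReal.ofReal (K * b) ∧
      -- compatibility relations
      normL2 (fun y => Dop (P χ b η) (P χ b η) y - P1 χ b η y) ≤ ENNReal.ofReal (K * b) ∧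
      normH21 (fun y => Dop (P χ b η) (P χ b η) y - P1 χ b η y) ≤ ENNReal.ofReal (K * b ^ 2) ∧
      normH12 (fun y => Aop (P χ b η) (P1 χ b η) y - P2 χ b η y)
        ≤ ENNReal.ofReal (K * (b ^ 2 / |Real.log b|)) ∧
      -- evolution equations along any modulation curves through `(b, η)`, for any phase speed `gts`
      ∃ Ψ Ψ1 Ψ2 : ℝ → ℂ,
        (∀ (lam gam bc ec : ℝ → ℝ) (s gts : ℝ),
          DifferentiableAt ℝ lam s → DifferentiableAt ℝ gam s → DifferentiableAt ℝ bc s →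
          DifferentiableAt ℝ ec s → 0 < lam s → bc s = b → ec s = η →
          ∀ y : ℝ, 0 < y →
            (deriv (fun s' => P χ (bc s') (ec s') y) s
                - ((deriv lam s / lam s : ℝ) : ℂ) * Lam 0 (P χ b η) y
                + ((deriv gam s : ℝ) : ℂ) * Complex.I * P χ b η y
                + Complex.I * Ladj (P χ b η) (P1 χ b η) y
              = -modDot (ModVec b η (deriv lam s / lam s) (deriv gam s) (deriv bc s) (deriv ec s))
                    (vvec 0 (P χ) b η) y
                + Complex.I * Ψ y) ∧
            (deriv (fun s' => P1 χ (bc s') (ec s') y) s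
                - ((deriv lam s / lam s : ℝ) : ℂ) * Lam (-1) (P1 χ b η) y
                + (gts : ℂ) * Complex.I * P1 χ b η y
                + Complex.I * Aadj (P χ b η) (P2 χ b η) y
                - (nonloc χ b η y : ℂ) * Complex.I * P1 χ b η y
              = -modDot (ModT χ b η (deriv lam s / lam s) gts (deriv bc s) (deriv ec s))
                    (vvec 1 (P1 χ) b η) y
                + Complex.I * Ψ1 y) ∧
            (deriv (fun s' => P2 χ (bc s') (ec s') y) s
                - ((deriv lam s / lam s : ℝ) : ℂ) * Lam (-2) (P2 χ b η) y
                + (gts : ℂ) * Complex.I * P2 χ b η y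
                + Complex.I * Aop (P χ b η) (Aadj (P χ b η) (P2 χ b η)) y
                - (nonloc χ b η y : ℂ) * Complex.I * P2 χ b η y
                - Complex.I * star (P χ b η y) * P1 χ b η y ^ 2
              = -modDot (ModT χ b η (deriv lam s / lam s) gts (deriv bc s) (deriv ec s))
                    (vvec 2 (P2 χ) b η) y
                + Complex.I * Ψ2 y)) ∧
        (∀ y : ℝ, 0 < y → y ≤ 2 * M → ‖Ψ y‖ ≤ K * (b ^ 2 * |Real.log b|)) ∧
        normX Ψ1 ≤ ENNReal.ofReal (K * (b ^ 3 * |Real.log b| ^ κ)) ∧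
        normH12 Ψ2 ≤ ENNReal.ofReal (K * (b ^ 3 / |Real.log b|)) := by
  -- The constants are uniform over the admissible parameters. `M` enters only through `b*`, which
  -- makes `2 M < B₀`, so that both cutoffs equal one on `(0, 2 M]`.
  obtain ⟨K1, hK1, hN⟩ := norms_le hχ
  obtain ⟨K2, hK2, hΨ⟩ := norm_Psi0_le hχ
  obtain ⟨K3, hK3, hh3⟩ := norm_hh_le
  have hK : 0 < K1 + K2 + K3 + 8 := by positivity
  refine ⟨K1 + K2 + K3 + 8, 4, hK, by norm_num, fun M hM => ⟨min (Real.exp (-16)) (1 / (4 * M ^ 2)),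
    lt_min (Real.exp_pos _) (by positivity), fun b η hb0 hb hη => ?_⟩⟩
  let i : Par := ⟨b, η, hb0, hb.trans_le (min_le_left _ _), hη⟩
  have hR0 : ∀ y, 0 < y → y ≤ 2 * M → y ∈ R0 i := fun y hy hyM =>
    mem_R0 i (hb.trans_le (min_le_right _ _)) hM hy hyM
  have hL : 0 < |Real.log b| := i.L_pos
  obtain ⟨n1, n2, n3, n4, n5, n6, n7, n8, n9⟩ := hN i
  have widen : ∀ {a : ENNReal} {x : ℝ}, a ≤ ENNReal.ofReal (K1 * x) → 0 ≤ x →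
      a ≤ ENNReal.ofReal ((K1 + K2 + K3 + 8) * x) := fun h hx =>
    h.trans (ENNReal.ofReal_le_ofReal (mul_le_mul_of_nonneg_right (by linarith) hx))
  refine ⟨?_, smoothProfile_P hχ i, smoothProfile_P1 hχ i, smoothProfile_P2 hχ i, ?_,
    widen n1 hb0.le, widen n2 (by positivity), widen n3 (by positivity), widen n4 hb0.le,
    widen n5 hb0.le, widen n6 (by positivity), widen n7 (by positivity),
    Psi0 χ i, Psi1 χ i, Psi2 χ i, ?_, ?_, widen n8 (by positivity), widen n9 (by positivity)⟩
  · refine (abs_cb_sub_le hχ i).trans ?_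
    exact div_le_div_of_nonneg_right (by linarith) (by positivity)
  · intro y hy hyM
    have hyR := hR0 y hy hyM
    constructor
    · have e1 : Lam 0 (P χ b η) y - Lam 0 Qc y = hh b η y + euler (hh b η) y := by
        rw [show Lam 0 (P χ b η) y = _ from Lam_P_inner hχ i hyR, add_sub_cancel_left]
      have e2 : Complex.I * P χ b η y - Complex.I * Qc y = Complex.I * hh b η y := by
        rw [show P χ b η y = _ from P_inner hχ i hyR, Qc]
        ring
      rw [e1, e2, norm_mul, Complex.norm_I, one_mul]
      refine (hh3 i y hy).trans (mul_le_mul_of_nonneg_right (by linarith) hb0.le)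
    · have e1 : dB (P χ) b η y = -(Complex.I * qf y) := dBP_inner hχ i hyR
      have e2 : cut χ (B1 b) y = 1 := cut1_eq_one hχ (i := i) (RA0.lt (R0.sub_RA0 i hyR)).le
      rw [e1, dEta_P, e2, one_mul]
      simp [qf]
  · intro lam gam bc ec s gts _ _ hbc hec _ hbs hes y hy
    exact ⟨evolution_P hχ i hbc hec hbs hes, evolution_P1 hχ i hy hbc hec hbs hes,
      evolution_P2 hχ i hy hbc hec hbs hes⟩
  · intro y hy hyM
    exact (hΨ i y (hR0 y hy hyM)).trans
      (mul_le_mul_of_nonneg_right (by linarith) (by positivity))
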